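/- **Setting.** Let $q\in(-1,1)$, $n\in\mathbb N$, $\mathfrak H=L^2(\mathbb R)^n$. On the algebraic Fock space $\bigoplus_{k\ge 0}\mathfrak H^{\otimes k}$ (with the usual inner product $\langle f_1\otimes\cdots\otimes f_k,\,g_1\otimes\cdots\otimes g_k\rangle=\prod_i\langle f_i,g_i\rangle$, different sectors being orthogonal) let $\alpha_q^\dagger(f)u=f\otimes u$, $\alpha_q(f)(f_1\otimes\cdots\otimes f_k)=\sum_{i=1}^k q^{i-1}\langle f,f_i\rangle f_1\otimes\cdots\widehat{f_i}\cdots\otimes f_k$ and $\xi_q(f)=\alpha_q^\dagger(f)+\alpha_q(f)$. Let $\mathfrak A_q$ be the unital real algebra generated by the operators $\xi_q(f)$. An element $A\in\mathfrak A_q$ is determined by $A\mathbf 1=\sum_k A_k$, $A_k\in\mathfrak H^{\otimes k}$ (where $\mathbf 1$ is the vacuum), and every vector of the algebraic Fock space arises in this way. The *mezdonic norm* is $$|||A|||=\sum_{k\ge0}(k+1)\,C_q^{3/2}D_q^{k}\,\|A_k\|,\qquad C_q=\prod_{m\ge1}(1-|q|^m)^{-1},\quad D_q=(1-|q|)^{-1},$$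 and the Banach algebra $\mathscr A_q$ is the completion of $\mathfrak A_q$. Write $\omega_q(A)=\langle\mathbf 1,A\mathbf 1\rangle$ for the vacuum state, and $\Delta_q:\mathscr A_q\to\mathscr A_q$ for the contraction with $(\Delta_qA)_k=q^kA_k$. On the completed projective tensor product $\mathscr A_q\widehat\otimes_\pi\mathscr A_q$ let $\Delta_q^{R;(1),\emptyset}(x;\,\cdot\,)$, $x\in\mathscr A_q$, be the continuous linear map with $\Delta_q^{R;(1),\emptyset}(x;a\otimes b)=a\,x\,b$. **Noise.** For $j\in[n]$ let $\xi^j_q(\varphi)=\xi_q(\varphi e_j)$, $\varphi\in L^2(\mathbb R)$; these are the $n$ independent $q$-white noises. Put $B^{j}(s,t)=B^{j,(0)}(s,t)=\operatorname{sgn}(t-s)\,\xi^j_q(\mathbf 1_{[s,t]})$, where $[s,t]$ is the interval between $s$ and $t$. For each $j$ let $\rho_j\in C_c^\infty(\mathbb R)$ be even and nonnegative with $\int\rho_j=1$, and for $\varepsilon\in(0,1]$ let $\xi^{j,(\varepsilon)}_q(x)=\xi^j_q\big(\varepsilon^{-1}\rho_j((\cdot-x)/\varepsilon)\big)$ and $B^{j,(\varepsilon)}(s,t)=\int_s^t\xi_q^{j,(\varepsilon)}(x)\,dx$.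 **Nonlinearities.** Let $f^i,g^i_j,h^i_j:\mathbb R^n\to\mathbb R$, $i,j\in[n]$, be real-analytic in the following sense: for some common $R\in[0,\infty]$ each of them is given, for $|x_1|,\dots,|x_n|<R$, by a convergent series $\sum_w c_w x_w$ over all words $w=(k_1,\dots,k_m)$ in the alphabet $[n]$, where $x_w=x_{k_1}\cdots x_{k_m}$, $c_w\in\mathbb R$, and $\sum_w|c_w|r^{|w|}<\infty$ for every $0\le r<R$. (So $R=\infty$ is the case of entire functions. The choice of the $c_w$ fixes an ordering of the variables.) For $X\in\mathscr A_q^n$ with $|||X_i|||<R$ for all $i$, the same letter denotes the lift $F(X)=\sum_w c_wX_w\in\mathscr A_q$. The right and left $q$-commutative derivatives $D^{R}_{k,q}F(X),D^{L}_{k,q}F(X):\mathscr A_q\widehat\otimes_\pi\mathscr A_q\to\mathscr A_q$ are the continuous linear maps obtained by linearity and continuity from $$D^R_{k,q}X_w[B_1\otimes B_2]=\sum_{\ell:\,k_\ell=k}X_{k_1}\cdots X_{k_{\ell-1}}B_1\,\Delta_q\big(B_2X_{k_{\ell+1}}\cdots X_{k_m}\big),$$ $$D^L_{k,q}X_w[B_1\otimes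 B_2]=\sum_{\ell:\,k_\ell=k}\Delta_q\big(X_{k_1}\cdots X_{k_{\ell-1}}B_1\big)\,B_2X_{k_{\ell+1}}\cdots X_{k_m}.$$ **Theorem.** Let $X_0\in\mathscr A_q^n$ with $|||X_0^i|||<R$ for all $i$. The limits $$C^j_\varepsilon=\lim_{S\to\infty}\omega_q\big(B^{j,(\varepsilon)}(0,S)\,\xi_q^{j,(\varepsilon)}(0)\big),\qquad j\in[n],\ \varepsilon\in(0,1],$$ exist, and there are $T>0$ and functions $Y_{(\varepsilon)}=(Y^i_{(\varepsilon)})_i:[0,T)\to\mathscr A_q^n$ and $Y'_{(\varepsilon)}=(Y'^{i}_{(\varepsilon),j})_{i,j}:[0,T)\to(\mathscr A_q\widehat\otimes_\pi\mathscr A_q)^{n\times n}$, $\varepsilon\in[0,1]$, which are unique (on $[0,T)$, as a family indexed by $\varepsilon\in[0,1]$) with the following properties. 1. $Y_{(\varepsilon)}$ and $Y'_{(\varepsilon)}$ are of class $\mathcal C^{1/2-}$ on $[0,T)$, that is, $\alpha$-Hölder for every $\alpha<\frac12$, and as $\varepsilon\downarrow0$ they converge in this sense (uniformly and in $\alpha$-Hölder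 seminorm, for every $\alpha<\frac12$) to $Y_{(0)}$ and $Y'_{(0)}$. 2. For every $\kappa\in(0,1)$ there is a constant $K$ such that for all $\varepsilon\in[0,1]$, $s,t\in[0,T)$ and $i\in[n]$ $$\Big|\Big|\Big|Y^i_{(\varepsilon)}(t)-Y^i_{(\varepsilon)}(s)-\sum_{j=1}^n\Delta_q^{R;(1),\emptyset}\big(B^{j,(\varepsilon)}(s,t);Y'^{i}_{(\varepsilon),j}(s)\big)\Big|\Big|\Big|\le K|t-s|^{1-\kappa}.$$ 3. For all $\varepsilon\in[0,1]$: $Y_{(\varepsilon)}(0)=X_0$, and on $[0,T)$ one has $|||Y^i_{(\varepsilon)}|||<R$ and $Y'^{i}_{(\varepsilon),j}=g^i_j(Y_{(\varepsilon)})\otimes h^i_j(Y_{(\varepsilon)})$. 4. For all $\varepsilon\in(0,1]$, on $[0,T)$ (one-sided derivative at $0$), $$\partial_tY^i_{(\varepsilon)}=f^i(Y_{(\varepsilon)})+\sum_{j=1}^n g^i_j(Y_{(\varepsilon)})\,\xi_q^{j,(\varepsilon)}\,h^i_j(Y_{(\varepsilon)})-\sum_{j=1}^nC^j_\varepsilon\sum_{k=1}^n\Big(D^R_{k,q}g^i_j(Y_{(\varepsilon)})\big[Y'^{k}_{(\varepsilon),j}\big]\,h^i_j(Y_{(\varepsilon)})+g^i_j(Y_{(\varepsilon)})\,D^L_{k,q}h^i_j(Y_{(\varepsilon)})\big[Y'^{k}_{(\varepsilon),j}\big]\Big).$$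 -/

import Mathlib

open scoped TensorProduct ENNReal NNReal ContDiff Topology

noncomputable section

namespace Mezdon

set_option linter.unusedSectionVars false

/-! ### The algebraic Fock space, creation and annihilation operators -/

/-- The algebraic Fock space `⨁ₙ H^{⊗n}`, realised as the tensor algebra of `H`. -/
def Fock (H : Type*) [NormedAddCommGroup H] [InnerProductSpace ℝ H] : Type _ := TensorAlgebra ℝ H

section Fock
variable {H : Type*} [NormedAddCommGroup H] [InnerProductSpace ℝ H]

instance : Ring (Fock H) := inferInstanceAs (Ring (TensorAlgebra ℝ H))
instance : Algebra ℝ (Fock H) := inferInstanceAs (Algebra ℝ (TensorAlgebra ℝ H))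

/-- The inclusion of the one-particle space. -/
def inc : H →ₗ[ℝ] Fock H := TensorAlgebra.ι ℝ

/-- The universal property of the tensor algebra. -/
def flift {A : Type*} [Ring A] [Algebra ℝ A] (φ : H →ₗ[ℝ] A) : Fock H →ₐ[ℝ] A :=
  TensorAlgebra.lift ℝ φ

@[simp] theorem flift_inc {A : Type*} [Ring A] [Algebra ℝ A] (φ : H →ₗ[ℝ] A) (f : H) :
    flift φ (inc f) = φ f := TensorAlgebra.lift_ι_apply φ f

theorem fock_ind {C : Fock H → Prop} (one : C 1) (smul : ∀ (r : ℝ) u, C u → C (r • u))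
    (add : ∀ u v, C u → C v → C (u + v)) (mul : ∀ f u, C u → C (inc f * u)) (u : Fock H) : C u := by
  have key : ∀ a : TensorAlgebra ℝ H, ∀ u : Fock H, C u → C ((show Fock H from a) * u) := by
    intro a
    induction a using TensorAlgebra.induction with
    | algebraMap r =>
      intro u hu
      have := smul r u hu
      rwa [Algebra.smul_def] at this
    | ι x => intro u hu; exact mul x u hu
    | mul a b ha hb => intro u hu; have := ha _ (hb u hu); rwa [← mul_assoc] at this
    | add a b ha hb => intro u hu; have := add _ _ (ha u hu) (hb u hu); rwa [← add_mul] at this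
  have := key u 1 one
  rwa [show (show Fock H from u) * 1 = u from mul_one _] at this

/-- The vacuum component of a Fock vector. -/
def vac : Fock H →ₐ[ℝ] ℝ := flift 0

/-- Second quantisation of multiplication by `q`: multiplies the `n`-particle sector by `q ^ n`. -/
def scale (q : ℝ) : Fock H →ₐ[ℝ] Fock H := flift (q • inc)

/-- The creation operator `f₁ ⊗ ⋯ ⊗ fₙ ↦ f ⊗ f₁ ⊗ ⋯ ⊗ fₙ`. -/
def create : H →ₗ[ℝ] Module.End ℝ (Fock H) := (LinearMap.mul ℝ (Fock H)).comp inc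

@[simp] theorem create_apply (f : H) (u : Fock H) : create f u = inc f * u := rfl

/-- Auxiliary algebra morphism `u ↦ (u·, α_q(f)u ·)`. -/
def annihAux (q : ℝ) (f : H) : Fock H →ₐ[ℝ] Module.End ℝ (Fock H × Fock H) :=
  flift
    { toFun := fun g => LinearMap.prod ((create g).comp (LinearMap.fst ℝ _ _))
        ((inner ℝ f g) • LinearMap.fst ℝ _ _ + q • (create g).comp (LinearMap.snd ℝ _ _))
      map_add' := by
        intro g g'
        ext u <;> simp [inner_add_right, add_smul, map_add]
      map_smul' := by
        intro r g
        ext u <;> simp [inner_smul_right, mul_smul, smul_comm q r] }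

theorem annihAux_inc_mul (q : ℝ) (f g : H) (u : Fock H) (p : Fock H × Fock H) :
    annihAux q f (inc g * u) p = (inc g * (annihAux q f u p).1,
      inner ℝ f g • (annihAux q f u p).1 + q • (inc g * (annihAux q f u p).2)) := by
  rw [map_mul, Module.End.mul_apply]
  conv_lhs => rw [annihAux, flift_inc]
  rfl

theorem annihAux_fst (q : ℝ) (f : H) (u : Fock H) : (annihAux q f u (1, 0)).1 = u := by
  induction u using fock_ind with
  | one => simp
  | smul r u hu => simp [hu]
  | add u v hu hv => simp [hu, hv]
  | mul g u hu => rw [annihAux_inc_mul]; simp only [hu]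

/-- The second component of `annihAux` at the vacuum. -/
def annihFun (q : ℝ) (f : H) : Module.End ℝ (Fock H) :=
  (LinearMap.snd ℝ _ _).comp ((LinearMap.applyₗ ((1 : Fock H), (0 : Fock H))).comp
    (annihAux q f).toLinearMap)

theorem annihFun_one (q : ℝ) (f : H) : annihFun q f 1 = 0 := by
  simp [annihFun]

theorem annihFun_inc_mul (q : ℝ) (f g : H) (u : Fock H) :
    annihFun q f (inc g * u) = inner ℝ f g • u + q • (inc g * annihFun q f u) := by
  have h := annihAux_fst q f u
  simp only [annihFun, LinearMap.comp_apply, AlgHom.toLinearMap_apply, LinearMap.applyₗ_apply_apply,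
    annihAux_inc_mul, LinearMap.snd_apply, h]

/-- The annihilation operator
`f₁ ⊗ ⋯ ⊗ fₙ ↦ ∑ᵢ q^{i-1} ⟨f, fᵢ⟩ f₁ ⊗ ⋯ f̂ᵢ ⋯ ⊗ fₙ`, characterised by `annih_one` and
`annih_inc_mul`. -/
def annih (q : ℝ) : H →ₗ[ℝ] Module.End ℝ (Fock H) where
  toFun := annihFun q
  map_add' f f' := by
    ext u
    induction u using fock_ind with
    | one => simp [annihFun_one]
    | smul r u hu => simp only [map_smul, hu]
    | add u v hu hv => simp only [map_add, hu, hv]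
    | mul g u hu =>
      simp only [annihFun_inc_mul, LinearMap.add_apply] at hu ⊢
      rw [hu, inner_add_left, add_smul, mul_add, smul_add]; abel
  map_smul' r f := by
    ext u
    induction u using fock_ind with
    | one => simp [annihFun_one]
    | smul r u hu => simp only [map_smul, hu]
    | add u v hu hv => simp only [map_add, hu, hv]
    | mul g u hu =>
      simp only [annihFun_inc_mul, LinearMap.smul_apply, RingHom.id_apply] at hu ⊢
      rw [hu, real_inner_smul_left, smul_add, mul_smul, mul_smul_comm, smul_comm q r]

@[simp] theorem annih_one (q : ℝ) (f : H) : annih q f 1 = 0 := annihFun_one q f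

theorem annih_inc_mul (q : ℝ) (f g : H) (u : Fock H) :
    annih q f (inc g * u) = inner ℝ f g • u + q • (inc g * annih q f u) :=
  annihFun_inc_mul q f g u

/-- The anti-homomorphism `f₁ ⊗ ⋯ ⊗ fₙ ↦ α₀(fₙ) ⋯ α₀(f₁)`. -/
def annihAll (q : ℝ) : Fock H →ₐ[ℝ] (Module.End ℝ (Fock H))ᵐᵒᵖ :=
  flift ((MulOpposite.opLinearEquiv ℝ).toLinearMap.comp (annih q))

theorem annihAll_inc_mul (q : ℝ) (f : H) (u v : Fock H) :
    (annihAll q (inc f * u)).unop v = (annihAll q u).unop (annih q f v) := by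
  simp [annihAll]

/-- The inner product of `F₀(H)`. -/
def form : Fock H →ₗ[ℝ] Fock H →ₗ[ℝ] ℝ :=
  LinearMap.mk₂ ℝ (fun u v => vac ((annihAll 0 u).unop v))
    (by intros; simp) (by intros; simp) (by intros; simp) (by intros; simp)

theorem form_one_left (v : Fock H) : form 1 v = vac v := by simp [form]

@[simp] theorem vac_inc_mul (f : H) (v : Fock H) : vac (inc f * v) = 0 := by simp [vac]

theorem form_inc_mul_left (f : H) (u v : Fock H) : form (inc f * u) v = form u (annih 0 f v) := by
  rw [form, LinearMap.mk₂_apply, annihAll_inc_mul, LinearMap.mk₂_apply]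

theorem form_inc_mul (f g : H) (u v : Fock H) :
    form (inc f * u) (inc g * v) = inner ℝ f g * form u v := by
  rw [form_inc_mul_left, annih_inc_mul]; simp

theorem form_inc_mul_one (f : H) (u : Fock H) : form (inc f * u) 1 = 0 := by
  rw [form_inc_mul_left]; simp

theorem form_one_one : form (1 : Fock H) 1 = 1 := by simp [form_one_left]

theorem form_symm (u v : Fock H) : form u v = form v u := by
  induction u using fock_ind generalizing v with
  | one =>
    induction v using fock_ind with
    | one => rfl
    | smul r u hu => simp [hu]
    | add u v hu hv => simp [hu, hv]
    | mul f u _ => rw [form_inc_mul_one, form_one_left, vac_inc_mul]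
  | smul r u hu => simp [hu]
  | add u v hu hv => simp [hu, hv]
  | mul f u hu =>
    induction v using fock_ind with
    | one => rw [form_inc_mul_one, form_one_left, vac_inc_mul]
    | smul r u hu => simp [hu]
    | add u v hu hv => simp [hu, hv]
    | mul g v _ => rw [form_inc_mul, form_inc_mul, hu, real_inner_comm]

/-- Right multiplications by vectors of `H` are isometric as well. -/
theorem form_mul_inc (f g : H) (u v : Fock H) :
    form (u * inc f) (v * inc g) = inner ℝ f g * form u v := by
  induction u using fock_ind generalizing v with
  | one =>
    induction v using fock_ind with
    | one => simpa [form_one_one] using form_inc_mul f g (1 : Fock H) 1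
    | smul r u hu => simp only [smul_mul_assoc, map_smul, hu, smul_eq_mul]; ring
    | add u v hu hv => simp only [add_mul, map_add, hu, hv]; ring
    | mul k v _ =>
      have := form_inc_mul f k (1 : Fock H) (v * inc g)
      rw [mul_one] at this
      rw [one_mul, mul_assoc, this, form_one_left, form_one_left, vac_inc_mul, map_mul]
      simp [vac]
  | smul r u hu => simp only [smul_mul_assoc, map_smul, hu, smul_eq_mul, LinearMap.smul_apply]; ring
  | add u v hu hv => simp only [add_mul, map_add, hu, hv, LinearMap.add_apply]; ring
  | mul k u hu =>
    induction v using fock_ind with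
    | one =>
      have := form_inc_mul k g (u * inc f) (1 : Fock H)
      rw [mul_one] at this
      rw [one_mul, mul_assoc, this, form_inc_mul_one, form_symm, form_one_left, map_mul]
      simp [vac]
    | smul r u hu => simp only [smul_mul_assoc, map_smul, hu, smul_eq_mul]; ring
    | add u v hu hv => simp only [add_mul, map_add, hu, hv]; ring
    | mul l v _ => rw [mul_assoc, mul_assoc, form_inc_mul, form_inc_mul, hu]; ring

end Fock

/-! ### The inner product of the Fock space and its homogeneous components -/

section Fock
variable {H : Type*} [NormedAddCommGroup H] [InnerProductSpace ℝ H]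

/-- The span of the one-particle vectors `e i`. -/
def oneSpan {ι : Type*} (e : ι → H) : Submodule ℝ (Fock H) :=
  Submodule.span ℝ (Set.range fun i => inc (e i))

theorem peel {ι : Type*} [Fintype ι] (e : ι → H) (m : ℕ) {v : Fock H} (hv : v ∈ oneSpan e ^ (m + 1)) :
    ∃ w : ι → Fock H, (∀ i, w i ∈ oneSpan e ^ m) ∧ v = ∑ i, inc (e i) * w i := by
  classical
  rw [pow_succ'] at hv
  refine Submodule.mul_induction_on hv ?_ ?_
  · intro a ha b hb
    obtain ⟨c, rfl⟩ := (Submodule.mem_span_range_iff_exists_fun ℝ).1 ha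
    refine ⟨fun i => c i • b, fun i => Submodule.smul_mem _ _ hb, ?_⟩
    rw [Finset.sum_mul]
    exact Finset.sum_congr rfl fun i _ => by rw [smul_mul_assoc, mul_smul_comm]
  · rintro x y ⟨w, hw, rfl⟩ ⟨w', hw', rfl⟩
    exact ⟨fun i => w i + w' i, fun i => Submodule.add_mem _ (hw i) (hw' i), by
      simp [mul_add, Finset.sum_add_distrib]⟩

theorem mem_zero {ι : Type*} (e : ι → H) {v : Fock H} (hv : v ∈ oneSpan e ^ 0) :
    ∃ c : ℝ, v = c • 1 := by
  rw [pow_zero, Submodule.mem_one] at hv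
  obtain ⟨c, rfl⟩ := hv
  exact ⟨c, Algebra.algebraMap_eq_smul_one c⟩

theorem inc_mem {ι : Type*} (e : ι → H) (i : ι) : inc (e i) ∈ oneSpan e :=
  Submodule.subset_span ⟨i, rfl⟩

theorem inc_mul_mem {ι : Type*} (e : ι → H) (i : ι) {m : ℕ} {v : Fock H} (hv : v ∈ oneSpan e ^ m) :
    inc (e i) * v ∈ oneSpan e ^ (m + 1) := by
  rw [pow_succ']; exact Submodule.mul_mem_mul (inc_mem e i) hv

theorem form_sum {ι : Type*} [Fintype ι] {e : ι → H} (he : Orthonormal ℝ e) (w w' : ι → Fock H) :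
    form (∑ i, inc (e i) * w i) (∑ i, inc (e i) * w' i) = ∑ i, form (w i) (w' i) := by
  classical
  simp only [map_sum, LinearMap.sum_apply, form_inc_mul, orthonormal_iff_ite.1 he, ite_mul, one_mul,
    zero_mul, Finset.mem_univ, if_true, Finset.sum_ite_eq']

theorem form_orth {ι : Type*} [Fintype ι] {e : ι → H} (he : Orthonormal ℝ e) {m n : ℕ}
    (hmn : m ≠ n) {u v : Fock H} (hu : u ∈ oneSpan e ^ m) (hv : v ∈ oneSpan e ^ n) :
    form u v = 0 := by
  induction m generalizing n u v with
  | zero =>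
    obtain ⟨n, rfl⟩ := Nat.exists_eq_succ_of_ne_zero hmn.symm
    obtain ⟨c, rfl⟩ := mem_zero e hu
    obtain ⟨w, _, rfl⟩ := peel e n hv
    simp [form_one_left]
  | succ m ih =>
    obtain ⟨w, hw, rfl⟩ := peel e m hu
    cases n with
    | zero =>
      obtain ⟨c, rfl⟩ := mem_zero e hv
      simp [form_inc_mul_one]
    | succ n =>
      obtain ⟨w', hw', rfl⟩ := peel e n hv
      rw [form_sum he]
      exact Finset.sum_eq_zero fun i _ => ih (by simpa using hmn) (hw i) (hw' i)

theorem form_pos_hom {ι : Type*} [Fintype ι] {e : ι → H} (he : Orthonormal ℝ e) {m : ℕ}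
    {u : Fock H} (hu : u ∈ oneSpan e ^ m) : 0 ≤ form u u ∧ (form u u = 0 → u = 0) := by
  induction m generalizing u with
  | zero =>
    obtain ⟨c, rfl⟩ := mem_zero e hu
    simp only [map_smul, LinearMap.smul_apply, form_one_one, smul_eq_mul, mul_one]
    exact ⟨mul_self_nonneg c, fun h => by rw [mul_self_eq_zero.1 h, zero_smul]⟩
  | succ m ih =>
    obtain ⟨w, hw, rfl⟩ := peel e m hu
    rw [form_sum he]
    refine ⟨Finset.sum_nonneg fun i _ => (ih (hw i)).1, fun h => ?_⟩
    rw [Finset.sum_eq_zero_iff_of_nonneg fun i _ => (ih (hw i)).1] at h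
    exact Finset.sum_eq_zero fun i hi => by rw [(ih (hw i)).2 (h i hi), mul_zero]

theorem exists_sub (u : Fock H) :
    ∃ V : Submodule ℝ H, FiniteDimensional ℝ V ∧ u ∈ ⨆ m : ℕ, (V.map inc) ^ m := by
  have mono : ∀ V W : Submodule ℝ H, V ≤ W →
      (⨆ m : ℕ, (V.map inc) ^ m) ≤ ⨆ m : ℕ, (W.map inc : Submodule ℝ (Fock H)) ^ m :=
    fun V W h => iSup_mono fun m => pow_le_pow_left' (Submodule.map_mono h) m
  induction u using fock_ind with
  | one => exact ⟨⊥, inferInstance, Submodule.mem_iSup_of_mem 0 (by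
      rw [pow_zero]; exact Submodule.one_le.1 le_rfl)⟩
  | smul r u hu =>
    obtain ⟨V, h, hV⟩ := hu
    exact ⟨V, h, Submodule.smul_mem _ _ hV⟩
  | add u v hu hv =>
    obtain ⟨V, h, hV⟩ := hu
    obtain ⟨W, h', hW⟩ := hv
    exact ⟨V ⊔ W, inferInstance, Submodule.add_mem _ (mono _ _ le_sup_left hV)
      (mono _ _ le_sup_right hW)⟩
  | mul f u hu =>
    obtain ⟨V, h, hV⟩ := hu
    refine ⟨(ℝ ∙ f) ⊔ V, inferInstance, ?_⟩
    have h1 : inc f * u ∈ (((ℝ ∙ f) ⊔ V).map inc : Submodule ℝ (Fock H)) *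
        ⨆ m : ℕ, (((ℝ ∙ f) ⊔ V).map inc : Submodule ℝ (Fock H)) ^ m :=
      Submodule.mul_mem_mul (Submodule.mem_map_of_mem
        (Submodule.mem_sup_left (Submodule.mem_span_singleton_self f))) (mono _ _ le_sup_right hV)
    rw [Submodule.mul_iSup] at h1
    have hle : (⨆ m : ℕ, (((ℝ ∙ f) ⊔ V).map inc : Submodule ℝ (Fock H)) *
        (((ℝ ∙ f) ⊔ V).map inc) ^ m) ≤ ⨆ m : ℕ, (((ℝ ∙ f) ⊔ V).map inc) ^ m := iSup_le fun m => by
      rw [← pow_succ']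
      exact le_iSup (fun m : ℕ => (((ℝ ∙ f) ⊔ V).map inc : Submodule ℝ (Fock H)) ^ m) (m + 1)
    exact hle h1

/-- Two Fock vectors are finite sums of homogeneous words in a common orthonormal family. -/
theorem exists_common (u v : Fock H) :
    ∃ (d : ℕ) (e : Fin d → H), Orthonormal ℝ e ∧
      (∃ c : ℕ →₀ Fock H, (∀ m, c m ∈ oneSpan e ^ m) ∧ u = c.sum fun _ x => x) ∧
      (∃ c : ℕ →₀ Fock H, (∀ m, c m ∈ oneSpan e ^ m) ∧ v = c.sum fun _ x => x) := by
  obtain ⟨V, hV, hu⟩ := exists_sub u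
  obtain ⟨W, hW, hv⟩ := exists_sub v
  let U : Submodule ℝ H := V ⊔ W
  let b := stdOrthonormalBasis ℝ U
  let e : Fin (Module.finrank ℝ U) → H := fun i => (b i : H)
  have he : Orthonormal ℝ e := b.orthonormal.comp_linearIsometry U.subtypeₗᵢ
  have hU : U.map inc ≤ oneSpan e := by
    rintro _ ⟨x, hx, rfl⟩
    have hb : (⟨x, hx⟩ : U) ∈ Submodule.span ℝ (Set.range b) := by
      rw [← b.coe_toBasis, b.toBasis.span_eq]; trivial
    have := Submodule.mem_map_of_mem (f := (inc : H →ₗ[ℝ] Fock H).comp U.subtype) hb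
    rw [Submodule.map_span, ← Set.range_comp] at this
    exact this
  have key : ∀ (V' : Submodule ℝ H) (_ : V' ≤ U) (u : Fock H) (_ : u ∈ ⨆ m : ℕ, (V'.map inc) ^ m),
      ∃ c : ℕ →₀ Fock H, (∀ m, c m ∈ oneSpan e ^ m) ∧ u = c.sum fun _ x => x := by
    intro V' hV' u hu
    have : u ∈ ⨆ m : ℕ, oneSpan e ^ m := (iSup_mono fun m => pow_le_pow_left' ((Submodule.map_mono hV').trans hU) m : (⨆ m : ℕ, (V'.map inc) ^ m) ≤ _) hu
    obtain ⟨c, hc, h⟩ := (Submodule.mem_iSup_iff_exists_finsupp _ _).1 this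
    exact ⟨c, hc, h.symm⟩
  exact ⟨_, e, he, key V le_sup_left u hu, key W le_sup_right v hv⟩

theorem form_sum_hom {ι : Type*} [Fintype ι] {e : ι → H} (he : Orthonormal ℝ e) (c : ℕ →₀ Fock H)
    (hc : ∀ m, c m ∈ oneSpan e ^ m) :
    form (c.sum fun _ x => x) (c.sum fun _ x => x) = ∑ m ∈ c.support, form (c m) (c m) := by
  simp only [Finsupp.sum, map_sum, LinearMap.sum_apply]
  refine Finset.sum_congr rfl fun m hm => ?_
  rw [Finset.sum_eq_single m]
  · intro n _ hn
    exact form_orth he hn (hc n) (hc m)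
  · exact fun h => absurd hm h

instance fockCore : InnerProductSpace.Core ℝ (Fock H) where
  inner u v := form u v
  conj_inner_symm u v := form_symm v u
  re_inner_nonneg u := by
    obtain ⟨d, e, he, ⟨c, hc, rfl⟩, -⟩ := exists_common u u
    change 0 ≤ form _ _
    rw [form_sum_hom he c hc]
    exact Finset.sum_nonneg fun m _ => (form_pos_hom he (hc m)).1
  add_left u v w := by simp
  smul_left u v r := by simp
  definite u hu := by
    obtain ⟨d, e, he, ⟨c, hc, rfl⟩, -⟩ := exists_common u u
    change form _ _ = 0 at hu
    rw [form_sum_hom he c hc,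
      Finset.sum_eq_zero_iff_of_nonneg fun m _ => (form_pos_hom he (hc m)).1] at hu
    exact Finset.sum_eq_zero fun m hm => (form_pos_hom he (hc m)).2 (hu m hm)

instance : NormedAddCommGroup (Fock H) := fockCore.toNormedAddCommGroup
instance : InnerProductSpace ℝ (Fock H) := InnerProductSpace.ofCore fockCore.toCore

theorem inner_eq_form (u v : Fock H) : inner ℝ u v = form u v := rfl

instance : GradedAlgebra fun k : ℕ => (LinearMap.range (inc : H →ₗ[ℝ] Fock H)) ^ k :=
  inferInstanceAs (GradedAlgebra fun k : ℕ =>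
    (LinearMap.range (TensorAlgebra.ι ℝ : H →ₗ[ℝ] TensorAlgebra ℝ H)) ^ k)

/-- The projection onto the `k`-particle sector `H^{⊗k}`. -/
def chaos (k : ℕ) : Fock H →ₗ[ℝ] Fock H :=
  GradedAlgebra.proj (fun k : ℕ => (LinearMap.range (inc : H →ₗ[ℝ] Fock H)) ^ k) k

end Fock

/-! ### Field operators and the Wick map -/

section Wick
variable {H : Type*} [NormedAddCommGroup H] [InnerProductSpace ℝ H]

/-- The field operator `ξ_q(f) = α_q†(f) + α_q(f)`. -/
def field (q : ℝ) : H →ₗ[ℝ] Module.End ℝ (Fock H) := create + annih q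

/-- The unital algebra generated by the field operators. -/
def fieldSub (H : Type*) [NormedAddCommGroup H] [InnerProductSpace ℝ H] (q : ℝ) :
    Subalgebra ℝ (Module.End ℝ (Fock H)) :=
  Algebra.adjoin ℝ (Set.range (field q))

@[simp] theorem scale_inc_mul (q : ℝ) (f : H) (u : Fock H) :
    scale q (inc f * u) = q • (inc f * scale q u) := by
  simp [scale]

theorem annih_scale (q : ℝ) (f : H) (u : Fock H) :
    annih q f (scale q u) = q • scale q (annih q f u) := by
  induction u using fock_ind with
  | one => simp
  | smul r u hu => simp only [map_smul, hu, smul_comm q r]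
  | add u v hu hv => simp only [map_add, hu, hv, smul_add]
  | mul g u hu =>
    simp only [scale_inc_mul, map_smul, annih_inc_mul, hu, map_add, smul_add, mul_smul_comm]

theorem annih_mul (q : ℝ) (f : H) (x u : Fock H) :
    annih q f (x * u) = annih q f x * u + scale q x * annih q f u := by
  induction x using fock_ind with
  | one => simp
  | smul r x hx => simp only [map_smul, smul_mul_assoc, hx, smul_add]
  | add x y hx hy => simp only [map_add, add_mul, hx, hy]; abel
  | mul g x hx =>
    rw [mul_assoc, annih_inc_mul, hx, annih_inc_mul, scale_inc_mul, add_mul, mul_add, smul_add]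
    simp only [smul_mul_assoc, mul_assoc, add_assoc]

/-- The homomorphism `f₁ ⊗ ⋯ ⊗ fₙ ↦ α_q(f₁) ⋯ α_q(fₙ)`. -/
def annR (q : ℝ) : Fock H →ₐ[ℝ] Module.End ℝ (Fock H) := flift (annih q)

@[simp] theorem annR_inc (q : ℝ) (f : H) : annR q (inc f) = annih q f := by simp [annR]

@[simp] theorem vac_inc (f : H) : vac (inc f) = 0 := by simp [vac]

@[simp] theorem annR_inc_mul (q : ℝ) (f : H) (y u : Fock H) :
    annR q (inc f * y) u = annih q f (annR q y u) := by simp [annR]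

theorem annR_vac (q : ℝ) (y : Fock H) : annR q y 1 = vac y • 1 := by
  induction y using fock_ind with
  | one => simp
  | smul r x hx => simp [hx, mul_smul]
  | add x y hx hy => simp [hx, hy, add_smul]
  | mul g x hx => simp [hx]

/-- The sum over all ways of splitting a word into creators and annihilators, weighted by `q` to
the number of inversions. -/
def shuf (q : ℝ) : Fock H →ₗ[ℝ] Fock H ⊗[ℝ] Fock H :=
  (LinearMap.applyₗ ((1 : Fock H) ⊗ₜ[ℝ] (1 : Fock H))).comp
    (flift { toFun := fun f => (create f).rTensor (Fock H) +
              TensorProduct.map (scale q).toLinearMap (create f)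
             map_add' := by
               intro f g; simp only [map_add, LinearMap.rTensor_add, TensorProduct.map_add_right]; abel
             map_smul' := by
               intro r f
               simp only [map_smul, LinearMap.rTensor_smul, TensorProduct.map_smul_right, smul_add,
                 RingHom.id_apply] }).toLinearMap

theorem shuf_one (q : ℝ) : shuf q (1 : Fock H) = 1 ⊗ₜ 1 := by simp [shuf]

theorem shuf_inc_mul (q : ℝ) (f : H) (v : Fock H) :
    shuf q (inc f * v) = (create f).rTensor (Fock H) (shuf q v) +
      TensorProduct.map (scale q).toLinearMap (create f) (shuf q v) := by
  simp [shuf]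

/-- `x ⊗ y ↦ α†(x) α(y)`. -/
def wickM (q : ℝ) : Fock H ⊗[ℝ] Fock H →ₗ[ℝ] Module.End ℝ (Fock H) :=
  TensorProduct.lift ((LinearMap.mul ℝ (Module.End ℝ (Fock H))).compl₁₂
    (LinearMap.mul ℝ (Fock H)) (annR q).toLinearMap)

@[simp] theorem wickM_tmul (q : ℝ) (x y u : Fock H) : wickM q (x ⊗ₜ y) u = x * annR q y u := by
  simp [wickM]

/-- The Wick map: `wick q v` is the Wick polynomial `ξ_q^{⋄}(v)`. -/
def wick (q : ℝ) : Fock H →ₗ[ℝ] Module.End ℝ (Fock H) := (wickM q).comp (shuf q)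

theorem wick_one (q : ℝ) : wick q (1 : Fock H) = 1 := by
  ext u; simp [wick, shuf_one]

theorem wick_apply_one (q : ℝ) (v : Fock H) : wick q v 1 = v := by
  induction v using fock_ind with
  | one => rw [wick_one]; rfl
  | smul r x hx => simp [hx]
  | add x y hx hy => simp [hx, hy]
  | mul f x hx =>
    have h1 : ∀ z : Fock H ⊗[ℝ] Fock H,
        wickM q ((create f).rTensor (Fock H) z) 1 = inc f * wickM q z 1 := by
      intro z
      induction z using TensorProduct.induction_on with
      | zero => simp
      | tmul x y => simp [mul_assoc]
      | add x y hx hy => simp [hx, hy, mul_add]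
    have h2 : ∀ z : Fock H ⊗[ℝ] Fock H,
        wickM q (TensorProduct.map (scale q).toLinearMap (create f) z) 1 = 0 := by
      intro z
      induction z using TensorProduct.induction_on with
      | zero => simp
      | tmul x y => simp [annR_vac]
      | add x y hx hy => simp [hx, hy]
    simp only [wick, LinearMap.comp_apply, shuf_inc_mul, map_add, LinearMap.add_apply, h1, h2] at hx ⊢
    rw [hx, add_zero]

theorem shuf_annih (q : ℝ) (f : H) (v : Fock H) :
    shuf q (annih q f v) = (annih q f).rTensor (Fock H) (shuf q v) := by
  induction v using fock_ind with
  | one => simp [shuf_one]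
  | smul r x hx => simp [hx]
  | add x y hx hy => simp [hx, hy]
  | mul g v hv =>
    have h : ∀ z : Fock H ⊗[ℝ] Fock H, (annih q f).rTensor (Fock H)
        ((create g).rTensor (Fock H) z + TensorProduct.map (scale q).toLinearMap (create g) z) =
        (inner ℝ f g : ℝ) • z + q • ((create g).rTensor (Fock H) ((annih q f).rTensor (Fock H) z) +
          TensorProduct.map (scale q).toLinearMap (create g) ((annih q f).rTensor (Fock H) z)) := by
      intro z
      induction z using TensorProduct.induction_on with
      | zero => simp
      | tmul x y =>
        simp [annih_inc_mul, annih_scale, TensorProduct.add_tmul, TensorProduct.smul_tmul',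
          add_assoc]
      | add x y hx hy =>
        simp only [map_add, smul_add] at hx hy ⊢
        rw [← sub_eq_zero] at hx hy ⊢
        rw [← add_zero (0 : Fock H ⊗[ℝ] Fock H)]
        nth_rewrite 1 [← hx]
        rw [← hy]
        abel
    rw [annih_inc_mul, map_add, map_smul, map_smul, shuf_inc_mul, shuf_inc_mul, hv, h]

theorem field_mul_wick (q : ℝ) (f : H) (v : Fock H) :
    field q f * wick q v = wick q (field q f v) := by
  have h1 : ∀ z : Fock H ⊗[ℝ] Fock H, create f * wickM q z = wickM q ((create f).rTensor _ z) := by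
    intro z
    induction z using TensorProduct.induction_on with
    | zero => simp
    | tmul x y => ext u; simp [mul_assoc]
    | add x y hx hy => simp [hx, hy, mul_add]
  have h2 : ∀ z : Fock H ⊗[ℝ] Fock H, annih q f * wickM q z =
      wickM q ((annih q f).rTensor _ z) +
        wickM q (TensorProduct.map (scale q).toLinearMap (create f) z) := by
    intro z
    induction z using TensorProduct.induction_on with
    | zero => simp
    | tmul x y => ext u; simp [annih_mul]
    | add x y hx hy => simp only [map_add, mul_add, hx, hy]; abel
  simp only [field, wick, LinearMap.add_apply, create_apply, LinearMap.comp_apply, map_add,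
    shuf_inc_mul, shuf_annih, add_mul, h1, h2]
  abel

theorem mul_wick (q : ℝ) {A : Module.End ℝ (Fock H)} (hA : A ∈ fieldSub H q) (v : Fock H) :
    A * wick q v = wick q (A v) := by
  induction hA using Algebra.adjoin_induction generalizing v with
  | mem x hx => obtain ⟨f, rfl⟩ := hx; exact field_mul_wick q f v
  | algebraMap r => simp [Algebra.algebraMap_eq_smul_one]
  | add x y _ _ hx hy => rw [add_mul, hx, hy]; simp
  | mul x y _ _ hx hy => rw [mul_assoc, hy, hx]; rfl

/-- Every element of the field algebra is the Wick polynomial of its vacuum vector. -/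
theorem eq_wick (q : ℝ) {A : Module.End ℝ (Fock H)} (hA : A ∈ fieldSub H q) :
    A = wick q (A 1) := by
  rw [← mul_wick q hA, wick_one, mul_one]

theorem wick_mem (q : ℝ) (v : Fock H) : wick q v ∈ fieldSub H q := by
  let G : Submodule ℝ (Fock H) :=
    (fieldSub H q).toSubmodule.map (LinearMap.applyₗ (1 : Fock H))
  have hG : ∀ f u, u ∈ G → field q f u ∈ G := by
    rintro f _ ⟨A, hA, rfl⟩
    exact ⟨field q f * A, (fieldSub H q).mul_mem (Algebra.subset_adjoin ⟨f, rfl⟩) hA, rfl⟩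
  have key : ∀ u y : Fock H, annR q y u ∈ G := by
    intro u
    induction u using fock_ind with
    | one =>
      intro y; rw [annR_vac]
      exact G.smul_mem _ ⟨1, (fieldSub H q).one_mem, rfl⟩
    | smul r x hx => intro y; rw [map_smul]; exact G.smul_mem _ (hx y)
    | add x x' hx hx' => intro y; rw [map_add]; exact G.add_mem (hx y) (hx' y)
    | mul g u hu =>
      intro y
      have h : ∃ y₁ y₂ : Fock H, annR q y (inc g * u) = inc g * annR q y₁ u + annR q y₂ u := by
        induction y using fock_ind with
        | one => exact ⟨1, 0, by simp⟩
        | smul r x hx =>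
          obtain ⟨y₁, y₂, h⟩ := hx
          exact ⟨r • y₁, r • y₂, by simp [h]⟩
        | add x x' hx hx' =>
          obtain ⟨y₁, y₂, h⟩ := hx
          obtain ⟨y₃, y₄, h'⟩ := hx'
          refine ⟨y₁ + y₃, y₂ + y₄, ?_⟩
          simp only [map_add, LinearMap.add_apply, h, h', mul_add]; abel
        | mul f x hx =>
          obtain ⟨y₁, y₂, h⟩ := hx
          refine ⟨q • (inc f * y₁), (inner ℝ f g : ℝ) • y₁ + inc f * y₂, ?_⟩
          rw [annR_inc_mul, h, map_add, annih_inc_mul]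
          simp only [map_add, map_smul, LinearMap.add_apply, LinearMap.smul_apply, annR_inc_mul,
            mul_smul_comm]
          abel
      obtain ⟨y₁, y₂, h⟩ := h
      rw [h]
      have e : inc g * annR q y₁ u = field q g (annR q y₁ u) - annR q (inc g * y₁) u := by
        simp [field]
      rw [e]
      exact G.add_mem (G.sub_mem (hG _ _ (hu _)) (hu _)) (hu _)
  obtain ⟨A, hA, h⟩ := key v 1
  have h' : A 1 = v := by simpa using h
  have := eq_wick q hA
  rw [h'] at this
  rw [← this]
  exact hA

end Wick

/-! ### Norm bounds for Wick products -/

section Bounds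
variable {H : Type*} [NormedAddCommGroup H] [InnerProductSpace ℝ H]

theorem iso_sum {ι E F : Type*} [Fintype ι] [NormedAddCommGroup E] [InnerProductSpace ℝ E]
    [NormedAddCommGroup F] [InnerProductSpace ℝ F] {e : ι → H} (he : Orthonormal ℝ e)
    {T : H → E →ₗ[ℝ] F} (hT : ∀ f g u v, inner ℝ (T f u) (T g v) = inner ℝ f g * inner ℝ u v)
    (w : ι → E) : ‖∑ i, T (e i) (w i)‖ ^ 2 = ∑ i, ‖w i‖ ^ 2 := by
  classical
  simp only [← real_inner_self_eq_norm_sq]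
  simp only [sum_inner, inner_sum, hT, orthonormal_iff_ite.1 he, ite_mul, one_mul,
    zero_mul, Finset.sum_ite_eq', Finset.mem_univ, if_true]

theorem iso_le {ι E F E' F' : Type*} [Fintype ι] [NormedAddCommGroup E] [InnerProductSpace ℝ E]
    [NormedAddCommGroup F] [InnerProductSpace ℝ F] [NormedAddCommGroup E'] [InnerProductSpace ℝ E']
    [NormedAddCommGroup F'] [InnerProductSpace ℝ F'] {e : ι → H} (he : Orthonormal ℝ e)
    {T : H → E →ₗ[ℝ] F} (hT : ∀ f g u v, inner ℝ (T f u) (T g v) = inner ℝ f g * inner ℝ u v)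
    {T' : H → E' →ₗ[ℝ] F'} (hT' : ∀ f g u v, inner ℝ (T' f u) (T' g v) = inner ℝ f g * inner ℝ u v)
    (w : ι → E) (w' : ι → E') {p : ℝ} (hp : 0 ≤ p) (h : ∀ i, ‖w i‖ ≤ p * ‖w' i‖) :
    ‖∑ i, T (e i) (w i)‖ ≤ p * ‖∑ i, T' (e i) (w' i)‖ := by
  apply le_of_sq_le_sq _ (by positivity)
  rw [mul_pow, iso_sum he hT, iso_sum he hT', Finset.mul_sum]
  refine Finset.sum_le_sum fun i _ => ?_
  rw [← mul_pow]
  exact pow_le_pow_left₀ (norm_nonneg _) (h i) 2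

theorem create_iso (f g : H) (u v : Fock H) :
    inner ℝ (create f u) (create g v) = inner ℝ f g * inner ℝ u v := form_inc_mul f g u v

/-- Right creation operator. -/
def createR : H →ₗ[ℝ] Module.End ℝ (Fock H) := (LinearMap.mul ℝ (Fock H)).flip.comp inc

@[simp] theorem createR_apply (f : H) (u : Fock H) : createR f u = u * inc f := rfl

theorem lTensor_iso {T : H → Module.End ℝ (Fock H)}
    (hT : ∀ f g u v, inner ℝ (T f u) (T g v) = inner ℝ f g * inner ℝ u v) (f g : H)
    (u v : Fock H ⊗[ℝ] Fock H) :
    inner ℝ ((T f).lTensor (Fock H) u) ((T g).lTensor (Fock H) v) = inner ℝ f g * inner ℝ u v := by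
  induction u using TensorProduct.induction_on with
  | zero => simp
  | add x y hx hy => simp only [map_add, inner_add_left, hx, hy, mul_add]
  | tmul a b =>
    induction v using TensorProduct.induction_on with
    | zero => simp
    | add x y hx hy => simp only [map_add, inner_add_right, hx, hy, mul_add]
    | tmul c d => simp only [LinearMap.lTensor_tmul, TensorProduct.inner_tmul, hT]; ring

theorem rTensor_iso {T : H → Module.End ℝ (Fock H)}
    (hT : ∀ f g u v, inner ℝ (T f u) (T g v) = inner ℝ f g * inner ℝ u v) (f g : H)
    (u v : Fock H ⊗[ℝ] Fock H) :
    inner ℝ ((T f).rTensor (Fock H) u) ((T g).rTensor (Fock H) v) = inner ℝ f g * inner ℝ u v := by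
  induction u using TensorProduct.induction_on with
  | zero => simp
  | add x y hx hy => simp only [map_add, inner_add_left, hx, hy, mul_add]
  | tmul a b =>
    induction v using TensorProduct.induction_on with
    | zero => simp
    | add x y hx hy => simp only [map_add, inner_add_right, hx, hy, mul_add]
    | tmul c d => simp only [LinearMap.rTensor_tmul, TensorProduct.inner_tmul, hT]; ring

theorem norm_one_fock : ‖(1 : Fock H)‖ = 1 := by
  have : ‖(1 : Fock H)‖ ^ 2 = 1 := by
    rw [← real_inner_self_eq_norm_sq, inner_eq_form, form_one_one]
  nlinarith [norm_nonneg (1 : Fock H)]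

/-- `C_q = ∏ₙ (1 - |q|ⁿ)⁻¹`, `n ≥ 1`. -/
def Cq (q : ℝ) : ℝ := ∏' i : ℕ, (1 - |q| ^ (i + 1))⁻¹

/-- `D_q = (1 - |q|)⁻¹` -/
def Dq (q : ℝ) : ℝ := (1 - |q|)⁻¹

/-- The partial products of `C_q`. -/
def pq (q : ℝ) (k : ℕ) : ℝ := ∏ i ∈ Finset.range k, (1 - |q| ^ (i + 1))⁻¹

variable {q : ℝ}

theorem one_le_fac (hq : |q| < 1) (i : ℕ) : 1 ≤ (1 - |q| ^ (i + 1))⁻¹ := by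
  have h : |q| ^ (i + 1) < 1 := pow_lt_one₀ (abs_nonneg q) hq (by simp)
  have h' : 0 ≤ |q| ^ (i + 1) := by positivity
  rw [one_le_inv₀ (by linarith)]; linarith

theorem one_le_Dq (hq : |q| < 1) : 1 ≤ Dq q := by
  simpa [Dq] using one_le_fac hq 0

theorem Dq_eq (hq : |q| < 1) : 1 + |q| * Dq q = Dq q := by
  have : 1 - |q| ≠ 0 := by linarith
  rw [Dq]; field_simp; ring

theorem pq_succ (hq : |q| < 1) (k : ℕ) : pq q k + |q| ^ (k + 1) * pq q (k + 1) = pq q (k + 1) := by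
  have h : |q| ^ (k + 1) < 1 := pow_lt_one₀ (abs_nonneg q) hq (by simp)
  have : 1 - |q| ^ (k + 1) ≠ 0 := by linarith
  rw [pq, pq, Finset.prod_range_succ]
  field_simp
  ring

theorem one_le_pq (hq : |q| < 1) (k : ℕ) : 1 ≤ pq q k := by
  induction k with
  | zero => simp [pq]
  | succ k ih =>
    rw [pq, Finset.prod_range_succ]
    exact one_le_mul_of_one_le_of_one_le ih (one_le_fac hq k)

theorem pq_le_Cq (hq : |q| < 1) (k : ℕ) : pq q k ≤ Cq q := by
  have hm : Multipliable fun i : ℕ => (1 - |q| ^ (i + 1))⁻¹ := by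
    have hs : Summable fun i : ℕ => |q| ^ (i + 1) * (1 - |q| ^ (i + 1))⁻¹ := by
      refine Summable.of_nonneg_of_le (fun i => ?_) (fun i => ?_)
        (((summable_geometric_of_lt_one (abs_nonneg q) hq).mul_left |q|).mul_right (Dq q))
      · have := one_le_fac hq i; positivity
      · rw [pow_succ']
        refine mul_le_mul_of_nonneg_left ?_ (by positivity)
        have h' : 0 ≤ |q| ^ i := by positivity
        have h'' : |q| ^ i ≤ 1 := pow_le_one₀ (abs_nonneg q) hq.le
        exact inv_anti₀ (by linarith) (by nlinarith [abs_nonneg q])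
    convert Real.multipliable_one_add_of_summable hs using 2 with i
    have h : |q| ^ (i + 1) < 1 := pow_lt_one₀ (abs_nonneg q) hq (by simp)
    have : 1 - |q| ^ (i + 1) ≠ 0 := by linarith
    field_simp; ring
  have mono : Monotone (pq q) := monotone_nat_of_le_succ fun k => by
    rw [pq, pq, Finset.prod_range_succ]
    exact le_mul_of_one_le_right (zero_le_one.trans (one_le_pq hq k)) (one_le_fac hq k)
  exact mono.ge_of_tendsto hm.hasProd.tendsto_prod_nat k

theorem one_le_Cq (hq : |q| < 1) : 1 ≤ Cq q := pq_le_Cq hq 0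

variable {ι : Type*} [Fintype ι] {e : ι → H}

theorem norm_mul_hom (he : Orthonormal ℝ e) {k : ℕ} {x : Fock H} (hx : x ∈ oneSpan e ^ k)
    (u : Fock H) : ‖x * u‖ ≤ ‖x‖ * ‖u‖ := by
  induction k generalizing x with
  | zero =>
    obtain ⟨c, rfl⟩ := mem_zero e hx
    simp [norm_smul, norm_one_fock]
  | succ k ih =>
    obtain ⟨w, hw, rfl⟩ := peel e k hx
    have := iso_le he create_iso create_iso (fun i => w i * u) w (norm_nonneg u)
      fun i => by rw [mul_comm]; exact ih (hw i)
    simp only [create_apply] at this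
    simpa only [Finset.sum_mul, mul_assoc, mul_comm ‖u‖] using this

theorem annih_hom (q : ℝ) (f : H) {n : ℕ} {u : Fock H} (hu : u ∈ oneSpan e ^ (n + 1)) :
    annih q f u ∈ oneSpan e ^ n := by
  induction n generalizing u with
  | zero =>
    obtain ⟨w, hw, rfl⟩ := peel e 0 hu
    rw [map_sum]
    refine Submodule.sum_mem _ fun i _ => ?_
    obtain ⟨c, hc⟩ := mem_zero e (hw i)
    rw [annih_inc_mul, hc, map_smul, annih_one, smul_zero, mul_zero, smul_zero, add_zero, ← hc]
    exact Submodule.smul_mem _ _ (hw i)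
  | succ n ih =>
    obtain ⟨w, hw, rfl⟩ := peel e (n + 1) hu
    rw [map_sum]
    refine Submodule.sum_mem _ fun i _ => ?_
    rw [annih_inc_mul]
    exact Submodule.add_mem _ (Submodule.smul_mem _ _ (hw i))
      (Submodule.smul_mem _ _ (inc_mul_mem e i (ih (hw i))))

theorem annih_bound (hq : |q| < 1) (he : Orthonormal ℝ e) {n : ℕ} {u : Fock H}
    (hu : u ∈ oneSpan e ^ n) : ∑ i, ‖annih q (e i) u‖ ^ 2 ≤ Dq q ^ 2 * ‖u‖ ^ 2 := by
  classical
  induction n generalizing u with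
  | zero =>
    obtain ⟨c, rfl⟩ := mem_zero e hu
    simp only [map_smul, annih_one, smul_zero, norm_zero]
    simp only [ne_eq, OfNat.ofNat_ne_zero, not_false_eq_true, zero_pow, Finset.sum_const_zero]
    positivity
  | succ n ih =>
    obtain ⟨w, hw, rfl⟩ := peel e n hu
    have hD := one_le_Dq hq
    have hDe := Dq_eq hq
    have e1 : ∀ i, annih q (e i) (∑ j, inc (e j) * w j) =
        w i + q • ∑ j, create (e j) (annih q (e i) (w j)) := by
      intro i
      simp only [map_sum, annih_inc_mul, Finset.sum_add_distrib, orthonormal_iff_ite.1 he, ite_smul,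
        one_smul, zero_smul, Finset.sum_ite_eq, Finset.mem_univ, if_true, Finset.smul_sum,
        create_apply]
    have e2 : ∀ i, ‖annih q (e i) (∑ j, inc (e j) * w j)‖ ^ 2 ≤
        Dq q * ‖w i‖ ^ 2 + |q| * ∑ j, ‖annih q (e i) (w j)‖ ^ 2 := by
      intro i
      rw [e1, ← iso_sum he create_iso]
      set b := ‖∑ j, create (e j) (annih q (e i) (w j))‖
      have h := norm_add_le (w i) (q • ∑ j, create (e j) (annih q (e i) (w j)))
      rw [norm_smul, Real.norm_eq_abs] at h
      have hb : 0 ≤ b := norm_nonneg _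
      have ha := norm_nonneg (w i)
      have hq0 := abs_nonneg q
      refine (pow_le_pow_left₀ (norm_nonneg _) h 2).trans ?_
      have hinv : (1 - |q|) * Dq q = 1 := by linarith
      have : 0 ≤ |q| * (1 - |q|) * (Dq q * ‖w i‖ - b) ^ 2 :=
        mul_nonneg (mul_nonneg hq0 (by linarith)) (sq_nonneg _)
      have e3 : Dq q * ‖w i‖ ^ 2 + |q| * b ^ 2 - (‖w i‖ + |q| * b) ^ 2 =
          |q| * (1 - |q|) * (Dq q * ‖w i‖ - b) ^ 2 := by
        have hD2 : Dq q = 1 + |q| * Dq q := hDe.symm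
        linear_combination (|q| * Dq q * ‖w i‖ ^ 2 - 2 * |q| * ‖w i‖ * b) * (-hinv)
          + ‖w i‖ ^ 2 * hD2
      linarith
    refine (Finset.sum_le_sum fun i _ => e2 i).trans ?_
    rw [Finset.sum_add_distrib, ← Finset.mul_sum, ← Finset.mul_sum, Finset.sum_comm]
    have e4 : ∑ j, ∑ i, ‖annih q (e i) (w j)‖ ^ 2 ≤ Dq q ^ 2 * ∑ j, ‖w j‖ ^ 2 := by
      rw [Finset.mul_sum]
      exact Finset.sum_le_sum fun j _ => ih (hw j)
    have e5 := iso_sum he create_iso w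
    simp only [create_apply] at e5
    rw [e5]
    have := mul_le_mul_of_nonneg_left e4 (abs_nonneg q)
    have e6 : Dq q ^ 2 * ∑ i, ‖w i‖ ^ 2 = Dq q * ∑ i, ‖w i‖ ^ 2 +
      |q| * (Dq q ^ 2 * ∑ i, ‖w i‖ ^ 2) := by
      linear_combination (-Dq q * ∑ i, ‖w i‖ ^ 2) * hDe
    linarith

/-- Span of the split words with `k` creators and `l` annihilators. -/
def splitSpan (e : ι → H) (k l : ℕ) : Submodule ℝ (Fock H ⊗[ℝ] Fock H) :=
  Submodule.map₂ (TensorProduct.mk ℝ (Fock H) (Fock H)) (oneSpan e ^ k) (oneSpan e ^ l)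

theorem split_mem {k l : ℕ} {x y : Fock H} (hx : x ∈ oneSpan e ^ k) (hy : y ∈ oneSpan e ^ l) :
    x ⊗ₜ y ∈ splitSpan e k l :=
  Submodule.apply_mem_map₂ (TensorProduct.mk ℝ (Fock H) (Fock H)) hx hy

theorem split_ind {k l : ℕ} {S : Submodule ℝ (Fock H ⊗[ℝ] Fock H)}
    (h : ∀ x ∈ oneSpan e ^ k, ∀ y ∈ oneSpan e ^ l, x ⊗ₜ y ∈ S) {z : Fock H ⊗[ℝ] Fock H}
    (hz : z ∈ splitSpan e k l) : z ∈ S := by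
  have : splitSpan e k l ≤ S := Submodule.map₂_le.2 fun x hx y hy => h x hx y hy
  exact this hz

theorem peelR (m : ℕ) {v : Fock H} (hv : v ∈ oneSpan e ^ (m + 1)) :
    ∃ w : ι → Fock H, (∀ i, w i ∈ oneSpan e ^ m) ∧ v = ∑ i, w i * inc (e i) := by
  classical
  rw [pow_succ] at hv
  refine Submodule.mul_induction_on hv ?_ ?_
  · intro b hb a ha
    obtain ⟨c, rfl⟩ := (Submodule.mem_span_range_iff_exists_fun ℝ).1 ha
    refine ⟨fun i => c i • b, fun i => Submodule.smul_mem _ _ hb, ?_⟩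
    rw [Finset.mul_sum]
    exact Finset.sum_congr rfl fun i _ => by rw [smul_mul_assoc, mul_smul_comm]
  · rintro x y ⟨w, hw, rfl⟩ ⟨w', hw', rfl⟩
    exact ⟨fun i => w i + w' i, fun i => Submodule.add_mem _ (hw i) (hw' i), by
      simp [add_mul, Finset.sum_add_distrib]⟩

theorem split_peel (k l : ℕ) {z : Fock H ⊗[ℝ] Fock H} (hz : z ∈ splitSpan e k (l + 1)) :
    ∃ w : ι → Fock H ⊗[ℝ] Fock H, (∀ i, w i ∈ splitSpan e k l) ∧
      z = ∑ i, (createR (e i)).lTensor (Fock H) (w i) := by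
  let S : Submodule ℝ (Fock H ⊗[ℝ] Fock H) :=
    { carrier := {z | ∃ w : ι → Fock H ⊗[ℝ] Fock H, (∀ i, w i ∈ splitSpan e k l) ∧
        z = ∑ i, (createR (e i)).lTensor (Fock H) (w i)}
      add_mem' := by
        rintro x y ⟨w, hw, rfl⟩ ⟨w', hw', rfl⟩
        exact ⟨fun i => w i + w' i, fun i => Submodule.add_mem _ (hw i) (hw' i), by
          simp [Finset.sum_add_distrib]⟩
      zero_mem' := ⟨0, fun i => Submodule.zero_mem _, by simp⟩
      smul_mem' := by
        rintro r x ⟨w, hw, rfl⟩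
        exact ⟨fun i => r • w i, fun i => Submodule.smul_mem _ _ (hw i), by
          simp [Finset.smul_sum]⟩ }
  refine split_ind (S := S) (fun x hx y hy => ?_) hz
  obtain ⟨w, hw, rfl⟩ := peelR l hy
  exact ⟨fun i => x ⊗ₜ w i, fun i => split_mem hx (hw i), by simp [TensorProduct.tmul_sum]⟩

theorem split_zero (k : ℕ) {z : Fock H ⊗[ℝ] Fock H} (hz : z ∈ splitSpan e k 0) :
    ∃ x ∈ oneSpan e ^ k, z = x ⊗ₜ 1 := by
  have : z ∈ (oneSpan e ^ k).map ((TensorProduct.mk ℝ (Fock H) (Fock H)).flip 1) := by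
    refine split_ind (fun x hx y hy => ?_) hz
    obtain ⟨c, rfl⟩ := mem_zero e hy
    rw [TensorProduct.tmul_smul, TensorProduct.smul_tmul']
    exact Submodule.mem_map_of_mem (f := (TensorProduct.mk ℝ (Fock H) (Fock H)).flip 1)
      (Submodule.smul_mem _ c hx)
  obtain ⟨x, hx, rfl⟩ := this
  exact ⟨x, hx, rfl⟩

theorem wickM_createR (q : ℝ) (f : H) (z : Fock H ⊗[ℝ] Fock H) (u : Fock H) :
    wickM q ((createR f).lTensor (Fock H) z) u = wickM q z (annih q f u) := by
  induction z using TensorProduct.induction_on with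
  | zero => simp
  | add x y hx hy => simp [hx, hy]
  | tmul x y => simp

theorem wickM_hom (q : ℝ) {k l n : ℕ} {z : Fock H ⊗[ℝ] Fock H} (hz : z ∈ splitSpan e k l)
    {u : Fock H} (hu : u ∈ oneSpan e ^ n) :
    (l ≤ n → wickM q z u ∈ oneSpan e ^ (k + (n - l))) ∧ (n < l → wickM q z u = 0) := by
  induction l generalizing n z u with
  | zero =>
    obtain ⟨x, hx, rfl⟩ := split_zero k hz
    refine ⟨fun _ => ?_, fun h => absurd h (by simp)⟩
    simp only [wickM_tmul, map_one, Module.End.one_apply, Nat.sub_zero, pow_add]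
    exact Submodule.mul_mem_mul hx hu
  | succ l ih =>
    obtain ⟨w, hw, rfl⟩ := split_peel k l hz
    simp only [map_sum, LinearMap.sum_apply, wickM_createR]
    cases n with
    | zero =>
      refine ⟨fun h => absurd h (by simp), fun _ => Finset.sum_eq_zero fun i _ => ?_⟩
      obtain ⟨c, rfl⟩ := mem_zero e hu
      simp
    | succ n =>
      refine ⟨fun h => Submodule.sum_mem _ fun i _ => ?_, fun h => Finset.sum_eq_zero fun i _ => ?_⟩
      · rw [Nat.add_sub_add_right]
        exact (ih (hw i) (annih_hom q (e i) hu)).1 (by omega)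
      · exact (ih (hw i) (annih_hom q (e i) hu)).2 (by omega)

theorem createR_iso (f g : H) (u v : Fock H) :
    inner ℝ (createR f u) (createR g v) = inner ℝ f g * inner ℝ u v := form_mul_inc f g u v

theorem wickM_bound (hq : |q| < 1) (he : Orthonormal ℝ e) {k l n : ℕ} {z : Fock H ⊗[ℝ] Fock H}
    (hz : z ∈ splitSpan e k l) {u : Fock H} (hu : u ∈ oneSpan e ^ n) :
    ‖wickM q z u‖ ≤ Dq q ^ l * ‖z‖ * ‖u‖ := by
  have hD := one_le_Dq hq
  induction l generalizing n z u with
  | zero =>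
    obtain ⟨x, hx, rfl⟩ := split_zero k hz
    simpa [norm_one_fock] using norm_mul_hom he hx u
  | succ l ih =>
    cases n with
    | zero =>
      rw [(wickM_hom q hz hu).2 (by omega), norm_zero]
      positivity
    | succ n =>
    obtain ⟨w, hw, rfl⟩ := split_peel k l hz
    have hi : ‖wickM q (∑ i, (createR (e i)).lTensor (Fock H) (w i)) u‖ ≤
        ∑ i, Dq q ^ l * ‖w i‖ * ‖annih q (e i) u‖ := by
      simp only [map_sum, LinearMap.sum_apply, wickM_createR]
      exact (norm_sum_le _ _).trans (Finset.sum_le_sum fun i _ =>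
        ih (hw i) (annih_hom q (e i) hu))
    refine hi.trans ?_
    have e1 := iso_sum he (lTensor_iso createR_iso) w
    have e2 := annih_bound hq he hu
    have cs := Finset.sum_mul_sq_le_sq_mul_sq Finset.univ (fun i => ‖w i‖)
      fun i => ‖annih q (e i) u‖
    rw [← e1] at cs
    simp only [mul_assoc, ← Finset.mul_sum]
    rw [pow_succ, mul_assoc]
    refine mul_le_mul_of_nonneg_left ?_ (by positivity)
    apply le_of_sq_le_sq _ (by positivity)
    refine cs.trans ((mul_le_mul_of_nonneg_left e2 (by positivity)).trans (le_of_eq ?_))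
    ring

theorem scale_hom (q : ℝ) {k : ℕ} {x : Fock H}
    (hx : x ∈ oneSpan e ^ k) : scale q x = q ^ k • x := by
  induction k generalizing x with
  | zero => obtain ⟨c, rfl⟩ := mem_zero e hx; simp
  | succ k ih =>
    obtain ⟨w, hw, rfl⟩ := peel e k hx
    rw [map_sum, Finset.smul_sum]
    refine Finset.sum_congr rfl fun i _ => ?_
    rw [scale_inc_mul, ih (hw i), pow_succ', mul_smul, mul_smul_comm]

theorem map_scale_create (q : ℝ) {k l : ℕ} (f : H) {z : Fock H ⊗[ℝ] Fock H}
    (hz : z ∈ splitSpan e k l) : TensorProduct.map (scale q).toLinearMap (create f) z =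
      q ^ k • (create f).lTensor (Fock H) z := by
  have hs : ∀ x ∈ oneSpan e ^ k, scale q x = q ^ k • x := fun x hx => scale_hom q hx
  let S : Submodule ℝ (Fock H ⊗[ℝ] Fock H) := LinearMap.ker
    (TensorProduct.map (scale q).toLinearMap (create f) - q ^ k • (create f).lTensor (Fock H))
  have : z ∈ S := by
    refine split_ind (fun x hx y hy => ?_) hz
    rw [LinearMap.mem_ker, LinearMap.sub_apply, LinearMap.smul_apply, TensorProduct.map_tmul,
      LinearMap.lTensor_tmul, AlgHom.toLinearMap_apply, hs x hx, TensorProduct.smul_tmul', sub_self]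
  rw [LinearMap.mem_ker, LinearMap.sub_apply, sub_eq_zero] at this
  exact this

theorem split_create_left {k l : ℕ} (i : ι) {z : Fock H ⊗[ℝ] Fock H} (hz : z ∈ splitSpan e k l) :
    (create (e i)).rTensor (Fock H) z ∈ splitSpan e (k + 1) l := by
  refine split_ind (S := (splitSpan e (k + 1) l).comap ((create (e i)).rTensor (Fock H)))
    (fun x hx y hy => ?_) hz
  rw [Submodule.mem_comap, LinearMap.rTensor_tmul]
  exact split_mem (inc_mul_mem e i hx) hy

theorem split_create_right {k l : ℕ} (i : ι) {z : Fock H ⊗[ℝ] Fock H} (hz : z ∈ splitSpan e k l) :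
    (create (e i)).lTensor (Fock H) z ∈ splitSpan e k (l + 1) := by
  refine split_ind (S := (splitSpan e k (l + 1)).comap ((create (e i)).lTensor (Fock H)))
    (fun x hx y hy => ?_) hz
  rw [Submodule.mem_comap, LinearMap.lTensor_tmul]
  exact split_mem hx (inc_mul_mem e i hy)

theorem shuf_bound (hq : |q| < 1) (he : Orthonormal ℝ e) {m : ℕ} {v : Fock H}
    (hv : v ∈ oneSpan e ^ m) : ∃ z : ℕ → Fock H ⊗[ℝ] Fock H,
      shuf q v = ∑ k ∈ Finset.range (m + 1), z k ∧ ∀ k ≤ m, z k ∈ splitSpan e k (m - k) ∧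
        ‖z k‖ ≤ pq q k * ‖v‖ := by
  induction m generalizing v with
  | zero =>
    obtain ⟨c, rfl⟩ := mem_zero e hv
    refine ⟨fun _ => c • (1 ⊗ₜ 1), by simp [shuf_one], fun k hk => ?_⟩
    obtain rfl : k = 0 := by omega
    refine ⟨Submodule.smul_mem _ _ (split_mem ?_ ?_), ?_⟩
    · simp [Submodule.one_le.1 le_rfl]
    · simp [Submodule.one_le.1 le_rfl]
    · simp [pq, norm_smul, norm_one_fock]
  | succ m ih =>
    obtain ⟨w, hw, rfl⟩ := peel e m hv
    choose z hz hz' using fun i => ih (hw i)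
    let a : ℕ → Fock H ⊗[ℝ] Fock H := fun k =>
      match k with
      | 0 => 0
      | k + 1 => ∑ i, (create (e i)).rTensor (Fock H) (z i k)
    let b : ℕ → Fock H ⊗[ℝ] Fock H := fun k =>
      if k ≤ m then q ^ k • ∑ i, (create (e i)).lTensor (Fock H) (z i k) else 0
    have hn : 0 ≤ ‖∑ i, inc (e i) * w i‖ := norm_nonneg _
    have ha : ∀ k ≤ m, ‖a (k + 1)‖ ≤ pq q k * ‖∑ i, inc (e i) * w i‖ := fun k hk =>
      iso_le he (rTensor_iso create_iso) create_iso _ _ (zero_le_one.trans (one_le_pq hq k))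
        fun i => (hz' i k hk).2
    have hb : ∀ k, ‖b k‖ ≤ |q| ^ k * (pq q k * ‖∑ i, inc (e i) * w i‖) := by
      intro k
      have hp := one_le_pq hq k
      by_cases hk : k ≤ m
      · simp only [b, if_pos hk, norm_smul, norm_pow, Real.norm_eq_abs]
        exact mul_le_mul_of_nonneg_left (iso_le he (lTensor_iso create_iso) create_iso _ _
          (zero_le_one.trans hp) fun i => (hz' i k hk).2) (by positivity)
      · simp only [b, if_neg hk, norm_zero]
        positivity
    refine ⟨fun k => a k + b k, ?_, ?_⟩
    · rw [Finset.sum_add_distrib, Finset.sum_range_succ' a, Finset.sum_range_succ b]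
      simp only [a, b, add_zero]
      rw [if_neg (by omega), add_zero]
      rw [Finset.sum_congr rfl fun k hk => if_pos (Nat.lt_succ_iff.1 (Finset.mem_range.1 hk))]
      simp only [map_sum, shuf_inc_mul, hz, Finset.sum_add_distrib]
      congr 1
      · rw [Finset.sum_comm]
      · simp only [Finset.smul_sum]
        rw [Finset.sum_comm]
        refine Finset.sum_congr rfl fun k hk => Finset.sum_congr rfl fun i _ => ?_
        exact map_scale_create q _ (hz' i k (Nat.lt_succ_iff.1 (Finset.mem_range.1 hk))).1
    · intro k hk
      constructor
      · refine Submodule.add_mem _ ?_ ?_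
        · cases k with
          | zero => exact Submodule.zero_mem _
          | succ k =>
            refine Submodule.sum_mem _ fun i _ => ?_
            rw [Nat.add_sub_add_right]
            exact split_create_left i (hz' i k (by omega)).1
        · by_cases h : k ≤ m
          · simp only [b, if_pos h]
            refine Submodule.smul_mem _ _ (Submodule.sum_mem _ fun i _ => ?_)
            rw [Nat.sub_add_comm h]
            exact split_create_right i (hz' i k h).1
          · simp only [b, if_neg h]; exact Submodule.zero_mem _
      · refine (norm_add_le _ _).trans ?_
        cases k with
        | zero => simpa [a] using hb 0
        | succ k =>
          have := pq_succ hq k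
          calc _ ≤ pq q k * ‖∑ i, inc (e i) * w i‖ +
                |q| ^ (k + 1) * (pq q (k + 1) * ‖∑ i, inc (e i) * w i‖) :=
                add_le_add (ha k (by omega)) (hb _)
            _ = (pq q k + |q| ^ (k + 1) * pq q (k + 1)) * ‖∑ i, inc (e i) * w i‖ := by ring
            _ = _ := by rw [this]

end Bounds

/-! ### The norm of the field algebra -/

section Norm
variable {H : Type*} [NormedAddCommGroup H] [InnerProductSpace ℝ H] {q : ℝ}

theorem oneSpan_le {ι : Type*} (e : ι → H) (m : ℕ) :
    oneSpan e ^ m ≤ (LinearMap.range (inc : H →ₗ[ℝ] Fock H)) ^ m := by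
  refine pow_le_pow_left' ?_ m
  rw [oneSpan, Submodule.span_le]
  rintro _ ⟨i, rfl⟩
  exact ⟨e i, rfl⟩

theorem chaos_same {ι : Type*} {e : ι → H} {m : ℕ} {u : Fock H} (hu : u ∈ oneSpan e ^ m) :
    chaos m u = u := DirectSum.decompose_of_mem_same _ (oneSpan_le e m hu)

theorem chaos_ne {ι : Type*} {e : ι → H} {m k : ℕ} {u : Fock H} (hu : u ∈ oneSpan e ^ m)
    (h : m ≠ k) : chaos k u = 0 := DirectSum.decompose_of_mem_ne _ (oneSpan_le e m hu) h

/-- The weight `(k + 1) C_q^{3/2} D_q^k`. -/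
def wt (q : ℝ) (k : ℕ) : ℝ := (k + 1) * Cq q ^ (3 / 2 : ℝ) * Dq q ^ k

/-- The norm of the Wick polynomial with chaos components `chaos k u`. -/
def mnorm (q : ℝ) (u : Fock H) : ℝ := ∑' k, wt q k * ‖chaos k u‖

theorem wt_pos (hq : |q| < 1) (k : ℕ) : 0 < wt q k := by
  have h1 := one_le_Cq hq
  have h2 := one_le_Dq hq
  unfold wt; positivity

theorem mnorm_summable (q : ℝ) (u : Fock H) : Summable fun k => wt q k * ‖chaos k u‖ := by
  classical
  refine summable_of_hasFiniteSupport (Set.Finite.subset (Finset.finite_toSet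
    (DFinsupp.support (DirectSum.decompose
      (fun k : ℕ => (LinearMap.range (inc : H →ₗ[ℝ] Fock H)) ^ k) u))) ?_)
  intro k hk
  simp only [Finset.mem_coe, DFinsupp.mem_support_toFun]
  intro h
  apply hk
  have : chaos k u = 0 := by
    change ((DirectSum.decompose
      (fun k : ℕ => (LinearMap.range (inc : H →ₗ[ℝ] Fock H)) ^ k) u k) : Fock H) = 0
    rw [h]; rfl
  simp [this]

theorem mnorm_nonneg (hq : |q| < 1) (u : Fock H) : 0 ≤ mnorm q u :=
  tsum_nonneg fun k => mul_nonneg (wt_pos hq k).le (norm_nonneg _)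

theorem mnorm_add (hq : |q| < 1) (u v : Fock H) : mnorm q (u + v) ≤ mnorm q u + mnorm q v := by
  rw [mnorm, mnorm, mnorm, ← (mnorm_summable q u).tsum_add (mnorm_summable q v)]
  refine (mnorm_summable q _).tsum_le_tsum (fun k => ?_)
    ((mnorm_summable q u).add (mnorm_summable q v))
  rw [← mul_add, map_add]
  exact mul_le_mul_of_nonneg_left (norm_add_le _ _) (wt_pos hq k).le

theorem mnorm_smul (q r : ℝ) (u : Fock H) : mnorm q (r • u) = |r| * mnorm q u := by
  simp only [mnorm, map_smul, norm_smul, Real.norm_eq_abs, mul_left_comm _ |r|, tsum_mul_left]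

theorem mnorm_zero (q : ℝ) : mnorm q (0 : Fock H) = 0 := by simp [mnorm]

theorem mnorm_sum (hq : |q| < 1) {α : Type*} (s : Finset α) (x : α → Fock H) :
    mnorm q (∑ i ∈ s, x i) ≤ ∑ i ∈ s, mnorm q (x i) := by
  classical
  induction s using Finset.induction_on with
  | empty => simp [mnorm_zero]
  | insert a s ha ih =>
    rw [Finset.sum_insert ha, Finset.sum_insert ha]
    exact (mnorm_add hq _ _).trans (by gcongr)

theorem mnorm_hom {ι : Type*} {e : ι → H} {m : ℕ} {u : Fock H} (hu : u ∈ oneSpan e ^ m) :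
    mnorm q u = wt q m * ‖u‖ := by
  rw [mnorm, tsum_eq_single m fun k hk => by rw [chaos_ne hu hk.symm]; simp, chaos_same hu]

theorem chaos_finsupp {ι : Type*} {e : ι → H} (c : ℕ →₀ Fock H) (hc : ∀ m, c m ∈ oneSpan e ^ m)
    (k : ℕ) : chaos k (c.sum fun _ x => x) = c k := by
  rw [Finsupp.sum, map_sum, Finset.sum_eq_single k]
  · exact chaos_same (hc k)
  · intro m _ hm; exact chaos_ne (hc m) hm
  · intro hk; rw [Finsupp.notMem_support_iff.1 hk, map_zero]

theorem mnorm_finsupp {ι : Type*} {e : ι → H} (c : ℕ →₀ Fock H) (hc : ∀ m, c m ∈ oneSpan e ^ m) :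
    mnorm q (c.sum fun _ x => x) = ∑ m ∈ c.support, wt q m * ‖c m‖ := by
  simp only [mnorm, chaos_finsupp c hc]
  exact tsum_eq_sum fun k hk => by rw [Finsupp.notMem_support_iff.1 hk]; simp

theorem count (m n : ℕ) :
    ∑ l ∈ Finset.range (m + 1), (if l ≤ n then m + n - 2 * l + 1 else 0) ≤ (m + 1) * (n + 1) := by
  induction m generalizing n with
  | zero => simp
  | succ m ih =>
    rw [Finset.sum_range_succ']
    cases n with
    | zero => simp
    | succ n =>
      have : ∀ l, (if l + 1 ≤ n + 1 then m + 1 + (n + 1) - 2 * (l + 1) + 1 else 0) =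
          if l ≤ n then m + n - 2 * l + 1 else 0 := by
        intro l
        by_cases h : l ≤ n
        · rw [if_pos h, if_pos (by omega)]; omega
        · rw [if_neg h, if_neg (by omega)]
      simp only [this]
      have := ih n
      simp only [zero_le, if_true]
      have e : (m + 1 + 1) * (n + 1 + 1) = (m + 1) * (n + 1) + (m + n + 3) := by ring
      omega

theorem mnorm_mul_hom (hq : |q| < 1) {ι : Type*} [Fintype ι] {e : ι → H} (he : Orthonormal ℝ e)
    {m n : ℕ} {v u : Fock H} (hv : v ∈ oneSpan e ^ m) (hu : u ∈ oneSpan e ^ n) :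
    mnorm q (wick q v u) ≤ (wt q m * ‖v‖) * (wt q n * ‖u‖) := by
  obtain ⟨z, hz, hz'⟩ := shuf_bound hq he hv
  have hC := one_le_Cq hq
  have hD := one_le_Dq hq
  set c := Cq q ^ (3 / 2 : ℝ) with hc
  have hcC : Cq q ≤ c := by
    rw [hc]; nth_rewrite 1 [← Real.rpow_one (Cq q)]
    exact Real.rpow_le_rpow_of_exponent_le hC (by norm_num)
  have hc1 : 1 ≤ c := hC.trans hcC
  have key : ∀ l ∈ Finset.range (m + 1), mnorm q (wickM q (z (m - l)) u) ≤
      ((if l ≤ n then m + n - 2 * l + 1 else 0 : ℕ) : ℝ) *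
        (c * c * Dq q ^ (m + n) * ‖v‖ * ‖u‖) := by
    intro l hl
    have hl' : l ≤ m := Nat.lt_succ_iff.1 (Finset.mem_range.1 hl)
    obtain ⟨h1, h2⟩ := hz' (m - l) (Nat.sub_le _ _)
    rw [Nat.sub_sub_self hl'] at h1
    by_cases h : l ≤ n
    · rw [if_pos h, mnorm_hom ((wickM_hom q h1 hu).1 h)]
      have h3 := wickM_bound hq he h1 hu
      have h4 : ‖wickM q (z (m - l)) u‖ ≤ Dq q ^ l * (c * ‖v‖) * ‖u‖ := by
        refine h3.trans ?_
        gcongr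
        exact h2.trans (by gcongr; exact (pq_le_Cq hq _).trans hcC)
      have h5 : wt q (m - l + (n - l)) =
          ((m + n - 2 * l + 1 : ℕ) : ℝ) * c * Dq q ^ (m - l + (n - l)) := by
        have : m + n - 2 * l = m - l + (n - l) := by omega
        rw [wt, this]; push_cast; ring
      rw [h5]
      calc _ ≤ ((m + n - 2 * l + 1 : ℕ) : ℝ) * c * Dq q ^ (m - l + (n - l)) *
            (Dq q ^ l * (c * ‖v‖) * ‖u‖) := by gcongr
        _ = ((m + n - 2 * l + 1 : ℕ) : ℝ) * (c * c * Dq q ^ (m - l + (n - l) + l) * ‖v‖ * ‖u‖) := by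
            rw [pow_add _ _ l]; ring
        _ ≤ _ := by
            have e2 : Dq q ^ (m - l + (n - l) + l) ≤ Dq q ^ (m + n) :=
              pow_le_pow_right₀ hD (by omega)
            gcongr
    · rw [(wickM_hom q h1 hu).2 (by omega), mnorm_zero]
      positivity
  have e1 : wick q v u = ∑ l ∈ Finset.range (m + 1), wickM q (z (m - l)) u := by
    rw [wick, LinearMap.comp_apply, hz, map_sum, LinearMap.sum_apply,
      ← Finset.sum_range_reflect]
    refine Finset.sum_congr rfl fun l _ => ?_
    simp
  rw [e1]
  refine (mnorm_sum hq _ _).trans ((Finset.sum_le_sum key).trans ?_)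
  rw [← Finset.sum_mul, ← Nat.cast_sum]
  have := count m n
  have h6 : ((∑ l ∈ Finset.range (m + 1), (if l ≤ n then m + n - 2 * l + 1 else 0) : ℕ) : ℝ) ≤
    (m + 1) * (n + 1) := by exact_mod_cast this
  calc _ ≤ ((m : ℝ) + 1) * (n + 1) * (c * c * Dq q ^ (m + n) * ‖v‖ * ‖u‖) := by gcongr
    _ = _ := by rw [wt, wt, pow_add]; ring

theorem mnorm_mul (hq : |q| < 1) (v u : Fock H) : mnorm q (wick q v u) ≤ mnorm q v * mnorm q u := by
  obtain ⟨d, e, he, ⟨c, hc, rfl⟩, ⟨c', hc', rfl⟩⟩ := exists_common v u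
  rw [mnorm_finsupp c hc, mnorm_finsupp c' hc', Finset.sum_mul_sum]
  simp only [Finsupp.sum, map_sum, LinearMap.sum_apply]
  rw [Finset.sum_comm]
  refine (mnorm_sum hq _ _).trans (Finset.sum_le_sum fun m _ => ?_)
  exact (mnorm_sum hq _ _).trans (Finset.sum_le_sum fun n _ => mnorm_mul_hom hq he (hc m) (hc' n))

theorem chaos_scale (q : ℝ) (k : ℕ) (u : Fock H) : chaos k (scale q u) = q ^ k • chaos k u := by
  obtain ⟨d, e, he, ⟨c, hc, rfl⟩, -⟩ := exists_common u u
  rw [chaos_finsupp c hc, Finsupp.sum, map_sum, map_sum, Finset.sum_eq_single k]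
  · rw [scale_hom q (hc k), map_smul, chaos_same (hc k)]
  · intro m _ hm
    rw [scale_hom q (hc m), map_smul, chaos_ne (hc m) hm, smul_zero]
  · intro hk; rw [Finsupp.notMem_support_iff.1 hk, map_zero, map_zero]

theorem mnorm_scale (hq : |q| < 1) (u : Fock H) : mnorm q (scale q u) ≤ mnorm q u := by
  refine (mnorm_summable q _).tsum_le_tsum (fun k => ?_) (mnorm_summable q u)
  rw [chaos_scale, norm_smul, norm_pow, Real.norm_eq_abs]
  refine mul_le_mul_of_nonneg_left ?_ (wt_pos hq k).le
  exact mul_le_of_le_one_left (norm_nonneg _) (pow_le_one₀ (abs_nonneg q) hq.le)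

theorem vac_le (hq : |q| < 1) (u : Fock H) : ‖vac u‖ ≤ mnorm q u := by
  have h0 : ‖vac u‖ ≤ wt q 0 * ‖chaos 0 u‖ := by
    obtain ⟨d, e, he, ⟨c, hc, rfl⟩, -⟩ := exists_common u u
    obtain ⟨r, hr⟩ := mem_zero e (hc 0)
    have h1 : vac (c.sum fun _ x => x) = r := by
      rw [Finsupp.sum, map_sum, Finset.sum_eq_single 0]
      · simp [hr]
      · intro m _ hm
        obtain ⟨m, rfl⟩ := Nat.exists_eq_succ_of_ne_zero hm
        obtain ⟨w, _, h⟩ := peel e m (hc _)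
        simp [h]
      · intro hk; rw [Finsupp.notMem_support_iff.1 hk, map_zero]
    rw [chaos_finsupp c hc, h1, hr, norm_smul, norm_one_fock, mul_one]
    refine le_mul_of_one_le_left (norm_nonneg _) ?_
    simpa [wt] using Real.one_le_rpow (one_le_Cq hq) (by norm_num)
  exact h0.trans ((mnorm_summable q u).le_tsum 0 fun k _ =>
    mul_nonneg (wt_pos hq k).le (norm_nonneg _))

end Norm


/-! ### The algebra `𝒜_q` -/

/-- The unital algebra generated by the field operators `ξ_q(f)`, `f ∈ H`, acting on the algebraic
Fock space. -/
def FieldAlg (q : Set.Ioo (-1 : ℝ) 1) (H : Type*) [NormedAddCommGroup H] [InnerProductSpace ℝ H] :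
    Type _ := fieldSub H (q : ℝ)

section Alg
variable (q : Set.Ioo (-1 : ℝ) 1) (H : Type*) [NormedAddCommGroup H] [InnerProductSpace ℝ H]

theorem abs_lt_one (q : Set.Ioo (-1 : ℝ) 1) : |(q : ℝ)| < 1 := abs_lt.2 q.2

instance : Ring (FieldAlg q H) := inferInstanceAs (Ring (fieldSub H (q : ℝ)))
instance : Algebra ℝ (FieldAlg q H) := inferInstanceAs (Algebra ℝ (fieldSub H (q : ℝ)))

variable {q H}

/-- An element of the field algebra as an operator on the algebraic Fock space. -/
def FieldAlg.op : FieldAlg q H →ₐ[ℝ] Module.End ℝ (Fock H) := (fieldSub H (q : ℝ)).val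

/-- The vacuum vector `A 1` of an operator. -/
def FieldAlg.vec : FieldAlg q H →ₗ[ℝ] Fock H :=
  (LinearMap.applyₗ (1 : Fock H)).comp FieldAlg.op.toLinearMap

/-- The Wick map, inverse to `FieldAlg.vec`. -/
def FieldAlg.ofVec : Fock H →ₗ[ℝ] FieldAlg q H :=
  (wick (q : ℝ)).codRestrict (fieldSub H (q : ℝ)).toSubmodule fun v => wick_mem _ v

theorem FieldAlg.vec_ofVec (v : Fock H) : (FieldAlg.ofVec v : FieldAlg q H).vec = v :=
  wick_apply_one _ v

theorem FieldAlg.ofVec_vec (A : FieldAlg q H) : FieldAlg.ofVec A.vec = A :=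
  Subtype.ext (eq_wick _ A.2).symm

theorem FieldAlg.vec_mul (A B : FieldAlg q H) : (A * B).vec = wick (q : ℝ) A.vec B.vec := by
  have h : A.op = wick (q : ℝ) A.vec := eq_wick _ A.2
  rw [← h]
  simp [FieldAlg.vec]

/-- The norm `|||A||| = ∑ₖ (k + 1) C_q^{3/2} D_q^k ‖A_k‖`, where `A_k` is the `k`-th homogeneous
chaos component of `A`. -/
instance : SeminormedRing (FieldAlg q H) where
  toRing := inferInstance
  norm A := mnorm (q : ℝ) A.vec
  dist A B := mnorm (q : ℝ) (-A + B).vec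
  dist_self A := by simp [mnorm_zero]
  dist_comm A B := by
    have h := mnorm_smul (q : ℝ) (-1) (-B + A).vec
    rw [abs_neg, abs_one, one_mul, ← map_smul] at h
    rw [← h]
    congr 2
    rw [neg_smul, one_smul]; abel
  dist_triangle A B C := by
    rw [show -A + C = (-A + B) + (-B + C) by abel, map_add]
    exact mnorm_add (abs_lt_one q) _ _
  dist_eq A B := rfl
  norm_mul_le A B := by
    rw [FieldAlg.vec_mul]
    exact mnorm_mul (abs_lt_one q) _ _

theorem FieldAlg.norm_def (A : FieldAlg q H) : ‖A‖ = mnorm (q : ℝ) A.vec := rfl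

instance : NormedAlgebra ℝ (FieldAlg q H) where
  norm_smul_le r A := by
    rw [FieldAlg.norm_def, FieldAlg.norm_def, map_smul, mnorm_smul, Real.norm_eq_abs]

variable (q H)

/-- The Banach algebra `𝒜_q`: the completion of the field algebra. -/
abbrev MezdonAlg : Type _ := UniformSpace.Completion (FieldAlg q H)

instance : NormedAlgebra ℝ (MezdonAlg q H) where
  __ := (inferInstance : Algebra ℝ (MezdonAlg q H))
  norm_smul_le r a := norm_smul_le r a

variable {q H}

/-- The field operator `ξ_q(f)` as an element of the field algebra. -/
def FieldAlg.xi : H →ₗ[ℝ] FieldAlg q H :=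
  (field (q : ℝ)).codRestrict (fieldSub H (q : ℝ)).toSubmodule fun f =>
    Algebra.subset_adjoin ⟨f, rfl⟩

/-- The field operator `ξ_q(f)` as an element of `𝒜_q`. -/
def xi : H →ₗ[ℝ] MezdonAlg q H :=
  UniformSpace.Completion.toComplL.toLinearMap.comp FieldAlg.xi

/-- The vacuum state `A ↦ ⟨1, A 1⟩` on the field algebra. -/
def vacuumState : FieldAlg q H →L[ℝ] ℝ :=
  (vac.toLinearMap.comp FieldAlg.vec).mkContinuous 1 fun A => by
    rw [one_mul]; exact vac_le (abs_lt_one q) A.vec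

/-- The vacuum state `ω_q` on `𝒜_q`. -/
def omega : MezdonAlg q H →L[ℝ] ℝ := vacuumState.extend UniformSpace.Completion.toComplL

/-- `Δ_q` on the field algebra: it multiplies the `n`-th chaos component by `q ^ n`. -/
def deltaPre : FieldAlg q H →L[ℝ] MezdonAlg q H :=
  UniformSpace.Completion.toComplL.comp
    ((FieldAlg.ofVec.comp ((scale (q : ℝ)).toLinearMap.comp FieldAlg.vec)).mkContinuous 1 fun A => by
      rw [one_mul, FieldAlg.norm_def, FieldAlg.norm_def]
      simp only [LinearMap.comp_apply, FieldAlg.vec_ofVec]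
      exact mnorm_scale (abs_lt_one q) A.vec)

/-- The operator `Δ_q` on `𝒜_q`. -/
def delta : MezdonAlg q H →L[ℝ] MezdonAlg q H := deltaPre.extend UniformSpace.Completion.toComplL

theorem omega_coe (A : FieldAlg q H) : omega (A : MezdonAlg q H) = vac A.vec :=
  ContinuousLinearMap.extend_eq _ UniformSpace.Completion.denseRange_coe
    (UniformSpace.Completion.isUniformInducing_coe _) A

theorem delta_coe (A : FieldAlg q H) :
    delta (A : MezdonAlg q H) = (FieldAlg.ofVec (scale (q : ℝ) A.vec) : FieldAlg q H) :=
  ContinuousLinearMap.extend_eq _ UniformSpace.Completion.denseRange_coe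
    (UniformSpace.Completion.isUniformInducing_coe _) A

variable (q H)

/-- The completed projective tensor product `𝒜_q ⊗̂_π 𝒜_q`. -/
abbrev MezdonTensor : Type _ :=
  UniformSpace.Completion (PiTensorProduct ℝ fun _ : Fin 2 => MezdonAlg q H)

variable {q H}

/-- The elementary tensor `a ⊗ b`. -/
def tmul (a b : MezdonAlg q H) : MezdonTensor q H :=
  (PiTensorProduct.tprod ℝ ![a, b] : PiTensorProduct ℝ fun _ : Fin 2 => MezdonAlg q H)

/-- The continuous linear map on `𝒜_q ⊗̂_π 𝒜_q` with `a ⊗ b ↦ S a * T b`. -/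
def mulMap (S T : MezdonAlg q H →L[ℝ] MezdonAlg q H) : MezdonTensor q H →L[ℝ] MezdonAlg q H :=
  (PiTensorProduct.liftIsometry ℝ (fun _ : Fin 2 => MezdonAlg q H) (MezdonAlg q H)
    ((ContinuousMultilinearMap.mkPiAlgebraFin ℝ 2 (MezdonAlg q H)).compContinuousLinearMap
      ![S, T])).extend UniformSpace.Completion.toComplL

theorem mulMap_tmul (S T : MezdonAlg q H →L[ℝ] MezdonAlg q H) (a b : MezdonAlg q H) :
    mulMap S T (tmul a b) = S a * T b := by
  refine (ContinuousLinearMap.extend_eq _ UniformSpace.Completion.denseRange_coe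
    (UniformSpace.Completion.isUniformInducing_coe _) _).trans ?_
  simp [PiTensorProduct.liftIsometry_apply_apply]

/-- Left multiplication by `a`. -/
abbrev mulLeft (a : MezdonAlg q H) : MezdonAlg q H →L[ℝ] MezdonAlg q H :=
  ContinuousLinearMap.mul ℝ (MezdonAlg q H) a

/-- Right multiplication by `a`. -/
abbrev mulRight (a : MezdonAlg q H) : MezdonAlg q H →L[ℝ] MezdonAlg q H :=
  (ContinuousLinearMap.mul ℝ (MezdonAlg q H)).flip a

/-- The operator `Δ_q^{R;(1),∅}(x; a ⊗ b) = a x b`. -/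
def sandwich (x : MezdonAlg q H) : MezdonTensor q H →L[ℝ] MezdonAlg q H :=
  mulMap (mulRight x) (ContinuousLinearMap.id ℝ _)

theorem sandwich_tmul (x a b : MezdonAlg q H) : sandwich x (tmul a b) = a * x * b := by
  simp [sandwich, mulMap_tmul]

end Alg

open MeasureTheory Filter Set

/-! ### White noise, Brownian motion and mollification -/

/-- The Hilbert space `L²(ℝ)^n`. -/
abbrev NoiseSpace (n : ℕ) : Type := Lp (EuclideanSpace ℝ (Fin n)) 2 (volume : Measure ℝ)

/-- The algebra `𝒜_q = 𝒜_q(L²(ℝ)^n)`. -/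
abbrev Alg (q : Ioo (-1 : ℝ) 1) (n : ℕ) : Type := MezdonAlg q (NoiseSpace n)

/-- The space `𝒜_q ⊗̂_π 𝒜_q`. -/
abbrev Ten (q : Ioo (-1 : ℝ) 1) (n : ℕ) : Type := MezdonTensor q (NoiseSpace n)

/-- The embedding `φ ↦ φ e_j` of `L²(ℝ)` as the `j`-th component of `L²(ℝ)^n`. -/
def component {n : ℕ} (j : Fin n) : Lp ℝ 2 (volume : Measure ℝ) →L[ℝ] NoiseSpace n :=
  (ContinuousLinearMap.toSpanSingleton ℝ (EuclideanSpace.single j (1 : ℝ))).compLpL 2 volume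

section Noise
variable (q : Ioo (-1 : ℝ) 1) {n : ℕ}

/-- The `j`-th `q`-white noise `ξ^j_q(φ) = ξ_q(φ e_j)`. -/
def whiteNoise (j : Fin n) (φ : Lp ℝ 2 (volume : Measure ℝ)) : Alg q n := xi (component j φ)

/-- The increment `B^j_q(s, t) = sgn(t - s) ξ^j_q(1_{[s, t]})`, where `[s, t]` is the interval with
end points `s` and `t`. -/
def brownian (j : Fin n) (s t : ℝ) : Alg q n :=
  Real.sign (t - s) • whiteNoise q j
    (indicatorConstLp 2 (measurableSet_uIcc (a := s) (b := t)) isCompact_uIcc.measure_lt_top.ne 1)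

/-- An even, nonnegative, smooth, compactly supported mollifier of integral one. -/
structure Mollifier where
  toFun : ℝ → ℝ
  smooth : ContDiff ℝ ∞ toFun
  compact : HasCompactSupport toFun
  nonneg : ∀ x, 0 ≤ toFun x
  even : ∀ x, toFun (-x) = toFun x
  integral_eq_one : ∫ x, toFun x = 1

/-- The rescaled and translated mollifier `y ↦ ε⁻¹ ρ((y - x) / ε)`. -/
def Mollifier.scaled (ρ : Mollifier) (ε x : ℝ) (y : ℝ) : ℝ := ε⁻¹ * ρ.toFun ((y - x) / ε)

theorem Mollifier.memLp (ρ : Mollifier) (ε x : ℝ) : MemLp (ρ.scaled ε x) 2 volume := by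
  by_cases hε : ε = 0
  · have : ρ.scaled ε x = fun _ => 0 := by funext y; simp [Mollifier.scaled, hε]
    rw [this]
    exact MemLp.zero'
  · have hc : Continuous (ρ.scaled ε x) := by
      have := ρ.smooth.continuous
      unfold Mollifier.scaled
      fun_prop
    refine hc.memLp_of_hasCompactSupport ?_
    have h : HasCompactSupport fun y => ρ.toFun ((y - x) / ε) := by
      have e : (fun y => ρ.toFun ((y - x) / ε)) =
          ρ.toFun ∘ ((Homeomorph.subRight x).trans (Homeomorph.mulRight₀ ε⁻¹ (inv_ne_zero hε))) := by
        funext y; simp [div_eq_mul_inv]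
      rw [e]
      exact ρ.compact.comp_homeomorph _
    exact h.mul_left

/-- The mollified noise `ξ^{j,(ε)}_q(x) = ξ^j_q(ε⁻¹ ρ((· - x) / ε))`. -/
def noiseMoll (ρ : Mollifier) (j : Fin n) (ε x : ℝ) : Alg q n :=
  whiteNoise q j ((ρ.memLp ε x).toLp _)

/-- The increments `B^{j,(ε)}_q(s, t)`: the integral of the mollified noise over `[s, t]` for
`ε ≠ 0`, and the increment of the Brownian motion itself for `ε = 0`. -/
def brownianMoll (ρ : Mollifier) (j : Fin n) (ε s t : ℝ) : Alg q n :=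
  if ε = 0 then brownian q j s t else ∫ x in s..t, noiseMoll q ρ j ε x

end Noise

/-! ### Analytic functions of noncommuting variables -/

/-- The noncommutative monomial `X_{k₁} ⋯ X_{kₘ}` for the word `k = [k₁, …, kₘ]`. -/
def monomial {A : Type*} [Ring A] {n : ℕ} (X : Fin n → A) (w : List (Fin n)) : A := (w.map X).prod

/-- `c` is a family of coefficients of a noncommutative power series `∑_w c_w X_w` which converges
absolutely for `|X_i| < R` and which for commuting real variables sums to `φ`. -/
structure IsLift {n : ℕ} (R : ℝ≥0∞) (φ : (Fin n → ℝ) → ℝ) (c : List (Fin n) → ℝ) : Prop where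
  summable : ∀ r : ℝ≥0, (r : ℝ≥0∞) < R → Summable fun w => |c w| * (r : ℝ) ^ w.length
  hasSum : ∀ x : Fin n → ℝ, (∀ i, ‖x i‖ₑ < R) → HasSum (fun w => c w * monomial x w) (φ x)

section Series
variable {q : Ioo (-1 : ℝ) 1} {n : ℕ}

/-- The value `∑_w c_w X_w` of a noncommutative power series. -/
def evalSeries (c : List (Fin n) → ℝ) (X : Fin n → Alg q n) : Alg q n :=
  ∑' w, c w • monomial X w

/-- The right derivative `D^R_{k,q}` of `∑_w c_w X_w` in a direction in `𝒜_q ⊗̂_π 𝒜_q`: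
each monomial contributes, for each occurrence `X_w = U X_k V` of `X_k`, the term
`B₁ ⊗ B₂ ↦ U B₁ Δ_q(B₂ V)`. -/
def derivR (k : Fin n) (c : List (Fin n) → ℝ) (X : Fin n → Alg q n) (B : Ten q n) : Alg q n :=
  ∑' w, c w • ∑ l : Fin w.length, if w.get l = k then
    mulMap (mulLeft (monomial X (w.take l))) (delta.comp (mulRight (monomial X (w.drop (l + 1))))) B
  else 0

/-- The left derivative `D^L_{k,q}`: each occurrence `X_w = U X_k V` of `X_k` contributes
`B₁ ⊗ B₂ ↦ Δ_q(U B₁) B₂ V`. -/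
def derivL (k : Fin n) (c : List (Fin n) → ℝ) (X : Fin n → Alg q n) (B : Ten q n) : Alg q n :=
  ∑' w, c w • ∑ l : Fin w.length, if w.get l = k then
    mulMap (delta.comp (mulLeft (monomial X (w.take l)))) (mulRight (monomial X (w.drop (l + 1)))) B
  else 0

/-- The right-hand side of the `i`-th component of the renormalised equation at time `t`. -/
def renormRHS (ρ : Fin n → Mollifier) (cf : Fin n → List (Fin n) → ℝ)
    (cg ch : Fin n → Fin n → List (Fin n) → ℝ) (C : Fin n → ℝ) (ε t : ℝ)
    (Y : Fin n → Alg q n) (Y' : Fin n → Fin n → Ten q n) (i : Fin n) : Alg q n :=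
  evalSeries (cf i) Y +
    ∑ j, evalSeries (cg i j) Y * noiseMoll q (ρ j) j ε t * evalSeries (ch i j) Y -
    ∑ j, C j • ∑ k, (derivR k (cg i j) Y (Y' k j) * evalSeries (ch i j) Y +
      evalSeries (cg i j) Y * derivL k (ch i j) Y (Y' k j))

/-- The families `(Y_{(ε)}, Y'_{(ε)})`, `ε ∈ [0, 1]`, of controlled solutions on `[0, T)`. -/
structure IsSolutionFamily (ρ : Fin n → Mollifier) (R : ℝ≥0∞) (cf : Fin n → List (Fin n) → ℝ)
    (cg ch : Fin n → Fin n → List (Fin n) → ℝ) (C : Fin n → ℝ → ℝ) (X₀ : Fin n → Alg q n) (T : ℝ)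
    (Y : ℝ → ℝ → Fin n → Alg q n) (Y' : ℝ → ℝ → Fin n → Fin n → Ten q n) : Prop where
  /-- `Y_{(ε)}` and `Y'_{(ε)}` are of class `𝒞^{1/2-}` on `[0, T)`. -/
  holder : ∀ ε ∈ Icc (0 : ℝ) 1, ∀ α : ℝ≥0, α < 1 / 2 →
    ∃ K : ℝ≥0, HolderOnWith K α (Y ε) (Ico 0 T) ∧ HolderOnWith K α (Y' ε) (Ico 0 T)
  /-- `Y_{(ε)} → Y_{(0)}` and `Y'_{(ε)} → Y'_{(0)}` in `𝒞^{1/2-}` as `ε ↓ 0`. -/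
  tendsto : ∀ α : ℝ≥0, α < 1 / 2 → ∀ δ : ℝ≥0, 0 < δ → ∀ᶠ ε in 𝓝[>] (0 : ℝ),
    (∀ t ∈ Ico 0 T, ‖Y ε t - Y 0 t‖ ≤ δ ∧ ‖Y' ε t - Y' 0 t‖ ≤ δ) ∧
    HolderOnWith δ α (fun t => Y ε t - Y 0 t) (Ico 0 T) ∧
    HolderOnWith δ α (fun t => Y' ε t - Y' 0 t) (Ico 0 T)
  /-- `Y_{(ε)}` is controlled, with bound `|t - s|^{1-}`, uniformly in `ε`. -/
  controlled : ∀ κ ∈ Ioo (0 : ℝ) 1, ∃ K : ℝ, ∀ ε ∈ Icc (0 : ℝ) 1, ∀ s ∈ Ico 0 T, ∀ t ∈ Ico 0 T,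
    ∀ i, ‖Y ε t i - Y ε s i - ∑ j, sandwich (brownianMoll q (ρ j) j ε s t) (Y' ε s i j)‖ ≤
      K * |t - s| ^ (1 - κ)
  /-- `Y_{(ε)}` starts at `X₀`. -/
  initial : ∀ ε ∈ Icc (0 : ℝ) 1, Y ε 0 = X₀
  /-- `Y_{(ε)}` stays in the domain of convergence of the power series. -/
  mem_domain : ∀ ε ∈ Icc (0 : ℝ) 1, ∀ t ∈ Ico 0 T, ∀ i, ‖Y ε t i‖ₑ < R
  /-- The derivative process is the integrand: `Y'^i_j = g^i_j(Y) ⊗ h^i_j(Y)`. -/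
  deriv_eq : ∀ ε ∈ Icc (0 : ℝ) 1, ∀ t ∈ Ico 0 T, ∀ i j,
    Y' ε t i j = tmul (evalSeries (cg i j) (Y ε t)) (evalSeries (ch i j) (Y ε t))
  /-- For `ε > 0`, `Y_{(ε)}` solves the renormalised ordinary differential equation. -/
  ode : ∀ ε ∈ Ioc (0 : ℝ) 1, ∀ t ∈ Ico 0 T, ∀ i,
    HasDerivWithinAt (fun r => Y ε r i)
      (renormRHS ρ cf cg ch (fun j => C j ε) ε t (Y ε t) (Y' ε t) i) (Ico 0 T) t

end Series

end Mezdon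

end

/-!
The noises `ξ^j` have distributional regularity `-1/2`, so the equation is one of rough paths, with
operator-valued second-order integrals. Three ideas make it tractable.

*The sandwich formula.* On the Fock space, `ξ(f) x ξ(g)` splits as `cross (f ⊗ g) x` plus the
single contraction `⟨f, g⟩ Δ_q x` of the two outer fields (`field_fieldR`). In `cross` no contraction
joins `f` and `g`, so it is bounded in the mezdonic norm by the Hilbert--Schmidt norm of its kernel
(`mnorm_cross_hom`, `norm_crossPre_le`). A second-order integral of the mollified noise is therefore a
kernel in the Hilbert space `L² ⊗ L²`, where bounds and convergence are computed from covariances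
(`norm_iterated_sq_le`, `norm_iterated_sub_sq_le`), plus the trace part `½ ‖b(s, t)‖² Δ_q`. The trace
part tends to `½ (t - s) Δ_q`. The renormalisation subtracts this term from the second-order integrals.
Since the covariance is an even kernel of mass one, the constants `C^j_ε` exist and all are `1/2`
(`tendsto_covariance`), and the counterterm is the effect of this subtraction on the equation
(`renormRHS_eq`). Thus the renormalised signals are bounded uniformly in `ε` (`isDriver_signal`) and
form a Cauchy family (`norm_signal_sub_le`).

*A priori estimates.* For `ε > 0` the equation is an ordinary differential equation. Its local
expansion is the `germ`: the drift, the first-order term `∑ g β h`, and the derivative of the latter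
applied to the second-order integrals. By the relation of Chen, the germ along a solution is additive
up to terms of order `3 α > 1` (`norm_defect_le`). Sewing turns this into a bound for the remainder of
the first-order expansion which depends on the rough signal only (`norm_remainder_le`). Hence solutions
exist, and stay in a fixed ball, up to a time which does not depend on `ε` (`norm_lt_of_solution`,
`exists_solution`).

*Comparison by doubling.* All estimates hold in an arbitrary Banach algebra. A pair of solutions is a
single solution in the algebra `Twin l A`, the product `A × A` with norm `max ‖y‖ ‖z‖ + l ‖y - z‖`. If
the signals are at distance of order `1 / l`, then the pair of signals is bounded uniformly in `l`; so
the pair of solutions stays in a fixed ball, which says that the solutions are at distance of order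
`1 / l` (`mul_norm_sub_le_of_solutions`). No separate stability theory is needed. The solutions thus
converge as `ε ↓ 0`, with the estimates passing to the limit (`exists_solution_family`).

Uniqueness is uniqueness for ordinary differential equations when `ε > 0`, and follows for `ε = 0` from
the required convergence (`IsSolutionFamily.unique`).
-/

noncomputable section

namespace Mezdon

set_option linter.unusedSectionVars false

/-! ### Right multiplication by the fields on the Fock space -/

section RightField
variable {H : Type*} [NormedAddCommGroup H] [InnerProductSpace ℝ H]

/-- Reversal of words, `f₁ ⊗ ⋯ ⊗ fₖ ↦ fₖ ⊗ ⋯ ⊗ f₁`. -/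
def rev : Fock H →ₗ[ℝ] Fock H :=
  (MulOpposite.opLinearEquiv ℝ).symm.toLinearMap.comp
    (flift ((MulOpposite.opLinearEquiv ℝ).toLinearMap.comp inc) :
      Fock H →ₐ[ℝ] (Fock H)ᵐᵒᵖ).toLinearMap

@[simp] theorem rev_one : rev (1 : Fock H) = 1 := by simp [rev]

@[simp] theorem rev_inc (f : H) : rev (inc f) = inc f := by simp [rev]

theorem rev_mul (u v : Fock H) : rev (u * v) = rev v * rev u := by simp [rev]

@[simp] theorem rev_rev (u : Fock H) : rev (rev u) = u := by
  induction u using fock_ind with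
  | one => simp
  | smul r u hu => simp [hu]
  | add u v hu hv => simp [hu, hv]
  | mul f u hu => simp [rev_mul, hu]

theorem form_rev (u v : Fock H) : form (rev u) (rev v) = form u v := by
  have h1 : ∀ (f : H) (u : Fock H), form 1 (u * inc f) = 0 := by
    intro f u
    rw [form_one_left, map_mul]
    simp
  induction u using fock_ind generalizing v with
  | one =>
    induction v using fock_ind with
    | one => simp
    | smul r u hu => rw [map_smul, map_smul, map_smul, hu]
    | add u v hu hv => rw [map_add, map_add, map_add, hu, hv]
    | mul f u _ => rw [rev_mul, rev_one, rev_inc, h1, form_one_left, vac_inc_mul]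
  | smul r u hu => simp [hu]
  | add u v hu hv => simp [hu, hv]
  | mul f u hu =>
    induction v using fock_ind with
    | one => rw [rev_mul, rev_one, rev_inc, form_symm, h1, form_inc_mul_one]
    | smul r u hu => simp [hu]
    | add u v hu hv => simp [hu, hv]
    | mul g v _ => rw [rev_mul, rev_mul, rev_inc, rev_inc, form_mul_inc, form_inc_mul, hu]

theorem norm_rev (u : Fock H) : ‖rev u‖ = ‖u‖ := by
  rw [← sq_eq_sq₀ (norm_nonneg _) (norm_nonneg _), ← real_inner_self_eq_norm_sq,
    ← real_inner_self_eq_norm_sq]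
  exact form_rev u u

theorem rev_hom {ι : Type*} [Fintype ι] {e : ι → H} {m : ℕ} {u : Fock H}
    (hu : u ∈ oneSpan e ^ m) : rev u ∈ oneSpan e ^ m := by
  induction m generalizing u with
  | zero =>
    obtain ⟨c, rfl⟩ := mem_zero e hu
    simpa using hu
  | succ m ih =>
    obtain ⟨w, hw, rfl⟩ := peel e m hu
    rw [map_sum]
    refine Submodule.sum_mem _ fun i _ => ?_
    rw [rev_mul, rev_inc, pow_succ]
    exact Submodule.mul_mem_mul (ih (hw i)) (inc_mem e i)

theorem rev_scale (q : ℝ) (u : Fock H) : rev (scale q u) = scale q (rev u) := by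
  induction u using fock_ind with
  | one => simp
  | smul r u hu => simp [hu]
  | add u v hu hv => simp [hu, hv]
  | mul f u hu =>
    rw [scale_inc_mul, map_smul, rev_mul, rev_mul, hu, map_mul, rev_inc]
    simp [scale]

/-- The right annihilation operator
`f₁ ⊗ ⋯ ⊗ fₖ ↦ ∑ᵢ q^{k-i} ⟨f, fᵢ⟩ f₁ ⊗ ⋯ f̂ᵢ ⋯ ⊗ fₖ`. -/
def annihR (q : ℝ) : H →ₗ[ℝ] Module.End ℝ (Fock H) where
  toFun f := rev.comp ((annih q f).comp rev)
  map_add' f g := by ext u; simp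
  map_smul' r f := by ext u; simp

theorem annihR_apply (q : ℝ) (f : H) (u : Fock H) : annihR q f u = rev (annih q f (rev u)) := rfl

@[simp] theorem annihR_one (q : ℝ) (f : H) : annihR q f (1 : Fock H) = 0 := by
  simp [annihR_apply]

theorem annihR_inc_mul (q : ℝ) (f g : H) (u : Fock H) :
    annihR q f (inc g * u) = inc g * annihR q f u + (inner ℝ f g : ℝ) • scale q u := by
  have h : annih q f (inc g) = (inner ℝ f g : ℝ) • (1 : Fock H) := by
    have := annih_inc_mul q f g (1 : Fock H)
    simpa using this
  rw [annihR_apply, rev_mul, rev_inc, annih_mul, h, map_add, rev_mul, rev_inc, mul_smul_comm,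
    mul_one, map_smul, rev_scale, rev_rev, annihR_apply]

/-- Creating a particle on the right and annihilating one from the left commute up to the
contraction, which passes all particles and picks up the factor `Δ_q`. -/
theorem annih_mul_inc (q : ℝ) (f g : H) (u : Fock H) :
    annih q f (u * inc g) = annih q f u * inc g + (inner ℝ f g : ℝ) • scale q u := by
  have h : annih q f (inc g) = (inner ℝ f g : ℝ) • (1 : Fock H) := by
    have := annih_inc_mul q f g (1 : Fock H)
    simpa using this
  rw [annih_mul, h, mul_smul_comm, mul_one]

theorem annih_annihR_comm (q : ℝ) (f g : H) (u : Fock H) :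
    annih q f (annihR q g u) = annihR q g (annih q f u) := by
  induction u using fock_ind with
  | one => simp
  | smul r u hu => simp [hu]
  | add u v hu hv => simp [hu, hv]
  | mul k u hu =>
    simp only [annihR_inc_mul, annih_inc_mul, map_add, map_smul, hu, annih_scale, smul_add]
    rw [smul_comm q (inner ℝ g k : ℝ)]
    abel

/-- The right field operator, the action of `· ξ_q(g)` on vacuum vectors. -/
def fieldR (q : ℝ) : H →ₗ[ℝ] Module.End ℝ (Fock H) := createR + annihR q

theorem field_fieldR_comm (q : ℝ) (f g : H) (u : Fock H) :
    field q f (fieldR q g u) = fieldR q g (field q f u) := by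
  simp only [field, fieldR, LinearMap.add_apply, create_apply, createR_apply, map_add,
    annih_mul_inc, annihR_inc_mul, annih_annihR_comm, mul_assoc]
  rw [real_inner_comm]
  abel

/-- Left and right fields commute, hence right fields commute with the whole field algebra. -/
theorem fieldSub_fieldR_comm (q : ℝ) {A : Module.End ℝ (Fock H)} (hA : A ∈ fieldSub H q) (g : H)
    (u : Fock H) : A (fieldR q g u) = fieldR q g (A u) := by
  induction hA using Algebra.adjoin_induction generalizing u with
  | mem x hx => obtain ⟨f, rfl⟩ := hx; exact field_fieldR_comm q f g u
  | algebraMap r => simp [Algebra.algebraMap_eq_smul_one]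
  | add x y _ _ hx hy => simp [hx, hy]
  | mul x y _ _ hx hy => simp [hx, hy]

/-- An element of the field algebra commutes with right fields, so multiplying it by `ξ_q(g)` from
the right acts on its vacuum vector as the right field. -/
theorem fieldSub_inc (q : ℝ) {A : Module.End ℝ (Fock H)} (hA : A ∈ fieldSub H q) (g : H) :
    A (inc g) = fieldR q g (A 1) := by
  rw [← fieldSub_fieldR_comm q hA]
  simp [fieldR]

/-! ### The sandwich operators without their trace -/

/-- The map `f ⊗ g ↦ (α†(f) + α(f)) (α†_R(g) + α_R(g))`, where in `α(f) α†_R(g)` the contraction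
of `f` with `g` is left out. -/
def cross (q : ℝ) : H ⊗[ℝ] H →ₗ[ℝ] Module.End ℝ (Fock H) :=
  TensorProduct.lift (
    (LinearMap.mul ℝ (Module.End ℝ (Fock H))).compl₁₂ create createR +
    (LinearMap.mul ℝ (Module.End ℝ (Fock H))).flip.compl₁₂ (annih q) createR +
    (LinearMap.mul ℝ (Module.End ℝ (Fock H))).compl₁₂ create (annihR q) +
    (LinearMap.mul ℝ (Module.End ℝ (Fock H))).compl₁₂ (annih q) (annihR q))

theorem cross_tmul (q : ℝ) (f g : H) (u : Fock H) :
    cross q (f ⊗ₜ g) u = inc f * (u * inc g) + annih q f u * inc g + inc f * annihR q g u +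
      annih q f (annihR q g u) := by
  simp [cross]

/-- The sandwich formula on the Fock space: the only contraction of `f` with `g` contributes
`⟨f, g⟩ Δ_q`. -/
theorem field_fieldR (q : ℝ) (f g : H) (u : Fock H) :
    field q f (fieldR q g u) = cross q (f ⊗ₜ g) u + (inner ℝ f g : ℝ) • scale q u := by
  rw [cross_tmul]
  simp only [field, fieldR, LinearMap.add_apply, create_apply, createR_apply, map_add,
    annih_mul_inc]
  abel

section Bound
variable {ι : Type*} [Fintype ι] {e : ι → H} {q : ℝ}

theorem annihR_hom (q : ℝ) (f : H) {n : ℕ} {u : Fock H} (hu : u ∈ oneSpan e ^ (n + 1)) :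
    annihR q f u ∈ oneSpan e ^ n := rev_hom (annih_hom q f (rev_hom hu))

theorem annihR_bound (hq : |q| < 1) (he : Orthonormal ℝ e) {n : ℕ} {u : Fock H}
    (hu : u ∈ oneSpan e ^ n) : ∑ i, ‖annihR q (e i) u‖ ^ 2 ≤ Dq q ^ 2 * ‖u‖ ^ 2 := by
  have := annih_bound hq he (rev_hom hu)
  rw [norm_rev] at this
  simpa only [annihR_apply, norm_rev] using this

theorem norm_sum_smul_sq_le {E : Type*} [NormedAddCommGroup E] [NormedSpace ℝ E] (c : ι → ℝ)
    (x : ι → E) : ‖∑ i, c i • x i‖ ^ 2 ≤ (∑ i, c i ^ 2) * ∑ i, ‖x i‖ ^ 2 := by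
  have h : ‖∑ i, c i • x i‖ ≤ ∑ i, |c i| * ‖x i‖ :=
    (norm_sum_le _ _).trans (Finset.sum_le_sum fun i _ => by rw [norm_smul, Real.norm_eq_abs])
  refine (pow_le_pow_left₀ (norm_nonneg _) h 2).trans ?_
  have := Finset.sum_mul_sq_le_sq_mul_sq Finset.univ (fun i => |c i|) fun i => ‖x i‖
  simpa only [sq_abs] using this

theorem norm_sum_sum_smul_sq_le {E : Type*} [NormedAddCommGroup E] [NormedSpace ℝ E]
    (c : ι → ι → ℝ) (x : ι → ι → E) :
    ‖∑ a, ∑ b, c a b • x a b‖ ^ 2 ≤ (∑ a, ∑ b, c a b ^ 2) * ∑ a, ∑ b, ‖x a b‖ ^ 2 := by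
  have := norm_sum_smul_sq_le (fun p : ι × ι => c p.1 p.2) fun p => x p.1 p.2
  simpa only [Fintype.sum_prod_type] using this

variable (e) in
/-- The kernel `∑ K_ab e_a ⊗ e_b`. -/
def kernel (K : ι → ι → ℝ) : H ⊗[ℝ] H := ∑ a, ∑ b, K a b • (e a ⊗ₜ[ℝ] e b)

theorem norm_kernel_sq (he : Orthonormal ℝ e) (K : ι → ι → ℝ) :
    ‖kernel e K‖ ^ 2 = ∑ a, ∑ b, K a b ^ 2 := by
  classical
  rw [← real_inner_self_eq_norm_sq]
  simp only [kernel, TensorProduct.smul_tmul', sum_inner, inner_sum, real_inner_smul_left,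
    real_inner_smul_right, TensorProduct.inner_tmul, orthonormal_iff_ite.1 he]
  simp [sq]

/-- The four homogeneous parts of `cross q (kernel e K) u`, each bounded by Cauchy--Schwarz. No
contraction joins the two legs of the kernel, so that only its Hilbert--Schmidt norm enters. -/
theorem mnorm_cross_hom (hq : |q| < 1) (he : Orthonormal ℝ e) (K : ι → ι → ℝ) {m : ℕ}
    {u : Fock H} (hu : u ∈ oneSpan e ^ m) :
    mnorm q (cross q (kernel e K) u) ≤ 6 * Dq q ^ 2 * ‖kernel e K‖ * mnorm q u := by
  have hD := one_le_Dq hq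
  have hC : 0 < Cq q ^ (3 / 2 : ℝ) := Real.rpow_pos_of_pos (by linarith [one_le_Cq hq]) _
  set z := kernel e K with hz
  have hK := norm_kernel_sq he K
  rw [← hz] at hK
  have hz0 := norm_nonneg z
  have hu0 := norm_nonneg u
  have hwt := wt_pos hq m
  have e0 : cross q z u = (∑ a, ∑ b, K a b • (inc (e a) * (u * inc (e b)))) +
      (∑ a, ∑ b, K a b • (annih q (e a) u * inc (e b))) +
      (∑ a, ∑ b, K a b • (inc (e a) * annihR q (e b) u)) +
      ∑ a, ∑ b, K a b • annih q (e a) (annihR q (e b) u) := by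
    rw [hz, kernel]
    simp only [map_sum, LinearMap.sum_apply, map_smul, LinearMap.smul_apply, cross_tmul, smul_add,
      Finset.sum_add_distrib]
  -- creation on both sides
  have b1 : mnorm q (∑ a, ∑ b, K a b • (inc (e a) * (u * inc (e b)))) ≤
      3 * Dq q ^ 2 * (‖z‖ * (wt q m * ‖u‖)) := by
    have hm : (∑ a, ∑ b, K a b • (inc (e a) * (u * inc (e b)))) ∈ oneSpan e ^ (m + 2) :=
      Submodule.sum_mem _ fun a _ => Submodule.sum_mem _ fun b _ => Submodule.smul_mem _ _
        (inc_mul_mem e a (by rw [pow_succ]; exact Submodule.mul_mem_mul hu (inc_mem e b)))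
    have hn : ‖∑ a, ∑ b, K a b • (inc (e a) * (u * inc (e b)))‖ = ‖z‖ * ‖u‖ := by
      rw [← sq_eq_sq₀ (norm_nonneg _) (by positivity), mul_pow, hK]
      have h1 := iso_sum he create_iso (fun a => ∑ b, createR (e b) (K a b • u))
      have h2 := fun a => iso_sum he createR_iso (fun b => K a b • u)
      simp only [h2, norm_smul, mul_pow, Real.norm_eq_abs, sq_abs, ← Finset.sum_mul] at h1
      rw [← h1]
      simp
    rw [mnorm_hom hm, hn]
    have hw : wt q (m + 2) ≤ 3 * Dq q ^ 2 * wt q m := by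
      have h3 : ((m + 2 : ℕ) : ℝ) + 1 ≤ 3 * (m + 1) := by push_cast; linarith
      have h4 : 0 < Dq q := by linarith
      calc wt q (m + 2) = (((m + 2 : ℕ) : ℝ) + 1) * (Cq q ^ (3 / 2 : ℝ) * Dq q ^ (m + 2)) := by
            rw [wt]; ring
        _ ≤ (3 * (m + 1)) * (Cq q ^ (3 / 2 : ℝ) * Dq q ^ (m + 2)) := by gcongr
        _ = _ := by rw [wt]; ring
    calc _ ≤ (3 * Dq q ^ 2 * wt q m) * (‖z‖ * ‖u‖) := by gcongr
      _ = _ := by ring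
  -- one contraction from the left
  have b2 : mnorm q (∑ a, ∑ b, K a b • (annih q (e a) u * inc (e b))) ≤
      Dq q * (‖z‖ * (wt q m * ‖u‖)) := by
    rcases m with _ | m
    · obtain ⟨c, rfl⟩ := mem_zero e hu
      simp only [map_smul, annih_one, smul_zero, zero_mul, Finset.sum_const_zero, mnorm_zero]
      positivity
    have hm : (∑ a, ∑ b, K a b • (annih q (e a) u * inc (e b))) ∈ oneSpan e ^ (m + 1) :=
      Submodule.sum_mem _ fun a _ => Submodule.sum_mem _ fun b _ => Submodule.smul_mem _ _
        (by rw [pow_succ]; exact Submodule.mul_mem_mul (annih_hom q _ hu) (inc_mem e b))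
    have hn : ‖∑ a, ∑ b, K a b • (annih q (e a) u * inc (e b))‖ ≤ Dq q * (‖z‖ * ‖u‖) := by
      apply le_of_sq_le_sq _ (by positivity)
      have h1 := iso_sum he createR_iso (fun b => ∑ a, K a b • annih q (e a) u)
      have h2 : ∑ b, createR (e b) (∑ a, K a b • annih q (e a) u) =
          ∑ a, ∑ b, K a b • (annih q (e a) u * inc (e b)) := by
        rw [Finset.sum_comm]; simp
      rw [← h2, h1]
      calc _ ≤ ∑ b, (∑ a, K a b ^ 2) * (Dq q ^ 2 * ‖u‖ ^ 2) :=
            Finset.sum_le_sum fun b _ => (norm_sum_smul_sq_le _ _).trans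
              (mul_le_mul_of_nonneg_left (annih_bound hq he hu)
                (Finset.sum_nonneg fun _ _ => sq_nonneg _))
        _ = _ := by rw [← Finset.sum_mul, Finset.sum_comm, ← hK]; ring
    rw [mnorm_hom hm]
    calc _ ≤ wt q (m + 1) * (Dq q * (‖z‖ * ‖u‖)) := by gcongr
      _ = _ := by ring
  -- one contraction from the right
  have b3 : mnorm q (∑ a, ∑ b, K a b • (inc (e a) * annihR q (e b) u)) ≤
      Dq q * (‖z‖ * (wt q m * ‖u‖)) := by
    rcases m with _ | m
    · obtain ⟨c, rfl⟩ := mem_zero e hu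
      simp only [map_smul, annihR_one, smul_zero, mul_zero, Finset.sum_const_zero, mnorm_zero]
      positivity
    have hm : (∑ a, ∑ b, K a b • (inc (e a) * annihR q (e b) u)) ∈ oneSpan e ^ (m + 1) :=
      Submodule.sum_mem _ fun a _ => Submodule.sum_mem _ fun b _ => Submodule.smul_mem _ _
        (inc_mul_mem e a (annihR_hom q _ hu))
    have hn : ‖∑ a, ∑ b, K a b • (inc (e a) * annihR q (e b) u)‖ ≤ Dq q * (‖z‖ * ‖u‖) := by
      apply le_of_sq_le_sq _ (by positivity)
      have h1 := iso_sum he create_iso (fun a => ∑ b, K a b • annihR q (e b) u)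
      have h2 : ∑ a, create (e a) (∑ b, K a b • annihR q (e b) u) =
          ∑ a, ∑ b, K a b • (inc (e a) * annihR q (e b) u) := by
        simp
      rw [← h2, h1]
      calc _ ≤ ∑ a, (∑ b, K a b ^ 2) * (Dq q ^ 2 * ‖u‖ ^ 2) :=
            Finset.sum_le_sum fun b _ => (norm_sum_smul_sq_le _ _).trans
              (mul_le_mul_of_nonneg_left (annihR_bound hq he hu)
                (Finset.sum_nonneg fun _ _ => sq_nonneg _))
        _ = _ := by rw [← Finset.sum_mul, ← hK]; ring
    rw [mnorm_hom hm]
    calc _ ≤ wt q (m + 1) * (Dq q * (‖z‖ * ‖u‖)) := by gcongr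
      _ = _ := by ring
  -- two contractions
  have b4 : mnorm q (∑ a, ∑ b, K a b • annih q (e a) (annihR q (e b) u)) ≤
      Dq q ^ 2 * (‖z‖ * (wt q m * ‖u‖)) := by
    rcases m with _ | _ | m
    · obtain ⟨c, rfl⟩ := mem_zero e hu
      simp only [map_smul, annihR_one, map_zero, smul_zero, Finset.sum_const_zero, mnorm_zero]
      positivity
    · have : ∀ a b, annih q (e a) (annihR q (e b) u) = 0 := by
        intro a b
        obtain ⟨c, hc⟩ := mem_zero e (annihR_hom q (e b) hu)
        rw [hc]; simp
      simp only [this, smul_zero, Finset.sum_const_zero, mnorm_zero]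
      positivity
    have hm : (∑ a, ∑ b, K a b • annih q (e a) (annihR q (e b) u)) ∈ oneSpan e ^ m :=
      Submodule.sum_mem _ fun a _ => Submodule.sum_mem _ fun b _ => Submodule.smul_mem _ _
        (annih_hom q _ (annihR_hom q _ hu))
    have hn : ‖∑ a, ∑ b, K a b • annih q (e a) (annihR q (e b) u)‖ ≤
        Dq q ^ 2 * (‖z‖ * ‖u‖) := by
      apply le_of_sq_le_sq _ (by positivity)
      refine (norm_sum_sum_smul_sq_le K _).trans ?_
      rw [← hK]
      have h1 : ∑ a, ∑ b, ‖annih q (e a) (annihR q (e b) u)‖ ^ 2 ≤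
          Dq q ^ 2 * (Dq q ^ 2 * ‖u‖ ^ 2) := by
        rw [Finset.sum_comm]
        calc _ ≤ ∑ b, Dq q ^ 2 * ‖annihR q (e b) u‖ ^ 2 :=
              Finset.sum_le_sum fun b _ => annih_bound hq he (annihR_hom q (e b) hu)
          _ ≤ _ := by
              rw [← Finset.mul_sum]
              exact mul_le_mul_of_nonneg_left (annihR_bound hq he hu) (by positivity)
      calc _ ≤ ‖z‖ ^ 2 * (Dq q ^ 2 * (Dq q ^ 2 * ‖u‖ ^ 2)) := by gcongr
        _ = _ := by ring
    rw [mnorm_hom hm]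
    have hw : wt q m ≤ wt q (m + 2) := by
      have h3 : ((m : ℕ) : ℝ) + 1 ≤ ((m + 2 : ℕ) : ℝ) + 1 := by push_cast; linarith
      have h4 : Dq q ^ m ≤ Dq q ^ (m + 2) := pow_le_pow_right₀ hD (by omega)
      rw [wt, wt]
      gcongr
    calc _ ≤ wt q (m + 2) * (Dq q ^ 2 * (‖z‖ * ‖u‖)) := by gcongr
      _ = _ := by ring
  rw [e0, mnorm_hom hu]
  set X := ‖z‖ * (wt q m * ‖u‖) with hX
  have hX0 : 0 ≤ X := by positivity
  have h12 := mnorm_add hq (∑ a, ∑ b, K a b • (inc (e a) * (u * inc (e b))))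
    (∑ a, ∑ b, K a b • (annih q (e a) u * inc (e b)))
  have h123 := mnorm_add hq ((∑ a, ∑ b, K a b • (inc (e a) * (u * inc (e b)))) +
    (∑ a, ∑ b, K a b • (annih q (e a) u * inc (e b))))
    (∑ a, ∑ b, K a b • (inc (e a) * annihR q (e b) u))
  have hDD : Dq q * X ≤ Dq q ^ 2 * X := mul_le_mul_of_nonneg_right (by nlinarith) hX0
  refine (mnorm_add hq _ _).trans ?_
  have : 6 * Dq q ^ 2 * ‖z‖ * (wt q m * ‖u‖) = 6 * (Dq q ^ 2 * X) := by rw [hX]; ring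
  rw [this]
  nlinarith

end Bound

end RightField

/-! ### The Hilbert--Schmidt bound -/

section CrossBound
variable {H : Type*} [NormedAddCommGroup H] [InnerProductSpace ℝ H]

/-- The identification of `H ⊗ H` with the two-particle sector. -/
def twoParticle : H ⊗[ℝ] H →ₗ[ℝ] Fock H :=
  TensorProduct.lift ((LinearMap.mul ℝ (Fock H)).compl₁₂ inc inc)

theorem twoParticle_tmul (f g : H) : twoParticle (f ⊗ₜ[ℝ] g) = inc f * inc g := by
  simp [twoParticle]

theorem form_twoParticle (z w : H ⊗[ℝ] H) :
    form (twoParticle z) (twoParticle w) = inner ℝ z w := by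
  induction z using TensorProduct.induction_on with
  | zero => simp
  | add x y hx hy => simp only [map_add, LinearMap.add_apply, hx, hy, inner_add_left]
  | tmul a b =>
    induction w using TensorProduct.induction_on with
    | zero => simp
    | add x y hx hy => simp only [map_add, hx, hy, inner_add_right]
    | tmul c d =>
      have := form_inc_mul b d (1 : Fock H) 1
      rw [mul_one, mul_one, form_one_one, mul_one] at this
      rw [twoParticle_tmul, twoParticle_tmul, form_inc_mul, this, TensorProduct.inner_tmul]

theorem twoParticle_injective : Function.Injective (twoParticle : H ⊗[ℝ] H →ₗ[ℝ] Fock H) := by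
  rw [injective_iff_map_eq_zero]
  intro z hz
  have := form_twoParticle z z
  rw [hz, map_zero] at this
  exact inner_self_eq_zero.1 this.symm

theorem chaos_twoParticle (z : H ⊗[ℝ] H) : chaos 2 (twoParticle z) = twoParticle z := by
  induction z using TensorProduct.induction_on with
  | zero => simp
  | add x y hx hy => simp only [map_add, hx, hy]
  | tmul a b =>
    rw [twoParticle_tmul]
    refine chaos_same (e := ![a, b]) (m := 2) ?_
    rw [sq]
    exact Submodule.mul_mem_mul (inc_mem ![a, b] 0) (inc_mem ![a, b] 1)

/-- A kernel in `H ⊗ H` and a Fock vector can be written in a common orthonormal family. -/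
theorem exists_common_kernel (z : H ⊗[ℝ] H) (u : Fock H) :
    ∃ (d : ℕ) (e : Fin d → H), Orthonormal ℝ e ∧ (∃ K, z = kernel e K) ∧
      ∃ c : ℕ →₀ Fock H, (∀ m, c m ∈ oneSpan e ^ m) ∧ u = c.sum fun _ x => x := by
  obtain ⟨d, e, he, ⟨c, hc, hz⟩, hu⟩ := exists_common (twoParticle z) u
  refine ⟨d, e, he, ?_, hu⟩
  have h2 : twoParticle z = c 2 := by rw [← chaos_twoParticle, hz, chaos_finsupp c hc]
  obtain ⟨w, hw, h⟩ := peel e 1 (hc 2)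
  choose w' hw' h' using fun i => peel e 0 (hw i)
  choose K hK using fun i j => mem_zero e (hw' i j)
  refine ⟨K, twoParticle_injective ?_⟩
  rw [h2, h, kernel]
  simp only [map_sum, map_smul, twoParticle_tmul, h', hK, Finset.mul_sum, mul_smul_comm, mul_one]

variable {q : ℝ}

theorem mnorm_cross (hq : |q| < 1) (z : H ⊗[ℝ] H) (u : Fock H) :
    mnorm q (cross q z u) ≤ 6 * Dq q ^ 2 * ‖z‖ * mnorm q u := by
  obtain ⟨d, e, he, ⟨K, rfl⟩, c, hc, rfl⟩ := exists_common_kernel z u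
  rw [mnorm_finsupp c hc, Finset.mul_sum, Finsupp.sum, map_sum]
  refine (mnorm_sum hq _ _).trans (Finset.sum_le_sum fun m _ => ?_)
  rw [← mnorm_hom (hc m)]
  exact mnorm_cross_hom hq he K (hc m)

end CrossBound

/-! ### Sandwiches with fields in the mezdonic algebra -/

section Sandwich
variable {q : Set.Ioo (-1 : ℝ) 1} {H : Type*} [NormedAddCommGroup H] [InnerProductSpace ℝ H]

theorem FieldAlg.vec_xi_mul (f : H) (A : FieldAlg q H) :
    (FieldAlg.xi f * A).vec = field (q : ℝ) f A.vec := rfl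

theorem FieldAlg.vec_xi (f : H) : (FieldAlg.xi f : FieldAlg q H).vec = inc f := by
  change field (q : ℝ) f 1 = inc f
  simp [field]

theorem FieldAlg.vec_mul_xi (A : FieldAlg q H) (g : H) :
    (A * FieldAlg.xi g).vec = fieldR (q : ℝ) g A.vec := by
  have h1 : (A * FieldAlg.xi g).vec = A.op ((FieldAlg.xi g : FieldAlg q H).vec) := by
    simp [FieldAlg.vec]
  rw [h1, FieldAlg.vec_xi]
  exact fieldSub_inc (q : ℝ) A.2 g

theorem mnorm_inc {p : ℝ} (f : H) : mnorm p (inc f) = wt p 1 * ‖f‖ := by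
  have hm : inc f ∈ oneSpan (fun _ : Unit => f) ^ 1 := by
    rw [pow_one]; exact inc_mem (fun _ : Unit => f) ()
  have hn : ‖inc f‖ = ‖f‖ := by
    rw [← sq_eq_sq₀ (norm_nonneg _) (norm_nonneg _), ← real_inner_self_eq_norm_sq,
      ← real_inner_self_eq_norm_sq, inner_eq_form]
    have := form_inc_mul f f (1 : Fock H) 1
    rwa [mul_one, form_one_one, mul_one] at this
  rw [mnorm_hom hm, hn]

theorem norm_xi (f : H) : ‖(xi f : MezdonAlg q H)‖ = wt (q : ℝ) 1 * ‖f‖ := by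
  change ‖((FieldAlg.xi f : FieldAlg q H) : MezdonAlg q H)‖ = _
  rw [UniformSpace.Completion.norm_coe, FieldAlg.norm_def, FieldAlg.vec_xi, mnorm_inc]

variable (q H) in
/-- The field operator as a bounded linear map. -/
def xiL : H →L[ℝ] MezdonAlg q H :=
  xi.mkContinuous (wt (q : ℝ) 1) fun f => (norm_xi f).le

theorem omega_xi_mul_xi (f g : H) : omega (xi f * xi g : MezdonAlg q H) = inner ℝ f g := by
  have : (xi f * xi g : MezdonAlg q H) = ((FieldAlg.xi f * FieldAlg.xi g : FieldAlg q H) :) := by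
    rw [UniformSpace.Completion.coe_mul]; rfl
  have h := annih_inc_mul (q : ℝ) f g 1
  rw [this, omega_coe, FieldAlg.vec_xi_mul, FieldAlg.vec_xi, field, LinearMap.add_apply,
    LinearMap.add_apply, map_add, create_apply, vac_inc_mul]
  rw [mul_one] at h
  simp [h]

theorem norm_delta_le : ‖(delta : MezdonAlg q H →L[ℝ] MezdonAlg q H)‖ ≤ 1 := by
  refine ContinuousLinearMap.opNorm_le_bound _ zero_le_one fun x => ?_
  induction x using UniformSpace.Completion.induction_on with
  | hp => exact isClosed_le (by fun_prop) (by fun_prop)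
  | ih A =>
    rw [delta_coe, UniformSpace.Completion.norm_coe, UniformSpace.Completion.norm_coe, one_mul,
      FieldAlg.norm_def, FieldAlg.norm_def, FieldAlg.vec_ofVec]
    exact mnorm_scale (abs_lt_one q) _

/-- `x ↦ ξ(f) x ξ(g) - ⟨f, g⟩ Δ_q x`, extended linearly to `f ⊗ g`. -/
def crossPre : H ⊗[ℝ] H →ₗ[ℝ] MezdonAlg q H →L[ℝ] MezdonAlg q H :=
  TensorProduct.lift (LinearMap.mk₂ ℝ
    (fun f g => ContinuousLinearMap.mulLeftRight ℝ (MezdonAlg q H) (xi f) (xi g) -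
      (inner ℝ f g : ℝ) • delta)
    (by intro f f' g; simp only [map_add, _root_.add_apply, inner_add_left,
          add_smul]; abel)
    (by intro r f g; simp only [map_smul, _root_.smul_apply, real_inner_smul_left,
          smul_sub, mul_smul])
    (by intro f g g'; simp only [map_add, inner_add_right, add_smul]; abel)
    (by intro r f g; simp only [map_smul, real_inner_smul_right, smul_sub, mul_smul]))

theorem crossPre_tmul (f g : H) : (crossPre (f ⊗ₜ g) : MezdonAlg q H →L[ℝ] MezdonAlg q H) =
    ContinuousLinearMap.mulLeftRight ℝ (MezdonAlg q H) (xi f) (xi g) -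
      (inner ℝ f g : ℝ) • delta := by
  simp [crossPre]

/-- On field operators, `crossPre` acts through the Fock space map `cross` on vacuum vectors. -/
theorem crossPre_coe (z : H ⊗[ℝ] H) (A : FieldAlg q H) :
    crossPre z (A : MezdonAlg q H) = (FieldAlg.ofVec (cross (q : ℝ) z A.vec) : FieldAlg q H) := by
  induction z using TensorProduct.induction_on with
  | zero =>
    rw [map_zero, map_zero, LinearMap.zero_apply, map_zero, UniformSpace.Completion.coe_zero]
    rfl
  | add x y hx hy =>
    rw [map_add, _root_.add_apply, hx, hy, map_add, LinearMap.add_apply, map_add,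
      UniformSpace.Completion.coe_add]
  | tmul f g =>
    have h : (xi f * (A : MezdonAlg q H) * xi g) =
        ((FieldAlg.xi f * A * FieldAlg.xi g : FieldAlg q H) : MezdonAlg q H) := by
      rw [UniformSpace.Completion.coe_mul, UniformSpace.Completion.coe_mul]; rfl
    have h' : (FieldAlg.ofVec (cross (q : ℝ) (f ⊗ₜ g) A.vec) : FieldAlg q H) =
        FieldAlg.xi f * A * FieldAlg.xi g -
          (inner ℝ f g : ℝ) • FieldAlg.ofVec (scale (q : ℝ) A.vec) := by
      rw [eq_sub_iff_add_eq, ← map_smul, ← map_add, ← field_fieldR, ← FieldAlg.vec_mul_xi,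
        ← FieldAlg.vec_xi_mul, FieldAlg.ofVec_vec, mul_assoc]
    rw [crossPre_tmul, _root_.sub_apply, _root_.smul_apply, delta_coe, h',
      ContinuousLinearMap.mulLeftRight_apply, h, UniformSpace.Completion.coe_sub,
      UniformSpace.Completion.coe_smul]

/-- The key estimate: a second-order integral against the noise without its trace part is
bounded by the Hilbert--Schmidt norm of its kernel. -/
theorem norm_crossPre_le (z : H ⊗[ℝ] H) :
    ‖(crossPre z : MezdonAlg q H →L[ℝ] MezdonAlg q H)‖ ≤ 6 * Dq (q : ℝ) ^ 2 * ‖z‖ := by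
  refine ContinuousLinearMap.opNorm_le_bound _ (by positivity) fun x => ?_
  induction x using UniformSpace.Completion.induction_on with
  | hp => exact isClosed_le (by fun_prop) (by fun_prop)
  | ih A =>
    rw [crossPre_coe, UniformSpace.Completion.norm_coe, UniformSpace.Completion.norm_coe,
      FieldAlg.norm_def, FieldAlg.norm_def, FieldAlg.vec_ofVec]
    exact mnorm_cross (abs_lt_one q) _ _

variable (q H) in
/-- The extension of `crossPre` to the Hilbert space tensor product. -/
def crossL : UniformSpace.Completion (H ⊗[ℝ] H) →L[ℝ] MezdonAlg q H →L[ℝ] MezdonAlg q H :=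
  let T : H ⊗[ℝ] H →L[ℝ] MezdonAlg q H →L[ℝ] MezdonAlg q H :=
    ⟨crossPre, AddMonoidHomClass.continuous_of_bound crossPre (6 * Dq (q : ℝ) ^ 2)
      norm_crossPre_le⟩
  T.extend UniformSpace.Completion.toComplL

theorem crossL_coe (z : H ⊗[ℝ] H) : crossL q H (z : UniformSpace.Completion (H ⊗[ℝ] H)) =
    crossPre z :=
  ContinuousLinearMap.extend_eq _ UniformSpace.Completion.denseRange_coe
    (UniformSpace.Completion.isUniformInducing_coe _) z

theorem norm_crossL_le (z : UniformSpace.Completion (H ⊗[ℝ] H)) :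
    ‖crossL q H z‖ ≤ 6 * Dq (q : ℝ) ^ 2 * ‖z‖ := by
  induction z using UniformSpace.Completion.induction_on with
  | hp =>
    exact isClosed_le ((continuous_norm (E := MezdonAlg q H →L[ℝ] MezdonAlg q H)).comp
      (crossL q H).continuous) (by fun_prop)
  | ih z =>
    rw [crossL_coe, UniformSpace.Completion.norm_coe]
    exact norm_crossPre_le z

end Sandwich

/-! ### Noncommutative power series in a Banach algebra -/

section Words
@[simp] theorem monomial_nil {A : Type*} [Ring A] {n : ℕ} (X : Fin n → A) :
    monomial X [] = 1 := rfl

@[simp] theorem monomial_cons {A : Type*} [Ring A] {n : ℕ} (X : Fin n → A) (k : Fin n)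
    (w : List (Fin n)) : monomial X (k :: w) = X k * monomial X w := by simp [monomial]

variable {A : Type*} [NormedRing A] [NormedAlgebra ℝ A] {n : ℕ}

/-- `∑ U P_k(V)` over all occurrences `w = U k V` of letters in `w`. -/
def dR (X : Fin n → A) (P : Fin n → A →L[ℝ] A) : List (Fin n) → A
  | [] => 0
  | k :: w => P k (monomial X w) + X k * dR X P w

/-- `∑ P_k(U) V` over all occurrences `w = U k V` of letters in `w`. -/
def dL (X : Fin n → A) : (Fin n → A →L[ℝ] A) → List (Fin n) → A
  | _, [] => 0
  | P, k :: w => P k 1 * monomial X w +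
      dL X (fun i => (P i).comp (ContinuousLinearMap.mul ℝ A (X k))) w

theorem dR_add (X : Fin n → A) (P P' : Fin n → A →L[ℝ] A) (w : List (Fin n)) :
    dR X (P + P') w = dR X P w + dR X P' w := by
  induction w with
  | nil => simp [dR]
  | cons k w ih => simp only [dR, ih, Pi.add_apply, _root_.add_apply, mul_add]; abel

theorem dR_smul (X : Fin n → A) (c : ℝ) (P : Fin n → A →L[ℝ] A) (w : List (Fin n)) :
    dR X (c • P) w = c • dR X P w := by
  induction w with
  | nil => simp [dR]
  | cons k w ih => simp only [dR, ih, Pi.smul_apply, _root_.smul_apply, mul_smul_comm, smul_add]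

theorem dL_add (X : Fin n → A) (P P' : Fin n → A →L[ℝ] A) (w : List (Fin n)) :
    dL X (P + P') w = dL X P w + dL X P' w := by
  induction w generalizing P P' with
  | nil => simp [dL]
  | cons k w ih =>
    have := ih (fun i => (P i).comp (ContinuousLinearMap.mul ℝ A (X k)))
      (fun i => (P' i).comp (ContinuousLinearMap.mul ℝ A (X k)))
    simp only [dL, Pi.add_apply, _root_.add_apply, add_mul, ContinuousLinearMap.add_comp]
    rw [← Pi.add_def, this]
    abel

theorem dL_smul (X : Fin n → A) (c : ℝ) (P : Fin n → A →L[ℝ] A) (w : List (Fin n)) :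
    dL X (c • P) w = c • dL X P w := by
  induction w generalizing P with
  | nil => simp [dL]
  | cons k w ih =>
    have := ih (fun i => (P i).comp (ContinuousLinearMap.mul ℝ A (X k)))
    simp only [dL, Pi.smul_apply, _root_.smul_apply, smul_mul_assoc, ContinuousLinearMap.smul_comp,
      smul_add]
    rw [← this]
    rfl

/-- The derivative of `X ↦ X_w` in the direction `v`. -/
abbrev dW (X v : Fin n → A) (w : List (Fin n)) : A :=
  dR X (fun k => ContinuousLinearMap.mul ℝ A (v k)) w

theorem dR_mul (X v : Fin n → A) (b : A) (w : List (Fin n)) :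
    dR X (fun k => ContinuousLinearMap.mulLeftRight ℝ A (v k) b) w = dW X v w * b := by
  induction w with
  | nil => simp [dR]
  | cons k w ih => simp [dR, ih, add_mul, mul_assoc]

theorem dL_mul (X v : Fin n → A) (b : A) (w : List (Fin n)) :
    dL X (fun k => ContinuousLinearMap.mulLeftRight ℝ A b (v k)) w = b * dW X v w := by
  induction w generalizing b with
  | nil => simp [dL, dR]
  | cons k w ih =>
    have h : (fun i => (ContinuousLinearMap.mulLeftRight ℝ A b (v i)).comp
        (ContinuousLinearMap.mul ℝ A (X k))) =
        fun i => ContinuousLinearMap.mulLeftRight ℝ A (b * X k) (v i) := by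
      ext i x; simp [mul_assoc]
    rw [dL, h, ih]
    simp [dR, mul_add, mul_assoc]

section Bounds
variable {m r : ℝ} {X X' : Fin n → A}

theorem norm_monomial_le (hm : ‖(1 : A)‖ ≤ m) (hr : 0 ≤ r) (hX : ‖X‖ ≤ r) (w : List (Fin n)) :
    ‖monomial X w‖ ≤ m * r ^ w.length := by
  induction w with
  | nil => simpa
  | cons k w ih =>
    rw [monomial_cons, List.length_cons, pow_succ]
    calc _ ≤ ‖X k‖ * ‖monomial X w‖ := norm_mul_le _ _
      _ ≤ r * (m * r ^ w.length) := by
        gcongr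
        exact (norm_le_pi_norm X k).trans hX
      _ = _ := by ring

theorem norm_monomial_sub_le (hm : ‖(1 : A)‖ ≤ m) (hr : 0 ≤ r) (hX : ‖X‖ ≤ r) (hX' : ‖X'‖ ≤ r)
    (w : List (Fin n)) :
    r * ‖monomial X w - monomial X' w‖ ≤ m * w.length * r ^ w.length * ‖X - X'‖ := by
  induction w with
  | nil => simp
  | cons k w ih =>
    have h1 := norm_monomial_le hm hr hX' w
    have h2 : ‖X k‖ ≤ r := (norm_le_pi_norm X k).trans hX
    have h3 : ‖X k - X' k‖ ≤ ‖X - X'‖ := norm_le_pi_norm (X - X') k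
    have e : monomial X (k :: w) - monomial X' (k :: w) =
        X k * (monomial X w - monomial X' w) + (X k - X' k) * monomial X' w := by
      simp only [monomial_cons]; noncomm_ring
    have h4 := (norm_add_le (X k * (monomial X w - monomial X' w))
      ((X k - X' k) * monomial X' w)).trans (add_le_add (norm_mul_le _ _) (norm_mul_le _ _))
    have h0 := norm_nonneg (monomial X w - monomial X' w)
    have hd := norm_nonneg (X - X')
    rw [e, List.length_cons]
    calc _ ≤ r * (‖X k‖ * ‖monomial X w - monomial X' w‖ + ‖X k - X' k‖ * ‖monomial X' w‖) := by
          gcongr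
      _ ≤ r * (r * ‖monomial X w - monomial X' w‖ + ‖X - X'‖ * (m * r ^ w.length)) := by
          gcongr
      _ = r * (r * ‖monomial X w - monomial X' w‖) + r * (‖X - X'‖ * (m * r ^ w.length)) := by ring
      _ ≤ r * (m * w.length * r ^ w.length * ‖X - X'‖) + r * (‖X - X'‖ * (m * r ^ w.length)) := by
          gcongr
      _ = _ := by push_cast; ring

/-- Second-order Taylor estimate for a single word. The factor `(length)² r ^ length` is absorbed by
the weights in `CoefBound`. -/
theorem norm_monomial_taylor_le (hm : ‖(1 : A)‖ ≤ m) (hr : 0 ≤ r) (hX : ‖X‖ ≤ r)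
    (hX' : ‖X'‖ ≤ r) (w : List (Fin n)) :
    r ^ 2 * ‖monomial X' w - monomial X w - dW X (X' - X) w‖ ≤
      m * w.length ^ 2 * r ^ w.length * ‖X' - X‖ ^ 2 := by
  induction w with
  | nil => simp [dR]
  | cons k w ih =>
    have hm0 : 0 ≤ m := (norm_nonneg _).trans hm
    have h1 := norm_monomial_sub_le hm hr hX' hX w
    have h2 : ‖X k‖ ≤ r := (norm_le_pi_norm X k).trans hX
    have h3 : ‖X' k - X k‖ ≤ ‖X' - X‖ := norm_le_pi_norm (X' - X) k
    have e : monomial X' (k :: w) - monomial X (k :: w) - dW X (X' - X) (k :: w) =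
        X k * (monomial X' w - monomial X w - dW X (X' - X) w) +
          (X' k - X k) * (monomial X' w - monomial X w) := by
      simp only [monomial_cons, dR, ContinuousLinearMap.mul_apply', Pi.sub_apply]; noncomm_ring
    set T := monomial X' w - monomial X w - dW X (X' - X) w
    set D := monomial X' w - monomial X w
    have h4 := (norm_add_le (X k * T) ((X' k - X k) * D)).trans
      (add_le_add (norm_mul_le _ _) (norm_mul_le _ _))
    have hd := norm_nonneg (X' - X)
    rw [e, List.length_cons]
    calc _ ≤ r ^ 2 * (‖X k‖ * ‖T‖ + ‖X' k - X k‖ * ‖D‖) := by gcongr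
      _ ≤ r ^ 2 * (r * ‖T‖ + ‖X' - X‖ * ‖D‖) := by gcongr
      _ = r * (r ^ 2 * ‖T‖) + r * ‖X' - X‖ * (r * ‖D‖) := by ring
      _ ≤ r * (m * w.length ^ 2 * r ^ w.length * ‖X' - X‖ ^ 2) +
          r * ‖X' - X‖ * (m * w.length * r ^ w.length * ‖X' - X‖) := by gcongr
      _ = m * (w.length ^ 2 + w.length) * (r ^ w.length * r) * ‖X' - X‖ ^ 2 := by ring
      _ ≤ _ := by
          rw [pow_succ r]
          push_cast
          gcongr
          nlinarith [Nat.cast_nonneg (α := ℝ) w.length]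

theorem norm_dR_le (hm : ‖(1 : A)‖ ≤ m) (hr : 0 ≤ r) (hX : ‖X‖ ≤ r) (P : Fin n → A →L[ℝ] A)
    (w : List (Fin n)) : r * ‖dR X P w‖ ≤ m * w.length * r ^ w.length * ‖P‖ := by
  induction w with
  | nil => simp [dR]
  | cons k w ih =>
    have h1 := norm_monomial_le hm hr hX w
    have h2 : ‖X k‖ ≤ r := (norm_le_pi_norm X k).trans hX
    have h3 : ‖P k‖ ≤ ‖P‖ := norm_le_pi_norm P k
    have h4 := (norm_add_le (P k (monomial X w)) (X k * dR X P w)).trans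
      (add_le_add ((P k).le_opNorm _) (norm_mul_le _ _))
    rw [dR, List.length_cons]
    calc _ ≤ r * (‖P k‖ * ‖monomial X w‖ + ‖X k‖ * ‖dR X P w‖) := by gcongr
      _ ≤ r * (‖P‖ * (m * r ^ w.length) + r * ‖dR X P w‖) := by gcongr
      _ = r * ‖P‖ * (m * r ^ w.length) + r * (r * ‖dR X P w‖) := by ring
      _ ≤ r * ‖P‖ * (m * r ^ w.length) + r * (m * w.length * r ^ w.length * ‖P‖) := by gcongr
      _ = _ := by push_cast; ring

theorem norm_dR_sub_le (hm : ‖(1 : A)‖ ≤ m) (hr : 0 ≤ r) (hX : ‖X‖ ≤ r) (hX' : ‖X'‖ ≤ r)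
    (P : Fin n → A →L[ℝ] A) (w : List (Fin n)) : r ^ 2 * ‖dR X P w - dR X' P w‖ ≤
      m * w.length ^ 2 * r ^ w.length * (‖P‖ * ‖X - X'‖) := by
  induction w with
  | nil => simp [dR]
  | cons k w ih =>
    have hm0 : 0 ≤ m := (norm_nonneg _).trans hm
    have h1 := norm_monomial_sub_le hm hr hX hX' w
    have h1' := norm_dR_le hm hr hX' P w
    have h2 : ‖X k‖ ≤ r := (norm_le_pi_norm X k).trans hX
    have h3 : ‖P k‖ ≤ ‖P‖ := norm_le_pi_norm P k
    have h3' : ‖X k - X' k‖ ≤ ‖X - X'‖ := norm_le_pi_norm (X - X') k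
    have e : dR X P (k :: w) - dR X' P (k :: w) = P k (monomial X w - monomial X' w) +
        X k * (dR X P w - dR X' P w) + (X k - X' k) * dR X' P w := by
      simp only [dR, map_sub]; noncomm_ring
    set D := monomial X w - monomial X' w
    set E := dR X P w - dR X' P w
    set F := dR X' P w
    have h4 : ‖P k D + X k * E + (X k - X' k) * F‖ ≤
        ‖P k‖ * ‖D‖ + ‖X k‖ * ‖E‖ + ‖X k - X' k‖ * ‖F‖ :=
      norm_add₃_le.trans (add_le_add (add_le_add ((P k).le_opNorm _) (norm_mul_le _ _))
        (norm_mul_le _ _))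
    have hd := norm_nonneg (X - X')
    have hp := norm_nonneg P
    rw [e, List.length_cons]
    calc _ ≤ r ^ 2 * (‖P k‖ * ‖D‖ + ‖X k‖ * ‖E‖ + ‖X k - X' k‖ * ‖F‖) := by gcongr
      _ ≤ r ^ 2 * (‖P‖ * ‖D‖ + r * ‖E‖ + ‖X - X'‖ * ‖F‖) := by gcongr
      _ = r * ‖P‖ * (r * ‖D‖) + r * (r ^ 2 * ‖E‖) + r * ‖X - X'‖ * (r * ‖F‖) := by ring
      _ ≤ r * ‖P‖ * (m * w.length * r ^ w.length * ‖X - X'‖) +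
          r * (m * w.length ^ 2 * r ^ w.length * (‖P‖ * ‖X - X'‖)) +
          r * ‖X - X'‖ * (m * w.length * r ^ w.length * ‖P‖) := by gcongr
      _ = m * (w.length ^ 2 + 2 * w.length) * (r ^ w.length * r) * (‖P‖ * ‖X - X'‖) := by ring
      _ ≤ _ := by
          rw [pow_succ r]
          push_cast
          gcongr
          nlinarith [Nat.cast_nonneg (α := ℝ) w.length]

theorem norm_comp_mul_le (P : Fin n → A →L[ℝ] A) (a : A) :
    ‖fun i => (P i).comp (ContinuousLinearMap.mul ℝ A a)‖ ≤ ‖P‖ * ‖a‖ := by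
  refine (pi_norm_le_iff_of_nonneg (by positivity)).2 fun i => ?_
  refine (ContinuousLinearMap.opNorm_comp_le _ _).trans ?_
  gcongr
  · exact norm_le_pi_norm P i
  · exact ContinuousLinearMap.opNorm_mul_apply_le ℝ A a

theorem norm_dL_le (hm : ‖(1 : A)‖ ≤ m) (hr : 0 ≤ r) (hX : ‖X‖ ≤ r) (P : Fin n → A →L[ℝ] A)
    (w : List (Fin n)) : r * ‖dL X P w‖ ≤ m ^ 2 * w.length * r ^ w.length * ‖P‖ := by
  induction w generalizing P with
  | nil => simp [dL]
  | cons k w ih =>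
    have h1 := norm_monomial_le hm hr hX w
    have h2 : ‖X k‖ ≤ r := (norm_le_pi_norm X k).trans hX
    have h3 : ‖P k‖ ≤ ‖P‖ := norm_le_pi_norm P k
    have h5 : ‖P k 1‖ ≤ ‖P‖ * m := ((P k).le_opNorm _).trans (by gcongr)
    have ih' := ih fun i => (P i).comp (ContinuousLinearMap.mul ℝ A (X k))
    have h6 := norm_comp_mul_le P (X k)
    set F := dL X (fun i => (P i).comp (ContinuousLinearMap.mul ℝ A (X k))) w with hF
    set p' := ‖fun i => (P i).comp (ContinuousLinearMap.mul ℝ A (X k))‖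
    have h4 := (norm_add_le (P k 1 * monomial X w) F).trans (add_le_add_left (norm_mul_le _ _) _)
    have hm0 : 0 ≤ m := (norm_nonneg _).trans hm
    have h7 : r * ‖F‖ ≤ m ^ 2 * w.length * r ^ w.length * (‖P‖ * r) :=
      ih'.trans (by gcongr; exact h6.trans (by gcongr))
    rw [dL, ← hF, List.length_cons]
    calc _ ≤ r * (‖P k 1‖ * ‖monomial X w‖ + ‖F‖) := by gcongr
      _ ≤ r * (‖P‖ * m * (m * r ^ w.length) + ‖F‖) := by gcongr
      _ = r * (‖P‖ * m * (m * r ^ w.length)) + r * ‖F‖ := by ring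
      _ ≤ r * (‖P‖ * m * (m * r ^ w.length)) + m ^ 2 * w.length * r ^ w.length * (‖P‖ * r) := by
          gcongr
      _ = _ := by push_cast; ring

theorem norm_dL_sub_le (hm : ‖(1 : A)‖ ≤ m) (hr : 0 ≤ r) (hX : ‖X‖ ≤ r) (hX' : ‖X'‖ ≤ r)
    (P : Fin n → A →L[ℝ] A) (w : List (Fin n)) : r ^ 2 * ‖dL X P w - dL X' P w‖ ≤
      m ^ 2 * w.length ^ 2 * r ^ w.length * (‖P‖ * ‖X - X'‖) := by
  induction w generalizing P with
  | nil => simp [dL]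
  | cons k w ih =>
    have hm0 : 0 ≤ m := (norm_nonneg _).trans hm
    have h1 := norm_monomial_sub_le hm hr hX hX' w
    have h2 : ‖X k‖ ≤ r := (norm_le_pi_norm X k).trans hX
    have h3 : ‖P k‖ ≤ ‖P‖ := norm_le_pi_norm P k
    have h3' : ‖X k - X' k‖ ≤ ‖X - X'‖ := norm_le_pi_norm (X - X') k
    have h5 : ‖P k 1‖ ≤ ‖P‖ * m := ((P k).le_opNorm _).trans (by gcongr)
    set Q := fun i => (P i).comp (ContinuousLinearMap.mul ℝ A (X k)) with hQ
    set Q' := fun i => (P i).comp (ContinuousLinearMap.mul ℝ A (X' k)) with hQ'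
    set Q'' := fun i => (P i).comp (ContinuousLinearMap.mul ℝ A (X k - X' k)) with hQ''
    have hQQ : Q = Q' + Q'' := by
      ext i x; simp [hQ, hQ', hQ'']
    have h6 : ‖Q‖ ≤ ‖P‖ * r := (norm_comp_mul_le P (X k)).trans (by gcongr)
    have h7 : ‖Q''‖ ≤ ‖P‖ * ‖X - X'‖ := (norm_comp_mul_le P (X k - X' k)).trans (by gcongr)
    have e : dL X P (k :: w) - dL X' P (k :: w) = P k 1 * (monomial X w - monomial X' w) +
        (dL X Q w - dL X' Q w) + dL X' Q'' w := by
      have : dL X' Q w = dL X' Q' w + dL X' Q'' w := by rw [hQQ, dL_add]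
      rw [this]
      simp only [dL, mul_sub]
      abel
    have ih' := ih Q
    have h8 := norm_dL_le hm hr hX' Q'' w
    set D := monomial X w - monomial X' w
    set E := dL X Q w - dL X' Q w
    set F := dL X' Q'' w
    have h4 : ‖P k 1 * D + E + F‖ ≤ ‖P k 1‖ * ‖D‖ + ‖E‖ + ‖F‖ :=
      norm_add₃_le.trans (by gcongr; exact norm_mul_le _ _)
    have hd := norm_nonneg (X - X')
    have hp := norm_nonneg P
    have h9 : r ^ 2 * ‖E‖ ≤ m ^ 2 * w.length ^ 2 * r ^ w.length * (‖P‖ * r * ‖X - X'‖) :=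
      ih'.trans (by gcongr)
    have h10 : r * ‖F‖ ≤ m ^ 2 * w.length * r ^ w.length * (‖P‖ * ‖X - X'‖) :=
      h8.trans (by gcongr)
    rw [e, List.length_cons]
    calc _ ≤ r ^ 2 * (‖P k 1‖ * ‖D‖ + ‖E‖ + ‖F‖) := by gcongr
      _ ≤ r ^ 2 * (‖P‖ * m * ‖D‖ + ‖E‖ + ‖F‖) := by gcongr
      _ = r * (‖P‖ * m) * (r * ‖D‖) + r ^ 2 * ‖E‖ + r * (r * ‖F‖) := by ring
      _ ≤ r * (‖P‖ * m) * (m * w.length * r ^ w.length * ‖X - X'‖) +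
          m ^ 2 * w.length ^ 2 * r ^ w.length * (‖P‖ * r * ‖X - X'‖) +
          r * (m ^ 2 * w.length * r ^ w.length * (‖P‖ * ‖X - X'‖)) := by
          refine add_le_add (add_le_add ?_ h9) (mul_le_mul_of_nonneg_left h10 hr)
          gcongr
      _ = m ^ 2 * (w.length ^ 2 + 2 * w.length) * (r ^ w.length * r) * (‖P‖ * ‖X - X'‖) := by ring
      _ ≤ _ := by
          rw [pow_succ r]
          push_cast
          gcongr
          nlinarith [Nat.cast_nonneg (α := ℝ) w.length]

end Bounds
end Words

section SeriesBounds

/-- `Λ` dominates the values and the first two derivatives of `∑_w c_w X_w` on the ball of radius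
`r` of any Banach algebra whose unit has norm at most `m`. The same weighted sum serves for all three
orders: the `k`-th derivative of a word loses at most `(length + 1)²` and `k` powers of `r`. -/
structure CoefBound {n : ℕ} (m r Λ : ℝ) (c : List (Fin n) → ℝ) : Prop where
  one_le : 1 ≤ m
  pos : 0 < r
  summable : Summable fun w => |c w| * ((w.length + 1) ^ 2 * r ^ w.length)
  le₀ : m ^ 2 * ∑' w, |c w| * ((w.length + 1) ^ 2 * r ^ w.length) ≤ Λ
  le₁ : m ^ 2 * ∑' w, |c w| * ((w.length + 1) ^ 2 * r ^ w.length) ≤ Λ * r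
  le₂ : m ^ 2 * ∑' w, |c w| * ((w.length + 1) ^ 2 * r ^ w.length) ≤ Λ * r ^ 2

variable {n : ℕ} {m r Λ : ℝ} {c : List (Fin n) → ℝ}

theorem CoefBound.nonneg (h : CoefBound m r Λ c) : 0 ≤ Λ :=
  le_trans (mul_nonneg (sq_nonneg _) (tsum_nonneg fun w => by
    have := h.pos; positivity)) h.le₀

theorem CoefBound.mono (h : CoefBound m r Λ c) {Λ' : ℝ} (hΛ : Λ ≤ Λ') : CoefBound m r Λ' c where
  one_le := h.one_le
  pos := h.pos
  summable := h.summable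
  le₀ := h.le₀.trans hΛ
  le₁ := h.le₁.trans (mul_le_mul_of_nonneg_right hΛ h.pos.le)
  le₂ := h.le₂.trans (mul_le_mul_of_nonneg_right hΛ (sq_nonneg _))

/-- A polynomial loss in the length of the word is compensated by a slightly larger radius. -/
theorem exists_coefBound {r' : ℝ} (hm : 1 ≤ m) (hr : 0 < r) (hr' : r < r')
    (hc : Summable fun w => |c w| * r' ^ w.length) : ∃ Λ, CoefBound m r Λ c := by
  have h0 : 0 < r' := hr.trans hr'
  have h1 : Summable fun k : ℕ => ((k : ℝ) + 1) ^ 2 * (r / r') ^ k := by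
    have hlt : ‖r / r'‖ < 1 := by
      rw [Real.norm_eq_abs, abs_of_pos (by positivity), div_lt_one h0]; exact hr'
    have a := summable_pow_mul_geometric_of_norm_lt_one 2 hlt
    have b := summable_pow_mul_geometric_of_norm_lt_one 1 hlt
    have d := summable_pow_mul_geometric_of_norm_lt_one 0 hlt
    refine ((a.add (b.mul_left 2)).add d).congr fun k => ?_
    ring
  obtain ⟨K, hK⟩ := h1.tendsto_atTop_zero.bddAbove_range
  have hK' : ∀ k : ℕ, ((k : ℝ) + 1) ^ 2 * r ^ k ≤ K * r' ^ k := by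
    intro k
    have := hK ⟨k, rfl⟩
    simp only [div_pow] at this
    rw [← mul_div_assoc, div_le_iff₀ (by positivity)] at this
    exact this
  have hs : Summable fun w => |c w| * (((w.length : ℝ) + 1) ^ 2 * r ^ w.length) := by
    refine Summable.of_nonneg_of_le (fun w => by positivity) (fun w => ?_) (hc.mul_left K)
    calc _ ≤ |c w| * (K * r' ^ w.length) :=
          mul_le_mul_of_nonneg_left (hK' _) (abs_nonneg _)
      _ = _ := by ring
  set S := ∑' w, |c w| * (((w.length : ℝ) + 1) ^ 2 * r ^ w.length)
  have hS : 0 ≤ S := tsum_nonneg fun w => by positivity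
  have hM : 0 ≤ m ^ 2 * S := by positivity
  refine ⟨m ^ 2 * S * (1 + 1 / r + 1 / r ^ 2), hm, hr, hs, ?_, ?_, ?_⟩
  · have : 0 ≤ 1 / r + 1 / r ^ 2 := by positivity
    nlinarith
  · have e : m ^ 2 * S * (1 + 1 / r + 1 / r ^ 2) * r = m ^ 2 * S * (r + 1 + 1 / r) := by
      field_simp
    have : 0 ≤ r + 1 / r := by positivity
    rw [e]; nlinarith
  · have e : m ^ 2 * S * (1 + 1 / r + 1 / r ^ 2) * r ^ 2 = m ^ 2 * S * (r ^ 2 + r + 1) := by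
      field_simp
    have : 0 ≤ r ^ 2 + r := by positivity
    rw [e]; nlinarith

variable {A : Type*} [NormedRing A] [NormedAlgebra ℝ A] [CompleteSpace A]

/-- The common bound for all series below. The powers `s = 1`, `s = r` and `s = r ^ 2` stand for
values, first and second derivatives. -/
theorem CoefBound.sum_le (h : CoefBound m r Λ c) {t : List (Fin n) → A} {D s : ℝ} (hD : 0 ≤ D)
    (hs : s = 1 ∨ s = r ∨ s = r ^ 2)
    (ht : ∀ w, s * ‖t w‖ ≤ m ^ 2 * (((w.length : ℝ) + 1) ^ 2 * r ^ w.length) * D) :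
    (Summable fun w => c w • t w) ∧ ‖∑' w, c w • t w‖ ≤ Λ * D := by
  have hr := h.pos
  have hs0 : 0 < s := by rcases hs with rfl | rfl | rfl <;> positivity
  have hle : m ^ 2 * ∑' w, |c w| * (((w.length : ℝ) + 1) ^ 2 * r ^ w.length) ≤ Λ * s := by
    rcases hs with rfl | rfl | rfl
    · rw [mul_one]; exact h.le₀
    · exact h.le₁
    · exact h.le₂
  have hb : ∀ w, ‖c w • t w‖ ≤
      |c w| * (((w.length : ℝ) + 1) ^ 2 * r ^ w.length) * (m ^ 2 * D / s) := by
    intro w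
    rw [norm_smul, Real.norm_eq_abs, mul_assoc]
    refine mul_le_mul_of_nonneg_left ?_ (abs_nonneg _)
    rw [← mul_div_assoc, le_div_iff₀ hs0]
    linarith [ht w]
  have hsum := h.summable.mul_right (m ^ 2 * D / s)
  refine ⟨Summable.of_norm_bounded hsum hb, ?_⟩
  refine (tsum_of_norm_bounded hsum.hasSum hb).trans ?_
  rw [tsum_mul_right]
  calc _ = (m ^ 2 * ∑' w, |c w| * (((w.length : ℝ) + 1) ^ 2 * r ^ w.length)) * D / s := by ring
    _ ≤ (Λ * s) * D / s := by gcongr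
    _ = _ := by field_simp

/-- The value `∑_w c_w X_w` of a noncommutative power series. -/
def ser (c : List (Fin n) → ℝ) (X : Fin n → A) : A := ∑' w, c w • monomial X w

/-- `∑ c_{UkV} U P_k(V)`. -/
def DR (c : List (Fin n) → ℝ) (X : Fin n → A) (P : Fin n → A →L[ℝ] A) : A :=
  ∑' w, c w • dR X P w

/-- `∑ c_{UkV} P_k(U) V`. -/
def DL (c : List (Fin n) → ℝ) (X : Fin n → A) (P : Fin n → A →L[ℝ] A) : A :=
  ∑' w, c w • dL X P w

/-- The derivative of `ser c` at `X` in the direction `v`. -/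
def DW (c : List (Fin n) → ℝ) (X v : Fin n → A) : A := ∑' w, c w • dW X v w

variable {X X' : Fin n → A}

theorem CoefBound.ser_le (h : CoefBound m r Λ c) (hm : ‖(1 : A)‖ ≤ m) (hX : ‖X‖ ≤ r) :
    (Summable fun w => c w • monomial X w) ∧ ‖ser c X‖ ≤ Λ := by
  have h1 := h.one_le
  have hr := h.pos
  have := h.sum_le (t := monomial X) zero_le_one (Or.inl rfl) fun w => by
    refine (one_mul _).le.trans ((norm_monomial_le hm hr.le hX w).trans ?_)
    have h2 : m ≤ m ^ 2 := by nlinarith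
    have h3 : (1 : ℝ) ≤ ((w.length : ℝ) + 1) ^ 2 := by
      nlinarith [Nat.cast_nonneg (α := ℝ) w.length]
    calc _ ≤ m ^ 2 * (1 * r ^ w.length) := by rw [one_mul]; gcongr
      _ ≤ m ^ 2 * (((w.length : ℝ) + 1) ^ 2 * r ^ w.length) := by gcongr
      _ = _ := by rw [mul_one]
  rwa [mul_one] at this

/-- The weights of a word in its value and derivatives are dominated by those of `CoefBound`. -/
theorem CoefBound.len_le (h : CoefBound m r Λ c) (w : List (Fin n)) :
    m * w.length * r ^ w.length ≤ m ^ 2 * (((w.length : ℝ) + 1) ^ 2 * r ^ w.length) ∧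
    m ^ 2 * w.length * r ^ w.length ≤ m ^ 2 * (((w.length : ℝ) + 1) ^ 2 * r ^ w.length) ∧
    m * w.length ^ 2 * r ^ w.length ≤ m ^ 2 * (((w.length : ℝ) + 1) ^ 2 * r ^ w.length) ∧
    m ^ 2 * w.length ^ 2 * r ^ w.length ≤
      m ^ 2 * (((w.length : ℝ) + 1) ^ 2 * r ^ w.length) := by
  have h1 := h.one_le
  have hr := h.pos
  have h2 : m ≤ m ^ 2 := by nlinarith
  have h0 := Nat.cast_nonneg (α := ℝ) w.length
  have h3 : (w.length : ℝ) ≤ ((w.length : ℝ) + 1) ^ 2 := by nlinarith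
  have h4 : (w.length : ℝ) ^ 2 ≤ ((w.length : ℝ) + 1) ^ 2 := by nlinarith
  simp only [← mul_assoc]
  refine ⟨?_, ?_, ?_, ?_⟩ <;> gcongr

theorem CoefBound.ser_sub_le (h : CoefBound m r Λ c) (hm : ‖(1 : A)‖ ≤ m) (hX : ‖X‖ ≤ r)
    (hX' : ‖X'‖ ≤ r) : ‖ser c X - ser c X'‖ ≤ Λ * ‖X - X'‖ := by
  have := (h.sum_le (t := fun w => monomial X w - monomial X' w) (norm_nonneg (X - X'))
    (Or.inr (Or.inl rfl)) fun w => (norm_monomial_sub_le hm h.pos.le hX hX' w).trans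
      (mul_le_mul_of_nonneg_right (h.len_le w).1 (norm_nonneg _))).2
  simp only [smul_sub] at this
  rwa [(h.ser_le hm hX).1.tsum_sub (h.ser_le hm hX').1] at this

theorem CoefBound.DR_le (h : CoefBound m r Λ c) (hm : ‖(1 : A)‖ ≤ m) (hX : ‖X‖ ≤ r)
    (P : Fin n → A →L[ℝ] A) : (Summable fun w => c w • dR X P w) ∧ ‖DR c X P‖ ≤ Λ * ‖P‖ :=
  h.sum_le (norm_nonneg P) (Or.inr (Or.inl rfl)) fun w => (norm_dR_le hm h.pos.le hX P w).trans
      (mul_le_mul_of_nonneg_right (h.len_le w).1 (norm_nonneg _))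

theorem CoefBound.DL_le (h : CoefBound m r Λ c) (hm : ‖(1 : A)‖ ≤ m) (hX : ‖X‖ ≤ r)
    (P : Fin n → A →L[ℝ] A) : (Summable fun w => c w • dL X P w) ∧ ‖DL c X P‖ ≤ Λ * ‖P‖ :=
  h.sum_le (norm_nonneg P) (Or.inr (Or.inl rfl)) fun w => (norm_dL_le hm h.pos.le hX P w).trans
      (mul_le_mul_of_nonneg_right (h.len_le w).2.1 (norm_nonneg _))

theorem norm_mul_pi_le (v : Fin n → A) : ‖fun k => ContinuousLinearMap.mul ℝ A (v k)‖ ≤ ‖v‖ :=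
  (pi_norm_le_iff_of_nonneg (norm_nonneg _)).2 fun i =>
    (ContinuousLinearMap.opNorm_mul_apply_le ℝ A _).trans (norm_le_pi_norm v i)

theorem CoefBound.DW_le (h : CoefBound m r Λ c) (hm : ‖(1 : A)‖ ≤ m) (hX : ‖X‖ ≤ r)
    (v : Fin n → A) : (Summable fun w => c w • dW X v w) ∧ ‖DW c X v‖ ≤ Λ * ‖v‖ :=
  ⟨(h.DR_le hm hX _).1, (h.DR_le hm hX _).2.trans
    (mul_le_mul_of_nonneg_left (norm_mul_pi_le v) h.nonneg)⟩

theorem CoefBound.taylor_le (h : CoefBound m r Λ c) (hm : ‖(1 : A)‖ ≤ m) (hX : ‖X‖ ≤ r)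
    (hX' : ‖X'‖ ≤ r) : ‖ser c X' - ser c X - DW c X (X' - X)‖ ≤ Λ * ‖X' - X‖ ^ 2 := by
  have := (h.sum_le (t := fun w => monomial X' w - monomial X w - dW X (X' - X) w)
    (sq_nonneg ‖X' - X‖) (Or.inr (Or.inr rfl)) fun w =>
      (norm_monomial_taylor_le hm h.pos.le hX hX' w).trans
      (mul_le_mul_of_nonneg_right (h.len_le w).2.2.1 (sq_nonneg _))).2
  simp only [smul_sub] at this
  rwa [((h.ser_le hm hX').1.sub (h.ser_le hm hX).1).tsum_sub (h.DW_le hm hX _).1,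
    (h.ser_le hm hX').1.tsum_sub (h.ser_le hm hX).1] at this

theorem CoefBound.DR_sub_le (h : CoefBound m r Λ c) (hm : ‖(1 : A)‖ ≤ m) (hX : ‖X‖ ≤ r)
    (hX' : ‖X'‖ ≤ r) (P : Fin n → A →L[ℝ] A) :
    ‖DR c X P - DR c X' P‖ ≤ Λ * (‖P‖ * ‖X - X'‖) := by
  have := (h.sum_le (t := fun w => dR X P w - dR X' P w)
    (mul_nonneg (norm_nonneg P) (norm_nonneg (X - X'))) (Or.inr (Or.inr rfl)) fun w =>
      (norm_dR_sub_le hm h.pos.le hX hX' P w).trans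
      (mul_le_mul_of_nonneg_right (h.len_le w).2.2.1 (by positivity))).2
  simp only [smul_sub] at this
  rwa [(h.DR_le hm hX P).1.tsum_sub (h.DR_le hm hX' P).1] at this

theorem CoefBound.DL_sub_le (h : CoefBound m r Λ c) (hm : ‖(1 : A)‖ ≤ m) (hX : ‖X‖ ≤ r)
    (hX' : ‖X'‖ ≤ r) (P : Fin n → A →L[ℝ] A) :
    ‖DL c X P - DL c X' P‖ ≤ Λ * (‖P‖ * ‖X - X'‖) := by
  have := (h.sum_le (t := fun w => dL X P w - dL X' P w)
    (mul_nonneg (norm_nonneg P) (norm_nonneg (X - X'))) (Or.inr (Or.inr rfl)) fun w =>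
      (norm_dL_sub_le hm h.pos.le hX hX' P w).trans
      (mul_le_mul_of_nonneg_right (h.len_le w).2.2.2 (by positivity))).2
  simp only [smul_sub] at this
  rwa [(h.DL_le hm hX P).1.tsum_sub (h.DL_le hm hX' P).1] at this

theorem CoefBound.DR_add (h : CoefBound m r Λ c) (hm : ‖(1 : A)‖ ≤ m) (hX : ‖X‖ ≤ r)
    (P P' : Fin n → A →L[ℝ] A) : DR c X (P + P') = DR c X P + DR c X P' := by
  simp only [DR, dR_add, smul_add]
  exact (h.DR_le hm hX P).1.tsum_add (h.DR_le hm hX P').1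

theorem CoefBound.DL_add (h : CoefBound m r Λ c) (hm : ‖(1 : A)‖ ≤ m) (hX : ‖X‖ ≤ r)
    (P P' : Fin n → A →L[ℝ] A) : DL c X (P + P') = DL c X P + DL c X P' := by
  simp only [DL, dL_add, smul_add]
  exact (h.DL_le hm hX P).1.tsum_add (h.DL_le hm hX P').1

theorem DR_smul (s : ℝ) (P : Fin n → A →L[ℝ] A) : DR c X (s • P) = s • DR c X P := by
  simp only [DR, dR_smul, smul_comm (c _) s, tsum_const_smul'']

theorem DL_smul (s : ℝ) (P : Fin n → A →L[ℝ] A) : DL c X (s • P) = s • DL c X P := by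
  simp only [DL, dL_smul, smul_comm (c _) s, tsum_const_smul'']

theorem CoefBound.DW_add (h : CoefBound m r Λ c) (hm : ‖(1 : A)‖ ≤ m) (hX : ‖X‖ ≤ r)
    (v v' : Fin n → A) : DW c X (v + v') = DW c X v + DW c X v' := by
  rw [DW, DW, DW, ← (h.DW_le hm hX v).1.tsum_add (h.DW_le hm hX v').1]
  have e : (fun k => ContinuousLinearMap.mul ℝ A ((v + v') k)) =
      (fun k => ContinuousLinearMap.mul ℝ A (v k)) +
        fun k => ContinuousLinearMap.mul ℝ A (v' k) := by
    ext k x; simp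
  refine tsum_congr fun w => ?_
  rw [← smul_add, ← dR_add, dW, e]

theorem CoefBound.DR_mul (h : CoefBound m r Λ c) (hm : ‖(1 : A)‖ ≤ m) (hX : ‖X‖ ≤ r)
    (v : Fin n → A) (b : A) :
    DR c X (fun k => ContinuousLinearMap.mulLeftRight ℝ A (v k) b) = DW c X v * b := by
  rw [DR, DW, ← (h.DW_le hm hX v).1.tsum_mul_right]
  simp only [dR_mul, smul_mul_assoc]

theorem CoefBound.DL_mul (h : CoefBound m r Λ c) (hm : ‖(1 : A)‖ ≤ m) (hX : ‖X‖ ≤ r)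
    (v : Fin n → A) (b : A) :
    DL c X (fun k => ContinuousLinearMap.mulLeftRight ℝ A b (v k)) = b * DW c X v := by
  rw [DL, DW, ← (h.DW_le hm hX v).1.tsum_mul_left]
  simp only [dL_mul, mul_smul_comm]

end SeriesBounds

/-! ### Bounded Lipschitz maps -/

section BL
variable {E F : Type*} [NormedAddCommGroup E] [NormedAddCommGroup F]

/-- `f` is bounded by `M` and Lipschitz with constant `M` on `s`. -/
structure BddLip (s : Set E) (f : E → F) (M : ℝ) : Prop where
  bound : ∀ x ∈ s, ‖f x‖ ≤ M
  lip : ∀ x ∈ s, ∀ y ∈ s, ‖f x - f y‖ ≤ M * ‖x - y‖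

variable {s : Set E} {f g : E → F} {M N : ℝ}

theorem BddLip.mono (h : BddLip s f M) (hMN : M ≤ N) : BddLip s f N :=
  ⟨fun x hx => (h.bound x hx).trans hMN, fun x hx y hy => (h.lip x hx y hy).trans (by gcongr)⟩

theorem BddLip.const (s : Set E) (a : F) : BddLip s (fun _ => a) ‖a‖ :=
  ⟨fun _ _ => le_rfl, fun _ _ _ _ => by simp; positivity⟩

theorem BddLip.add (h : BddLip s f M) (h' : BddLip s g N) :
    BddLip s (fun x => f x + g x) (M + N) := by
  refine ⟨fun x hx => (norm_add_le _ _).trans (add_le_add (h.bound x hx) (h'.bound x hx)),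
    fun x hx y hy => ?_⟩
  rw [add_sub_add_comm, add_mul]
  exact (norm_add_le _ _).trans (add_le_add (h.lip x hx y hy) (h'.lip x hx y hy))

theorem BddLip.smul [NormedSpace ℝ F] (h : BddLip s f M) (c : ℝ) :
    BddLip s (fun x => c • f x) (|c| * M) := by
  refine ⟨fun x hx => ?_, fun x hx y hy => ?_⟩
  · rw [norm_smul, Real.norm_eq_abs]
    exact mul_le_mul_of_nonneg_left (h.bound x hx) (abs_nonneg c)
  · rw [← smul_sub, norm_smul, Real.norm_eq_abs, mul_assoc]
    exact mul_le_mul_of_nonneg_left (h.lip x hx y hy) (abs_nonneg c)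

theorem BddLip.sum {ι : Type*} [Fintype ι] {f : ι → E → F} (h : ∀ i, BddLip s (f i) M) :
    BddLip s (fun x => ∑ i, f i x) (Fintype.card ι * M) := by
  refine ⟨fun x hx => ?_, fun x hx y hy => ?_⟩
  · refine (norm_sum_le_of_le _ fun i _ => (h i).bound x hx).trans (le_of_eq ?_)
    simp
  · rw [← Finset.sum_sub_distrib]
    refine (norm_sum_le_of_le _ fun i _ => (h i).lip x hx y hy).trans (le_of_eq ?_)
    simp [mul_assoc]

theorem BddLip.pi {ι : Type*} [Fintype ι] {f : ι → E → F} (hM : 0 ≤ M)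
    (h : ∀ i, BddLip s (f i) M) : BddLip s (fun x i => f i x) M :=
  ⟨fun x hx => (pi_norm_le_iff_of_nonneg hM).2 fun i => (h i).bound x hx,
    fun x hx y hy => (pi_norm_le_iff_of_nonneg (by positivity)).2 fun i => (h i).lip x hx y hy⟩

theorem BddLip.clm {G : Type*} [NormedAddCommGroup G] [NormedSpace ℝ F] [NormedSpace ℝ G]
    (h : BddLip s f M) (L : F →L[ℝ] G) (hL : ∀ x, ‖L x‖ ≤ ‖x‖) : BddLip s (fun x => L (f x)) M :=
  ⟨fun x hx => (hL _).trans (h.bound x hx), fun x hx y hy => by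
    rw [← map_sub]; exact (hL _).trans (h.lip x hx y hy)⟩

/-- For a product, the Lipschitz constant has two terms `M * N`; the bound `2 * M * N` serves both
purposes. -/
theorem BddLip.mul {A : Type*} [NormedRing A] {f g : E → A} (h : BddLip s f M)
    (h' : BddLip s g N) : BddLip s (fun x => f x * g x) (2 * M * N) := by
  refine ⟨fun x hx => ?_, fun x hx y hy => ?_⟩
  · have h1 := h.bound x hx
    have h2 := h'.bound x hx
    have h3 := (norm_nonneg _).trans h1
    have h4 := (norm_nonneg _).trans h2
    calc _ ≤ ‖f x‖ * ‖g x‖ := norm_mul_le _ _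
      _ ≤ M * N := by gcongr
      _ ≤ _ := by nlinarith [mul_nonneg h3 h4]
  · have h1 := h.bound x hx
    have h2 := h'.bound y hy
    have h3 := h.lip x hx y hy
    have h4 := h'.lip x hx y hy
    have h5 := (norm_nonneg _).trans h1
    have e : f x * g x - f y * g y = f x * (g x - g y) + (f x - f y) * g y := by noncomm_ring
    rw [e]
    calc _ ≤ ‖f x‖ * ‖g x - g y‖ + ‖f x - f y‖ * ‖g y‖ :=
          (norm_add_le _ _).trans (add_le_add (norm_mul_le _ _) (norm_mul_le _ _))
      _ ≤ M * (N * ‖x - y‖) + (M * ‖x - y‖) * N := by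
          gcongr
      _ = _ := by ring

end BL

/-! ### The germ of the rough equation -/

section Germ
variable {n : ℕ} {A : Type*} [NormedRing A] [NormedAlgebra ℝ A] [CompleteSpace A]

/-- The coefficients of the equation are dominated on a ball of radius `r`. -/
structure EqBound (m r Λ : ℝ) (cf : Fin n → List (Fin n) → ℝ)
    (cg ch : Fin n → Fin n → List (Fin n) → ℝ) : Prop where
  f : ∀ i, CoefBound m r Λ (cf i)
  g : ∀ i j, CoefBound m r Λ (cg i j)
  h : ∀ i j, CoefBound m r Λ (ch i j)

theorem CoefBound.bddLip {m r Λ : ℝ} {c : List (Fin n) → ℝ} (h : CoefBound m r Λ c)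
    (hm : ‖(1 : A)‖ ≤ m) : BddLip (Metric.closedBall (0 : Fin n → A) r) (ser c) Λ :=
  ⟨fun _ hx => (h.ser_le hm (mem_closedBall_zero_iff.1 hx)).2, fun _ hx _ hy =>
    h.ser_sub_le hm (mem_closedBall_zero_iff.1 hx) (mem_closedBall_zero_iff.1 hy)⟩

theorem CoefBound.bddLip_DR {m r Λ M : ℝ} {c : List (Fin n) → ℝ} (h : CoefBound m r Λ c)
    (hm : ‖(1 : A)‖ ≤ m) {P : (Fin n → A) → Fin n → A →L[ℝ] A}
    (hP : BddLip (Metric.closedBall (0 : Fin n → A) r) P M) :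
    BddLip (Metric.closedBall (0 : Fin n → A) r) (fun X => DR c X (P X)) (2 * Λ * M) := by
  have h0 := h.nonneg
  refine ⟨fun x hx => ?_, fun x hx y hy => ?_⟩
  · have := (h.DR_le hm (mem_closedBall_zero_iff.1 hx) (P x)).2
    have h1 := hP.bound x hx
    have h2 := (norm_nonneg _).trans h1
    calc _ ≤ Λ * ‖P x‖ := this
      _ ≤ Λ * M := by gcongr
      _ ≤ _ := by nlinarith [mul_nonneg h0 h2]
  · have hx' := mem_closedBall_zero_iff.1 hx
    have hy' := mem_closedBall_zero_iff.1 hy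
    have e : DR c x (P x) - DR c y (P y) = DR c x (P x - P y) + (DR c x (P y) - DR c y (P y)) := by
      have := h.DR_add hm hx' (P x - P y) (P y)
      rw [sub_add_cancel] at this
      rw [this]; abel
    rw [e]
    calc _ ≤ Λ * ‖P x - P y‖ + Λ * (‖P y‖ * ‖x - y‖) :=
          (norm_add_le _ _).trans (add_le_add (h.DR_le hm hx' _).2 (h.DR_sub_le hm hx' hy' _))
      _ ≤ Λ * (M * ‖x - y‖) + Λ * (M * ‖x - y‖) := by
          gcongr
          · exact hP.lip x hx y hy
          · exact hP.bound y hy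
      _ = _ := by ring

theorem CoefBound.bddLip_DL {m r Λ M : ℝ} {c : List (Fin n) → ℝ} (h : CoefBound m r Λ c)
    (hm : ‖(1 : A)‖ ≤ m) {P : (Fin n → A) → Fin n → A →L[ℝ] A}
    (hP : BddLip (Metric.closedBall (0 : Fin n → A) r) P M) :
    BddLip (Metric.closedBall (0 : Fin n → A) r) (fun X => DL c X (P X)) (2 * Λ * M) := by
  have h0 := h.nonneg
  refine ⟨fun x hx => ?_, fun x hx y hy => ?_⟩
  · have := (h.DL_le hm (mem_closedBall_zero_iff.1 hx) (P x)).2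
    have h1 := hP.bound x hx
    have h2 := (norm_nonneg _).trans h1
    calc _ ≤ Λ * ‖P x‖ := this
      _ ≤ Λ * M := by gcongr
      _ ≤ _ := by nlinarith [mul_nonneg h0 h2]
  · have hx' := mem_closedBall_zero_iff.1 hx
    have hy' := mem_closedBall_zero_iff.1 hy
    have e : DL c x (P x) - DL c y (P y) = DL c x (P x - P y) + (DL c x (P y) - DL c y (P y)) := by
      have := h.DL_add hm hx' (P x - P y) (P y)
      rw [sub_add_cancel] at this
      rw [this]; abel
    rw [e]
    calc _ ≤ Λ * ‖P x - P y‖ + Λ * (‖P y‖ * ‖x - y‖) :=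
          (norm_add_le _ _).trans (add_le_add (h.DL_le hm hx' _).2 (h.DL_sub_le hm hx' hy' _))
      _ ≤ Λ * (M * ‖x - y‖) + Λ * (M * ‖x - y‖) := by
          gcongr
          · exact hP.lip x hx y hy
          · exact hP.bound y hy
      _ = _ := by ring

variable (n A) in
/-- A signal on a time interval: its length, the increments `β_j` of the noises, and the second
order integrals `L_{j'j}(x) = ∫∫ dβ_{j'} x dβ_j` and `R_{jj'}(x) = ∫∫ dβ_j x dβ_{j'}`, where in
both cases the noise `j'` is integrated first. -/
abbrev Sig : Type _ := ℝ × (Fin n → A) × (Fin n → Fin n → A →L[ℝ] A) × (Fin n → Fin n → A →L[ℝ] A)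

variable (cf : Fin n → List (Fin n) → ℝ) (cg ch : Fin n → Fin n → List (Fin n) → ℝ)

/-- `x ↦ ∑_{j'} g_{kj'} L_{j'j}(h_{kj'} x)`, as a function of `k`. -/
def innerL (X : Fin n → A) (P : Fin n → Fin n → A →L[ℝ] A) (j k : Fin n) : A →L[ℝ] A :=
  ∑ j', ContinuousLinearMap.mul ℝ A (ser (cg k j') X) * P j' j *
    ContinuousLinearMap.mul ℝ A (ser (ch k j') X)

/-- `x ↦ ∑_{j'} R_{jj'}(x g_{kj'}) h_{kj'}`, as a function of `k`. -/
def innerR (X : Fin n → A) (P : Fin n → Fin n → A →L[ℝ] A) (j k : Fin n) : A →L[ℝ] A :=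
  ∑ j', (ContinuousLinearMap.mul ℝ A).flip (ser (ch k j') X) * P j j' *
    (ContinuousLinearMap.mul ℝ A).flip (ser (cg k j') X)

/-- The first-order part `∑_j g_{ij}(X) β_j h_{ij}(X)` of the germ. -/
def germ₁ (X β : Fin n → A) (i : Fin n) : A := ∑ j, ser (cg i j) X * β j * ser (ch i j) X

/-- The second-order part of the germ. Within `g_{ij}(X) dβ_j h_{ij}(X)`, the variable `X_k` in
`g_{ij}` or `h_{ij}` is replaced by its first-order increment `∑_{j'} g_{kj'} β_{j'} h_{kj'}`. If this
happens in `g_{ij}`, then `β_{j'}` stands to the left of `β_j`; otherwise it stands to its right. -/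
def germ₂ (X : Fin n → A) (PL PR : Fin n → Fin n → A →L[ℝ] A) (i : Fin n) : A :=
  ∑ j, (DR (cg i j) X (innerL cg ch X PL j) * ser (ch i j) X +
    ser (cg i j) X * DL (ch i j) X (innerR cg ch X PR j))

/-- The local expansion of the solution which is at `X` when the signal `v` sets in. It also
expresses the right-hand side of the smooth equation. -/
def germ (X : Fin n → A) (v : Sig n A) (i : Fin n) : A :=
  v.1 • ser (cf i) X + germ₁ cg ch X v.2.1 i + germ₂ cg ch X v.2.2.1 v.2.2.2 i

variable {cf cg ch} {m r Λ : ℝ}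

theorem innerL_add (X : Fin n → A) (P P' : Fin n → Fin n → A →L[ℝ] A) (j : Fin n) :
    innerL cg ch X (P + P') j = innerL cg ch X P j + innerL cg ch X P' j := by
  ext k x; simp [innerL, Finset.sum_add_distrib, mul_add]

theorem innerR_add (X : Fin n → A) (P P' : Fin n → Fin n → A →L[ℝ] A) (j : Fin n) :
    innerR cg ch X (P + P') j = innerR cg ch X P j + innerR cg ch X P' j := by
  ext k x; simp [innerR, Finset.sum_add_distrib]

theorem innerL_smul (X : Fin n → A) (s : ℝ) (P : Fin n → Fin n → A →L[ℝ] A) (j : Fin n) :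
    innerL cg ch X (s • P) j = s • innerL cg ch X P j := by
  ext k x; simp [innerL, Finset.smul_sum]

theorem innerR_smul (X : Fin n → A) (s : ℝ) (P : Fin n → Fin n → A →L[ℝ] A) (j : Fin n) :
    innerR cg ch X (s • P) j = s • innerR cg ch X P j := by
  ext k x; simp [innerR, Finset.smul_sum]

theorem germ₂_add (H : EqBound m r Λ cf cg ch) (hm : ‖(1 : A)‖ ≤ m) {X : Fin n → A} (hX : ‖X‖ ≤ r)
    (PL PR PL' PR' : Fin n → Fin n → A →L[ℝ] A) (i : Fin n) :
    germ₂ cg ch X (PL + PL') (PR + PR') i = germ₂ cg ch X PL PR i + germ₂ cg ch X PL' PR' i := by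
  rw [germ₂, germ₂, germ₂, ← Finset.sum_add_distrib]
  refine Finset.sum_congr rfl fun j _ => ?_
  rw [innerL_add, innerR_add, (H.g i j).DR_add hm hX, (H.h i j).DL_add hm hX, add_mul, mul_add]
  abel

theorem germ_add (H : EqBound m r Λ cf cg ch) (hm : ‖(1 : A)‖ ≤ m) {X : Fin n → A} (hX : ‖X‖ ≤ r)
    (v v' : Sig n A) : germ cf cg ch X (v + v') = germ cf cg ch X v + germ cf cg ch X v' := by
  ext i
  have h1 : germ₁ cg ch X (v.2.1 + v'.2.1) i =
      germ₁ cg ch X v.2.1 i + germ₁ cg ch X v'.2.1 i := by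
    simp [germ₁, mul_add, add_mul, Finset.sum_add_distrib]
  simp only [germ, Prod.fst_add, Prod.snd_add, Pi.add_apply]
  rw [h1, germ₂_add H hm hX, add_smul]
  abel

theorem germ_smul (X : Fin n → A) (s : ℝ) (v : Sig n A) :
    germ cf cg ch X (s • v) = s • germ cf cg ch X v := by
  ext i
  simp only [germ, germ₁, germ₂, Prod.smul_fst, Prod.smul_snd, Pi.smul_apply, innerL_smul,
    innerR_smul, DR_smul, DL_smul, smul_add, Finset.smul_sum, smul_mul_assoc, mul_smul_comm,
    smul_assoc]

/-- A bound and Lipschitz constant for the germ of a unit signal. -/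
def germK (n : ℕ) (Λ : ℝ) : ℝ := Λ + 4 * n * Λ ^ 2 + 32 * n ^ 2 * Λ ^ 4

theorem bddLip_innerL (H : EqBound m r Λ cf cg ch) (hm : ‖(1 : A)‖ ≤ m)
    (P : Fin n → Fin n → A →L[ℝ] A) (j : Fin n) :
    BddLip (Metric.closedBall (0 : Fin n → A) r) (fun X => innerL cg ch X P j)
      (4 * n * Λ ^ 2 * ‖P‖) := by
  refine BddLip.pi (by positivity) fun k => ?_
  have hmul : ∀ x : A, ‖ContinuousLinearMap.mul ℝ A x‖ ≤ ‖x‖ :=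
    ContinuousLinearMap.opNorm_mul_apply_le ℝ A
  have h := BddLip.sum (fun j' => ((((H.g k j').bddLip hm).clm (ContinuousLinearMap.mul ℝ A)
    hmul).mul ((BddLip.const _ (P j' j)).mono
      ((norm_le_pi_norm (P j') j).trans (norm_le_pi_norm P j')))).mul
        (((H.h k j').bddLip hm).clm (ContinuousLinearMap.mul ℝ A) hmul))
  rw [Fintype.card_fin] at h
  exact h.mono (le_of_eq (by ring))

theorem bddLip_innerR (H : EqBound m r Λ cf cg ch) (hm : ‖(1 : A)‖ ≤ m)
    (P : Fin n → Fin n → A →L[ℝ] A) (j : Fin n) :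
    BddLip (Metric.closedBall (0 : Fin n → A) r) (fun X => innerR cg ch X P j)
      (4 * n * Λ ^ 2 * ‖P‖) := by
  refine BddLip.pi (by positivity) fun k => ?_
  have hmul : ∀ x : A, ‖(ContinuousLinearMap.mul ℝ A).flip x‖ ≤ ‖x‖ :=
    fun x => ContinuousLinearMap.opNorm_le_bound _ (norm_nonneg _) fun y => by
      rw [ContinuousLinearMap.flip_apply, ContinuousLinearMap.mul_apply', mul_comm ‖x‖]
      exact norm_mul_le _ _
  have h := BddLip.sum (fun j' => ((((H.h k j').bddLip hm).clm (ContinuousLinearMap.mul ℝ A).flip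
    hmul).mul ((BddLip.const _ (P j j')).mono
      ((norm_le_pi_norm (P j) j').trans (norm_le_pi_norm P j)))).mul
        (((H.g k j').bddLip hm).clm (ContinuousLinearMap.mul ℝ A).flip hmul))
  rw [Fintype.card_fin] at h
  exact h.mono (le_of_eq (by ring))

theorem bddLip_germ₁ (H : EqBound m r Λ cf cg ch) (hm : ‖(1 : A)‖ ≤ m) (β : Fin n → A)
    (i : Fin n) : BddLip (Metric.closedBall (0 : Fin n → A) r) (fun X => germ₁ cg ch X β i)
      (4 * n * Λ ^ 2 * ‖β‖) := by
  have h := BddLip.sum (fun j => (((H.g i j).bddLip hm).mul ((BddLip.const _ (β j)).mono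
    (norm_le_pi_norm β j))).mul ((H.h i j).bddLip hm))
  rw [Fintype.card_fin] at h
  exact h.mono (le_of_eq (by ring))

theorem bddLip_germ₂ (H : EqBound m r Λ cf cg ch) (hm : ‖(1 : A)‖ ≤ m)
    (PL PR : Fin n → Fin n → A →L[ℝ] A) (i : Fin n) :
    BddLip (Metric.closedBall (0 : Fin n → A) r) (fun X => germ₂ cg ch X PL PR i)
      (16 * n ^ 2 * Λ ^ 4 * (‖PL‖ + ‖PR‖)) := by
  have h := BddLip.sum (fun j =>
    ((((H.g i j).bddLip_DR hm (bddLip_innerL H hm PL j)).mul ((H.h i j).bddLip hm)).add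
      (((H.g i j).bddLip hm).mul ((H.h i j).bddLip_DL hm (bddLip_innerR H hm PR j)))))
  rw [Fintype.card_fin] at h
  exact h.mono (le_of_eq (by ring))

theorem norm_sig_le (v : Sig n A) : |v.1| ≤ ‖v‖ ∧ ‖v.2.1‖ ≤ ‖v‖ ∧ ‖v.2.2.1‖ ≤ ‖v‖ ∧
    ‖v.2.2.2‖ ≤ ‖v‖ :=
  ⟨norm_fst_le v, (norm_fst_le v.2).trans (norm_snd_le v),
    (norm_fst_le v.2.2).trans ((norm_snd_le v.2).trans (norm_snd_le v)),
    (norm_snd_le v.2.2).trans ((norm_snd_le v.2).trans (norm_snd_le v))⟩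

theorem EqBound.nonneg (H : EqBound m r Λ cf cg ch) (i : Fin n) : 0 ≤ Λ := (H.f i).nonneg

theorem germK_nonneg (hΛ : 0 ≤ Λ) : 0 ≤ germK n Λ := by
  unfold germK; positivity

theorem bddLip_germ (H : EqBound m r Λ cf cg ch) (hΛ : 0 ≤ Λ) (hm : ‖(1 : A)‖ ≤ m) (v : Sig n A) :
    BddLip (Metric.closedBall (0 : Fin n → A) r) (fun X => germ cf cg ch X v)
      (germK n Λ * ‖v‖) := by
  have hK := germK_nonneg (n := n) hΛ
  refine BddLip.pi (by positivity) fun i => ?_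
  obtain ⟨h1, h2, h3, h4⟩ := norm_sig_le v
  refine (((((H.f i).bddLip hm).smul v.1).add (bddLip_germ₁ H hm v.2.1 i)).add
    (bddLip_germ₂ H hm v.2.2.1 v.2.2.2 i)).mono ?_
  calc _ ≤ ‖v‖ * Λ + 4 * n * Λ ^ 2 * ‖v‖ + 16 * n ^ 2 * Λ ^ 4 * (‖v‖ + ‖v‖) := by gcongr
    _ = _ := by rw [germK]; ring

/-- The product of two increments, as a left second-order integral. -/
def chenL (β' β : Fin n → A) (j' j : Fin n) : A →L[ℝ] A :=
  ContinuousLinearMap.mulLeftRight ℝ A (β' j') (β j)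

/-- The product of two increments, as a right second-order integral. -/
def chenR (β' β : Fin n → A) (j j' : Fin n) : A →L[ℝ] A :=
  ContinuousLinearMap.mulLeftRight ℝ A (β j) (β' j')

/-- The second-order part at a product of increments is the derivative of the first-order part. With
the relation of Chen for signals, this makes the germ additive up to terms of third order. -/
theorem germ₂_chen (H : EqBound m r Λ cf cg ch) (hm : ‖(1 : A)‖ ≤ m) {X : Fin n → A} (hX : ‖X‖ ≤ r)
    (β' β : Fin n → A) (i : Fin n) : germ₂ cg ch X (chenL β' β) (chenR β' β) i =
      ∑ j, (DW (cg i j) X (germ₁ cg ch X β') * β j * ser (ch i j) X +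
        ser (cg i j) X * (β j * DW (ch i j) X (germ₁ cg ch X β'))) := by
  rw [germ₂]
  refine Finset.sum_congr rfl fun j _ => ?_
  have h1 : innerL cg ch X (chenL β' β) j = fun k =>
      ContinuousLinearMap.mulLeftRight ℝ A (germ₁ cg ch X β' k) (β j) := by
    ext k x
    simp [innerL, chenL, germ₁, mul_assoc]
  have h2 : innerR cg ch X (chenR β' β) j = fun k =>
      ContinuousLinearMap.mulLeftRight ℝ A (β j) (germ₁ cg ch X β' k) := by
    ext k x
    simp [innerR, chenR, germ₁, mul_assoc]
  rw [h1, h2, (H.g i j).DR_mul hm hX, (H.h i j).DL_mul hm hX]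

/-- Taylor expansion of the first-order part; `germ₁ cg ch X β'` is a first-order approximation of
the increment of `X`, with error `X' - X - germ₁ cg ch X β'`. -/
theorem norm_germ₁_taylor_le (H : EqBound m r Λ cf cg ch) (hm : ‖(1 : A)‖ ≤ m) {X X' : Fin n → A}
    (hX : ‖X‖ ≤ r) (hX' : ‖X'‖ ≤ r) (β' β : Fin n → A) (i : Fin n) :
    ‖germ₁ cg ch X' β i - germ₁ cg ch X β i - germ₂ cg ch X (chenL β' β) (chenR β' β) i‖ ≤
      n * (3 * Λ ^ 2 * ‖β‖ * (‖X' - X‖ ^ 2 + ‖X' - X - germ₁ cg ch X β'‖)) := by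
  rw [germ₂_chen H hm hX, germ₁, germ₁, ← Finset.sum_sub_distrib, ← Finset.sum_sub_distrib]
  have hΛ := H.nonneg i
  set u := germ₁ cg ch X β'
  set ψ := X' - X - u with hψ
  have key : ∀ j ∈ Finset.univ, ‖ser (cg i j) X' * β j * ser (ch i j) X' -
      ser (cg i j) X * β j * ser (ch i j) X -
      (DW (cg i j) X u * β j * ser (ch i j) X + ser (cg i j) X * (β j * DW (ch i j) X u))‖ ≤
      3 * Λ ^ 2 * ‖β‖ * (‖X' - X‖ ^ 2 + ‖ψ‖) := by
    intro j _
    have hb : ‖β j‖ ≤ ‖β‖ := norm_le_pi_norm β j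
    have hd : X' - X = u + ψ := by rw [hψ]; abel
    have g1 := (H.g i j).taylor_le hm hX hX'
    have h1 := (H.h i j).taylor_le hm hX hX'
    have g2 := ((H.g i j).DW_le hm hX ψ).2
    have h2 := ((H.h i j).DW_le hm hX ψ).2
    have g3 := (H.g i j).ser_sub_le hm hX' hX
    have h3 := (H.h i j).ser_sub_le hm hX' hX
    have g4 := ((H.g i j).ser_le hm hX).2
    have h4 := ((H.h i j).ser_le hm hX).2
    have ge : DW (cg i j) X (X' - X) = DW (cg i j) X u + DW (cg i j) X ψ := by
      rw [hd]; exact (H.g i j).DW_add hm hX u ψ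
    have he : DW (ch i j) X (X' - X) = DW (ch i j) X u + DW (ch i j) X ψ := by
      rw [hd]; exact (H.h i j).DW_add hm hX u ψ
    have n3 : ∀ a b c : A, ‖a * b * c‖ ≤ ‖a‖ * ‖b‖ * ‖c‖ := fun a b c =>
      (norm_mul_le _ _).trans (by gcongr; exact norm_mul_le _ _)
    set g := ser (cg i j) X
    set g' := ser (cg i j) X'
    set h := ser (ch i j) X
    set h' := ser (ch i j) X'
    set b := β j
    have e : g' * b * h' - g * b * h - (DW (cg i j) X u * b * h + g * (b * DW (ch i j) X u)) =
        (g' - g - DW (cg i j) X (X' - X)) * b * h + DW (cg i j) X ψ * b * h +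
        g * b * (h' - h - DW (ch i j) X (X' - X)) + g * b * DW (ch i j) X ψ +
        (g' - g) * b * (h' - h) := by
      rw [ge, he]; noncomm_ring
    have hΛ0 : 0 ≤ Λ * ‖X' - X‖ := by positivity
    rw [e]
    calc _ ≤ ‖g' - g - DW (cg i j) X (X' - X)‖ * ‖b‖ * ‖h‖ + ‖DW (cg i j) X ψ‖ * ‖b‖ * ‖h‖ +
          ‖g‖ * ‖b‖ * ‖h' - h - DW (ch i j) X (X' - X)‖ + ‖g‖ * ‖b‖ * ‖DW (ch i j) X ψ‖ +
          ‖g' - g‖ * ‖b‖ * ‖h' - h‖ := by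
          refine (norm_add_le _ _).trans (add_le_add ((norm_add_le _ _).trans (add_le_add
            ((norm_add_le _ _).trans (add_le_add ((norm_add_le _ _).trans (add_le_add ?_ ?_)) ?_))
              ?_)) ?_) <;> exact n3 _ _ _
      _ ≤ (Λ * ‖X' - X‖ ^ 2) * ‖β‖ * Λ + (Λ * ‖ψ‖) * ‖β‖ * Λ +
          Λ * ‖β‖ * (Λ * ‖X' - X‖ ^ 2) + Λ * ‖β‖ * (Λ * ‖ψ‖) +
          (Λ * ‖X' - X‖) * ‖β‖ * (Λ * ‖X' - X‖) := by gcongr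
      _ = Λ ^ 2 * ‖β‖ * (3 * ‖X' - X‖ ^ 2 + 2 * ‖ψ‖) := by ring
      _ ≤ Λ ^ 2 * ‖β‖ * (3 * ‖X' - X‖ ^ 2 + 3 * ‖ψ‖) := by
          gcongr; norm_num
      _ = _ := by ring
  refine (norm_sum_le_of_le _ key).trans (le_of_eq ?_)
  simp

end Germ

open Set

/-! ### Sewing -/

section Sewing

/-- A bound which improves itself by a contraction holds with the constant of the fixed point. -/
theorem le_of_self_improving {ι : Type*} {x y : ι → ℝ} {a θ : ℝ} (hy : ∀ i, 0 ≤ y i) (ha : 0 ≤ a)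
    (hθ : 0 ≤ θ) (hθ1 : θ < 1)
    (h : ∀ Q, 0 ≤ Q → (∀ i, x i ≤ Q * y i) → ∀ i, x i ≤ (a + θ * Q) * y i)
    (h0 : ∃ Q, 0 ≤ Q ∧ ∀ i, x i ≤ Q * y i) (i : ι) : x i ≤ a / (1 - θ) * y i := by
  obtain ⟨Q, hQ, hQ'⟩ := h0
  have hb : 0 ≤ a / (1 - θ) := div_nonneg ha (by linarith)
  have key : ∀ k : ℕ, ∀ i, x i ≤ (a / (1 - θ) + θ ^ k * Q) * y i := by
    intro k
    induction k with
    | zero =>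
      intro i
      refine (hQ' i).trans ?_
      rw [pow_zero, one_mul]
      exact mul_le_mul_of_nonneg_right (by linarith) (hy i)
    | succ k ih =>
      intro i
      refine (h _ (by positivity) ih i).trans (le_of_eq ?_)
      have : 1 - θ ≠ 0 := by linarith
      field_simp
      ring
  have ht : Filter.Tendsto (fun k : ℕ => (a / (1 - θ) + θ ^ k * Q) * y i) Filter.atTop
      (𝓝 ((a / (1 - θ) + 0 * Q) * y i)) :=
    (((tendsto_pow_atTop_nhds_zero_of_lt_one hθ hθ1).mul_const Q).const_add _).mul_const _
  rw [zero_mul, add_zero] at ht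
  exact ge_of_tendsto' ht fun k => key k i

/-- The sewing constant. -/
def sewC (p : ℝ) : ℝ := 1 / (1 - 2 ^ (1 - p))

theorem two_rpow_lt_one {p : ℝ} (hp : 1 < p) : (2 : ℝ) ^ (1 - p) < 1 :=
  Real.rpow_lt_one_of_one_lt_of_neg (by norm_num) (by linarith)

theorem sewC_pos {p : ℝ} (hp : 1 < p) : 0 < sewC p := by
  have := two_rpow_lt_one hp
  exact div_pos one_pos (by linarith)

/-- The sewing lemma: an almost additive function of intervals, which is known to be negligible, is
negligible with a constant which depends on its defect of additivity only. Halving the interval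
improves a bound `Q` to `D + 2 ^ (1 - p) * Q`. -/
theorem sewing {E : Type*} [NormedAddCommGroup E] {R : ℝ → ℝ → E} {τ D p : ℝ} (hp : 1 < p)
    (hD : 0 ≤ D)
    (hR : ∀ s u t, 0 ≤ s → s ≤ u → u ≤ t → t ≤ τ → ‖R s t - R s u - R u t‖ ≤ D * (t - s) ^ p)
    (h0 : ∃ L, 0 ≤ L ∧ ∀ s t, 0 ≤ s → s ≤ t → t ≤ τ → ‖R s t‖ ≤ L * (t - s) ^ p)
    {s t : ℝ} (hs : 0 ≤ s) (hst : s ≤ t) (ht : t ≤ τ) : ‖R s t‖ ≤ D * sewC p * (t - s) ^ p := by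
  obtain ⟨L, hL, hL'⟩ := h0
  let ι := {i : ℝ × ℝ // 0 ≤ i.1 ∧ i.1 ≤ i.2 ∧ i.2 ≤ τ}
  have := le_of_self_improving (ι := ι) (x := fun i => ‖R i.1.1 i.1.2‖)
    (y := fun i => (i.1.2 - i.1.1) ^ p) (a := D) (θ := 2 ^ (1 - p))
    (fun i => Real.rpow_nonneg (sub_nonneg.2 i.2.2.1) _) hD (by positivity) (two_rpow_lt_one hp)
    (fun Q hQ hQ' i => by
      obtain ⟨⟨s, t⟩, hs, hst, ht⟩ := i
      simp only at hs hst ht ⊢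
      have h1 := hQ' ⟨(s, (s + t) / 2), hs, by simp only; linarith, by simp only; linarith⟩
      have h2 := hQ' ⟨((s + t) / 2, t), by simp only; linarith, by simp only; linarith, ht⟩
      have h3 := hR s ((s + t) / 2) t hs (by linarith) (by linarith) ht
      simp only at h1 h2
      have e1 : (s + t) / 2 - s = (t - s) / 2 := by ring
      have e2 : t - (s + t) / 2 = (t - s) / 2 := by ring
      rw [e1] at h1
      rw [e2] at h2
      have e3 : 2 * (Q * ((t - s) / 2) ^ p) = 2 ^ (1 - p) * Q * (t - s) ^ p := by
        rw [Real.div_rpow (by linarith) (by norm_num), Real.rpow_sub (by norm_num), Real.rpow_one]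
        ring
      have e4 : R s t = (R s t - R s ((s + t) / 2) - R ((s + t) / 2) t) + R s ((s + t) / 2) +
          R ((s + t) / 2) t := by abel
      rw [e4]
      refine norm_add₃_le.trans ?_
      rw [add_mul]
      linarith)
    ⟨L, hL, fun i => hL' _ _ i.2.1 i.2.2.1 i.2.2.2⟩ ⟨(s, t), hs, hst, ht⟩
  refine this.trans (le_of_eq ?_)
  simp only [sewC]
  ring

end Sewing

/-! ### A priori estimates -/

section Apriori
variable {n : ℕ} {A : Type*} [NormedRing A] [NormedAlgebra ℝ A] [CompleteSpace A]

/-- The signal of the smooth equation per unit of time: `Θ` collects the renormalisation terms. -/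
def rate (ξ : ℝ → Fin n → A) (Θ : Fin n → Fin n → A →L[ℝ] A) (t : ℝ) : Sig n A := (1, ξ t, Θ, Θ)

/-- `sig` is a rough signal over the time interval `[0, 1]`, bounded by `M` in Hölder class `α`, and
generated by the smooth noise `ξ` and the renormalisation `Θ`. The relation of Chen and the Hölder
bounds drive the quantitative estimates. The last two fields tie the signal to the smooth equation;
their constants are not controlled, and enter no uniform estimate. -/
structure IsDriver (α M : ℝ) (ξ : ℝ → Fin n → A) (Θ : Fin n → Fin n → A →L[ℝ] A)
    (sig : ℝ → ℝ → Sig n A) : Prop where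
  len : ∀ s t, (sig s t).1 = t - s
  chen : ∀ s u t, 0 ≤ s → s ≤ u → u ≤ t → t ≤ 1 → sig s t = sig s u + sig u t +
    (0, 0, chenL (sig s u).2.1 (sig u t).2.1, chenR (sig s u).2.1 (sig u t).2.1)
  bound₁ : ∀ s t, 0 ≤ s → s ≤ t → t ≤ 1 → ‖(sig s t).2.1‖ ≤ M * (t - s) ^ α
  boundL : ∀ s t, 0 ≤ s → s ≤ t → t ≤ 1 → ‖(sig s t).2.2.1‖ ≤ M * (t - s) ^ (2 * α)
  boundR : ∀ s t, 0 ≤ s → s ≤ t → t ≤ 1 → ‖(sig s t).2.2.2‖ ≤ M * (t - s) ^ (2 * α)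
  smooth : ∃ L, 0 ≤ L ∧ ∀ s t, 0 ≤ s → s ≤ t → t ≤ 1 →
    ‖sig s t - (t - s) • rate ξ Θ s‖ ≤ L * (t - s) ^ 2
  lip : ∃ L, 0 ≤ L ∧ ∀ s t, 0 ≤ s → s ≤ t → t ≤ 1 → ‖ξ t - ξ s‖ ≤ L * (t - s)

variable (n) in
/-- The constant of the first-order increments. -/
def incC (Λ M : ℝ) : ℝ := 4 * n * Λ ^ 2 * M

variable (n) in
/-- The constant in the defect of additivity of the germ. -/
def defectC (r Λ M : ℝ) : ℝ :=
  Λ * (incC n Λ M + 1) +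
    3 * n * Λ ^ 2 * M * (incC n Λ M ^ 2 + incC n Λ M + 2 * r + 1) +
    32 * n ^ 2 * Λ ^ 4 * M * (incC n Λ M + 1)

variable (n) in
/-- The constant of the remainder in the first-order expansion of solutions. -/
def remC (Λ M : ℝ) : ℝ := 2 * (Λ + 32 * n ^ 2 * Λ ^ 4 * M + 1 / 2)

variable {cf : Fin n → List (Fin n) → ℝ} {cg ch : Fin n → Fin n → List (Fin n) → ℝ}
  {m r Λ α M : ℝ} {ξ : ℝ → Fin n → A} {Θ : Fin n → Fin n → A →L[ℝ] A} {sig : ℝ → ℝ → Sig n A}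

theorem incC_nonneg (hM : 0 ≤ M) :
    0 ≤ incC n Λ M := by unfold incC; positivity

theorem remC_nonneg (hΛ : 0 ≤ Λ) (hM : 0 ≤ M) : 0 ≤ remC n Λ M := by unfold remC; positivity

theorem defectC_nonneg (hr : 0 ≤ r) (hΛ : 0 ≤ Λ) (hM : 0 ≤ M) : 0 ≤ defectC n r Λ M := by
  have := incC_nonneg (n := n) (Λ := Λ) hM
  unfold defectC; positivity

theorem norm_germ₁_le (H : EqBound m r Λ cf cg ch) (hm : ‖(1 : A)‖ ≤ m)
    {X : Fin n → A} (hX : ‖X‖ ≤ r) (β : Fin n → A) : ‖germ₁ cg ch X β‖ ≤ 4 * n * Λ ^ 2 * ‖β‖ :=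
  (pi_norm_le_iff_of_nonneg (by positivity)).2 fun i =>
    (bddLip_germ₁ H hm β i).bound X (mem_closedBall_zero_iff.2 hX)

theorem norm_germ_le (H : EqBound m r Λ cf cg ch) (hΛ : 0 ≤ Λ) (hm : ‖(1 : A)‖ ≤ m)
    {X : Fin n → A} (hX : ‖X‖ ≤ r) (v : Sig n A) :
    ‖germ cf cg ch X v‖ ≤ germK n Λ * ‖v‖ :=
  (bddLip_germ H hΛ hm v).bound X (mem_closedBall_zero_iff.2 hX)

theorem norm_germ_sub_le (H : EqBound m r Λ cf cg ch) (hΛ : 0 ≤ Λ) (hm : ‖(1 : A)‖ ≤ m)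
    {X X' : Fin n → A} (hX : ‖X‖ ≤ r) (hX' : ‖X'‖ ≤ r) (v : Sig n A) :
    ‖germ cf cg ch X v - germ cf cg ch X' v‖ ≤ germK n Λ * ‖v‖ * ‖X - X'‖ :=
  (bddLip_germ H hΛ hm v).lip X (mem_closedBall_zero_iff.2 hX) X' (mem_closedBall_zero_iff.2 hX')

/-- Collects the three contributions to the defect of additivity, where `a = h ^ α` and where
`G a + Q a ^ 2` bounds the increment of the path. -/
theorem defect_arith {G Q r Λ M N a : ℝ} (hG : 0 ≤ G) (hQ : 0 ≤ Q) (hr : 0 ≤ r) (hΛ : 0 ≤ Λ)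
    (hM : 0 ≤ M) (hN : 0 ≤ N) (ha : 0 ≤ a) :
    a ^ 2 * (Λ * ((G + Q) * a)) + N * (3 * Λ ^ 2 * (M * a) *
      ((G ^ 2 + (G + 2 * r) * Q) * a ^ 2 + Q * a ^ 2)) +
      16 * N ^ 2 * Λ ^ 4 * (M * a ^ 2 + M * a ^ 2) * ((G + Q) * a) ≤
    (Λ * (G + 1) + 3 * N * Λ ^ 2 * M * (G ^ 2 + G + 2 * r + 1) +
      32 * N ^ 2 * Λ ^ 4 * M * (G + 1)) * (1 + Q) * a ^ 3 := by
  have k0 := mul_nonneg hG hQ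
  have k0' := mul_nonneg (sq_nonneg G) hQ
  have k1 : G + Q ≤ (G + 1) * (1 + Q) := by linarith
  have k2 : G ^ 2 + (G + 2 * r + 1) * Q ≤ (G ^ 2 + G + 2 * r + 1) * (1 + Q) := by linarith
  calc _ = (Λ * (G + Q) + 3 * N * Λ ^ 2 * M * (G ^ 2 + (G + 2 * r + 1) * Q) +
        32 * N ^ 2 * Λ ^ 4 * M * (G + Q)) * a ^ 3 := by ring
    _ ≤ (Λ * ((G + 1) * (1 + Q)) +
        3 * N * Λ ^ 2 * M * ((G ^ 2 + G + 2 * r + 1) * (1 + Q)) +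
        32 * N ^ 2 * Λ ^ 4 * M * ((G + 1) * (1 + Q))) * a ^ 3 := by gcongr
    _ = _ := by ring

/-- The defect of additivity of the germ along a path `X → X'` over `[s, u]`, continued by a signal
over `[u, t]`, where `h = t - s`. The bound is linear in the remainder constant `Q`, which permits
absorbing it by the choice of a short time. -/
theorem norm_defect_le (H : EqBound m r Λ cf cg ch) (hΛ : 0 ≤ Λ) (hM : 0 ≤ M)
    (hα : 0 ≤ α) (hα' : α ≤ 1 / 2) (hm : ‖(1 : A)‖ ≤ m) {X X' : Fin n → A} (hX : ‖X‖ ≤ r)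
    (hX' : ‖X'‖ ≤ r) {v v' : Sig n A} {h Q : ℝ} (hh : 0 ≤ h) (hh1 : h ≤ 1) (hQ : 0 ≤ Q)
    (b' : ‖v'.2.1‖ ≤ M * h ^ α) (len : |v.1| ≤ h) (b₁ : ‖v.2.1‖ ≤ M * h ^ α)
    (bL : ‖v.2.2.1‖ ≤ M * h ^ (2 * α)) (bR : ‖v.2.2.2‖ ≤ M * h ^ (2 * α))
    (hψ : ‖X' - X - germ₁ cg ch X v'.2.1‖ ≤ Q * h ^ (2 * α)) :
    ‖germ cf cg ch X' v - germ cf cg ch X v -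
      germ cf cg ch X (0, 0, chenL v'.2.1 v.2.1, chenR v'.2.1 v.2.1)‖ ≤
      defectC n r Λ M * (1 + Q) * h ^ (3 * α) := by
  have hr : 0 ≤ r := (norm_nonneg _).trans hX
  set G := incC n Λ M with hG
  have hG0 : 0 ≤ G := incC_nonneg hM
  set a := h ^ α with ha
  have ha0 : 0 ≤ a := Real.rpow_nonneg hh _
  have ha1 : a ≤ 1 := Real.rpow_le_one hh hh1 hα
  have e2 : h ^ (2 * α) = a ^ 2 := by
    rw [mul_comm, Real.rpow_mul hh, ← ha]; exact_mod_cast Real.rpow_natCast a 2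
  have e3 : h ^ (3 * α) = a ^ 3 := by
    rw [mul_comm, Real.rpow_mul hh, ← ha]; exact_mod_cast Real.rpow_natCast a 3
  have hh2 : h ≤ a ^ 2 := by
    rw [← e2]
    nth_rewrite 1 [← Real.rpow_one h]
    exact Real.rpow_le_rpow_of_exponent_ge' hh hh1 (by linarith) (by linarith)
  rw [e2] at bL bR hψ
  rw [e3]
  set ψ := X' - X - germ₁ cg ch X v'.2.1 with hψd
  have hg : ‖germ₁ cg ch X v'.2.1‖ ≤ G * a :=
    (norm_germ₁_le H hm hX _).trans (by
      rw [hG, incC]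
      calc _ ≤ 4 * n * Λ ^ 2 * (M * a) := by gcongr
        _ = _ := by ring)
  have hd : X' - X = germ₁ cg ch X v'.2.1 + ψ := by rw [hψd]; abel
  have hδ0 := norm_nonneg (X' - X)
  have hψ0 := norm_nonneg ψ
  have hδ1 : ‖X' - X‖ ≤ G * a + ‖ψ‖ := by
    rw [hd]; exact (norm_add_le _ _).trans (by gcongr)
  have hδ2 : ‖X' - X‖ ≤ 2 * r := (norm_sub_le _ _).trans (by linarith)
  have hδ3 : ‖X' - X‖ ≤ (G + Q) * a := by
    have h1 : Q * a ^ 2 ≤ Q * a := mul_le_mul_of_nonneg_left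
      (by rw [sq]; exact mul_le_of_le_one_left ha0 ha1) hQ
    linarith
  -- one factor of the square is bounded, so that only the first power of `Q` enters
  have hδ4 : ‖X' - X‖ ^ 2 ≤ (G ^ 2 + (G + 2 * r) * Q) * a ^ 2 := by
    have h1 : ‖X' - X‖ ^ 2 ≤ ‖X' - X‖ * (G * a) + ‖X' - X‖ * ‖ψ‖ := by
      rw [← mul_add, sq]
      exact mul_le_mul_of_nonneg_left hδ1 hδ0
    have h2 : ‖X' - X‖ * (G * a) ≤ (G * a + ‖ψ‖) * (G * a) := by gcongr
    have h3 : ‖X' - X‖ * ‖ψ‖ ≤ 2 * r * (Q * a ^ 2) := by gcongr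
    have h4 : ‖ψ‖ * (G * a) ≤ (Q * a ^ 2) * (G * 1) := by gcongr
    calc _ ≤ (G * a + ‖ψ‖) * (G * a) + 2 * r * (Q * a ^ 2) := h1.trans (add_le_add h2 h3)
      _ = G * a * (G * a) + ‖ψ‖ * (G * a) + 2 * r * (Q * a ^ 2) := by ring
      _ ≤ G * a * (G * a) + Q * a ^ 2 * (G * 1) + 2 * r * (Q * a ^ 2) := by gcongr
      _ = _ := by ring
  refine (pi_norm_le_iff_of_nonneg (by
    have := defectC_nonneg (n := n) hr hΛ hM; positivity)).2 fun i => ?_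
  have hf := (H.f i).ser_sub_le hm hX' hX
  have h1 := norm_germ₁_taylor_le H hm hX hX' v'.2.1 v.2.1 i
  have h2 := (bddLip_germ₂ H hm v.2.2.1 v.2.2.2 i).lip X' (mem_closedBall_zero_iff.2 hX') X
    (mem_closedBall_zero_iff.2 hX)
  have e : (germ cf cg ch X' v - germ cf cg ch X v -
      germ cf cg ch X (0, 0, chenL v'.2.1 v.2.1, chenR v'.2.1 v.2.1)) i =
      v.1 • (ser (cf i) X' - ser (cf i) X) +
      (germ₁ cg ch X' v.2.1 i - germ₁ cg ch X v.2.1 i -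
        germ₂ cg ch X (chenL v'.2.1 v.2.1) (chenR v'.2.1 v.2.1) i) +
      (germ₂ cg ch X' v.2.2.1 v.2.2.2 i - germ₂ cg ch X v.2.2.1 v.2.2.2 i) := by
    have : germ₁ cg ch X 0 i = 0 := by simp [germ₁]
    simp only [germ, Pi.sub_apply, zero_smul, this, smul_sub]
    abel
  rw [e]
  have n1 : ‖v.1 • (ser (cf i) X' - ser (cf i) X)‖ ≤ a ^ 2 * (Λ * ((G + Q) * a)) := by
    rw [norm_smul, Real.norm_eq_abs]
    refine mul_le_mul (len.trans hh2) (hf.trans (by gcongr)) (norm_nonneg _) (by positivity)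
  have n2 := h1.trans (show _ ≤ n * (3 * Λ ^ 2 * (M * a) *
      ((G ^ 2 + (G + 2 * r) * Q) * a ^ 2 + Q * a ^ 2)) by gcongr)
  have n3 := h2.trans (show _ ≤ 16 * n ^ 2 * Λ ^ 4 * (M * a ^ 2 + M * a ^ 2) * ((G + Q) * a) by
    gcongr)
  refine norm_add₃_le.trans ((add_le_add (add_le_add n1 n2) n3).trans ?_)
  rw [defectC]
  exact defect_arith hG0 hQ hr hΛ hM (Nat.cast_nonneg n) ha0

end Apriori

section Apriori
variable {n : ℕ} {A : Type*} [NormedRing A] [NormedAlgebra ℝ A] [CompleteSpace A]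
variable {cf : Fin n → List (Fin n) → ℝ} {cg ch : Fin n → Fin n → List (Fin n) → ℝ}
  {m r Λ α M : ℝ} {ξ : ℝ → Fin n → A} {Θ : Fin n → Fin n → A →L[ℝ] A} {sig : ℝ → ℝ → Sig n A}

theorem rate_sub (s t : ℝ) : rate ξ Θ t - rate ξ Θ s = (0, ξ t - ξ s, 0, 0) := by
  simp [rate]
  rfl

theorem norm_rate_sub (s t : ℝ) : ‖rate ξ Θ t - rate ξ Θ s‖ = ‖ξ t - ξ s‖ := by
  rw [rate_sub]
  simp [Prod.norm_def]

theorem IsDriver.rate_le (D : IsDriver α M ξ Θ sig) :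
    ∃ V, 0 ≤ V ∧ ∀ t ∈ Icc (0 : ℝ) 1, ‖rate ξ Θ t‖ ≤ V := by
  obtain ⟨L, hL, h⟩ := D.lip
  refine ⟨‖rate ξ Θ 0‖ + L, by positivity, fun t ht => ?_⟩
  have h1 := h 0 t le_rfl ht.1 ht.2
  rw [← norm_rate_sub (Θ := Θ)] at h1
  have h2 := norm_le_norm_add_norm_sub' (rate ξ Θ t) (rate ξ Θ 0)
  nlinarith [ht.1, ht.2]

theorem pow_two_le_rpow {h p : ℝ} (hh : 0 ≤ h) (hh1 : h ≤ 1) (hp : 0 ≤ p) (hp2 : p ≤ 2) :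
    h ^ 2 ≤ h ^ p := by
  rw [← Real.rpow_two]
  exact Real.rpow_le_rpow_of_exponent_ge' hh hh1 hp hp2

/-- For a fixed smooth noise, the germ is a first-order expansion of the solution. The constant
depends on the smoothness of the noise; it only provides the qualitative input of `sewing`. -/
theorem exists_qualitative (H : EqBound m r Λ cf cg ch) (hΛ : 0 ≤ Λ) (hm : ‖(1 : A)‖ ≤ m)
    (D : IsDriver α M ξ Θ sig) {τ : ℝ} (hτ1 : τ ≤ 1) {Y : ℝ → Fin n → A}
    (hY : ∀ t ∈ Icc 0 τ, HasDerivWithinAt Y (germ cf cg ch (Y t) (rate ξ Θ t)) (Icc 0 τ) t)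
    (hb : ∀ t ∈ Icc 0 τ, ‖Y t‖ ≤ r) :
    ∃ L, 0 ≤ L ∧ ∀ s t, 0 ≤ s → s ≤ t → t ≤ τ →
      ‖Y t - Y s - germ cf cg ch (Y s) (sig s t)‖ ≤ L * (t - s) ^ 2 := by
  obtain ⟨V, hV, hV'⟩ := D.rate_le
  obtain ⟨L, hL, hL'⟩ := D.lip
  obtain ⟨L₂, hL₂, hL₂'⟩ := D.smooth
  have hK := germK_nonneg (n := n) hΛ
  set K := germK n Λ
  have h1 : ∀ s t, 0 ≤ s → s ≤ t → t ≤ τ → ‖Y t - Y s‖ ≤ K * V * (t - s) := by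
    intro s t hs hst ht
    have := Convex.norm_image_sub_le_of_norm_hasDerivWithin_le (𝕜 := ℝ) (C := K * V) hY
      (fun x hx => (norm_germ_le H hΛ hm (hb x hx) _).trans
        (by gcongr; exact hV' x ⟨hx.1, hx.2.trans hτ1⟩)) (convex_Icc 0 τ)
      (x := s) (y := t) ⟨hs, hst.trans ht⟩ ⟨hs.trans hst, ht⟩
    rwa [Real.norm_of_nonneg (sub_nonneg.2 hst)] at this
  have h2 : ∀ s t, 0 ≤ s → s ≤ t → t ≤ τ →
      ‖germ cf cg ch (Y t) (rate ξ Θ t) - germ cf cg ch (Y s) (rate ξ Θ s)‖ ≤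
        (K * V * (K * V) + K * L) * (t - s) := by
    intro s t hs hst ht
    have hbs := hb s ⟨hs, hst.trans ht⟩
    have hbt := hb t ⟨hs.trans hst, ht⟩
    have e : germ cf cg ch (Y t) (rate ξ Θ t) - germ cf cg ch (Y s) (rate ξ Θ s) =
        (germ cf cg ch (Y t) (rate ξ Θ t) - germ cf cg ch (Y s) (rate ξ Θ t)) +
          germ cf cg ch (Y s) (rate ξ Θ t - rate ξ Θ s) := by
      have := germ_add H hm hbs (rate ξ Θ t - rate ξ Θ s) (rate ξ Θ s)
      rw [sub_add_cancel] at this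
      rw [this]; abel
    rw [e]
    refine (norm_add_le _ _).trans ?_
    have a1 := norm_germ_sub_le H hΛ hm hbt hbs (rate ξ Θ t)
    have a2 := norm_germ_le H hΛ hm hbs (rate ξ Θ t - rate ξ Θ s)
    rw [norm_rate_sub] at a2
    have a3 := hL' s t hs hst (ht.trans hτ1)
    have a4 := hV' t ⟨hs.trans hst, ht.trans hτ1⟩
    have a5 := h1 s t hs hst ht
    calc _ ≤ K * ‖rate ξ Θ t‖ * ‖Y t - Y s‖ + K * ‖ξ t - ξ s‖ := add_le_add a1 a2
      _ ≤ K * V * (K * V * (t - s)) + K * (L * (t - s)) := by gcongr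
      _ = _ := by ring
  refine ⟨(K * V * (K * V) + K * L) + K * L₂, by positivity, fun s t hs hst ht => ?_⟩
  have hbs := hb s ⟨hs, hst.trans ht⟩
  have hts : 0 ≤ t - s := sub_nonneg.2 hst
  -- mean value inequality for `Y` minus its tangent at `s`
  have h3 : ‖Y t - Y s - (t - s) • germ cf cg ch (Y s) (rate ξ Θ s)‖ ≤
      (K * V * (K * V) + K * L) * (t - s) * (t - s) := by
    have hsub : Icc s t ⊆ Icc 0 τ := Icc_subset_Icc hs ht
    have := Convex.norm_image_sub_le_of_norm_hasDerivWithin_le (𝕜 := ℝ)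
      (f := fun x => Y x - x • germ cf cg ch (Y s) (rate ξ Θ s))
      (f' := fun x => germ cf cg ch (Y x) (rate ξ Θ x) - germ cf cg ch (Y s) (rate ξ Θ s))
      (C := (K * V * (K * V) + K * L) * (t - s)) (s := Icc s t)
      (fun x hx => by
        have hd := ((hasDerivAt_id x).smul_const
          (germ cf cg ch (Y s) (rate ξ Θ s))).hasDerivWithinAt (s := Icc s t)
        rw [one_smul] at hd
        exact ((hY x (hsub hx)).mono hsub).sub hd)
      (fun x hx => (h2 s x hs hx.1 (hx.2.trans ht)).trans (by gcongr; exact hx.2))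
      (convex_Icc s t) (x := s) (y := t) ⟨le_rfl, hst⟩ ⟨hst, le_rfl⟩
    rw [Real.norm_of_nonneg hts] at this
    have e : Y t - Y s - (t - s) • germ cf cg ch (Y s) (rate ξ Θ s) =
        (Y t - t • germ cf cg ch (Y s) (rate ξ Θ s)) -
          (Y s - s • germ cf cg ch (Y s) (rate ξ Θ s)) := by
      rw [sub_smul]; abel
    rw [e]
    exact this
  have h4 : ‖germ cf cg ch (Y s) (sig s t - (t - s) • rate ξ Θ s)‖ ≤ K * (L₂ * (t - s) ^ 2) :=
    (norm_germ_le H hΛ hm hbs _).trans (by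
      gcongr; exact hL₂' s t hs hst (ht.trans hτ1))
  have e : Y t - Y s - germ cf cg ch (Y s) (sig s t) =
      (Y t - Y s - (t - s) • germ cf cg ch (Y s) (rate ξ Θ s)) -
        germ cf cg ch (Y s) (sig s t - (t - s) • rate ξ Θ s) := by
    have := germ_add H hm hbs (sig s t - (t - s) • rate ξ Θ s) ((t - s) • rate ξ Θ s)
    rw [sub_add_cancel, germ_smul] at this
    rw [this]; abel
  rw [e]
  refine (norm_sub_le _ _).trans ((add_le_add h3 h4).trans (le_of_eq ?_))
  ring

/-- The germ differs from its first-order part by a term of order `2 α`. -/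
theorem norm_germ_sub_germ₁_le (H : EqBound m r Λ cf cg ch) (hΛ : 0 ≤ Λ) (hM : 0 ≤ M)
    (hα : 0 ≤ α) (hα' : α ≤ 1 / 2)
    (hm : ‖(1 : A)‖ ≤ m) {X : Fin n → A} (hX : ‖X‖ ≤ r) {v : Sig n A} {h : ℝ} (hh : 0 ≤ h)
    (hh1 : h ≤ 1) (len : |v.1| ≤ h) (bL : ‖v.2.2.1‖ ≤ M * h ^ (2 * α))
    (bR : ‖v.2.2.2‖ ≤ M * h ^ (2 * α)) :
    ‖germ cf cg ch X v - germ₁ cg ch X v.2.1‖ ≤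
      (Λ + 32 * n ^ 2 * Λ ^ 4 * M) * h ^ (2 * α) := by
  have hh2 : h ≤ h ^ (2 * α) := by
    nth_rewrite 1 [← Real.rpow_one h]
    exact Real.rpow_le_rpow_of_exponent_ge' hh hh1 (by linarith) (by linarith)
  have ha : 0 ≤ h ^ (2 * α) := Real.rpow_nonneg hh _
  refine (pi_norm_le_iff_of_nonneg (by positivity)).2 fun i => ?_
  have e : (germ cf cg ch X v - germ₁ cg ch X v.2.1) i =
      v.1 • ser (cf i) X + germ₂ cg ch X v.2.2.1 v.2.2.2 i := by
    simp only [germ, Pi.sub_apply]; abel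
  rw [e]
  have h1 := ((H.f i).ser_le hm hX).2
  have h2 := (bddLip_germ₂ H hm v.2.2.1 v.2.2.2 i).bound X (mem_closedBall_zero_iff.2 hX)
  calc _ ≤ |v.1| * ‖ser (cf i) X‖ + 16 * n ^ 2 * Λ ^ 4 * (‖v.2.2.1‖ + ‖v.2.2.2‖) := by
        refine (norm_add_le _ _).trans (add_le_add ?_ h2)
        rw [norm_smul, Real.norm_eq_abs]
    _ ≤ h ^ (2 * α) * Λ + 16 * n ^ 2 * Λ ^ 4 * (M * h ^ (2 * α) + M * h ^ (2 * α)) := by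
        gcongr
        exact len.trans hh2
    _ = _ := by ring

/-- The a priori estimate: over short times, the remainder of the first-order expansion of a
solution is bounded in terms of the Hölder bounds of the rough signal. The remainder constant `Q`
enters the defect of the germ, and sewing returns a constant which is smaller by the factor
`τ ^ α`; the qualitative bound for smooth noises starts this self-improvement. -/
theorem norm_remainder_le (H : EqBound m r Λ cf cg ch) (hΛ : 0 ≤ Λ) (hr : 0 ≤ r) (hM : 0 ≤ M)
    (hα : 1 / 3 < α) (hα' : α ≤ 1 / 2) (hm : ‖(1 : A)‖ ≤ m) (D : IsDriver α M ξ Θ sig) {τ : ℝ}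
    (hτ1 : τ ≤ 1) (hsmall : sewC (3 * α) * defectC n r Λ M * τ ^ α ≤ 1 / 2) {Y : ℝ → Fin n → A}
    (hY : ∀ t ∈ Icc 0 τ, HasDerivWithinAt Y (germ cf cg ch (Y t) (rate ξ Θ t)) (Icc 0 τ) t)
    (hb : ∀ t ∈ Icc 0 τ, ‖Y t‖ ≤ r) {s t : ℝ} (hs : 0 ≤ s) (hst : s ≤ t) (ht : t ≤ τ) :
    ‖Y t - Y s - germ₁ cg ch (Y s) (sig s t).2.1‖ ≤ remC n Λ M * (t - s) ^ (2 * α) := by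
  have hdef := defectC_nonneg (n := n) hr hΛ hM
  have hsew := sewC_pos (p := 3 * α) (by linarith)
  obtain ⟨L, hL, hL'⟩ := exists_qualitative H hΛ hm D hτ1 hY hb
  set B := Λ + 32 * n ^ 2 * Λ ^ 4 * M with hB
  have hB0 : 0 ≤ B := by positivity
  -- the second-order part of the germ
  have hsec : ∀ s t, 0 ≤ s → s ≤ t → t ≤ τ →
      ‖germ cf cg ch (Y s) (sig s t) - germ₁ cg ch (Y s) (sig s t).2.1‖ ≤
        B * (t - s) ^ (2 * α) := fun s t hs hst ht =>
    norm_germ_sub_germ₁_le H hΛ hM (by linarith) hα' hm (hb s ⟨hs, hst.trans ht⟩)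
      (sub_nonneg.2 hst) (by linarith)
      (by rw [D.len, abs_of_nonneg (sub_nonneg.2 hst)]) (D.boundL s t hs hst (ht.trans hτ1))
      (D.boundR s t hs hst (ht.trans hτ1))
  have hsplit : ∀ s t, Y t - Y s - germ₁ cg ch (Y s) (sig s t).2.1 =
      (Y t - Y s - germ cf cg ch (Y s) (sig s t)) +
      (germ cf cg ch (Y s) (sig s t) - germ₁ cg ch (Y s) (sig s t).2.1) := fun s t => by abel
  let ι := {i : ℝ × ℝ // 0 ≤ i.1 ∧ i.1 ≤ i.2 ∧ i.2 ≤ τ}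
  have key := le_of_self_improving (ι := ι)
    (x := fun i => ‖Y i.1.2 - Y i.1.1 - germ₁ cg ch (Y i.1.1) (sig i.1.1 i.1.2).2.1‖)
    (y := fun i => (i.1.2 - i.1.1) ^ (2 * α)) (a := B + 1 / 2) (θ := 1 / 2)
    (fun i => Real.rpow_nonneg (sub_nonneg.2 i.2.2.1) _) (by positivity) (by norm_num)
    (by norm_num) (fun Q hQ hQ' i => ?_) ?_ ⟨(s, t), hs, hst, ht⟩
  · refine key.trans (le_of_eq ?_)
    rw [remC, ← hB]; ring
  · obtain ⟨⟨s, t⟩, hs, hst, ht⟩ := i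
    simp only at hs hst ht ⊢
    have hts : 0 ≤ t - s := sub_nonneg.2 hst
    have hR := sewing (R := fun s t => Y t - Y s - germ cf cg ch (Y s) (sig s t)) (τ := τ)
      (D := defectC n r Λ M * (1 + Q)) (p := 3 * α) (by linarith) (by positivity)
      (fun s u t hs hsu hut ht => by
        have hst := hsu.trans hut
        have bs := hb s ⟨hs, hst.trans ht⟩
        have bu := hb u ⟨hs.trans hsu, hut.trans ht⟩
        have h0u : 0 ≤ u - s := sub_nonneg.2 hsu
        have h0t : 0 ≤ t - u := sub_nonneg.2 hut
        have hαp : 0 ≤ α := by linarith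
        have hψ := hQ' ⟨(s, u), hs, hsu, hut.trans ht⟩
        simp only at hψ
        have e : (Y t - Y s - germ cf cg ch (Y s) (sig s t)) -
            (Y u - Y s - germ cf cg ch (Y s) (sig s u)) -
            (Y t - Y u - germ cf cg ch (Y u) (sig u t)) =
            germ cf cg ch (Y u) (sig u t) - germ cf cg ch (Y s) (sig u t) -
            germ cf cg ch (Y s) (0, 0, chenL (sig s u).2.1 (sig u t).2.1,
              chenR (sig s u).2.1 (sig u t).2.1) := by
          rw [D.chen s u t hs hsu hut (ht.trans hτ1), germ_add H hm bs, germ_add H hm bs]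
          abel
        rw [e]
        refine norm_defect_le H hΛ hM hαp hα' hm bs bu (h := t - s) (by linarith)
          (by linarith) hQ ?_ ?_ ?_ ?_ ?_ ?_
        · exact (D.bound₁ s u hs hsu (by linarith)).trans (by gcongr)
        · rw [D.len, abs_of_nonneg h0t]; linarith
        · exact (D.bound₁ u t (by linarith) hut (by linarith)).trans (by gcongr)
        · exact (D.boundL u t (by linarith) hut (by linarith)).trans (by gcongr)
        · exact (D.boundR u t (by linarith) hut (by linarith)).trans (by gcongr)
        · exact hψ.trans (by gcongr))
      ⟨L, hL, fun s t hs hst ht => (hL' s t hs hst ht).trans (by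
        gcongr
        exact pow_two_le_rpow (sub_nonneg.2 hst) (by linarith) (by linarith) (by linarith))⟩
      hs hst ht
    rw [hsplit]
    refine (norm_add_le _ _).trans ((add_le_add hR (hsec s t hs hst ht)).trans ?_)
    have e3 : (t - s) ^ (3 * α) = (t - s) ^ α * (t - s) ^ (2 * α) := by
      rw [← Real.rpow_add_of_nonneg hts (by linarith) (by linarith)]; congr 1; ring
    have hpow : (t - s) ^ α ≤ τ ^ α := Real.rpow_le_rpow hts (by linarith) (by linarith)
    have h2 : 0 ≤ (t - s) ^ (2 * α) := Real.rpow_nonneg hts _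
    rw [e3]
    have h3 : defectC n r Λ M * (1 + Q) * sewC (3 * α) * ((t - s) ^ α * (t - s) ^ (2 * α)) ≤
        1 / 2 * (1 + Q) * (t - s) ^ (2 * α) :=
      calc _ = (sewC (3 * α) * defectC n r Λ M * (t - s) ^ α) * (1 + Q) *
            (t - s) ^ (2 * α) := by ring
        _ ≤ _ := by
            gcongr
            refine le_trans ?_ hsmall
            gcongr
    linarith
  · refine ⟨L + B, by positivity, fun i => ?_⟩
    obtain ⟨⟨s, t⟩, hs, hst, ht⟩ := i
    simp only at hs hst ht ⊢
    rw [hsplit, add_mul]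
    refine (norm_add_le _ _).trans (add_le_add ((hL' s t hs hst ht).trans ?_) (hsec s t hs hst ht))
    gcongr
    exact pow_two_le_rpow (sub_nonneg.2 hst) (by linarith) (by linarith) (by linarith)

/-- Hölder bound for solutions. -/
theorem norm_increment_le (H : EqBound m r Λ cf cg ch) (hΛ : 0 ≤ Λ) (hr : 0 ≤ r) (hM : 0 ≤ M)
    (hα : 1 / 3 < α) (hα' : α ≤ 1 / 2) (hm : ‖(1 : A)‖ ≤ m) (D : IsDriver α M ξ Θ sig) {τ : ℝ}
    (hτ1 : τ ≤ 1) (hsmall : sewC (3 * α) * defectC n r Λ M * τ ^ α ≤ 1 / 2) {Y : ℝ → Fin n → A}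
    (hY : ∀ t ∈ Icc 0 τ, HasDerivWithinAt Y (germ cf cg ch (Y t) (rate ξ Θ t)) (Icc 0 τ) t)
    (hb : ∀ t ∈ Icc 0 τ, ‖Y t‖ ≤ r) {s t : ℝ} (hs : 0 ≤ s) (hst : s ≤ t) (ht : t ≤ τ) :
    ‖Y t - Y s‖ ≤ (incC n Λ M + remC n Λ M) * (t - s) ^ α := by
  have h0 : 0 ≤ t - s := sub_nonneg.2 hst
  have h1 := norm_remainder_le H hΛ hr hM hα hα' hm D hτ1 hsmall hY hb hs hst ht
  have h2 := norm_germ₁_le H hm (hb s ⟨hs, hst.trans ht⟩) (sig s t).2.1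
  have h3 := D.bound₁ s t hs hst (ht.trans hτ1)
  have h4 : (t - s) ^ (2 * α) ≤ (t - s) ^ α :=
    Real.rpow_le_rpow_of_exponent_ge' h0 (by linarith) (by linarith) (by linarith)
  have hR := remC_nonneg (n := n) hΛ hM
  have e : Y t - Y s = (Y t - Y s - germ₁ cg ch (Y s) (sig s t).2.1) +
      germ₁ cg ch (Y s) (sig s t).2.1 := by abel
  rw [e]
  calc _ ≤ remC n Λ M * (t - s) ^ (2 * α) + 4 * n * Λ ^ 2 * ‖(sig s t).2.1‖ :=
        (norm_add_le _ _).trans (add_le_add h1 h2)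
    _ ≤ remC n Λ M * (t - s) ^ α + 4 * n * Λ ^ 2 * (M * (t - s) ^ α) := by gcongr
    _ = _ := by rw [incC]; ring

/-- A solution which starts well inside the ball of radius `r` does not leave it over short
times. -/
theorem norm_lt_of_solution (H : EqBound m r Λ cf cg ch) (hΛ : 0 ≤ Λ) (hM : 0 ≤ M)
    (hα : 1 / 3 < α) (hα' : α ≤ 1 / 2) (hm : ‖(1 : A)‖ ≤ m) (D : IsDriver α M ξ Θ sig) {T : ℝ}
    (hT1 : T ≤ 1) (hsmall : sewC (3 * α) * defectC n r Λ M * T ^ α ≤ 1 / 2) {Y : ℝ → Fin n → A}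
    (hc : ContinuousOn Y (Icc 0 T))
    (hY : ∀ t ∈ Icc 0 T, ‖Y t‖ ≤ r →
      HasDerivWithinAt Y (germ cf cg ch (Y t) (rate ξ Θ t)) (Icc 0 T) t)
    (h0 : ‖Y 0‖ + (incC n Λ M + remC n Λ M) * T ^ α < r) : ∀ t ∈ Icc 0 T, ‖Y t‖ < r := by
  by_contra! hcon
  obtain ⟨t₁, ht₁, hrt₁⟩ := hcon
  have hR := remC_nonneg (n := n) hΛ hM
  have hI := incC_nonneg (n := n) (Λ := Λ) hM
  have hT0 : 0 ≤ T := ht₁.1.trans ht₁.2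
  have hpos : 0 ≤ (incC n Λ M + remC n Λ M) * T ^ α := by positivity
  have h00 := norm_nonneg (Y 0)
  -- the first exit time
  have hcl : IsClosed (Icc 0 T ∩ (fun t => ‖Y t‖) ⁻¹' Ici r) :=
    hc.norm.preimage_isClosed_of_isClosed isClosed_Icc isClosed_Ici
  have hcomp : IsCompact (Icc 0 T ∩ (fun t => ‖Y t‖) ⁻¹' Ici r) :=
    isCompact_Icc.of_isClosed_subset hcl inter_subset_left
  obtain ⟨τ, ⟨hτ, hτr⟩, hmin⟩ := hcomp.exists_isLeast ⟨t₁, ht₁, hrt₁⟩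
  have hsub : Icc 0 τ ⊆ Icc 0 T := Icc_subset_Icc le_rfl hτ.2
  have hle : ∀ t ∈ Icc 0 τ, ‖Y t‖ ≤ r := by
    intro t ht
    rcases ht.2.eq_or_lt with rfl | hlt
    · obtain ⟨u, hu, hu'⟩ := intermediate_value_Icc ht.1 ((hc.mono hsub).norm)
        (show r ∈ Icc ‖Y 0‖ ‖Y t‖ from ⟨by linarith, hτr⟩)
      have := hmin ⟨hsub hu, hu'.ge⟩
      rw [le_antisymm hu.2 this] at hu'
      exact hu'.le
    · by_contra! hlt'
      exact absurd (hmin ⟨hsub ht, hlt'.le⟩) (not_le.2 hlt)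
  have hinc := norm_increment_le H hΛ (by linarith) hM hα hα' hm D (hτ.2.trans hT1)
    (le_trans (by
      have := sewC_pos (p := 3 * α) (by linarith)
      have := defectC_nonneg (n := n) (r := r) (by linarith) hΛ hM
      have h0τ := hτ.1
      gcongr
      exact hτ.2) hsmall)
    (fun t ht => (hY t (hsub ht) (hle t ht)).mono hsub) hle le_rfl hτ.1 le_rfl
  have h1 : (incC n Λ M + remC n Λ M) * (τ - 0) ^ α ≤ (incC n Λ M + remC n Λ M) * T ^ α := by
    have h0τ := hτ.1
    rw [sub_zero]
    gcongr
    exact hτ.2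
  have h2 := norm_le_norm_add_norm_sub' (Y τ) (Y 0)
  have h3 : r ≤ ‖Y τ‖ := hτr
  linarith

end Apriori

/-! ### Existence of solutions -/

section Retraction
variable {E : Type*} [NormedAddCommGroup E] [NormedSpace ℝ E]

/-- The radial retraction onto the closed ball of radius `r`. -/
def retract (r : ℝ) (x : E) : E := (r / max r ‖x‖) • x

theorem retract_eq {r : ℝ} (hr : 0 < r) {x : E} (hx : ‖x‖ ≤ r) : retract r x = x := by
  rw [retract, max_eq_left hx, div_self hr.ne', one_smul]

theorem norm_retract_le {r : ℝ} (hr : 0 < r) (x : E) : ‖retract r x‖ ≤ r := by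
  have h : 0 < max r ‖x‖ := lt_max_of_lt_left hr
  rw [retract, norm_smul, Real.norm_of_nonneg (by positivity), div_mul_eq_mul_div, div_le_iff₀ h]
  gcongr
  exact le_max_right _ _

theorem norm_retract_sub_le {r : ℝ} (hr : 0 < r) (x y : E) :
    ‖retract r x - retract r y‖ ≤ 2 * ‖x - y‖ := by
  have hp : 0 < max r ‖x‖ := lt_max_of_lt_left hr
  have hp' : 0 < max r ‖y‖ := lt_max_of_lt_left hr
  have h1 : |max r ‖y‖ - max r ‖x‖| ≤ ‖x - y‖ := by
    refine (abs_max_sub_max_le_max _ _ _ _).trans ?_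
    rw [sub_self, abs_zero, max_eq_right (abs_nonneg _), abs_sub_comm]
    exact abs_norm_sub_norm_le x y
  have e : retract r x - retract r y = (r / max r ‖x‖) • (x - y) +
      ((r / max r ‖x‖) * ((max r ‖y‖ - max r ‖x‖) / max r ‖y‖)) • y := by
    have e' : r / max r ‖y‖ = r / max r ‖x‖ -
        (r / max r ‖x‖) * ((max r ‖y‖ - max r ‖x‖) / max r ‖y‖) := by
      field_simp
      ring
    rw [retract, retract, e', sub_smul, smul_sub]
    abel
  have h2 : r / max r ‖x‖ ≤ 1 := (div_le_one hp).2 (le_max_left _ _)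
  have h3 : ‖y‖ / max r ‖y‖ ≤ 1 := (div_le_one hp').2 (le_max_right _ _)
  rw [e]
  refine (norm_add_le _ _).trans ?_
  rw [norm_smul, norm_smul, norm_mul, norm_div (_ - _), Real.norm_of_nonneg hp'.le,
    Real.norm_of_nonneg (by positivity : 0 ≤ r / max r ‖x‖), Real.norm_eq_abs]
  calc _ = r / max r ‖x‖ * ‖x - y‖ +
        r / max r ‖x‖ * |max r ‖y‖ - max r ‖x‖| * (‖y‖ / max r ‖y‖) := by ring
    _ ≤ 1 * ‖x - y‖ + 1 * ‖x - y‖ * 1 := by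
        refine add_le_add (mul_le_mul_of_nonneg_right h2 (norm_nonneg _)) ?_
        exact mul_le_mul (mul_le_mul h2 h1 (abs_nonneg _) zero_le_one) h3 (by positivity)
          (by positivity)
    _ = _ := by ring

end Retraction

section Existence
variable {n : ℕ} {A : Type*} [NormedRing A] [NormedAlgebra ℝ A] [CompleteSpace A]
variable {cf : Fin n → List (Fin n) → ℝ} {cg ch : Fin n → Fin n → List (Fin n) → ℝ}
  {m r Λ α M : ℝ} {ξ : ℝ → Fin n → A} {Θ : Fin n → Fin n → A →L[ℝ] A} {sig : ℝ → ℝ → Sig n A}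

theorem IsDriver.norm_rate_sub_le (D : IsDriver α M ξ Θ sig) :
    ∃ L, 0 ≤ L ∧ ∀ s ∈ Icc (0 : ℝ) 1, ∀ t ∈ Icc (0 : ℝ) 1,
      ‖rate ξ Θ t - rate ξ Θ s‖ ≤ L * |t - s| := by
  obtain ⟨L, hL, h⟩ := D.lip
  refine ⟨L, hL, fun s hs t ht => ?_⟩
  rw [norm_rate_sub]
  rcases le_total s t with hst | hst
  · rw [abs_of_nonneg (sub_nonneg.2 hst)]
    exact h s t hs.1 hst ht.2
  · rw [abs_sub_comm, abs_of_nonneg (sub_nonneg.2 hst), norm_sub_rev]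
    exact h t s ht.1 hst hs.2

/-- Existence up to a time which depends on the Hölder bounds of the rough signal only: the equation
with coefficients retracted to the ball has a solution on all of `[0, T]`, and the a priori estimate
keeps it inside the ball, where the retraction has no effect. -/
theorem exists_solution (H : EqBound m r Λ cf cg ch) (hΛ : 0 ≤ Λ) (hM : 0 ≤ M)
    (hα : 1 / 3 < α) (hα' : α ≤ 1 / 2) (hm : ‖(1 : A)‖ ≤ m) (D : IsDriver α M ξ Θ sig) {T : ℝ}
    (hT : 0 < T) (hT1 : T ≤ 1) (hsmall : sewC (3 * α) * defectC n r Λ M * T ^ α ≤ 1 / 2)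
    {x₀ : Fin n → A} (h0 : ‖x₀‖ + (incC n Λ M + remC n Λ M) * T ^ α < r) :
    ∃ Y : ℝ → Fin n → A, Y 0 = x₀ ∧ (∀ t ∈ Icc 0 T, ‖Y t‖ < r) ∧
      ∀ t ∈ Icc 0 T, HasDerivWithinAt Y (germ cf cg ch (Y t) (rate ξ Θ t)) (Icc 0 T) t := by
  have hR := remC_nonneg (n := n) hΛ hM
  have hI := incC_nonneg (n := n) (Λ := Λ) hM
  have hr : 0 < r := lt_of_le_of_lt (by positivity) h0
  obtain ⟨V, hV, hV'⟩ := D.rate_le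
  obtain ⟨L, hL, hL'⟩ := D.norm_rate_sub_le
  have hK := germK_nonneg (n := n) hΛ
  set K := germK n Λ
  have hsub : Icc 0 T ⊆ Icc (0 : ℝ) 1 := Icc_subset_Icc le_rfl hT1
  have hPL : IsPicardLindelof (fun t x => germ cf cg ch (retract r x) (rate ξ Θ t))
      (⟨0, le_rfl, hT.le⟩ : Icc (0 : ℝ) T) x₀ (⟨K * V * T, by positivity⟩ : ℝ≥0) 0
      (⟨K * V, by positivity⟩ : ℝ≥0) (⟨K * V * 2, by positivity⟩ : ℝ≥0) := by
    refine ⟨fun t ht => LipschitzOnWith.of_dist_le_mul fun x _ y _ => ?_, fun x _ => ?_,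
      fun t ht x _ => ?_, ?_⟩
    · rw [dist_eq_norm, dist_eq_norm]
      change _ ≤ K * V * 2 * ‖x - y‖
      have h1 := hV' t (hsub ht)
      have h2 := norm_retract_sub_le hr x y
      calc _ ≤ K * ‖rate ξ Θ t‖ * ‖retract r x - retract r y‖ :=
            norm_germ_sub_le H hΛ hm (norm_retract_le hr x) (norm_retract_le hr y) _
        _ ≤ K * V * (2 * ‖x - y‖) := by gcongr
        _ = _ := by ring
    · refine (LipschitzOnWith.of_dist_le_mul (K := ⟨K * L, by positivity⟩)
        fun t ht s hs => ?_).continuousOn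
      rw [dist_eq_norm, Real.dist_eq]
      change _ ≤ K * L * |t - s|
      have := germ_add H hm (norm_retract_le hr x) (rate ξ Θ t - rate ξ Θ s) (rate ξ Θ s)
      rw [sub_add_cancel] at this
      rw [this, add_sub_cancel_right]
      have h1 := hL' s (hsub hs) t (hsub ht)
      calc _ ≤ K * ‖rate ξ Θ t - rate ξ Θ s‖ :=
            norm_germ_le H hΛ hm (norm_retract_le hr x) _
        _ ≤ K * (L * |t - s|) := by gcongr
        _ = _ := by ring
    · have h1 := hV' t (hsub ht)
      refine (norm_germ_le H hΛ hm (norm_retract_le hr x) _).trans ?_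
      change K * _ ≤ K * V
      gcongr
    · change K * V * max (T - 0) (0 - 0) ≤ K * V * T - 0
      rw [sub_zero, sub_zero, max_eq_left hT.le, sub_zero]
  obtain ⟨Y, hY0, hY⟩ := hPL.exists_eq_forall_mem_Icc_hasDerivWithinAt₀
  have hlt : ∀ t ∈ Icc 0 T, ‖Y t‖ < r := by
    refine norm_lt_of_solution H hΛ hM hα hα' hm D hT1 hsmall
      (fun t ht => (hY t ht).continuousWithinAt) (fun t ht ht' => ?_) (by
        have e : Y 0 = x₀ := hY0
        rwa [e])
    have := hY t ht
    rwa [retract_eq hr ht'] at this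
  refine ⟨Y, hY0, hlt, fun t ht => ?_⟩
  have := hY t ht
  rwa [retract_eq hr (hlt t ht).le] at this

/-- Short times satisfy the smallness conditions of the a priori estimate. -/
theorem eventually_time (a b δ : ℝ) {α : ℝ} (hα : 0 < α) (hδ : 0 < δ) :
    ∀ᶠ T in 𝓝[>] (0 : ℝ), a * T ^ α ≤ 1 / 2 ∧ b * T ^ α < δ := by
  have h : Filter.Tendsto (fun T : ℝ => T ^ α) (𝓝[>] 0) (𝓝 0) := by
    have := (Real.continuousAt_rpow_const 0 α (Or.inr hα.le)).tendsto
    rw [Real.zero_rpow hα.ne'] at this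
    exact this.mono_left nhdsWithin_le_nhds
  have ha := h.const_mul a
  have hb := h.const_mul b
  rw [mul_zero] at ha hb
  filter_upwards [ha.eventually (gt_mem_nhds (show (0 : ℝ) < 1 / 2 by norm_num)),
    hb.eventually (gt_mem_nhds hδ)] with T hTa hTb
  exact ⟨hTa.le, hTb⟩

end Existence

/-! ### Pairs of solutions as one solution in a larger algebra -/

/-- The algebra `A × A` with the norm `max ‖y‖ ‖z‖ + l ‖y - z‖`. It is submultiplicative for every
`l`, and a bounded set of the algebra for large `l` consists of pairs with close components. -/
def Twin (_ : ℝ≥0) (A : Type*) : Type _ := A × A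

namespace Twin
variable {l : ℝ≥0} {A : Type*} [NormedRing A] [NormedAlgebra ℝ A]

instance : Ring (Twin l A) := inferInstanceAs (Ring (A × A))
instance : Algebra ℝ (Twin l A) := inferInstanceAs (Algebra ℝ (A × A))

/-- The first component. -/
def fstHom : Twin l A →ₐ[ℝ] A := AlgHom.fst ℝ A A

/-- The second component. -/
def sndHom : Twin l A →ₐ[ℝ] A := AlgHom.snd ℝ A A

variable (l) in
/-- The element with the given components. -/
def mk : A × A →ₗ[ℝ] Twin l A := LinearMap.id

@[simp] theorem fstHom_mk (p : A × A) : fstHom (mk l p) = p.1 := rfl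
@[simp] theorem sndHom_mk (p : A × A) : sndHom (mk l p) = p.2 := rfl

@[ext] theorem ext {x y : Twin l A} (h₁ : fstHom x = fstHom y) (h₂ : sndHom x = sndHom y) :
    x = y := Prod.ext h₁ h₂

instance : NormedAddCommGroup (Twin l A) :=
  AddGroupNorm.toNormedAddCommGroup
    { toFun := fun x => max ‖fstHom x‖ ‖sndHom x‖ + l * ‖fstHom x - sndHom x‖
      map_zero' := by simp
      add_le' := fun x y => by
        simp only [map_add]
        have h1 := norm_add_le (fstHom x) (fstHom y)
        have h2 := norm_add_le (sndHom x) (sndHom y)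
        have h3 := norm_add_le (fstHom x - sndHom x) (fstHom y - sndHom y)
        have e : fstHom x + fstHom y - (sndHom x + sndHom y) =
            (fstHom x - sndHom x) + (fstHom y - sndHom y) := by abel
        rw [e]
        have h4 : l * ‖(fstHom x - sndHom x) + (fstHom y - sndHom y)‖ ≤
            l * ‖fstHom x - sndHom x‖ + l * ‖fstHom y - sndHom y‖ := by
          rw [← mul_add]; gcongr
        have h5 : max ‖fstHom x + fstHom y‖ ‖sndHom x + sndHom y‖ ≤
            max ‖fstHom x‖ ‖sndHom x‖ + max ‖fstHom y‖ ‖sndHom y‖ :=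
          max_le (h1.trans (add_le_add (le_max_left _ _) (le_max_left _ _)))
            (h2.trans (add_le_add (le_max_right _ _) (le_max_right _ _)))
        linarith
      neg' := fun x => by
        simp only [map_neg, norm_neg]
        rw [← neg_sub', norm_neg]
      eq_zero_of_map_eq_zero' := fun x hx => by
        have h1 : 0 ≤ (l : ℝ) * ‖fstHom x - sndHom x‖ := by positivity
        have h2 := (norm_nonneg (fstHom x)).trans (le_max_left ‖fstHom x‖ ‖sndHom x‖)
        have h3 : max ‖fstHom x‖ ‖sndHom x‖ = 0 := by linarith
        exact ext (by simpa using (le_max_left _ _).trans h3.le)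
          (by simpa using (le_max_right _ _).trans h3.le) }

theorem norm_def (x : Twin l A) :
    ‖x‖ = max ‖fstHom x‖ ‖sndHom x‖ + l * ‖fstHom x - sndHom x‖ := rfl

instance : NormedRing (Twin l A) where
  __ := (inferInstance : Ring (Twin l A))
  __ := (inferInstance : NormedAddCommGroup (Twin l A))
  norm_mul_le x y := by
    simp only [norm_def, map_mul]
    set a := fstHom x
    set b := sndHom x
    set c := fstHom y
    set d := sndHom y
    have e : a * c - b * d = (a - b) * c + b * (c - d) := by noncomm_ring
    have h1 : ‖a * c‖ ≤ max ‖a‖ ‖b‖ * max ‖c‖ ‖d‖ := (norm_mul_le _ _).trans (by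
      gcongr <;> exact le_max_left _ _)
    have h2 : ‖b * d‖ ≤ max ‖a‖ ‖b‖ * max ‖c‖ ‖d‖ := (norm_mul_le _ _).trans (by
      gcongr <;> exact le_max_right _ _)
    have h3 : ‖a * c - b * d‖ ≤ ‖a - b‖ * max ‖c‖ ‖d‖ + max ‖a‖ ‖b‖ * ‖c - d‖ := by
      rw [e]
      refine (norm_add_le _ _).trans (add_le_add ((norm_mul_le _ _).trans ?_)
        ((norm_mul_le _ _).trans ?_))
      · gcongr; exact le_max_left _ _
      · gcongr; exact le_max_right _ _
    have h4 : (l : ℝ) * ‖a * c - b * d‖ ≤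
        l * (‖a - b‖ * max ‖c‖ ‖d‖ + max ‖a‖ ‖b‖ * ‖c - d‖) := by gcongr
    have h5 : 0 ≤ (l : ℝ) * ‖a - b‖ * (l * ‖c - d‖) := by positivity
    have := max_le h1 h2
    linarith

instance : NormedAlgebra ℝ (Twin l A) where
  norm_smul_le c x := le_of_eq (by
    simp only [norm_def, map_smul]
    rw [← smul_sub, norm_smul, norm_smul, norm_smul, ← mul_max_of_nonneg _ _ (norm_nonneg c)]
    ring)

theorem norm_fst_le (x : Twin l A) : ‖fstHom x‖ ≤ ‖x‖ :=
  (le_max_left _ _).trans (le_add_of_nonneg_right (by positivity))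

theorem norm_snd_le (x : Twin l A) : ‖sndHom x‖ ≤ ‖x‖ :=
  (le_max_right _ _).trans (le_add_of_nonneg_right (by positivity))

theorem mul_norm_sub_le (x : Twin l A) : l * ‖fstHom x - sndHom x‖ ≤ ‖x‖ :=
  le_add_of_nonneg_left ((norm_nonneg _).trans (le_max_left _ _))

theorem norm_mk_le (p : A × A) : ‖mk l p‖ ≤ (1 + 2 * l) * ‖p‖ := by
  have h1 := norm_sub_le p.1 p.2
  have h2 := _root_.norm_fst_le p
  have h3 := _root_.norm_snd_le p
  rw [norm_def, fstHom_mk, sndHom_mk]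
  calc max ‖p.1‖ ‖p.2‖ + l * ‖p.1 - p.2‖ ≤ ‖p‖ + l * (‖p‖ + ‖p‖) := by
        gcongr
        · exact max_le h2 h3
        · linarith
    _ = _ := by ring

@[simp] theorem norm_one : ‖(1 : Twin l A)‖ = ‖(1 : A)‖ := by
  simp [norm_def]

/-- `fstHom` as a continuous map. -/
def fstL : Twin l A →L[ℝ] A := fstHom.toLinearMap.mkContinuous 1 fun x => by
  rw [one_mul]; exact norm_fst_le x

/-- `sndHom` as a continuous map. -/
def sndL : Twin l A →L[ℝ] A := sndHom.toLinearMap.mkContinuous 1 fun x => by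
  rw [one_mul]; exact norm_snd_le x

variable (l) in
/-- `mk` as a continuous map. -/
def mkL : A × A →L[ℝ] Twin l A := (mk l).mkContinuous (1 + 2 * l) norm_mk_le

instance [CompleteSpace A] : CompleteSpace (Twin l A) := by
  let e : Twin l A ≃L[ℝ] A × A := ContinuousLinearEquiv.equivOfInverse (fstL.prod sndL) (mkL l)
    (fun x => rfl) (fun x => rfl)
  exact (completeSpace_congr (e := e.toEquiv) e.isUniformEmbedding).2 inferInstance

variable (l) in
/-- The operator which acts by `P` and `P'` on the two components. -/
def clm (P P' : A →L[ℝ] A) : Twin l A →L[ℝ] Twin l A :=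
  (mkL l).comp ((P.comp fstL).prod (P'.comp sndL))

@[simp] theorem fstHom_clm (P P' : A →L[ℝ] A) (x : Twin l A) :
    fstHom (clm l P P' x) = P (fstHom x) := rfl

@[simp] theorem sndHom_clm (P P' : A →L[ℝ] A) (x : Twin l A) :
    sndHom (clm l P P' x) = P' (sndHom x) := rfl

theorem norm_clm_le (P P' : A →L[ℝ] A) : ‖clm l P P'‖ ≤ max ‖P‖ ‖P'‖ + l * ‖P - P'‖ := by
  refine ContinuousLinearMap.opNorm_le_bound _ (by positivity) fun x => ?_
  rw [norm_def, norm_def, fstHom_clm, sndHom_clm]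
  set a := fstHom x
  set b := sndHom x
  have e : P a - P' b = P (a - b) + (P - P') b := by simp
  have h1 : ‖P a‖ ≤ max ‖P‖ ‖P'‖ * max ‖a‖ ‖b‖ := (P.le_opNorm a).trans (by
    gcongr <;> exact le_max_left _ _)
  have h2 : ‖P' b‖ ≤ max ‖P‖ ‖P'‖ * max ‖a‖ ‖b‖ := (P'.le_opNorm b).trans (by
    gcongr <;> exact le_max_right _ _)
  have h3 : ‖P a - P' b‖ ≤ max ‖P‖ ‖P'‖ * ‖a - b‖ + ‖P - P'‖ * max ‖a‖ ‖b‖ := by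
    rw [e]
    refine (norm_add_le _ _).trans (add_le_add ((P.le_opNorm _).trans ?_)
      (((P - P').le_opNorm _).trans ?_))
    · gcongr; exact le_max_left _ _
    · gcongr; exact le_max_right _ _
  have h4 : (l : ℝ) * ‖P a - P' b‖ ≤
      l * (max ‖P‖ ‖P'‖ * ‖a - b‖ + ‖P - P'‖ * max ‖a‖ ‖b‖) := by gcongr
  have h5 : 0 ≤ (l : ℝ) * ‖P - P'‖ * (l * ‖a - b‖) := by positivity
  have := max_le h1 h2
  linarith

end Twin

/-! ### Functoriality of the germ -/

section Functor
variable {n : ℕ} {A B : Type*} [NormedRing A] [NormedAlgebra ℝ A] [CompleteSpace A]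
  [NormedRing B] [NormedAlgebra ℝ B] [CompleteSpace B]
variable {cf : Fin n → List (Fin n) → ℝ} {cg ch : Fin n → Fin n → List (Fin n) → ℝ} {m r Λ : ℝ}
variable {π : B →ₐ[ℝ] A}

theorem map_monomial (X : Fin n → B) (w : List (Fin n)) :
    π (monomial X w) = monomial (fun i => π (X i)) w := by
  induction w with
  | nil => simp
  | cons k w ih => simp [ih]

theorem map_dR (X : Fin n → B) {P : Fin n → B →L[ℝ] B} {P' : Fin n → A →L[ℝ] A}
    (h : ∀ k x, π (P k x) = P' k (π x)) (w : List (Fin n)) :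
    π (dR X P w) = dR (fun i => π (X i)) P' w := by
  induction w with
  | nil => simp [dR]
  | cons k w ih => simp [dR, ih, h, map_monomial]

theorem map_dL (X : Fin n → B) {P : Fin n → B →L[ℝ] B} {P' : Fin n → A →L[ℝ] A}
    (h : ∀ k x, π (P k x) = P' k (π x)) (w : List (Fin n)) :
    π (dL X P w) = dL (fun i => π (X i)) P' w := by
  induction w generalizing P P' with
  | nil => simp [dL]
  | cons k w ih =>
    rw [dL, dL, map_add, map_mul, h, map_monomial, map_one,
      ih (P' := fun i => (P' i).comp (ContinuousLinearMap.mul ℝ A (π (X k)))) (by simp [h])]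

theorem map_tsum_smul (hπ : Continuous π) {c : List (Fin n) → ℝ} {t : List (Fin n) → B}
    (ht : Summable fun w => c w • t w) : π (∑' w, c w • t w) = ∑' w, c w • π (t w) := by
  rw [ht.map_tsum π hπ]
  simp only [map_smul]

theorem CoefBound.map_ser (hπ : Continuous π) {c : List (Fin n) → ℝ} (h : CoefBound m r Λ c)
    (hm : ‖(1 : B)‖ ≤ m) {X : Fin n → B} (hX : ‖X‖ ≤ r) :
    π (ser c X) = ser c fun i => π (X i) := by
  rw [ser, map_tsum_smul hπ (h.ser_le hm hX).1, ser]
  simp only [map_monomial]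

/-- Algebra morphisms commute with the germ. For the projections of `Twin l A` this identifies a pair
of solutions with a solution in `Twin l A`. -/
theorem map_germ (hπ : Continuous π) (H : EqBound m r Λ cf cg ch) (hm : ‖(1 : B)‖ ≤ m)
    {X : Fin n → B} (hX : ‖X‖ ≤ r) {v : Sig n B} {v' : Sig n A} (h0 : v.1 = v'.1)
    (h1 : ∀ j, π (v.2.1 j) = v'.2.1 j) (h2 : ∀ j' j x, π (v.2.2.1 j' j x) = v'.2.2.1 j' j (π x))
    (h3 : ∀ j j' x, π (v.2.2.2 j j' x) = v'.2.2.2 j j' (π x)) (i : Fin n) :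
    π (germ cf cg ch X v i) = germ cf cg ch (fun i => π (X i)) v' i := by
  have hg := fun i j => (H.g i j).map_ser hπ hm hX
  have hh := fun i j => (H.h i j).map_ser hπ hm hX
  have hL : ∀ j k x, π (innerL cg ch X v.2.2.1 j k x) =
      innerL cg ch (fun i => π (X i)) v'.2.2.1 j k (π x) := fun j k x => by
    simp [innerL, hg, hh, h2]
  have hR : ∀ j k x, π (innerR cg ch X v.2.2.2 j k x) =
      innerR cg ch (fun i => π (X i)) v'.2.2.2 j k (π x) := fun j k x => by
    simp [innerR, hg, hh, h3]
  have hDR : ∀ j, π (DR (cg i j) X (innerL cg ch X v.2.2.1 j)) =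
      DR (cg i j) (fun i => π (X i)) (innerL cg ch (fun i => π (X i)) v'.2.2.1 j) := fun j => by
    rw [DR, map_tsum_smul hπ ((H.g i j).DR_le hm hX _).1, DR]
    simp only [map_dR X (hL j)]
  have hDL : ∀ j, π (DL (ch i j) X (innerR cg ch X v.2.2.2 j)) =
      DL (ch i j) (fun i => π (X i)) (innerR cg ch (fun i => π (X i)) v'.2.2.2 j) := fun j => by
    rw [DL, map_tsum_smul hπ ((H.h i j).DL_le hm hX _).1, DL]
    simp only [map_dL X (hR j)]
  simp only [germ, germ₁, germ₂, map_add, map_sum, map_mul, map_smul, hg, hh, hDR, hDL, h0, h1,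
    (H.f i).map_ser hπ hm hX]

end Functor

/-! ### Comparison of solutions -/

section Comparison
variable {n : ℕ} {A : Type*} [NormedRing A] [NormedAlgebra ℝ A] [CompleteSpace A]
variable {cf : Fin n → List (Fin n) → ℝ} {cg ch : Fin n → Fin n → List (Fin n) → ℝ}
  {m r Λ α M M' : ℝ} {ξ ξ' : ℝ → Fin n → A} {Θ Θ' : Fin n → Fin n → A →L[ℝ] A}
  {sig sig' : ℝ → ℝ → Sig n A} {l : ℝ≥0}

variable (l) in
/-- Two signals over the same time interval, as one signal. -/
def twinSig (v v' : Sig n A) : Sig n (Twin l A) :=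
  (v.1, fun j => Twin.mk l (v.2.1 j, v'.2.1 j), fun j' j => Twin.clm l (v.2.2.1 j' j) (v'.2.2.1 j' j),
    fun j j' => Twin.clm l (v.2.2.2 j j') (v'.2.2.2 j j'))

theorem norm_twin₁_le (b b' : Fin n → A) :
    ‖fun j => Twin.mk l (b j, b' j)‖ ≤ max ‖b‖ ‖b'‖ + l * ‖b - b'‖ := by
  refine (pi_norm_le_iff_of_nonneg (by positivity)).2 fun j => ?_
  rw [Twin.norm_def, Twin.fstHom_mk, Twin.sndHom_mk]
  gcongr
  · exact norm_le_pi_norm b j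
  · exact norm_le_pi_norm b' j
  · exact norm_le_pi_norm (b - b') j

theorem norm_twin₂_le (P P' : Fin n → Fin n → A →L[ℝ] A) :
    ‖fun j' j => Twin.clm l (P j' j) (P' j' j)‖ ≤ max ‖P‖ ‖P'‖ + l * ‖P - P'‖ := by
  refine (pi_norm_le_iff_of_nonneg (by positivity)).2 fun j' =>
    (pi_norm_le_iff_of_nonneg (by positivity)).2 fun j => (Twin.norm_clm_le _ _).trans ?_
  gcongr
  · exact (norm_le_pi_norm (P j') j).trans (norm_le_pi_norm P j')
  · exact (norm_le_pi_norm (P' j') j).trans (norm_le_pi_norm P' j')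
  · exact (norm_le_pi_norm ((P - P') j') j).trans (norm_le_pi_norm (P - P') j')

theorem norm_twinSig_le (v v' : Sig n A) :
    ‖twinSig l v v'‖ ≤ (1 + 2 * l) * (‖v‖ + ‖v'‖) := by
  obtain ⟨a1, a2, a3, a4⟩ := norm_sig_le v
  obtain ⟨b1, b2, b3, b4⟩ := norm_sig_le v'
  have h0 := norm_nonneg v
  have h0' := norm_nonneg v'
  have hl : 0 ≤ (l : ℝ) * (‖v‖ + ‖v'‖) := by positivity
  have key : ∀ {E : Type _} [NormedAddCommGroup E] (a b : E), ‖a‖ ≤ ‖v‖ → ‖b‖ ≤ ‖v'‖ →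
      max ‖a‖ ‖b‖ + l * ‖a - b‖ ≤ (1 + 2 * l) * (‖v‖ + ‖v'‖) := by
    intro E _ a b ha hb
    have h1 : max ‖a‖ ‖b‖ ≤ ‖v‖ + ‖v'‖ := max_le (by linarith) (by linarith)
    have h2 : (l : ℝ) * ‖a - b‖ ≤ l * (‖v‖ + ‖v'‖) := by
      gcongr; exact (norm_sub_le _ _).trans (add_le_add ha hb)
    linarith
  refine norm_prod_le_iff.2 ⟨?_, norm_prod_le_iff.2 ⟨?_, norm_prod_le_iff.2 ⟨?_, ?_⟩⟩⟩
  · have h3 : |v.1| ≤ ‖v‖ := a1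
    change |v.1| ≤ _
    linarith
  · exact (norm_twin₁_le _ _).trans (key _ _ a2 b2)
  · exact (norm_twin₂_le _ _).trans (key _ _ a3 b3)
  · exact (norm_twin₂_le _ _).trans (key _ _ a4 b4)

/-- A driver of Hölder class `α` over `[0, 1]` is one of every smaller class. -/
theorem IsDriver.mono {α' : ℝ} (D : IsDriver α M ξ Θ sig) (hM : 0 ≤ M) (hMM : M ≤ M')
    (hα : 0 ≤ α') (hαα : α' ≤ α) : IsDriver α' M' ξ Θ sig where
  len := D.len
  chen := D.chen
  bound₁ s t hs hst ht := (D.bound₁ s t hs hst ht).trans (mul_le_mul hMM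
    (Real.rpow_le_rpow_of_exponent_ge' (by linarith) (by linarith) hα hαα)
    (Real.rpow_nonneg (by linarith) _) (hM.trans hMM))
  boundL s t hs hst ht := (D.boundL s t hs hst ht).trans (mul_le_mul hMM
    (Real.rpow_le_rpow_of_exponent_ge' (by linarith) (by linarith) (by linarith) (by linarith))
    (Real.rpow_nonneg (by linarith) _) (hM.trans hMM))
  boundR s t hs hst ht := (D.boundR s t hs hst ht).trans (mul_le_mul hMM
    (Real.rpow_le_rpow_of_exponent_ge' (by linarith) (by linarith) (by linarith) (by linarith))
    (Real.rpow_nonneg (by linarith) _) (hM.trans hMM))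
  smooth := D.smooth
  lip := D.lip

/-- Two drivers which are close to each other in Hölder norms form a driver in `Twin l A`, with a
bound which does not depend on `l`. -/
theorem IsDriver.twin (D : IsDriver α M ξ Θ sig) (D' : IsDriver α M ξ' Θ' sig')
    (h₁ : ∀ s t, 0 ≤ s → s ≤ t → t ≤ 1 →
      l * ‖(sig s t).2.1 - (sig' s t).2.1‖ ≤ M * (t - s) ^ α)
    (hL : ∀ s t, 0 ≤ s → s ≤ t → t ≤ 1 →
      l * ‖(sig s t).2.2.1 - (sig' s t).2.2.1‖ ≤ M * (t - s) ^ (2 * α))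
    (hR : ∀ s t, 0 ≤ s → s ≤ t → t ≤ 1 →
      l * ‖(sig s t).2.2.2 - (sig' s t).2.2.2‖ ≤ M * (t - s) ^ (2 * α)) :
    IsDriver α (2 * M) (fun t j => Twin.mk l (ξ t j, ξ' t j))
      (fun j' j => Twin.clm l (Θ j' j) (Θ' j' j)) fun s t => twinSig l (sig s t) (sig' s t) where
  len := D.len
  chen s u t hs hsu hut ht := by
    have e := D.chen s u t hs hsu hut ht
    have e' := D'.chen s u t hs hsu hut ht
    refine Prod.ext (by simp [twinSig, e]) (Prod.ext ?_ (Prod.ext ?_ ?_))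
    · funext j
      ext <;> simp [twinSig, e, e']
    · funext j' j
      ext x <;> simp [twinSig, e, e', chenL]
    · funext j' j
      ext x <;> simp [twinSig, e, e', chenR]
  bound₁ s t hs hst ht := by
    have := norm_twin₁_le (l := l) (sig s t).2.1 (sig' s t).2.1
    have a := max_le (D.bound₁ s t hs hst ht) (D'.bound₁ s t hs hst ht)
    have b := h₁ s t hs hst ht
    exact this.trans (by linarith)
  boundL s t hs hst ht := by
    have := norm_twin₂_le (l := l) (sig s t).2.2.1 (sig' s t).2.2.1
    have a := max_le (D.boundL s t hs hst ht) (D'.boundL s t hs hst ht)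
    have b := hL s t hs hst ht
    exact this.trans (by linarith)
  boundR s t hs hst ht := by
    have := norm_twin₂_le (l := l) (sig s t).2.2.2 (sig' s t).2.2.2
    have a := max_le (D.boundR s t hs hst ht) (D'.boundR s t hs hst ht)
    have b := hR s t hs hst ht
    exact this.trans (by linarith)
  smooth := by
    obtain ⟨L, hL, h⟩ := D.smooth
    obtain ⟨L', hL', h'⟩ := D'.smooth
    refine ⟨(1 + 2 * l) * (L + L'), by positivity, fun s t hs hst ht => ?_⟩
    have e : twinSig l (sig s t) (sig' s t) - (t - s) • rate (fun t j => Twin.mk l (ξ t j, ξ' t j))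
        (fun j' j => Twin.clm l (Θ j' j) (Θ' j' j)) s =
        twinSig l (sig s t - (t - s) • rate ξ Θ s) (sig' s t - (t - s) • rate ξ' Θ' s) := by
      refine Prod.ext (by simp [twinSig, rate]) (Prod.ext ?_ (Prod.ext ?_ ?_))
      · funext j
        ext <;> simp [twinSig, rate]
      · funext j' j
        ext x <;> simp [twinSig, rate]
      · funext j' j
        ext x <;> simp [twinSig, rate]
    rw [e]
    refine (norm_twinSig_le _ _).trans ?_
    calc _ ≤ (1 + 2 * (l : ℝ)) * (L * (t - s) ^ 2 + L' * (t - s) ^ 2) := by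
          gcongr
          · exact h s t hs hst ht
          · exact h' s t hs hst ht
      _ = _ := by ring
  lip := by
    obtain ⟨L, hL, h⟩ := D.lip
    obtain ⟨L', hL', h'⟩ := D'.lip
    refine ⟨(1 + 2 * l) * (L + L'), by positivity, fun s t hs hst ht => ?_⟩
    refine (pi_norm_le_iff_of_nonneg (mul_nonneg (by positivity) (by linarith))).2 fun j => ?_
    rw [Pi.sub_apply, ← map_sub]
    refine (Twin.norm_mk_le _).trans ?_
    rw [mul_assoc, add_mul L]
    refine mul_le_mul_of_nonneg_left ?_ (by positivity)
    have h1 := (norm_le_pi_norm (ξ t - ξ s) j).trans (h s t hs hst ht)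
    have h2 := (norm_le_pi_norm (ξ' t - ξ' s) j).trans (h' s t hs hst ht)
    rw [Prod.mk_sub_mk]
    exact norm_prod_le_iff.2 ⟨h1.trans (le_add_of_nonneg_right ((norm_nonneg _).trans h2)),
      h2.trans (le_add_of_nonneg_left ((norm_nonneg _).trans h1))⟩

/-- Solutions of equations with close drivers are close to each other: their pair solves an
equation in `Twin l A` and stays in the ball of radius `r` there, so that their distance is at most
`r / l`. -/
theorem mul_norm_sub_le_of_solutions (H : EqBound m r Λ cf cg ch) (hΛ : 0 ≤ Λ) (hM : 0 ≤ M)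
    (hα : 1 / 3 < α) (hα' : α ≤ 1 / 2) (hm : ‖(1 : A)‖ ≤ m) (D : IsDriver α M ξ Θ sig)
    (D' : IsDriver α M ξ' Θ' sig')
    (h₁ : ∀ s t, 0 ≤ s → s ≤ t → t ≤ 1 →
      l * ‖(sig s t).2.1 - (sig' s t).2.1‖ ≤ M * (t - s) ^ α)
    (hL : ∀ s t, 0 ≤ s → s ≤ t → t ≤ 1 →
      l * ‖(sig s t).2.2.1 - (sig' s t).2.2.1‖ ≤ M * (t - s) ^ (2 * α))
    (hR : ∀ s t, 0 ≤ s → s ≤ t → t ≤ 1 →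
      l * ‖(sig s t).2.2.2 - (sig' s t).2.2.2‖ ≤ M * (t - s) ^ (2 * α)) {T : ℝ}
    (hT1 : T ≤ 1) (hsmall : sewC (3 * α) * defectC n r Λ (2 * M) * T ^ α ≤ 1 / 2)
    {Y Y' : ℝ → Fin n → A}
    (hY : ∀ t ∈ Icc 0 T, HasDerivWithinAt Y (germ cf cg ch (Y t) (rate ξ Θ t)) (Icc 0 T) t)
    (hY' : ∀ t ∈ Icc 0 T, HasDerivWithinAt Y' (germ cf cg ch (Y' t) (rate ξ' Θ' t)) (Icc 0 T) t)
    (hYY : Y 0 = Y' 0) (h0 : ‖Y 0‖ + (incC n Λ (2 * M) + remC n Λ (2 * M)) * T ^ α < r) :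
    ∀ t ∈ Icc 0 T, l * ‖Y t - Y' t‖ ≤ r := by
  set Z : ℝ → Fin n → Twin l A := fun t i => Twin.mk l (Y t i, Y' t i) with hZ
  have hd : ∀ t ∈ Icc 0 T, HasDerivWithinAt Z (fun i => Twin.mk l
      (germ cf cg ch (Y t) (rate ξ Θ t) i, germ cf cg ch (Y' t) (rate ξ' Θ' t) i)) (Icc 0 T) t := by
    intro t ht
    refine hasDerivWithinAt_pi.2 fun i => ?_
    exact (Twin.mkL l).hasFDerivAt.comp_hasDerivWithinAt t
      ((hasDerivWithinAt_pi.1 (hY t ht) i).prodMk (hasDerivWithinAt_pi.1 (hY' t ht) i))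
  have hfin := norm_lt_of_solution (Y := Z) H hΛ (by positivity) hα hα' (Twin.norm_one.le.trans hm)
    (D.twin D' h₁ hL hR) hT1 hsmall (fun t ht => (hd t ht).continuousWithinAt)
    (fun t ht hZt => by
      convert hd t ht using 1
      funext i
      ext
      · rw [map_germ (π := Twin.fstHom) Twin.fstL.continuous H (Twin.norm_one.le.trans hm) hZt
          (v' := rate ξ Θ t) rfl (fun j => rfl) (fun j' j x => rfl) (fun j' j x => rfl) i]
        rfl
      · rw [map_germ (π := Twin.sndHom) Twin.sndL.continuous H (Twin.norm_one.le.trans hm) hZt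
          (v' := rate ξ' Θ' t) rfl (fun j => rfl) (fun j' j x => rfl) (fun j' j x => rfl) i]
        rfl) (by
      refine lt_of_le_of_lt ?_ h0
      gcongr
      refine (norm_twin₁_le _ _).trans ?_
      rw [← hYY, sub_self, norm_zero, mul_zero, add_zero, max_self])
  intro t ht
  have h0r : 0 ≤ r := (norm_nonneg _).trans (hfin t ht).le
  rcases eq_or_ne l 0 with rfl | hl
  · simpa using h0r
  · rw [← le_div_iff₀' (by positivity)]
    refine (pi_norm_le_iff_of_nonneg (by positivity)).2 fun i => ?_
    rw [le_div_iff₀' (by positivity)]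
    exact (Twin.mul_norm_sub_le (Z t i)).trans ((norm_le_pi_norm _ i).trans (hfin t ht).le)

end Comparison

open MeasureTheory

/-! ### Stationary covariances of small range -/

/-- A continuous probability density supported in `(-a, a)`. -/
structure IsKernel (a : ℝ) (γ : ℝ → ℝ) : Prop where
  cont : Continuous γ
  nonneg : ∀ x, 0 ≤ γ x
  supp : ∀ x, a ≤ |x| → γ x = 0
  integral : ∫ x, γ x = 1

namespace IsKernel
variable {a : ℝ} {γ : ℝ → ℝ}

theorem width_nonneg (h : IsKernel a γ) : 0 ≤ a := by
  by_contra! ha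
  have : γ = fun _ => 0 := funext fun x => h.supp x (ha.le.trans (abs_nonneg x))
  simpa [this] using h.integral

theorem mono (h : IsKernel a γ) {b : ℝ} (hab : a ≤ b) : IsKernel b γ :=
  ⟨h.cont, h.nonneg, fun x hx => h.supp x (hab.trans hx), h.integral⟩

theorem integrable (h : IsKernel a γ) : Integrable γ := by
  by_contra hn
  have := integral_undef hn
  rw [h.integral] at this
  exact one_ne_zero this

theorem integrable_sub (h : IsKernel a γ) (x : ℝ) : Integrable fun y => γ (x - y) :=
  h.integrable.comp_sub_left x

theorem integral_sub (h : IsKernel a γ) (x : ℝ) : ∫ y, γ (x - y) = 1 := by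
  rw [integral_sub_left_eq_self γ volume x, h.integral]

theorem slice_nonneg (h : IsKernel a γ) (x : ℝ) {s t : ℝ} (hst : s ≤ t) :
    0 ≤ ∫ y in s..t, γ (x - y) :=
  intervalIntegral.integral_nonneg hst fun _ _ => h.nonneg _

theorem slice_le (h : IsKernel a γ) (x : ℝ) {s t : ℝ} (hst : s ≤ t) :
    ∫ y in s..t, γ (x - y) ≤ 1 := by
  rw [intervalIntegral.integral_of_le hst, ← h.integral_sub x]
  exact setIntegral_le_integral (h.integrable_sub x) (Filter.Eventually.of_forall fun _ => h.nonneg _)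

theorem slice_eq (h : IsKernel a γ) {x s t : ℝ} (hst : s ≤ t) (hs : s ≤ x - a) (ht : x + a ≤ t) :
    ∫ y in s..t, γ (x - y) = 1 := by
  rw [intervalIntegral.integral_of_le hst, ← h.integral_sub x]
  refine setIntegral_eq_integral_of_forall_compl_eq_zero fun y hy => h.supp _ ?_
  by_cases h1 : s < y
  · have h2 : t < y := by
      by_contra! h2; exact hy ⟨h1, h2⟩
    rw [abs_sub_comm]
    exact le_trans (by linarith) (le_abs_self _)
  · exact le_trans (by linarith) (le_abs_self _)

theorem continuous_slice (h : IsKernel a γ) (s t : ℝ) :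
    Continuous fun x => ∫ y in s..t, γ (x - y) :=
  intervalIntegral.continuous_parametric_intervalIntegral_of_continuous'
    (f := fun x y => γ (x - y)) (by have := h.cont; fun_prop) s t

theorem rect_nonneg (h : IsKernel a γ) {s r r' : ℝ} (hr : s ≤ r) (hr' : s ≤ r') :
    0 ≤ ∫ x in s..r, ∫ y in s..r', γ (x - y) :=
  intervalIntegral.integral_nonneg hr fun x _ => h.slice_nonneg x hr'

/-- The covariance of two increments which start together is at most the length of the overlap. -/
theorem rect_le (h : IsKernel a γ) {s r r' : ℝ} (hr : s ≤ r) (hr' : s ≤ r') :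
    ∫ x in s..r, ∫ y in s..r', γ (x - y) ≤ r - s := by
  calc _ ≤ ∫ x in s..r, (1 : ℝ) :=
        intervalIntegral.integral_mono_on hr ((h.continuous_slice s r').intervalIntegrable _ _)
          (continuous_const.intervalIntegrable _ _) fun x _ => h.slice_le x hr'
    _ = r - s := by simp

/-- The covariance of two increments which start together falls short of the length of the overlap
by at most the range at the two ends. -/
theorem le_rect (h : IsKernel a γ) {s m r r' : ℝ} (hm : s ≤ m) (hr : m ≤ r) (hr' : m ≤ r') :
    m - s - 2 * a ≤ ∫ x in s..r, ∫ y in s..r', γ (x - y) := by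
  have ha := h.width_nonneg
  by_cases h0 : m - s - 2 * a ≤ 0
  · exact h0.trans (h.rect_nonneg (hm.trans hr) (hm.trans hr'))
  · have hi := fun u v => (h.continuous_slice s r').intervalIntegrable (μ := volume) u v
    have h1 : ∫ x in (s + a)..(m - a), ∫ y in s..r', γ (x - y) = m - s - 2 * a := by
      have : ∫ x in (s + a)..(m - a), ∫ y in s..r', γ (x - y) =
          ∫ x in (s + a)..(m - a), (1 : ℝ) := by
        refine intervalIntegral.integral_congr fun x hx => ?_
        rw [uIcc_of_le (by linarith)] at hx
        exact h.slice_eq (hm.trans hr') (by linarith [hx.1]) (by linarith [hx.2])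
      rw [this]
      simp
      ring
    rw [← h1]
    exact intervalIntegral.integral_mono_interval (by linarith) (by linarith) (by linarith)
      (Filter.Eventually.of_forall fun x => h.slice_nonneg x (hm.trans hr')) (hi _ _)

end IsKernel

/-! ### Increments of smooth Gaussian-type families -/

section Increments
variable {V : Type*} [NormedAddCommGroup V] [InnerProductSpace ℝ V] [CompleteSpace V]
variable {W : Type*} [NormedAddCommGroup W] [InnerProductSpace ℝ W] [CompleteSpace W]

/-- The increment of the primitive of `ζ`. -/
def incr (ζ : ℝ → V) (s t : ℝ) : V := ∫ x in s..t, ζ x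

variable {ζ ζ' : ℝ → V} {γ γ₁ : ℝ → ℝ} {a : ℝ}

theorem incr_add_incr (hζ : Continuous ζ) (s u t : ℝ) : incr ζ s u + incr ζ u t = incr ζ s t :=
  intervalIntegral.integral_add_adjacent_intervals (hζ.intervalIntegrable _ _)
    (hζ.intervalIntegrable _ _)

@[simp] theorem incr_self (ζ : ℝ → V) (s : ℝ) : incr ζ s s = 0 := intervalIntegral.integral_same

theorem hasDerivAt_incr (hζ : Continuous ζ) (s t : ℝ) : HasDerivAt (incr ζ s) (ζ t) t :=
  intervalIntegral.integral_hasDerivAt_right (hζ.intervalIntegrable _ _)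
    (hζ.stronglyMeasurableAtFilter _ _) hζ.continuousAt

theorem continuous_incr (hζ : Continuous ζ) (s : ℝ) : Continuous (incr ζ s) :=
  continuous_iff_continuousAt.2 fun t => (hasDerivAt_incr hζ s t).continuousAt

theorem inner_incr_left (hζ : Continuous ζ) (s t : ℝ) (v : V) :
    inner ℝ (incr ζ s t) v = ∫ x in s..t, inner ℝ (ζ x) v := by
  have := ((innerSL ℝ).flip v).intervalIntegral_comp_comm (hζ.intervalIntegrable s t)
    (μ := volume)
  exact this.symm

theorem inner_incr_right (hζ : Continuous ζ) (s t : ℝ) (v : V) :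
    inner ℝ v (incr ζ s t) = ∫ x in s..t, inner ℝ v (ζ x) :=
  ((innerSL ℝ v).intervalIntegral_comp_comm (hζ.intervalIntegrable s t)).symm

theorem inner_incr (hζ : Continuous ζ) (hζ' : Continuous ζ') (s r s' r' : ℝ) :
    inner ℝ (incr ζ s r) (incr ζ' s' r') =
      ∫ x in s..r, ∫ y in s'..r', inner ℝ (ζ x) (ζ' y) := by
  rw [inner_incr_left hζ]
  simp only [inner_incr_right hζ']

/-- The trace of the second-order integral of a noise against itself: integration by parts. -/
theorem integral_inner_incr_self (hζ : Continuous ζ) (s t : ℝ) :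
    ∫ r in s..t, inner ℝ (incr ζ s r) (ζ r) = ‖incr ζ s t‖ ^ 2 / 2 := by
  have h : ∀ r, HasDerivAt (fun r => ‖incr ζ s r‖ ^ 2 / 2) (inner ℝ (incr ζ s r) (ζ r)) r := by
    intro r
    have := (hasDerivAt_incr hζ s r).norm_sq.div_const 2
    rwa [mul_div_cancel_left₀ _ (two_ne_zero' ℝ)] at this
  rw [intervalIntegral.integral_eq_sub_of_hasDerivAt (fun r _ => h r)
    (((continuous_incr hζ s).inner hζ).intervalIntegrable _ _)]
  simp

theorem inner_incr_cov (hζ : Continuous ζ) (hζ' : Continuous ζ')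
    (h : ∀ x y, inner ℝ (ζ x) (ζ' y) = γ (x - y)) (s r r' : ℝ) :
    inner ℝ (incr ζ s r) (incr ζ' s r') = ∫ x in s..r, ∫ y in s..r', γ (x - y) := by
  rw [inner_incr hζ hζ']
  simp only [h]

theorem norm_incr_sq_le (hζ : Continuous ζ) (hγ : IsKernel a γ)
    (h : ∀ x y, inner ℝ (ζ x) (ζ y) = γ (x - y)) {s t : ℝ} (hst : s ≤ t) :
    ‖incr ζ s t‖ ^ 2 ≤ t - s := by
  rw [← real_inner_self_eq_norm_sq, inner_incr_cov hζ hζ h]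
  exact hγ.rect_le hst hst

theorem le_norm_incr_sq (hζ : Continuous ζ) (hγ : IsKernel a γ)
    (h : ∀ x y, inner ℝ (ζ x) (ζ y) = γ (x - y)) {s t : ℝ} (hst : s ≤ t) :
    t - s - 2 * a ≤ ‖incr ζ s t‖ ^ 2 := by
  rw [← real_inner_self_eq_norm_sq, inner_incr_cov hζ hζ h]
  exact hγ.le_rect hst le_rfl le_rfl

/-- Two families whose covariances have range at most `a` have close increments: in
`‖b‖² - 2 ⟨b, b'⟩ + ‖b'‖²` all three terms are `t - s` up to a multiple of `a`. -/
theorem norm_incr_sub_sq_le (hζ : Continuous ζ) (hζ' : Continuous ζ') {a₁ a₂ : ℝ}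
    {γ' γ'' : ℝ → ℝ} (hγ : IsKernel a₁ γ) (hγ' : IsKernel a γ') (hγ'' : IsKernel a₂ γ'')
    (h : ∀ x y, inner ℝ (ζ x) (ζ y) = γ (x - y)) (h' : ∀ x y, inner ℝ (ζ x) (ζ' y) = γ' (x - y))
    (h'' : ∀ x y, inner ℝ (ζ' x) (ζ' y) = γ'' (x - y)) {s t : ℝ} (hst : s ≤ t) :
    ‖incr ζ s t - incr ζ' s t‖ ^ 2 ≤ 4 * a ∧ ‖incr ζ s t - incr ζ' s t‖ ^ 2 ≤ 2 * (t - s) := by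
  have h1 := norm_incr_sq_le hζ hγ h hst
  have h2 := norm_incr_sq_le hζ' hγ'' h'' hst
  have h3 := hγ'.le_rect hst le_rfl le_rfl
  have h4 := hγ'.rect_nonneg hst hst
  rw [← inner_incr_cov hζ hζ' h'] at h3 h4
  rw [norm_sub_sq_real]
  constructor <;> linarith

/-- An upper bound for the inner product of two second-order integrals: `F(r)` stands for
`incr ζ₁ s r ⊗ ζ₂(r)`, in either order of the factors, and `γ₂` for the covariance of `ζ₂`. -/
theorem inner_iterated_le {ζ₁ ζ₁' : ℝ → V} {F F' : ℝ → W} (h₁ : Continuous ζ₁)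
    (h₁' : Continuous ζ₁') (hF : Continuous F) (hF' : Continuous F') {γ₂ : ℝ → ℝ} {a₁ a₂ : ℝ}
    (hγ₁ : IsKernel a₁ γ₁) (hγ₂ : IsKernel a₂ γ₂)
    (hc₁ : ∀ x y, inner ℝ (ζ₁ x) (ζ₁' y) = γ₁ (x - y)) {s t : ℝ} (hst : s ≤ t)
    (hc : ∀ x y, inner ℝ (F x) (F' y) = inner ℝ (incr ζ₁ s x) (incr ζ₁' s y) * γ₂ (x - y)) :
    inner ℝ (incr F s t) (incr F' s t) ≤ (t - s) ^ 2 / 2 := by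
  rw [inner_incr hF hF']
  have hcont : Continuous fun x => ∫ y in s..t, inner ℝ (F x) (F' y) :=
    intervalIntegral.continuous_parametric_intervalIntegral_of_continuous'
      (f := fun x y => inner ℝ (F x) (F' y)) (by fun_prop) s t
  have hx : ∀ x ∈ Icc s t, ∫ y in s..t, inner ℝ (F x) (F' y) ≤ x - s := by
    intro x hx
    have hxs : 0 ≤ x - s := by linarith [hx.1]
    calc _ ≤ ∫ y in s..t, (x - s) * γ₂ (x - y) := by
          refine intervalIntegral.integral_mono_on hst
            (Continuous.intervalIntegrable (by fun_prop) _ _)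
            (Continuous.intervalIntegrable (by have := hγ₂.cont; fun_prop) _ _) fun y hy => ?_
          rw [hc, inner_incr_cov h₁ h₁' hc₁]
          exact mul_le_mul_of_nonneg_right (hγ₁.rect_le hx.1 hy.1) (hγ₂.nonneg _)
      _ ≤ (x - s) * 1 := by
          rw [intervalIntegral.integral_const_mul]
          exact mul_le_mul_of_nonneg_left (hγ₂.slice_le x hst) hxs
      _ = x - s := mul_one _
  calc _ ≤ ∫ x in s..t, (x - s) :=
        intervalIntegral.integral_mono_on hst (hcont.intervalIntegrable _ _)
          (Continuous.intervalIntegrable (by fun_prop) _ _) hx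
    _ = (t - s) ^ 2 / 2 := by
        simp
        ring

/-- A lower bound for the inner product of two second-order integrals, which differs from the upper
bound by a multiple of the range of the covariances. -/
theorem le_inner_iterated {ζ₁ ζ₁' : ℝ → V} {F F' : ℝ → W} (h₁ : Continuous ζ₁)
    (h₁' : Continuous ζ₁') (hF : Continuous F) (hF' : Continuous F') {γ₂ : ℝ → ℝ}
    (hγ₁ : IsKernel a γ₁) (hγ₂ : IsKernel a γ₂)
    (hc₁ : ∀ x y, inner ℝ (ζ₁ x) (ζ₁' y) = γ₁ (x - y)) {s t : ℝ} (hst : s ≤ t)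
    (hc : ∀ x y, inner ℝ (F x) (F' y) = inner ℝ (incr ζ₁ s x) (incr ζ₁' s y) * γ₂ (x - y)) :
    (t - s) ^ 2 / 2 - 5 * a * (t - s) ≤ inner ℝ (incr F s t) (incr F' s t) := by
  have ha := hγ₁.width_nonneg
  rw [inner_incr hF hF']
  have hcont : Continuous fun x => ∫ y in s..t, inner ℝ (F x) (F' y) :=
    intervalIntegral.continuous_parametric_intervalIntegral_of_continuous'
      (f := fun x y => inner ℝ (F x) (F' y)) (by fun_prop) s t
  have hcs := hγ₂.continuous_slice s t
  have hx : ∀ x ∈ Icc s t, (x - s) - 3 * a - (t - s) * (1 - ∫ y in s..t, γ₂ (x - y)) ≤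
      ∫ y in s..t, inner ℝ (F x) (F' y) := by
    intro x hx
    have hI := hγ₂.slice_le x hst
    have hI0 := hγ₂.slice_nonneg x hst
    have hle : ∫ y in s..t, (x - s - 3 * a) * γ₂ (x - y) ≤
        ∫ y in s..t, inner ℝ (F x) (F' y) := by
      refine intervalIntegral.integral_mono_on hst
            (Continuous.intervalIntegrable (by have := hγ₂.cont; fun_prop) _ _)
            (Continuous.intervalIntegrable (by fun_prop) _ _) fun y hy => ?_
      rw [hc, inner_incr_cov h₁ h₁' hc₁]
      by_cases hxy : a ≤ |x - y|
      · rw [hγ₂.supp _ hxy, mul_zero, mul_zero]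
      · refine mul_le_mul_of_nonneg_right ?_ (hγ₂.nonneg _)
        have hlt := abs_lt.1 (not_le.1 hxy)
        have := hγ₁.le_rect (le_min hx.1 hy.1) (min_le_left x y) (min_le_right x y)
        refine le_trans ?_ this
        have : x - a ≤ min x y := le_min (by linarith) (by linarith [hlt.2])
        linarith
    rw [intervalIntegral.integral_const_mul] at hle
    refine le_trans ?_ hle
    have h2 := hx.2
    nlinarith [mul_nonneg ha (sub_nonneg.2 hI), mul_nonneg (sub_nonneg.2 h2) (sub_nonneg.2 hI)]
  refine le_trans ?_ (intervalIntegral.integral_mono_on hst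
    (Continuous.intervalIntegrable (by fun_prop) _ _) (hcont.intervalIntegrable _ _) hx)
  have hrect := hγ₂.le_rect hst le_rfl le_rfl
  have e : ∫ x in s..t, ((x - s) - 3 * a - (t - s) * (1 - ∫ y in s..t, γ₂ (x - y))) =
      (t - s) ^ 2 / 2 - 3 * a * (t - s) -
        (t - s) * ((t - s) - ∫ x in s..t, ∫ y in s..t, γ₂ (x - y)) := by
    rw [intervalIntegral.integral_sub (Continuous.intervalIntegrable (by fun_prop) _ _)
      (Continuous.intervalIntegrable (by fun_prop) _ _), intervalIntegral.integral_const_mul,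
      intervalIntegral.integral_sub (Continuous.intervalIntegrable (by fun_prop) _ _)
      (hcs.intervalIntegrable _ _)]
    simp
    ring
  rw [e]
  nlinarith [mul_le_mul_of_nonneg_left hrect (sub_nonneg.2 hst)]

/-- The norm of a second-order integral is of order `t - s`. -/
theorem norm_iterated_sq_le {ζ₁ : ℝ → V} {F : ℝ → W} (h₁ : Continuous ζ₁) (hF : Continuous F)
    {γ₂ : ℝ → ℝ} {a₁ a₂ : ℝ} (hγ₁ : IsKernel a₁ γ₁) (hγ₂ : IsKernel a₂ γ₂)
    (hc₁ : ∀ x y, inner ℝ (ζ₁ x) (ζ₁ y) = γ₁ (x - y)) {s t : ℝ} (hst : s ≤ t)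
    (hc : ∀ x y, inner ℝ (F x) (F y) = inner ℝ (incr ζ₁ s x) (incr ζ₁ s y) * γ₂ (x - y)) :
    ‖incr F s t‖ ^ 2 ≤ (t - s) ^ 2 / 2 := by
  rw [← real_inner_self_eq_norm_sq]
  exact inner_iterated_le h₁ h₁ hF hF hγ₁ hγ₂ hc₁ hst hc

theorem inner_iterated_nonneg {ζ₁ ζ₁' : ℝ → V} {F F' : ℝ → W} (h₁ : Continuous ζ₁)
    (h₁' : Continuous ζ₁') (hF : Continuous F) (hF' : Continuous F') {γ₂ : ℝ → ℝ} {a₁ a₂ : ℝ}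
    (hγ₁ : IsKernel a₁ γ₁) (hγ₂ : IsKernel a₂ γ₂)
    (hc₁ : ∀ x y, inner ℝ (ζ₁ x) (ζ₁' y) = γ₁ (x - y)) {s t : ℝ} (hst : s ≤ t)
    (hc : ∀ x y, inner ℝ (F x) (F' y) = inner ℝ (incr ζ₁ s x) (incr ζ₁' s y) * γ₂ (x - y)) :
    0 ≤ inner ℝ (incr F s t) (incr F' s t) := by
  rw [inner_incr hF hF']
  refine intervalIntegral.integral_nonneg hst fun x hx =>
    intervalIntegral.integral_nonneg hst fun y hy => ?_
  rw [hc, inner_incr_cov h₁ h₁' hc₁]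
  exact mul_nonneg (hγ₁.rect_nonneg hx.1 hy.1) (hγ₂.nonneg _)

/-- Second-order integrals of two families of noises which are close to each other. -/
theorem norm_iterated_sub_sq_le {ζ₁ ζ₁' : ℝ → V} {F F' : ℝ → W} (h₁ : Continuous ζ₁)
    (h₁' : Continuous ζ₁') (hF : Continuous F) (hF' : Continuous F') {a₁ a₂ b₁ b₂ : ℝ}
    {κ κ' κ'' μ μ' μ'' : ℝ → ℝ} (hκ : IsKernel a₁ κ) (hκ' : IsKernel a κ')
    (hκ'' : IsKernel a₂ κ'') (hμ : IsKernel b₁ μ) (hμ' : IsKernel a μ') (hμ'' : IsKernel b₂ μ'')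
    (k : ∀ x y, inner ℝ (ζ₁ x) (ζ₁ y) = κ (x - y))
    (k' : ∀ x y, inner ℝ (ζ₁ x) (ζ₁' y) = κ' (x - y))
    (k'' : ∀ x y, inner ℝ (ζ₁' x) (ζ₁' y) = κ'' (x - y)) {s t : ℝ} (hst : s ≤ t)
    (c : ∀ x y, inner ℝ (F x) (F y) = inner ℝ (incr ζ₁ s x) (incr ζ₁ s y) * μ (x - y))
    (c' : ∀ x y, inner ℝ (F x) (F' y) = inner ℝ (incr ζ₁ s x) (incr ζ₁' s y) * μ' (x - y))
    (c'' : ∀ x y, inner ℝ (F' x) (F' y) = inner ℝ (incr ζ₁' s x) (incr ζ₁' s y) * μ'' (x - y)) :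
    ‖incr F s t - incr F' s t‖ ^ 2 ≤ 10 * a * (t - s) ∧
      ‖incr F s t - incr F' s t‖ ^ 2 ≤ (t - s) ^ 2 := by
  have e1 := norm_iterated_sq_le h₁ hF hκ hμ k hst c
  have e2 := norm_iterated_sq_le h₁' hF' hκ'' hμ'' k'' hst c''
  have e3 := le_inner_iterated h₁ h₁' hF hF' hκ' hμ' k' hst c'
  have e4 := inner_iterated_nonneg h₁ h₁' hF hF' hκ' hμ' k' hst c'
  rw [norm_sub_sq_real]
  constructor <;> linarith

end Increments

open scoped Convolution

/-! ### Covariances of mollified white noise -/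

section Kernel
variable {a b : ℝ} {f g : ℝ → ℝ}

theorem IsKernel.hasCompactSupport (h : IsKernel a f) : HasCompactSupport f :=
  HasCompactSupport.of_support_subset_isCompact (isCompact_Icc (a := -a) (b := a)) fun x hx => by
    have h1 : |x| < a := not_le.1 fun h2 => hx (h.supp x h2)
    exact ⟨(abs_lt.1 h1).1.le, (abs_lt.1 h1).2.le⟩

theorem IsKernel.convolution (hf : IsKernel a f) (hg : IsKernel b g) :
    IsKernel (a + b) (f ⋆[ContinuousLinearMap.mul ℝ ℝ] g) where
  cont := hg.hasCompactSupport.continuous_convolution_right _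
    hf.integrable.locallyIntegrable hg.cont
  nonneg x := integral_nonneg fun y => mul_nonneg (hf.nonneg _) (hg.nonneg _)
  supp x hx := by
    have : ∀ y, f y * g (x - y) = 0 := fun y => by
      by_cases hy : a ≤ |y|
      · rw [hf.supp y hy, zero_mul]
      · have := abs_sub_abs_le_abs_sub x y
        rw [hg.supp (x - y) (by linarith), mul_zero]
    simp [convolution_def, this]
  integral := by
    rw [integral_convolution _ hf.integrable hg.integrable]
    simp [hf.integral, hg.integral]

theorem convolution_even (hf : ∀ x, f (-x) = f x) (hg : ∀ x, g (-x) = g x) (x : ℝ) :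
    (f ⋆[ContinuousLinearMap.mul ℝ ℝ] g) (-x) = (f ⋆[ContinuousLinearMap.mul ℝ ℝ] g) x := by
  rw [convolution_def, convolution_def, ← integral_neg_eq_self]
  refine integral_congr_ae (Filter.Eventually.of_forall fun y => ?_)
  simp only [ContinuousLinearMap.mul_apply']
  rw [hf, ← hg (x - y)]
  congr 2
  ring

/-- The covariance of two mollifications depends on the difference of the points only. -/
theorem integral_mul_translate (hf : ∀ x, f (-x) = f x) (x y : ℝ) :
    ∫ z, f (z - x) * g (z - y) = (f ⋆[ContinuousLinearMap.mul ℝ ℝ] g) (x - y) := by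
  rw [convolution_def, ← integral_add_right_eq_self (fun z => f (z - x) * g (z - y)) x,
    ← integral_neg_eq_self]
  refine integral_congr_ae (Filter.Eventually.of_forall fun z => ?_)
  simp only [ContinuousLinearMap.mul_apply']
  rw [add_sub_cancel_right, hf]
  congr 2
  ring

/-- Half of the mass of an even kernel lies to the right of the origin. -/
theorem IsKernel.tendsto_half (h : IsKernel a f) (he : ∀ x, f (-x) = f x) :
    Filter.Tendsto (fun S => ∫ x in (0 : ℝ)..S, f x) Filter.atTop (𝓝 (1 / 2)) := by
  have h1 := integral_comp_abs (f := f)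
  have h2 : (fun x => f |x|) = f := funext fun x => by
    rcases abs_choice x with hx | hx <;> rw [hx]
    exact he x
  rw [h2, h.integral] at h1
  have h3 : ∫ x in Ioi (0 : ℝ), f x = 1 / 2 := by linarith
  rw [← h3]
  exact intervalIntegral_tendsto_integral_Ioi 0 h.integrable.integrableOn Filter.tendsto_id

end Kernel

namespace Mollifier

/-- The mollifier at scale `ε` around the origin. -/
def at0 (ρ : Mollifier) (ε : ℝ) : ℝ → ℝ := ρ.scaled ε 0

theorem scaled_eq (ρ : Mollifier) (ε x y : ℝ) : ρ.scaled ε x y = ρ.at0 ε (y - x) := by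
  simp [at0, scaled]

theorem at0_even (ρ : Mollifier) (ε x : ℝ) : ρ.at0 ε (-x) = ρ.at0 ε x := by
  simp [at0, scaled, neg_div, ρ.even]

/-- The radius of a ball which contains the support. -/
def radius (ρ : Mollifier) : ℝ := ρ.compact.exists_pos_le_norm.choose

theorem radius_pos (ρ : Mollifier) : 0 < ρ.radius := ρ.compact.exists_pos_le_norm.choose_spec.1

theorem eq_zero (ρ : Mollifier) {x : ℝ} (hx : ρ.radius ≤ |x|) : ρ.toFun x = 0 :=
  ρ.compact.exists_pos_le_norm.choose_spec.2 x hx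

theorem isKernel_at0 (ρ : Mollifier) {ε : ℝ} (hε : 0 < ε) :
    IsKernel (ρ.radius * ε) (ρ.at0 ε) where
  cont := by
    have := ρ.smooth.continuous
    unfold at0 scaled
    fun_prop
  nonneg x := mul_nonneg (by positivity) (ρ.nonneg _)
  supp x hx := by
    rw [at0, scaled, ρ.eq_zero, mul_zero]
    rwa [sub_zero, abs_div, abs_of_pos hε, le_div_iff₀ hε]
  integral := by
    simp only [at0, scaled, sub_zero]
    rw [integral_const_mul, Measure.integral_comp_div, ρ.integral_eq_one, abs_of_pos hε,
      smul_eq_mul, mul_one, inv_mul_cancel₀ hε.ne']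

/-- The covariance function of two mollifications of a white noise. -/
def cov (ρ : Mollifier) (ε δ : ℝ) : ℝ → ℝ :=
  ρ.at0 ε ⋆[ContinuousLinearMap.mul ℝ ℝ] ρ.at0 δ

theorem isKernel_cov (ρ : Mollifier) {ε δ : ℝ} (hε : 0 < ε) (hδ : 0 < δ) :
    IsKernel (ρ.radius * (ε + δ)) (ρ.cov ε δ) := by
  rw [mul_add]
  exact (ρ.isKernel_at0 hε).convolution (ρ.isKernel_at0 hδ)

theorem cov_even (ρ : Mollifier) (ε δ x : ℝ) : ρ.cov ε δ (-x) = ρ.cov ε δ x :=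
  convolution_even (ρ.at0_even ε) (ρ.at0_even δ) x

end Mollifier

section Component
variable {n : ℕ}

theorem inner_component (j j' : Fin n) (φ ψ : Lp ℝ 2 (volume : Measure ℝ)) :
    inner ℝ (component j φ) (component j' ψ) = if j = j' then inner ℝ φ ψ else 0 := by
  rw [L2.inner_def, L2.inner_def]
  have h1 := (ContinuousLinearMap.toSpanSingleton ℝ
    (EuclideanSpace.single j (1 : ℝ))).coeFn_compLp φ
  have h2 := (ContinuousLinearMap.toSpanSingleton ℝ
    (EuclideanSpace.single j' (1 : ℝ))).coeFn_compLp ψ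
  have h3 : (fun x => inner ℝ (component j φ x) (component j' ψ x)) =ᵐ[volume]
      fun x => if j = j' then inner ℝ (φ x) (ψ x) else 0 := by
    filter_upwards [h1, h2] with x hx1 hx2
    change inner ℝ ((ContinuousLinearMap.toSpanSingleton ℝ
      (EuclideanSpace.single j (1 : ℝ))).compLp φ x) ((ContinuousLinearMap.toSpanSingleton ℝ
      (EuclideanSpace.single j' (1 : ℝ))).compLp ψ x) = _
    rw [hx1, hx2]
    by_cases h : j = j'
    · simp [ContinuousLinearMap.toSpanSingleton_apply, inner_smul_left, inner_smul_right, h]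
    · simp [ContinuousLinearMap.toSpanSingleton_apply, inner_smul_left, inner_smul_right, h,
        EuclideanSpace.inner_single_left]
  rw [integral_congr_ae h3]
  split_ifs <;> simp

theorem norm_component (j : Fin n) (φ : Lp ℝ 2 (volume : Measure ℝ)) :
    ‖component j φ‖ = ‖φ‖ := by
  rw [← sq_eq_sq₀ (norm_nonneg _) (norm_nonneg _), ← real_inner_self_eq_norm_sq,
    ← real_inner_self_eq_norm_sq, inner_component, if_pos rfl]

/-- The vector `ρ_ε(· - x) e_j` of the mollified noise at `x`. -/
def mollVec (ρ : Mollifier) (j : Fin n) (ε x : ℝ) : NoiseSpace n :=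
  component j ((ρ.memLp ε x).toLp _)

theorem noiseMoll_eq (q : Ioo (-1 : ℝ) 1) (ρ : Mollifier) (j : Fin n) (ε x : ℝ) :
    noiseMoll q ρ j ε x = xi (mollVec ρ j ε x) := rfl

theorem inner_toLp {φ ψ : ℝ → ℝ} (hφ : MemLp φ 2 volume) (hψ : MemLp ψ 2 volume) :
    inner ℝ (hφ.toLp φ) (hψ.toLp ψ) = ∫ z, φ z * ψ z := by
  rw [L2.inner_def]
  refine integral_congr_ae ?_
  filter_upwards [hφ.coeFn_toLp, hψ.coeFn_toLp] with z h1 h2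
  rw [h1, h2]
  simp [mul_comm]

theorem inner_mollVec (ρ : Mollifier) (j : Fin n) (ε δ x y : ℝ) :
    inner ℝ (mollVec ρ j ε x) (mollVec ρ j δ y) = ρ.cov ε δ (x - y) := by
  rw [mollVec, mollVec, inner_component, if_pos rfl, inner_toLp]
  simp only [Mollifier.scaled_eq]
  exact integral_mul_translate (ρ.at0_even ε) x y

theorem inner_mollVec_of_ne (ρ ρ' : Mollifier) {j j' : Fin n} (h : j ≠ j') (ε δ x y : ℝ) :
    inner ℝ (mollVec ρ j ε x) (mollVec ρ' j' δ y) = 0 := by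
  rw [mollVec, mollVec, inner_component, if_neg h]

/-- The mollified noise is Lipschitz at every fixed scale; the constant blows up as `ε ↓ 0`. -/
theorem exists_norm_mollVec_sub_le (ρ : Mollifier) (j : Fin n) {ε : ℝ} (hε : 0 < ε) :
    ∃ L, 0 ≤ L ∧ ∀ x y, x ≤ y → y ≤ x + 1 →
      ‖mollVec ρ j ε y - mollVec ρ j ε x‖ ≤ L * (y - x) := by
  have hK := ρ.isKernel_at0 hε
  obtain ⟨C, hC⟩ := ContDiff.lipschitzWith_of_hasCompactSupport (𝕂 := ℝ) (n := ∞)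
    hK.hasCompactSupport (by have := ρ.smooth; unfold Mollifier.at0 Mollifier.scaled; fun_prop)
    (by simp)
  set c := ρ.radius * ε
  have hc : 0 ≤ c := hK.width_nonneg
  refine ⟨C * Real.sqrt (2 * c + 1), by positivity, fun x y hxy hy => ?_⟩
  have h0 : 0 ≤ y - x := sub_nonneg.2 hxy
  rw [mollVec, mollVec, ← map_sub, norm_component, ← MemLp.toLp_sub]
  refine (sq_le_sq₀ (norm_nonneg _) (by positivity)).1 ?_
  rw [← real_inner_self_eq_norm_sq, inner_toLp]
  have hz : ∀ z ∉ Icc (x - c) (x + 1 + c), (ρ.scaled ε y - ρ.scaled ε x) z *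
      (ρ.scaled ε y - ρ.scaled ε x) z = 0 := fun z hz => by
    have h1 : c ≤ |z - y| ∧ c ≤ |z - x| := by
      by_cases h2 : x - c ≤ z
      · have h3 : x + 1 + c < z := by
          by_contra! h3; exact hz ⟨h2, h3⟩
        exact ⟨le_trans (by linarith) (le_abs_self _), le_trans (by linarith) (le_abs_self _)⟩
      · exact ⟨le_trans (by linarith) (neg_le_abs _), le_trans (by linarith) (neg_le_abs _)⟩
    rw [Pi.sub_apply, Mollifier.scaled_eq, Mollifier.scaled_eq, hK.supp _ h1.1, hK.supp _ h1.2]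
    simp
  rw [← setIntegral_eq_integral_of_forall_compl_eq_zero hz]
  have hb := norm_setIntegral_le_of_norm_le_const (μ := volume) (s := Icc (x - c) (x + 1 + c))
    (f := fun z => (ρ.scaled ε y - ρ.scaled ε x) z * (ρ.scaled ε y - ρ.scaled ε x) z)
    (C := (C * (y - x)) ^ 2) (by simp) (fun z _ => by
      have h1 := hC.dist_le_mul (z - y) (z - x)
      rw [Real.dist_eq, Real.dist_eq, show z - y - (z - x) = -(y - x) by ring, abs_neg,
        abs_of_nonneg h0] at h1
      rw [Pi.sub_apply, Mollifier.scaled_eq, Mollifier.scaled_eq, Real.norm_eq_abs, ← sq,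
        abs_of_nonneg (sq_nonneg _), ← sq_abs]
      gcongr)
  refine (le_abs_self _).trans (hb.trans (le_of_eq ?_))
  rw [Real.volume_real_Icc_of_le (by linarith), mul_pow, mul_pow, mul_pow,
    Real.sq_sqrt (by linarith)]
  ring

theorem continuous_mollVec (ρ : Mollifier) (j : Fin n) {ε : ℝ} (hε : 0 < ε) :
    Continuous (mollVec ρ j ε) := by
  have hc := (ρ.isKernel_cov hε hε).cont
  rw [continuous_iff_continuousAt]
  intro x
  rw [ContinuousAt, tendsto_iff_norm_sub_tendsto_zero]
  have h : ∀ y, ‖mollVec ρ j ε y - mollVec ρ j ε x‖ =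
      Real.sqrt (2 * ρ.cov ε ε 0 - 2 * ρ.cov ε ε (y - x)) := fun y => by
    rw [← Real.sqrt_sq (norm_nonneg _), norm_sub_sq_real, ← real_inner_self_eq_norm_sq,
      ← real_inner_self_eq_norm_sq, inner_mollVec, inner_mollVec, inner_mollVec, sub_self, sub_self]
    congr 1
    ring
  simp only [h]
  have : Continuous fun y => Real.sqrt (2 * ρ.cov ε ε 0 - 2 * ρ.cov ε ε (y - x)) := by fun_prop
  have h2 := this.tendsto x
  simpa using h2

/-- The vector of the Brownian increment over `[s, t]`. -/
def brownVec (j : Fin n) (s t : ℝ) : NoiseSpace n :=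
  component j (indicatorConstLp 2 (measurableSet_uIcc (a := s) (b := t))
    isCompact_uIcc.measure_lt_top.ne 1)

theorem brownian_eq (q : Ioo (-1 : ℝ) 1) (j : Fin n) {s t : ℝ} (hst : s ≤ t) :
    brownian q j s t = xi (brownVec j s t) := by
  rcases hst.eq_or_lt with rfl | hlt
  · have : ‖(brownVec j s s : NoiseSpace n)‖ = 0 := by
      rw [brownVec, norm_component, norm_indicatorConstLp (by simp) (by simp)]
      simp [Measure.real]
    rw [norm_eq_zero.1 this]
    simp [brownian]
  · rw [brownian, Real.sign_of_pos (sub_pos.2 hlt), one_smul]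
    rfl

theorem norm_brownVec_sq (j : Fin n) {s t : ℝ} (hst : s ≤ t) : ‖brownVec j s t‖ ^ 2 = t - s := by
  have h : volume.real (uIcc s t) = t - s := by
    rw [uIcc_of_le hst, Real.volume_real_Icc_of_le hst]
  rw [brownVec, norm_component, norm_indicatorConstLp (by simp) (by simp), h]
  simp only [norm_one, one_mul, ENNReal.toReal_ofNat]
  rw [← Real.sqrt_eq_rpow, Real.sq_sqrt (sub_nonneg.2 hst)]

theorem inner_mollVec_brownVec (ρ : Mollifier) (j : Fin n) (ε x : ℝ) {s t : ℝ} (hst : s ≤ t) :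
    inner ℝ (mollVec ρ j ε x) (brownVec j s t) = ∫ y in s..t, ρ.at0 ε (x - y) := by
  rw [mollVec, brownVec, inner_component, if_pos rfl, real_inner_comm,
    L2.inner_indicatorConstLp_one, uIcc_of_le hst, integral_Icc_eq_integral_Ioc,
    ← intervalIntegral.integral_of_le hst]
  have h1 : (∫ y in s..t, (ρ.memLp ε x).toLp _ y) = ∫ y in s..t, ρ.scaled ε x y :=
    intervalIntegral.integral_congr_ae (by
      filter_upwards [(ρ.memLp ε x).coeFn_toLp] with y hy _ using hy)
  rw [h1]
  refine intervalIntegral.integral_congr fun y _ => ?_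
  rw [Mollifier.scaled_eq, ← Mollifier.at0_even, neg_sub]

/-- The increments of the mollified noises converge to those of the noise. -/
theorem norm_incr_sub_brownVec_sq_le (ρ : Mollifier) (j : Fin n) {ε s t : ℝ} (hε : 0 < ε)
    (hst : s ≤ t) :
    ‖incr (mollVec ρ j ε) s t - brownVec j s t‖ ^ 2 ≤ 4 * (ρ.radius * ε) := by
  have h1 := norm_incr_sq_le (continuous_mollVec ρ j hε) (ρ.isKernel_cov hε hε)
    (inner_mollVec ρ j ε ε) hst
  have h2 := norm_brownVec_sq j hst
  have h3 := (ρ.isKernel_at0 hε).le_rect hst le_rfl le_rfl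
  have h4 : inner ℝ (incr (mollVec ρ j ε) s t) (brownVec j s t) =
      ∫ x in s..t, ∫ y in s..t, ρ.at0 ε (x - y) := by
    rw [inner_incr_left (continuous_mollVec ρ j hε)]
    simp only [inner_mollVec_brownVec ρ j ε _ hst]
  rw [norm_sub_sq_real, h4]
  linarith

end Component

/-! ### Iterated integrals -/

section Iterated
variable {V : Type*} [NormedAddCommGroup V] [InnerProductSpace ℝ V] [CompleteSpace V]
variable {B : Type*} [NormedAddCommGroup B] [NormedSpace ℝ B] [CompleteSpace B]
variable {ζ₁ ζ₂ : ℝ → V}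

/-- The iterated integral `∫ M(b(s, r), ζ₂(r)) dr` over `[s, t]`, where `b` is the primitive of
`ζ₁`. -/
def iter (M : V →L[ℝ] V →L[ℝ] B) (ζ₁ ζ₂ : ℝ → V) (s t : ℝ) : B :=
  ∫ r in s..t, M (incr ζ₁ s r) (ζ₂ r)

theorem continuous_bilin (M : V →L[ℝ] V →L[ℝ] B) {f g : ℝ → V} (hf : Continuous f)
    (hg : Continuous g) : Continuous fun r => M (f r) (g r) :=
  M.continuous₂.comp (hf.prodMk hg)

/-- The relation of Chen for iterated integrals. -/
theorem iter_chen (M : V →L[ℝ] V →L[ℝ] B) (h₁ : Continuous ζ₁) (h₂ : Continuous ζ₂) (s u t : ℝ) :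
    iter M ζ₁ ζ₂ s t =
      iter M ζ₁ ζ₂ s u + iter M ζ₁ ζ₂ u t + M (incr ζ₁ s u) (incr ζ₂ u t) := by
  have hc := fun s => continuous_bilin M (continuous_incr h₁ s) h₂
  have e : M (incr ζ₁ s u) (incr ζ₂ u t) = ∫ r in u..t, M (incr ζ₁ s u) (ζ₂ r) :=
    ((M (incr ζ₁ s u)).intervalIntegral_comp_comm (h₂.intervalIntegrable u t)).symm
  rw [iter, iter, iter, e, add_assoc, ← intervalIntegral.integral_add
    ((hc u).intervalIntegrable _ _) ((continuous_bilin M continuous_const h₂).intervalIntegrable _ _),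
    ← intervalIntegral.integral_add_adjacent_intervals ((hc s).intervalIntegrable s u)
    ((hc s).intervalIntegrable u t)]
  congr 1
  refine intervalIntegral.integral_congr fun r _ => ?_
  rw [← incr_add_incr h₁ s u r, map_add, _root_.add_apply, add_comm]

theorem exists_bound_Icc (h₁ : Continuous ζ₁) : ∃ C, 0 ≤ C ∧ ∀ r ∈ Icc (0 : ℝ) 1, ‖ζ₁ r‖ ≤ C := by
  obtain ⟨C, hC⟩ := isCompact_Icc.exists_bound_of_continuousOn (s := Icc (0 : ℝ) 1) h₁.continuousOn
  exact ⟨C, (norm_nonneg _).trans (hC 0 ⟨le_rfl, zero_le_one⟩), hC⟩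

theorem norm_incr_le {C : ℝ} (hC : ∀ r ∈ Icc (0 : ℝ) 1, ‖ζ₁ r‖ ≤ C) {s t : ℝ} (hs : 0 ≤ s)
    (hst : s ≤ t) (ht : t ≤ 1) : ‖incr ζ₁ s t‖ ≤ C * (t - s) := by
  rw [← abs_of_nonneg (sub_nonneg.2 hst)]
  refine intervalIntegral.norm_integral_le_of_norm_le_const fun r hr => ?_
  rw [uIoc_of_le hst] at hr
  exact hC r ⟨hs.trans hr.1.le, hr.2.trans ht⟩

theorem exists_norm_iter_le (M : V →L[ℝ] V →L[ℝ] B) (h₁ : Continuous ζ₁) (h₂ : Continuous ζ₂) :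
    ∃ L, 0 ≤ L ∧ ∀ s t, 0 ≤ s → s ≤ t → t ≤ 1 → ‖iter M ζ₁ ζ₂ s t‖ ≤ L * (t - s) ^ 2 := by
  obtain ⟨C, hC, hC'⟩ := exists_bound_Icc h₁
  obtain ⟨D, hD, hD'⟩ := exists_bound_Icc h₂
  refine ⟨‖M‖ * C * D, by positivity, fun s t hs hst ht => ?_⟩
  have h0 : 0 ≤ t - s := sub_nonneg.2 hst
  have : ‖iter M ζ₁ ζ₂ s t‖ ≤ ‖M‖ * (C * (t - s)) * D * |t - s| := by
    refine intervalIntegral.norm_integral_le_of_norm_le_const fun r hr => ?_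
    rw [uIoc_of_le hst] at hr
    have h1 := norm_incr_le hC' hs hr.1.le (hr.2.trans ht)
    have h2 := hD' r ⟨hs.trans hr.1.le, hr.2.trans ht⟩
    have h3 : C * (r - s) ≤ C * (t - s) := by gcongr; exact hr.2
    refine (M.le_opNorm₂ _ _).trans ?_
    gcongr
    exact h1.trans h3
  rw [abs_of_nonneg h0] at this
  exact this.trans (le_of_eq (by ring))

/-- An iterated integral of a bilinear map which is an operator plus a multiple of the inner product
splits accordingly. -/
theorem iter_eq_of_decomposition {W : Type*} [NormedAddCommGroup W] [NormedSpace ℝ W]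
    [CompleteSpace W] (M : V →L[ℝ] V →L[ℝ] B) (M' : V →L[ℝ] V →L[ℝ] W) (L : W →L[ℝ] B) (d : B)
    (h : ∀ f g, M f g = L (M' f g) + (inner ℝ f g : ℝ) • d) (h₁ : Continuous ζ₁)
    (h₂ : Continuous ζ₂) (s t : ℝ) :
    iter M ζ₁ ζ₂ s t =
      L (iter M' ζ₁ ζ₂ s t) + (∫ r in s..t, inner ℝ (incr ζ₁ s r) (ζ₂ r)) • d := by
  have hb := continuous_incr h₁ s
  have hF := continuous_bilin M' hb h₂
  have hi : Continuous fun r => inner ℝ (incr ζ₁ s r) (ζ₂ r) := hb.inner h₂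
  rw [iter, iter, ← L.intervalIntegral_comp_comm (hF.intervalIntegrable _ _),
    ← intervalIntegral.integral_smul_const, ← intervalIntegral.integral_add]
  · exact intervalIntegral.integral_congr fun r _ => h _ _
  · exact (L.continuous.comp hF).intervalIntegrable _ _
  · exact (hi.smul continuous_const).intervalIntegrable _ _

end Iterated

/-! ### Second-order integrals against the noise -/

/-- Field operators `field f`, `f ∈ V`, in a Banach algebra `A` which satisfy the sandwich formula
`field f * x * field g = cross (f ⊗ g) x + ⟨f, g⟩ Δ x`, where `cross` is bounded on the Hilbert space
tensor product `W` of `V` with itself. The map `tens` is `(f, g) ↦ f ⊗ g`, and `w`, `k` are bounds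
for the norms of `field` and `cross`. -/
structure SandwichRep (V W A : Type*) [NormedAddCommGroup V] [InnerProductSpace ℝ V]
    [NormedAddCommGroup W] [InnerProductSpace ℝ W] [NormedRing A] [NormedAlgebra ℝ A] where
  tens : V →L[ℝ] V →L[ℝ] W
  field : V →L[ℝ] A
  Δ : A →L[ℝ] A
  cross : W →L[ℝ] A →L[ℝ] A
  w : ℝ
  k : ℝ
  inner_tens : ∀ f g f' g', inner ℝ (tens f g) (tens f' g') = inner ℝ f f' * inner ℝ g g'
  sandwich_eq : ∀ f g, ContinuousLinearMap.mulLeftRight ℝ A (field f) (field g) =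
    cross (tens f g) + (inner ℝ f g : ℝ) • Δ
  w_nonneg : 0 ≤ w
  k_nonneg : 0 ≤ k
  norm_field_le : ∀ f, ‖field f‖ ≤ w * ‖f‖
  norm_Δ_le : ‖Δ‖ ≤ 1
  norm_cross_le : ∀ z, ‖cross z‖ ≤ k * ‖z‖

section SecondOrder
variable {V : Type*} [NormedAddCommGroup V] [InnerProductSpace ℝ V] [CompleteSpace V]
  {W : Type*} [NormedAddCommGroup W] [InnerProductSpace ℝ W] [CompleteSpace W]
  {A : Type*} [NormedRing A] [NormedAlgebra ℝ A] [CompleteSpace A]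
  {ζ₁ ζ₂ : ℝ → V} (S : SandwichRep V W A)

namespace SandwichRep

/-- The bilinear map `(f, g) ↦ (x ↦ ξ(f) x ξ(g))`. -/
def sand : V →L[ℝ] V →L[ℝ] A →L[ℝ] A :=
  (ContinuousLinearMap.mulLeftRight ℝ A).bilinearComp S.field S.field

theorem sand_apply (f g : V) :
    S.sand f g = ContinuousLinearMap.mulLeftRight ℝ A (S.field f) (S.field g) := rfl

/-- Second-order integrals against the noise: the kernel is integrated in `W`, and the contractions
add up to the trace part. -/
theorem iter_sand (h₁ : Continuous ζ₁) (h₂ : Continuous ζ₂) (s t : ℝ) :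
    iter S.sand ζ₁ ζ₂ s t =
      S.cross (incr (fun r => S.tens (incr ζ₁ s r) (ζ₂ r)) s t) +
        (∫ r in s..t, inner ℝ (incr ζ₁ s r) (ζ₂ r)) • S.Δ :=
  iter_eq_of_decomposition S.sand S.tens S.cross S.Δ S.sandwich_eq h₁ h₂ s t

theorem iter_sand_flip (h₁ : Continuous ζ₁) (h₂ : Continuous ζ₂) (s t : ℝ) :
    iter S.sand.flip ζ₁ ζ₂ s t =
      S.cross (incr (fun r => S.tens (ζ₂ r) (incr ζ₁ s r)) s t) +
        (∫ r in s..t, inner ℝ (incr ζ₁ s r) (ζ₂ r)) • S.Δ :=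
  iter_eq_of_decomposition S.sand.flip S.tens.flip S.cross S.Δ (fun f g => by
    rw [real_inner_comm]; exact S.sandwich_eq g f) h₁ h₂ s t

theorem norm_cross_add_le (z : W) (c : ℝ) : ‖S.cross z + c • S.Δ‖ ≤ S.k * ‖z‖ + |c| := by
  refine (norm_add_le _ _).trans (add_le_add (S.norm_cross_le z) ?_)
  rw [norm_smul, Real.norm_eq_abs]
  exact mul_le_of_le_one_right (abs_nonneg c) S.norm_Δ_le

end SandwichRep

end SecondOrder

/-! ### The rough signal of the mollified noises -/

section Signal
variable {n : ℕ} {W : Type*} [NormedAddCommGroup W] [InnerProductSpace ℝ W] [CompleteSpace W]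
  {A : Type*} [NormedRing A] [NormedAlgebra ℝ A] [CompleteSpace A]
  (S : SandwichRep (NoiseSpace n) W A) (ρ : Fin n → Mollifier) (ε : ℝ)

/-- The vector of mollified noises. -/
def noise (x : ℝ) : Fin n → A := fun j => S.field (mollVec (ρ j) j ε x)

/-- The renormalisation: the limit of the trace part of the second-order integrals, per unit of
time, with the opposite sign. -/
def renorm (j' j : Fin n) : A →L[ℝ] A := if j' = j then -(1 / 2 : ℝ) • S.Δ else 0

/-- The rough signal of the mollified noises, consisting of their increments and of the renormalised
second-order integrals. -/
def signal (s t : ℝ) : Sig n A :=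
  (t - s, fun j => S.field (incr (mollVec (ρ j) j ε) s t),
    fun j' j => iter S.sand (mollVec (ρ j') j' ε) (mollVec (ρ j) j ε) s t +
      (t - s) • renorm S j' j,
    fun j j' => iter S.sand.flip (mollVec (ρ j') j' ε) (mollVec (ρ j) j ε) s t +
      (t - s) • renorm S j j')

/-- The range of the covariances of the noises at unit scale. -/
def range : ℝ := 1 + ∑ j, (ρ j).radius

theorem range_pos : 0 < range ρ :=
  add_pos_of_pos_of_nonneg one_pos (Finset.sum_nonneg fun j _ => (ρ j).radius_pos.le)

theorem radius_le_range (j : Fin n) : (ρ j).radius ≤ range ρ :=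
  (Finset.single_le_sum (f := fun j => (ρ j).radius) (fun j _ => (ρ j).radius_pos.le)
    (Finset.mem_univ j)).trans (le_add_of_nonneg_left zero_le_one)

/-- The trace part of the renormalised second-order integrals. -/
def traceC (j' j : Fin n) (s t : ℝ) : ℝ :=
  if j' = j then (‖incr (mollVec (ρ j) j ε) s t‖ ^ 2 - (t - s)) / 2 else 0

variable {ε}

/-- The trace part `½ ‖b(s, t)‖²` is compensated by the renormalisation, up to `½ (‖b(s, t)‖² - (t - s))`,
which vanishes as `ε ↓ 0`. -/
theorem trace_add_renorm (hε : 0 < ε) (j' j : Fin n) (s t : ℝ) :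
    (∫ r in s..t, inner ℝ (incr (mollVec (ρ j') j' ε) s r) (mollVec (ρ j) j ε r)) • S.Δ +
      (t - s) • renorm S j' j = traceC ρ ε j' j s t • S.Δ := by
  by_cases h : j' = j
  · subst h
    rw [integral_inner_incr_self (continuous_mollVec _ _ hε), renorm, traceC, if_pos rfl,
      if_pos rfl, smul_smul, ← add_smul (R := ℝ) (M := A →L[ℝ] A)]
    congr 1
    ring
  · have h0 : ∀ r, inner ℝ (incr (mollVec (ρ j') j' ε) s r) (mollVec (ρ j) j ε r) = 0 := fun r => by
      rw [inner_incr_left (continuous_mollVec _ _ hε)]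
      simp [inner_mollVec_of_ne _ _ h]
    simp only [h0, renorm, traceC, h, if_false, intervalIntegral.integral_zero]
    ext x
    simp

theorem signal_left (hε : 0 < ε) (j' j : Fin n) (s t : ℝ) :
    (signal S ρ ε s t).2.2.1 j' j = S.cross (incr (fun r => S.tens
      (incr (mollVec (ρ j') j' ε) s r) (mollVec (ρ j) j ε r)) s t) +
      traceC ρ ε j' j s t • S.Δ := by
  rw [← trace_add_renorm S ρ hε, ← add_assoc, ← S.iter_sand (continuous_mollVec _ _ hε)
    (continuous_mollVec _ _ hε)]
  rfl

theorem signal_right (hε : 0 < ε) (j j' : Fin n) (s t : ℝ) :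
    (signal S ρ ε s t).2.2.2 j j' = S.cross (incr (fun r => S.tens
      (mollVec (ρ j) j ε r) (incr (mollVec (ρ j') j' ε) s r)) s t) +
      traceC ρ ε j' j s t • S.Δ := by
  have : renorm S j j' = renorm S j' j := by simp only [renorm, eq_comm]
  rw [← trace_add_renorm S ρ hε, ← add_assoc, ← S.iter_sand_flip (continuous_mollVec _ _ hε)
    (continuous_mollVec _ _ hε), ← this]
  rfl

/-- A bound for the rough signals, uniformly in the scale. -/
def signalC : ℝ := 2 * (S.k + 1 + S.w)

theorem signalC_nonneg : 0 ≤ signalC S := by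
  have := S.w_nonneg
  have := S.k_nonneg
  unfold signalC; positivity

theorem isKernel_range {δ : ℝ} (hε : 0 < ε) (hδ : 0 < δ) (j : Fin n) :
    IsKernel (range ρ * (ε + δ)) ((ρ j).cov ε δ) :=
  ((ρ j).isKernel_cov hε hδ).mono (by have := radius_le_range ρ j; gcongr)

theorem abs_traceC_le (hε : 0 < ε) (j' j : Fin n) {s t : ℝ} (hst : s ≤ t) :
    |traceC ρ ε j' j s t| ≤ (t - s) / 2 := by
  have h0 : 0 ≤ t - s := sub_nonneg.2 hst
  have h1 := norm_incr_sq_le (continuous_mollVec (ρ j) j hε) (isKernel_range ρ hε hε j)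
    (inner_mollVec (ρ j) j ε ε) hst
  rw [traceC]
  split_ifs
  · rw [abs_le]
    constructor <;> linarith [sq_nonneg ‖incr (mollVec (ρ j) j ε) s t‖]
  · rw [abs_zero]; linarith

/-- The renormalised trace parts at two scales differ by at most a multiple of the scales. -/
theorem abs_traceC_sub_le {δ : ℝ} (hε : 0 < ε) (hδ : 0 < δ) (j' j : Fin n) {s t : ℝ}
    (hst : s ≤ t) : |traceC ρ ε j' j s t - traceC ρ δ j' j s t| ≤ 2 * (range ρ * (ε + δ)) ∧
      |traceC ρ ε j' j s t - traceC ρ δ j' j s t| ≤ t - s := by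
  have h0 : 0 ≤ t - s := sub_nonneg.2 hst
  have hr := range_pos ρ
  have h1 := norm_incr_sq_le (continuous_mollVec (ρ j) j hε) (isKernel_range ρ hε hε j)
    (inner_mollVec (ρ j) j ε ε) hst
  have h2 := norm_incr_sq_le (continuous_mollVec (ρ j) j hδ) (isKernel_range ρ hδ hδ j)
    (inner_mollVec (ρ j) j δ δ) hst
  have h3 := le_norm_incr_sq (continuous_mollVec (ρ j) j hε) (isKernel_range ρ hε hε j)
    (inner_mollVec (ρ j) j ε ε) hst
  have h4 := le_norm_incr_sq (continuous_mollVec (ρ j) j hδ) (isKernel_range ρ hδ hδ j)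
    (inner_mollVec (ρ j) j δ δ) hst
  have h5 : 0 ≤ range ρ * ε := by positivity
  have h6 : 0 ≤ range ρ * δ := by positivity
  rw [traceC, traceC]
  split_ifs
  · rw [abs_le, abs_le]
    have := sq_nonneg ‖incr (mollVec (ρ j) j ε) s t‖
    have := sq_nonneg ‖incr (mollVec (ρ j) j δ) s t‖
    refine ⟨⟨?_, ?_⟩, ?_, ?_⟩ <;> linarith
  · rw [sub_zero, abs_zero]
    constructor
    · positivity
    · exact h0

/-- The mollified noises with their renormalised second-order integrals form a driver of Hölder class
`1 / 2`, with a bound which does not depend on the scale. -/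
theorem isDriver_signal (hε : 0 < ε) :
    IsDriver (1 / 2) (signalC S) (noise S ρ ε) (renorm S) (signal S ρ ε) where
  len s t := rfl
  chen s u t _ _ _ _ := by
    have hc := fun j => continuous_mollVec (ρ j) j hε
    refine Prod.ext ?_ (Prod.ext ?_ (Prod.ext ?_ ?_))
    · simp [signal]
    · funext j
      simp [signal, ← incr_add_incr (hc j) s u t]
    · funext j' j
      simp only [signal, Prod.snd_add, Prod.fst_add, Pi.add_apply, chenL]
      rw [iter_chen _ (hc j') (hc j) s u t, ← S.sand_apply, ← sub_add_sub_cancel t u s, add_smul (R := ℝ) (M := A →L[ℝ] A)]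
      abel
    · funext j j'
      simp only [signal, Prod.snd_add, Pi.add_apply, chenR]
      rw [iter_chen _ (hc j') (hc j) s u t, ← S.sand_apply, ← sub_add_sub_cancel t u s, add_smul (R := ℝ) (M := A →L[ℝ] A),
        ContinuousLinearMap.flip_apply]
      abel
  bound₁ s t _ hst _ := by
    have h0 : 0 ≤ t - s := sub_nonneg.2 hst
    have hw := S.w_nonneg
    have hC := signalC_nonneg S
    refine (pi_norm_le_iff_of_nonneg (by positivity)).2 fun j => ?_
    have h1 := norm_incr_sq_le (continuous_mollVec (ρ j) j hε) (isKernel_range ρ hε hε j)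
      (inner_mollVec (ρ j) j ε ε) hst
    have h2 := Real.le_sqrt_of_sq_le h1
    rw [Real.sqrt_eq_rpow] at h2
    change ‖S.field (incr (mollVec (ρ j) j ε) s t)‖ ≤ _
    refine (S.norm_field_le _).trans ?_
    have := S.k_nonneg
    gcongr
    unfold signalC
    linarith
  boundL s t _ hst _ := by
    have h0 : 0 ≤ t - s := sub_nonneg.2 hst
    have hw := S.w_nonneg
    have hC := signalC_nonneg S
    rw [mul_one_div_cancel two_ne_zero, Real.rpow_one]
    refine (pi_norm_le_iff_of_nonneg (by positivity)).2 fun j' =>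
      (pi_norm_le_iff_of_nonneg (by positivity)).2 fun j => ?_
    rw [signal_left S ρ hε]
    have h1 := norm_iterated_sq_le (continuous_mollVec (ρ j') j' hε)
      (continuous_bilin S.tens (continuous_incr (continuous_mollVec (ρ j') j' hε) s)
        (continuous_mollVec (ρ j) j hε)) (isKernel_range ρ hε hε j') (isKernel_range ρ hε hε j)
      (inner_mollVec (ρ j') j' ε ε) hst (fun x y => by
        rw [S.inner_tens, inner_mollVec (ρ j) j ε ε x y])
    have h2 := abs_le_of_sq_le_sq (h1.trans (half_le_self (sq_nonneg _))) h0
    have h3 := abs_traceC_le ρ hε j' j hst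
    refine (S.norm_cross_add_le _ _).trans ?_
    rw [abs_of_nonneg (norm_nonneg _)] at h2
    have hk := S.k_nonneg
    calc _ ≤ S.k * (t - s) + (t - s) / 2 := by gcongr
      _ ≤ _ := by
        unfold signalC
        have := mul_nonneg S.k_nonneg h0
        have := mul_nonneg hw h0
        nlinarith
  boundR s t _ hst _ := by
    have h0 : 0 ≤ t - s := sub_nonneg.2 hst
    have hw := S.w_nonneg
    have hC := signalC_nonneg S
    rw [mul_one_div_cancel two_ne_zero, Real.rpow_one]
    refine (pi_norm_le_iff_of_nonneg (by positivity)).2 fun j =>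
      (pi_norm_le_iff_of_nonneg (by positivity)).2 fun j' => ?_
    rw [signal_right S ρ hε]
    have h1 := norm_iterated_sq_le (continuous_mollVec (ρ j') j' hε)
      (continuous_bilin S.tens (continuous_mollVec (ρ j) j hε)
        (continuous_incr (continuous_mollVec (ρ j') j' hε) s)) (isKernel_range ρ hε hε j')
      (isKernel_range ρ hε hε j) (inner_mollVec (ρ j') j' ε ε) hst (fun x y => by
        rw [S.inner_tens, inner_mollVec (ρ j) j ε ε x y, mul_comm])
    have h2 := abs_le_of_sq_le_sq (h1.trans (half_le_self (sq_nonneg _))) h0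
    have h3 := abs_traceC_le ρ hε j' j hst
    refine (S.norm_cross_add_le _ _).trans ?_
    rw [abs_of_nonneg (norm_nonneg _)] at h2
    have hk := S.k_nonneg
    calc _ ≤ S.k * (t - s) + (t - s) / 2 := by gcongr
      _ ≤ _ := by
        unfold signalC
        have := mul_nonneg S.k_nonneg h0
        have := mul_nonneg hw h0
        nlinarith
  smooth := by
    have hw := S.w_nonneg
    have hc := fun j => continuous_mollVec (ρ j) j hε
    choose L₀ hL₀ hL₀' using fun j => exists_norm_mollVec_sub_le (ρ j) j hε
    choose L₁ hL₁ hL₁' using fun j' j =>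
      exists_norm_iter_le S.sand (hc j') (hc j)
    choose L₂ hL₂ hL₂' using fun j j' =>
      exists_norm_iter_le S.sand.flip (hc j') (hc j)
    have n1 : 0 ≤ ∑ j, S.w * L₀ j := Finset.sum_nonneg fun j _ => mul_nonneg hw (hL₀ j)
    have n2 : 0 ≤ ∑ j', ∑ j, L₁ j' j :=
      Finset.sum_nonneg fun j' _ => Finset.sum_nonneg fun j _ => hL₁ j' j
    have n3 : 0 ≤ ∑ j, ∑ j', L₂ j j' :=
      Finset.sum_nonneg fun j' _ => Finset.sum_nonneg fun j _ => hL₂ j' j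
    refine ⟨(∑ j, S.w * L₀ j) + (∑ j', ∑ j, L₁ j' j) + ∑ j, ∑ j', L₂ j j', by positivity,
      fun s t hs hst ht => ?_⟩
    have h0 : 0 ≤ t - s := sub_nonneg.2 hst
    refine norm_prod_le_iff.2 ⟨?_, norm_prod_le_iff.2 ⟨?_, norm_prod_le_iff.2 ⟨?_, ?_⟩⟩⟩
    · simp only [signal, rate, Prod.fst_sub, Prod.smul_fst, smul_eq_mul, mul_one, sub_self,
        norm_zero]
      positivity
    · refine (pi_norm_le_iff_of_nonneg (by positivity)).2 fun j => ?_
      change ‖S.field (incr (mollVec (ρ j) j ε) s t) - (t - s) • S.field (mollVec (ρ j) j ε s)‖ ≤ _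
      rw [← map_smul, ← map_sub]
      refine (S.norm_field_le _).trans ?_
      have e : incr (mollVec (ρ j) j ε) s t - (t - s) • mollVec (ρ j) j ε s =
          ∫ x in s..t, (mollVec (ρ j) j ε x - mollVec (ρ j) j ε s) := by
        rw [intervalIntegral.integral_sub ((hc j).intervalIntegrable _ _)
          (continuous_const.intervalIntegrable _ _), intervalIntegral.integral_const, incr]
      have h1 : ‖incr (mollVec (ρ j) j ε) s t - (t - s) • mollVec (ρ j) j ε s‖ ≤
          L₀ j * (t - s) * |t - s| := by
        rw [e]
        refine intervalIntegral.norm_integral_le_of_norm_le_const fun x hx => ?_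
        rw [uIoc_of_le hst] at hx
        refine (hL₀' j s x hx.1.le (by linarith [hx.2])).trans ?_
        have := hL₀ j
        gcongr
        exact hx.2
      rw [abs_of_nonneg h0] at h1
      have h2 := Finset.single_le_sum (f := fun j => S.w * L₀ j)
        (fun j _ => mul_nonneg hw (hL₀ j)) (Finset.mem_univ j)
      calc _ ≤ S.w * (L₀ j * (t - s) * (t - s)) := by gcongr
        _ = S.w * L₀ j * (t - s) ^ 2 := by ring
        _ ≤ _ := by gcongr; linarith
    · refine (pi_norm_le_iff_of_nonneg (by positivity)).2 fun j' =>
        (pi_norm_le_iff_of_nonneg (by positivity)).2 fun j => ?_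
      simp only [signal, rate, Prod.fst_sub, Prod.snd_sub, Prod.smul_fst, Prod.smul_snd,
        Pi.sub_apply, Pi.smul_apply, add_sub_cancel_right]
      have h2 := (Finset.single_le_sum (f := fun j => L₁ j' j) (fun j _ => hL₁ j' j)
        (Finset.mem_univ j)).trans (Finset.single_le_sum (f := fun j' => ∑ j, L₁ j' j)
        (fun j' _ => Finset.sum_nonneg fun j _ => hL₁ j' j) (Finset.mem_univ j'))
      refine (hL₁' j' j s t hs hst ht).trans ?_
      gcongr
      linarith
    · refine (pi_norm_le_iff_of_nonneg (by positivity)).2 fun j' =>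
        (pi_norm_le_iff_of_nonneg (by positivity)).2 fun j => ?_
      simp only [signal, rate, Prod.snd_sub, Prod.smul_snd,
        Pi.sub_apply, Pi.smul_apply, add_sub_cancel_right]
      have h2 := (Finset.single_le_sum (f := fun j => L₂ j' j) (fun j _ => hL₂ j' j)
        (Finset.mem_univ j)).trans (Finset.single_le_sum (f := fun j' => ∑ j, L₂ j' j)
        (fun j' _ => Finset.sum_nonneg fun j _ => hL₂ j' j) (Finset.mem_univ j'))
      refine (hL₂' j' j s t hs hst ht).trans ?_
      gcongr
      linarith
  lip := by
    have hw := S.w_nonneg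
    choose L₀ hL₀ hL₀' using fun j => exists_norm_mollVec_sub_le (ρ j) j hε
    have n1 : 0 ≤ ∑ j, S.w * L₀ j := Finset.sum_nonneg fun j _ => mul_nonneg hw (hL₀ j)
    refine ⟨∑ j, S.w * L₀ j, n1, fun s t hs hst ht => ?_⟩
    have h0 : 0 ≤ t - s := sub_nonneg.2 hst
    refine (pi_norm_le_iff_of_nonneg (by positivity)).2 fun j => ?_
    change ‖S.field (mollVec (ρ j) j ε t) - S.field (mollVec (ρ j) j ε s)‖ ≤ _
    rw [← map_sub]
    refine (S.norm_field_le _).trans ?_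
    have h1 := hL₀' j s t hst (by linarith)
    have h2 := Finset.single_le_sum (f := fun j => S.w * L₀ j)
        (fun j _ => mul_nonneg hw (hL₀ j)) (Finset.mem_univ j)
    calc _ ≤ S.w * (L₀ j * (t - s)) := by gcongr
      _ = S.w * L₀ j * (t - s) := by ring
      _ ≤ _ := by gcongr

/-- Extraction of a `k`-th root from an interpolated bound. -/
theorem le_two_mul_rpow {x a h p e : ℝ} {k : ℕ} (hk : k ≠ 0) (hx : 0 ≤ x) (ha : 0 ≤ a)
    (hh : 0 ≤ h) (hp : p * k = 3) (he : e * k = 1) (H : x ^ k ≤ 2 ^ k * a * h ^ 3) :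
    x ≤ 2 * (a ^ e * h ^ p) := by
  refine (pow_le_pow_iff_left₀ hx (by positivity) hk).1 (H.trans (le_of_eq ?_))
  have e1 : (a ^ e) ^ k = a := by
    rw [← Real.rpow_natCast, ← Real.rpow_mul ha, he, Real.rpow_one]
  have e2 : (h ^ p) ^ k = h ^ 3 := by
    rw [← Real.rpow_natCast, ← Real.rpow_mul hh, hp]
    norm_cast
  rw [mul_pow, mul_pow, e1, e2, mul_assoc]

theorem le_two_mul_quarter {x a h : ℝ} (hx : 0 ≤ x) (ha : 0 ≤ a) (hh : 0 ≤ h)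
    (H : x ^ 4 ≤ 16 * a * h ^ 3) : x ≤ 2 * (a ^ (1 / 4 : ℝ) * h ^ (2 * (3 / 8) : ℝ)) :=
  le_two_mul_rpow (k := 4) (by norm_num) hx ha hh (by norm_num) (by norm_num)
    (by norm_num; exact H)

/-- Interpolation between closeness of second-order integrals and their common Hölder bound. -/
theorem second_order_arith {x c k w a h : ℝ} (hx : 0 ≤ x) (hc : 0 ≤ c) (hk : 0 ≤ k) (hw : 0 ≤ w)
    (ha : 0 ≤ a) (ha1 : a ≤ 1) (hh : 0 ≤ h) (h1 : x ^ 2 ≤ 10 * a * h) (h2 : x ^ 2 ≤ h ^ 2)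
    (h3 : c ≤ 2 * a) (h4 : c ≤ h) :
    k * x + c ≤ 2 * (k + 1 + w) * (a ^ (1 / 8 : ℝ) * h ^ (2 * (3 / 8) : ℝ)) := by
  have b1 : x ≤ 2 * (a ^ (1 / 4 : ℝ) * h ^ (2 * (3 / 8) : ℝ)) :=
    le_two_mul_quarter hx ha hh (by
      calc x ^ 4 = x ^ 2 * x ^ 2 := by ring
        _ ≤ (10 * a * h) * h ^ 2 := by gcongr
        _ ≤ _ := by nlinarith [mul_nonneg ha (pow_nonneg hh 3)])
  have b2 : c ≤ 2 * (a ^ (1 / 4 : ℝ) * h ^ (2 * (3 / 8) : ℝ)) :=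
    le_two_mul_quarter hc ha hh (by
      calc c ^ 4 = c * c ^ 3 := by ring
        _ ≤ (2 * a) * h ^ 3 := by gcongr
        _ ≤ _ := by nlinarith [mul_nonneg ha (pow_nonneg hh 3)])
  have b3 : a ^ (1 / 4 : ℝ) ≤ a ^ (1 / 8 : ℝ) :=
    Real.rpow_le_rpow_of_exponent_ge' ha ha1 (by norm_num) (by norm_num)
  have b4 : a ^ (1 / 4 : ℝ) * h ^ (2 * (3 / 8) : ℝ) ≤
      a ^ (1 / 8 : ℝ) * h ^ (2 * (3 / 8) : ℝ) := by gcongr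
  set y := a ^ (1 / 8 : ℝ) * h ^ (2 * (3 / 8) : ℝ)
  have hy : 0 ≤ y := by positivity
  have := mul_nonneg hw hy
  calc k * x + c ≤ k * (2 * y) + 2 * y := by
        gcongr <;> linarith
    _ ≤ _ := by nlinarith

/-- The rough signals at two small scales are close to each other. Interpolation trades regularity
for closeness: from Hölder class `1 / 2` to `3 / 8`, which still exceeds the threshold `1 / 3`. -/
theorem norm_signal_sub_le {δ : ℝ} (hε : 0 < ε) (hδ : 0 < δ) (hle : range ρ * (ε + δ) ≤ 1)
    {s t : ℝ} (hst : s ≤ t) :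
    ‖(signal S ρ ε s t).2.1 - (signal S ρ δ s t).2.1‖ ≤
      signalC S * ((range ρ * (ε + δ)) ^ (1 / 8 : ℝ) * (t - s) ^ (3 / 8 : ℝ)) ∧
    ‖(signal S ρ ε s t).2.2.1 - (signal S ρ δ s t).2.2.1‖ ≤
      signalC S * ((range ρ * (ε + δ)) ^ (1 / 8 : ℝ) * (t - s) ^ (2 * (3 / 8) : ℝ)) ∧
    ‖(signal S ρ ε s t).2.2.2 - (signal S ρ δ s t).2.2.2‖ ≤
      signalC S * ((range ρ * (ε + δ)) ^ (1 / 8 : ℝ) * (t - s) ^ (2 * (3 / 8) : ℝ)) := by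
  have h0 : 0 ≤ t - s := sub_nonneg.2 hst
  have hw := S.w_nonneg
  have hk := S.k_nonneg
  have hC := signalC_nonneg S
  have hr := range_pos ρ
  set a := range ρ * (ε + δ) with ha_def
  have ha : 0 ≤ a := by positivity
  have hc := fun j => continuous_mollVec (ρ j) j hε
  have hc' := fun j => continuous_mollVec (ρ j) j hδ
  refine ⟨?_, ?_, ?_⟩
  · refine (pi_norm_le_iff_of_nonneg (by positivity)).2 fun j => ?_
    obtain ⟨h1, h2⟩ := norm_incr_sub_sq_le (hc j) (hc' j) (isKernel_range ρ hε hε j)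
      (isKernel_range ρ hε hδ j) (isKernel_range ρ hδ hδ j) (inner_mollVec (ρ j) j ε ε)
      (inner_mollVec (ρ j) j ε δ) (inner_mollVec (ρ j) j δ δ) hst
    change ‖S.field (incr (mollVec (ρ j) j ε) s t) - S.field (incr (mollVec (ρ j) j δ) s t)‖ ≤ _
    rw [← map_sub]
    refine (S.norm_field_le _).trans ?_
    set x := ‖incr (mollVec (ρ j) j ε) s t - incr (mollVec (ρ j) j δ) s t‖
    have b1 : x ≤ 2 * (a ^ (1 / 8 : ℝ) * (t - s) ^ (3 / 8 : ℝ)) := by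
      refine le_two_mul_rpow (k := 8) (by norm_num) (norm_nonneg _) ha h0 (by norm_num)
        (by norm_num) ?_
      calc x ^ 8 = x ^ 2 * (x ^ 2) ^ 3 := by ring
        _ ≤ (4 * a) * (2 * (t - s)) ^ 3 := by gcongr
        _ ≤ _ := by nlinarith [mul_nonneg ha (pow_nonneg h0 3)]
    have hy : 0 ≤ a ^ (1 / 8 : ℝ) * (t - s) ^ (3 / 8 : ℝ) := by positivity
    calc _ ≤ S.w * (2 * (a ^ (1 / 8 : ℝ) * (t - s) ^ (3 / 8 : ℝ))) := by gcongr
      _ ≤ _ := by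
        unfold signalC
        have := mul_nonneg hk hy
        nlinarith
  · refine (pi_norm_le_iff_of_nonneg (by positivity)).2 fun j' =>
      (pi_norm_le_iff_of_nonneg (by positivity)).2 fun j => ?_
    obtain ⟨h1, h2⟩ := norm_iterated_sub_sq_le (hc j') (hc' j')
      (continuous_bilin S.tens (continuous_incr (hc j') s) (hc j))
      (continuous_bilin S.tens (continuous_incr (hc' j') s) (hc' j))
      (isKernel_range ρ hε hε j') (isKernel_range ρ hε hδ j') (isKernel_range ρ hδ hδ j')
      (isKernel_range ρ hε hε j) (isKernel_range ρ hε hδ j) (isKernel_range ρ hδ hδ j)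
      (inner_mollVec (ρ j') j' ε ε) (inner_mollVec (ρ j') j' ε δ) (inner_mollVec (ρ j') j' δ δ) hst
      (fun x y => by rw [S.inner_tens, inner_mollVec (ρ j) j ε ε x y])
      (fun x y => by rw [S.inner_tens, inner_mollVec (ρ j) j ε δ x y])
      (fun x y => by rw [S.inner_tens, inner_mollVec (ρ j) j δ δ x y])
    obtain ⟨h3, h4⟩ := abs_traceC_sub_le ρ hε hδ j' j hst
    rw [Pi.sub_apply, Pi.sub_apply, signal_left S ρ hε, signal_left S ρ hδ, add_sub_add_comm,
      ← map_sub, ← sub_smul (R := ℝ) (M := A →L[ℝ] A)]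
    exact (S.norm_cross_add_le _ _).trans (second_order_arith (norm_nonneg _) (abs_nonneg _) hk hw
      ha hle h0 h1 h2 h3 h4)
  · refine (pi_norm_le_iff_of_nonneg (by positivity)).2 fun j =>
      (pi_norm_le_iff_of_nonneg (by positivity)).2 fun j' => ?_
    obtain ⟨h1, h2⟩ := norm_iterated_sub_sq_le (hc j') (hc' j')
      (continuous_bilin S.tens (hc j) (continuous_incr (hc j') s))
      (continuous_bilin S.tens (hc' j) (continuous_incr (hc' j') s))
      (isKernel_range ρ hε hε j') (isKernel_range ρ hε hδ j') (isKernel_range ρ hδ hδ j')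
      (isKernel_range ρ hε hε j) (isKernel_range ρ hε hδ j) (isKernel_range ρ hδ hδ j)
      (inner_mollVec (ρ j') j' ε ε) (inner_mollVec (ρ j') j' ε δ) (inner_mollVec (ρ j') j' δ δ) hst
      (fun x y => by rw [S.inner_tens, inner_mollVec (ρ j) j ε ε x y, mul_comm])
      (fun x y => by rw [S.inner_tens, inner_mollVec (ρ j) j ε δ x y, mul_comm])
      (fun x y => by rw [S.inner_tens, inner_mollVec (ρ j) j δ δ x y, mul_comm])
    obtain ⟨h3, h4⟩ := abs_traceC_sub_le ρ hε hδ j' j hst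
    rw [Pi.sub_apply, Pi.sub_apply, signal_right S ρ hε, signal_right S ρ hδ, add_sub_add_comm,
      ← map_sub, ← sub_smul (R := ℝ) (M := A →L[ℝ] A)]
    exact (S.norm_cross_add_le _ _).trans (second_order_arith (norm_nonneg _) (abs_nonneg _) hk hw
      ha hle h0 h1 h2 h3 h4)

end Signal

/-! ### The limit of the smooth solutions -/

section Limit
variable {n : ℕ} {W : Type*} [NormedAddCommGroup W] [InnerProductSpace ℝ W] [CompleteSpace W]
  {A : Type*} [NormedRing A] [NormedAlgebra ℝ A] [CompleteSpace A]
  (S : SandwichRep (NoiseSpace n) W A) (ρ : Fin n → Mollifier)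
  {cf : Fin n → List (Fin n) → ℝ} {cg ch : Fin n → Fin n → List (Fin n) → ℝ} {m r Λ : ℝ}

/-- The increments of the mollified noises, and of the noises themselves for `ε = 0`. -/
def increment (ε s t : ℝ) : Fin n → A := fun j =>
  S.field (if ε = 0 then brownVec j s t else incr (mollVec (ρ j) j ε) s t)

theorem tendsto_increment {ε : ℕ → ℝ} (hε : ∀ k, 0 < ε k)
    (h : Filter.Tendsto ε Filter.atTop (𝓝 0)) {s t : ℝ} (hst : s ≤ t) :
    Filter.Tendsto (fun k => increment S ρ (ε k) s t) Filter.atTop (𝓝 (increment S ρ 0 s t)) := by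
  refine tendsto_pi_nhds.2 fun j => ?_
  have h1 : Filter.Tendsto (fun k => incr (mollVec (ρ j) j (ε k)) s t) Filter.atTop
      (𝓝 (brownVec j s t)) := by
    rw [tendsto_iff_norm_sub_tendsto_zero]
    have h2 : Filter.Tendsto (fun k => Real.sqrt (4 * ((ρ j).radius * ε k))) Filter.atTop
        (𝓝 0) := by
      have := ((h.const_mul (ρ j).radius).const_mul 4).sqrt
      simpa using this
    exact squeeze_zero (fun k => norm_nonneg _) (fun k =>
      Real.le_sqrt_of_sq_le (norm_incr_sub_brownVec_sq_le (ρ j) j (hε k) hst)) h2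
  have h3 := (S.field.continuous.tendsto _).comp h1
  simp only [increment, if_true]
  refine h3.congr fun k => ?_
  simp [(hε k).ne']

theorem tendsto_germ₁ (H : EqBound m r Λ cf cg ch) (hm : ‖(1 : A)‖ ≤ m) {X : ℕ → Fin n → A}
    {X' : Fin n → A} {β : ℕ → Fin n → A} {β' : Fin n → A} (hX : ∀ k, ‖X k‖ ≤ r)
    (h : Filter.Tendsto X Filter.atTop (𝓝 X')) (h' : Filter.Tendsto β Filter.atTop (𝓝 β')) :
    Filter.Tendsto (fun k => germ₁ cg ch (X k) (β k)) Filter.atTop (𝓝 (germ₁ cg ch X' β')) := by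
  have hX' : ‖X'‖ ≤ r := le_of_tendsto' h.norm hX
  have hser : ∀ c, CoefBound m r Λ c →
      Filter.Tendsto (fun k => ser c (X k)) Filter.atTop (𝓝 (ser c X')) := fun c hc => by
    rw [tendsto_iff_norm_sub_tendsto_zero]
    have h1 := (tendsto_iff_norm_sub_tendsto_zero.1 h).const_mul Λ
    rw [mul_zero] at h1
    exact squeeze_zero (fun k => norm_nonneg _) (fun k => hc.ser_sub_le hm (hX k) hX') h1
  refine tendsto_pi_nhds.2 fun i => tendsto_finsetSum _ fun j _ => ?_
  exact ((hser _ (H.g i j)).mul (tendsto_pi_nhds.1 h' j)).mul (hser _ (H.h i j))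

/-- The solutions for mollified noises on a common time interval, and their limit. A priori estimates
are used in Hölder class `1 / 2`, and the comparison of two scales is made in class `3 / 8`. -/
theorem exists_solution_family (H : EqBound m r Λ cf cg ch) (hΛ : 0 ≤ Λ) (hm : ‖(1 : A)‖ ≤ m)
    {x₀ : Fin n → A} (hx₀ : ‖x₀‖ < r) :
    ∃ T K : ℝ, 0 < T ∧ T ≤ 1 ∧ 0 ≤ K ∧ ∃ Y : ℝ → ℝ → Fin n → A,
      (∀ ε, 0 ≤ ε → Y ε 0 = x₀) ∧
      (∀ ε, 0 ≤ ε → ∀ t ∈ Icc 0 T, ‖Y ε t‖ ≤ r) ∧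
      (∀ ε, 0 < ε → ∀ t ∈ Icc 0 T, HasDerivWithinAt (Y ε)
        (germ cf cg ch (Y ε t) (rate (noise S ρ ε) (renorm S) t)) (Icc 0 T) t) ∧
      (∀ ε, 0 ≤ ε → ∀ s t, 0 ≤ s → s ≤ t → t ≤ T →
        ‖Y ε t - Y ε s‖ ≤ K * (t - s) ^ (1 / 2 : ℝ)) ∧
      (∀ ε, 0 ≤ ε → ∀ s t, 0 ≤ s → s ≤ t → t ≤ T →
        ‖Y ε t - Y ε s - germ₁ cg ch (Y ε s) (increment S ρ ε s t)‖ ≤ K * (t - s)) ∧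
      ∀ ε, 0 < ε → range ρ * ε ≤ 1 / 2 → ∀ t ∈ Icc 0 T,
        ‖Y ε t - Y 0 t‖ ≤ r * (range ρ * ε) ^ (1 / 8 : ℝ) := by
  have hr : 0 < r := (norm_nonneg _).trans_lt hx₀
  have hδ : 0 < r - ‖x₀‖ := sub_pos.2 hx₀
  have hM := signalC_nonneg S
  have hrg := range_pos ρ
  set M := signalC S with hM_def
  have h1 : ∀ᶠ T in 𝓝[>] (0 : ℝ), T ∈ Ioc (0 : ℝ) 1 := Ioc_mem_nhdsGT one_pos
  obtain ⟨T, ⟨hT, hT1⟩, ⟨hA1, hA2⟩, hB1, hB2⟩ := (h1.and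
    ((eventually_time (sewC (3 * (1 / 2))  * defectC n r Λ M) (incC n Λ M + remC n Λ M)
      (r - ‖x₀‖) (α := 1 / 2) (by norm_num) hδ).and
    (eventually_time (sewC (3 * (3 / 8)) * defectC n r Λ (2 * M))
      (incC n Λ (2 * M) + remC n Λ (2 * M)) (r - ‖x₀‖) (α := 3 / 8) (by norm_num) hδ))).exists
  have hinc := incC_nonneg (n := n) (Λ := Λ) hM
  have hrem := remC_nonneg (n := n) hΛ hM
  have hex : ∀ ε : ℝ, ∃ Y : ℝ → Fin n → A, 0 < ε → Y 0 = x₀ ∧ (∀ t ∈ Icc 0 T, ‖Y t‖ < r) ∧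
      ∀ t ∈ Icc 0 T, HasDerivWithinAt Y
        (germ cf cg ch (Y t) (rate (noise S ρ ε) (renorm S) t)) (Icc 0 T) t := fun ε => by
    by_cases hε : 0 < ε
    · obtain ⟨Y, hY⟩ := exists_solution H hΛ hM (by norm_num) le_rfl hm (isDriver_signal S ρ hε) hT
        hT1 hA1 (x₀ := x₀) (by linarith)
      exact ⟨Y, fun _ => hY⟩
    · exact ⟨0, fun h => absurd h hε⟩
  choose Y hY using hex
  -- comparison of two scales
  have hcmp : ∀ ε δ, 0 < ε → 0 < δ → range ρ * (ε + δ) ≤ 1 → ∀ t ∈ Icc 0 T,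
      ‖Y ε t - Y δ t‖ ≤ r * (range ρ * (ε + δ)) ^ (1 / 8 : ℝ) := by
    intro ε δ hε hδ hle t ht
    -- the weight `l` of the difference is the inverse of the bound for the distance of the signals
    have hpos : 0 < (range ρ * (ε + δ)) ^ (1 / 8 : ℝ) := by positivity
    set b := (range ρ * (ε + δ)) ^ (1 / 8 : ℝ)
    let l : ℝ≥0 := ⟨b⁻¹, by positivity⟩
    have hl : (l : ℝ) = b⁻¹ := rfl
    have key : ∀ x y : ℝ, x ≤ M * (b * y) → (l : ℝ) * x ≤ M * y := fun x y hxy => by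
      rw [hl, inv_mul_le_iff₀ hpos]
      linarith
    have := mul_norm_sub_le_of_solutions (l := l) H hΛ hM (α := 3 / 8) (by norm_num)
      (by norm_num) hm ((isDriver_signal S ρ hε).mono hM le_rfl (by norm_num) (by norm_num))
      ((isDriver_signal S ρ hδ).mono hM le_rfl (by norm_num) (by norm_num))
      (fun s t _ hst _ => key _ _ (norm_signal_sub_le S ρ hε hδ hle hst).1)
      (fun s t _ hst _ => key _ _ (norm_signal_sub_le S ρ hε hδ hle hst).2.1)
      (fun s t _ hst _ => key _ _ (norm_signal_sub_le S ρ hε hδ hle hst).2.2)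
      hT1 hB1 (hY ε hε).2.2 (hY δ hδ).2.2 ((hY ε hε).1.trans (hY δ hδ).1.symm)
      (by rw [(hY ε hε).1]; linarith) t ht
    rwa [hl, inv_mul_le_iff₀ hpos, mul_comm] at this
  -- the limit along a sequence of scales
  let e : ℕ → ℝ := fun k => (2 * range ρ)⁻¹ * (1 / ((k : ℝ) + 1))
  have he : ∀ k, 0 < e k := fun k => by positivity
  have he' : ∀ k, range ρ * e k = 1 / 2 * (1 / ((k : ℝ) + 1)) := fun k => by
    simp only [e]; field_simp
  have he2 : ∀ k, range ρ * e k ≤ 1 / 2 := fun k => by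
    rw [he']
    have : 1 / ((k : ℝ) + 1) ≤ 1 := by
      rw [div_le_one (by positivity)]; linarith [(Nat.cast_nonneg k : (0 : ℝ) ≤ k)]
    linarith
  have hlim : Filter.Tendsto e Filter.atTop (𝓝 0) := by
    have := (tendsto_one_div_add_atTop_nhds_zero_nat (𝕜 := ℝ)).const_mul (2 * range ρ)⁻¹
    rwa [mul_zero] at this
  have hpow : Filter.Tendsto (fun x : ℝ => r * x ^ (1 / 8 : ℝ)) (𝓝 0) (𝓝 0) := by
    have h2 := ((Real.continuousAt_rpow_const 0 (1 / 8 : ℝ) (Or.inr (by norm_num))).tendsto).const_mul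
      r
    rwa [Real.zero_rpow (by norm_num), mul_zero] at h2
  have hlimY : ∀ t, ∃ y, t ∈ Icc 0 T → Filter.Tendsto (fun k => Y (e k) t) Filter.atTop (𝓝 y) := by
    intro t
    by_cases ht : t ∈ Icc 0 T
    · have hc : CauchySeq fun k => Y (e k) t := by
        refine cauchySeq_of_le_tendsto_0 (fun k : ℕ => r * (1 / ((k : ℝ) + 1)) ^ (1 / 8 : ℝ)) ?_
          (hpow.comp tendsto_one_div_add_atTop_nhds_zero_nat)
        intro k k' N hk hk'
        rw [dist_eq_norm]
        refine (hcmp _ _ (he k) (he k') (by rw [mul_add]; linarith [he2 k, he2 k']) t ht).trans ?_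
        have h3 : ∀ j : ℕ, N ≤ j → range ρ * e j ≤ 1 / 2 * (1 / ((N : ℝ) + 1)) := fun j hj => by
          rw [he']
          gcongr
        gcongr
        rw [mul_add]
        linarith [h3 k hk, h3 k' hk']
      obtain ⟨y, hy⟩ := cauchySeq_tendsto_of_complete hc
      exact ⟨y, fun _ => hy⟩
    · exact ⟨0, fun h => absurd h ht⟩
  choose Y₀ hY₀ using hlimY
  have h0T : (0 : ℝ) ∈ Icc 0 T := ⟨le_rfl, hT.le⟩
  have hholder : ∀ ε, 0 < ε → ∀ s t, 0 ≤ s → s ≤ t → t ≤ T →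
      ‖Y ε t - Y ε s‖ ≤ (incC n Λ M + remC n Λ M) * (t - s) ^ (1 / 2 : ℝ) :=
    fun ε hε s t hs hst ht => norm_increment_le H hΛ hr.le hM (by norm_num) le_rfl hm
      (isDriver_signal S ρ hε) hT1 hA1 (hY ε hε).2.2 (fun t ht => ((hY ε hε).2.1 t ht).le) hs hst ht
  have hremd : ∀ ε, 0 < ε → ∀ s t, 0 ≤ s → s ≤ t → t ≤ T →
      ‖Y ε t - Y ε s - germ₁ cg ch (Y ε s) (increment S ρ ε s t)‖ ≤
        (incC n Λ M + remC n Λ M) * (t - s) := fun ε hε s t hs hst ht => by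
    have := norm_remainder_le H hΛ hr.le hM (by norm_num) le_rfl hm
      (isDriver_signal S ρ hε) hT1 hA1 (hY ε hε).2.2 (fun t ht => ((hY ε hε).2.1 t ht).le) hs hst ht
    rw [mul_one_div_cancel two_ne_zero, Real.rpow_one] at this
    have hi : increment S ρ ε s t = (signal S ρ ε s t).2.1 := by
      funext j
      simp [increment, hε.ne', signal]
    rw [hi]
    refine this.trans (mul_le_mul_of_nonneg_right (by linarith) (sub_nonneg.2 hst))
  let Z : ℝ → ℝ → Fin n → A := fun ε => if ε = 0 then Y₀ else Y ε
  have hZ0 : Z 0 = Y₀ := if_pos rfl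
  have hZ : ∀ ε, 0 < ε → Z ε = Y ε := fun ε hε => if_neg hε.ne'
  have hcase : ∀ {P : ℝ → Prop}, P 0 → (∀ ε, 0 < ε → P ε) → ∀ ε, 0 ≤ ε → P ε :=
    fun h0 hp ε hε => hε.eq_or_lt.elim (fun h => h ▸ h0) (hp ε)
  refine ⟨T, incC n Λ M + remC n Λ M, hT, hT1, by positivity, Z, hcase ?_ ?_, hcase ?_ ?_, ?_,
    hcase ?_ ?_, hcase ?_ ?_, ?_⟩
  · rw [hZ0]
    refine tendsto_nhds_unique (hY₀ 0 h0T) ?_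
    simp only [(hY _ (he _)).1]
    exact tendsto_const_nhds
  · intro ε hε
    rw [hZ ε hε]
    exact (hY ε hε).1
  · intro t ht
    rw [hZ0]
    exact le_of_tendsto' (hY₀ t ht).norm fun k => ((hY _ (he k)).2.1 t ht).le
  · intro ε hε t ht
    rw [hZ ε hε]
    exact ((hY ε hε).2.1 t ht).le
  · intro ε hε t ht
    rw [hZ ε hε]
    exact (hY ε hε).2.2 t ht
  · intro s t hs hst ht
    rw [hZ0]
    exact le_of_tendsto' ((hY₀ t ⟨hs.trans hst, ht⟩).sub (hY₀ s ⟨hs, hst.trans ht⟩)).norm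
      fun k => hholder _ (he k) s t hs hst ht
  · intro ε hε
    rw [hZ ε hε]
    exact hholder ε hε
  · intro s t hs hst ht
    rw [hZ0]
    have hs' : s ∈ Icc 0 T := ⟨hs, hst.trans ht⟩
    exact le_of_tendsto' (((hY₀ t ⟨hs.trans hst, ht⟩).sub (hY₀ s hs')).sub
      (tendsto_germ₁ H hm (fun k => ((hY _ (he k)).2.1 s hs').le) (hY₀ s hs')
        (tendsto_increment S ρ he hlim hst))).norm
      fun k => hremd _ (he k) s t hs hst ht
  · intro ε hε
    rw [hZ ε hε]
    exact hremd ε hε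
  · intro ε hε hle t ht
    rw [hZ0, hZ ε hε]
    have h3 : Filter.Tendsto (fun k => r * (range ρ * (ε + e k)) ^ (1 / 8 : ℝ)) Filter.atTop
        (𝓝 (r * (range ρ * (ε + 0)) ^ (1 / 8 : ℝ))) :=
      (((hlim.const_add ε).const_mul (range ρ)).rpow_const (Or.inr (by norm_num))).const_mul r
    rw [add_zero] at h3
    exact le_of_tendsto_of_tendsto' ((hY₀ t ht).const_sub (Y ε t)).norm h3 fun k =>
      hcmp _ _ hε (he k) (by rw [mul_add]; linarith [he2 k]) t ht

end Limit

/-! ### Occurrences of letters -/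

section Letters
variable {n : ℕ} {A : Type*} [NormedRing A] [NormedAlgebra ℝ A]

/-- The sum over the positions of the letter `k` in a word, in recursive form. -/
theorem sum_get_eq_dR (X : Fin n → A) (k : Fin n) (Q : A →L[ℝ] A) (w : List (Fin n)) :
    (∑ l : Fin w.length, if w.get l = k then
      monomial X (w.take l) * Q (monomial X (w.drop (l + 1))) else 0) =
      dR X (Pi.single k Q) w := by
  induction w with
  | nil => simp [dR]
  | cons a w ih =>
    rw [dR, ← ih]
    refine (Fin.sum_univ_succ (n := w.length) _).trans ?_
    congr 1
    · by_cases h : a = k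
      · subst h; simp
      · simp [h]
    · rw [Finset.mul_sum]
      refine Finset.sum_congr rfl fun l _ => ?_
      simp [mul_assoc]

/-- The mirror image of `sum_get_eq_dR`. -/
theorem sum_get_eq_dL (X : Fin n → A) (k : Fin n) (Q : A →L[ℝ] A) (w : List (Fin n)) :
    (∑ l : Fin w.length, if w.get l = k then
      Q (monomial X (w.take l)) * monomial X (w.drop (l + 1)) else 0) =
      dL X (Pi.single k Q) w := by
  induction w generalizing Q with
  | nil => simp [dL]
  | cons a w ih =>
    have h1 : (fun i => ((Pi.single k Q : Fin n → A →L[ℝ] A) i).comp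
        (ContinuousLinearMap.mul ℝ A (X a))) =
        Pi.single k (Q.comp (ContinuousLinearMap.mul ℝ A (X a))) := by
      ext i x
      by_cases h : i = k
      · subst h; simp
      · simp [Pi.single_eq_of_ne h]
    rw [dL, h1, ← ih]
    refine (Fin.sum_univ_succ (n := w.length) _).trans ?_
    congr 1
    · by_cases h : a = k
      · subst h; simp
      · simp [h]

theorem sum_dR_single (X : Fin n → A) (P : Fin n → A →L[ℝ] A) (w : List (Fin n)) :
    ∑ k, dR X (Pi.single k (P k)) w = dR X P w := by
  have := map_sum (AddMonoidHom.mk' (fun P => dR X P w) fun P P' => dR_add X P P' w)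
    (fun k => Pi.single k (P k)) Finset.univ
  rw [Finset.univ_sum_single] at this
  exact this.symm

theorem sum_dL_single (X : Fin n → A) (P : Fin n → A →L[ℝ] A) (w : List (Fin n)) :
    ∑ k, dL X (Pi.single k (P k)) w = dL X P w := by
  have := map_sum (AddMonoidHom.mk' (fun P => dL X P w) fun P P' => dL_add X P P' w)
    (fun k => Pi.single k (P k)) Finset.univ
  rw [Finset.univ_sum_single] at this
  exact this.symm

variable [CompleteSpace A] {m r Λ : ℝ} {c : List (Fin n) → ℝ} {X : Fin n → A}

theorem CoefBound.sum_DR_single (h : CoefBound m r Λ c) (hm : ‖(1 : A)‖ ≤ m) (hX : ‖X‖ ≤ r)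
    (P : Fin n → A →L[ℝ] A) : ∑ k, DR c X (Pi.single k (P k)) = DR c X P := by
  simp only [DR]
  rw [← Summable.tsum_finsetSum fun k _ => (h.DR_le hm hX _).1]
  simp only [← Finset.smul_sum, sum_dR_single]

theorem CoefBound.sum_DL_single (h : CoefBound m r Λ c) (hm : ‖(1 : A)‖ ≤ m) (hX : ‖X‖ ≤ r)
    (P : Fin n → A →L[ℝ] A) : ∑ k, DL c X (Pi.single k (P k)) = DL c X P := by
  simp only [DL]
  rw [← Summable.tsum_finsetSum fun k _ => (h.DL_le hm hX _).1]
  simp only [← Finset.smul_sum, sum_dL_single]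

end Letters

/-! ### The counterterm -/

section Renorm
variable {n : ℕ} {W : Type*} [NormedAddCommGroup W] [InnerProductSpace ℝ W]
  {A : Type*} [NormedRing A] [NormedAlgebra ℝ A] [CompleteSpace A]
  (S : SandwichRep (NoiseSpace n) W A) {cg ch : Fin n → Fin n → List (Fin n) → ℝ}

/-- The second-order part of the germ at the renormalisation is the counterterm with the constant
`1 / 2`. Since different noises are independent, the sum over `j'` reduces to `j' = j`. -/
theorem germ₂_renorm (X : Fin n → A) (i : Fin n) :
    germ₂ cg ch X (renorm S) (renorm S) i = -∑ j, (1 / 2 : ℝ) •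
      (DR (cg i j) X (fun k => ContinuousLinearMap.mul ℝ A (ser (cg k j) X) * S.Δ *
          ContinuousLinearMap.mul ℝ A (ser (ch k j) X)) * ser (ch i j) X +
        ser (cg i j) X * DL (ch i j) X (fun k =>
          (ContinuousLinearMap.mul ℝ A).flip (ser (ch k j) X) * S.Δ *
            (ContinuousLinearMap.mul ℝ A).flip (ser (cg k j) X))) := by
  rw [germ₂, ← Finset.sum_neg_distrib]
  refine Finset.sum_congr rfl fun j _ => ?_
  have h1 : innerL cg ch X (renorm S) j = (-(1 / 2) : ℝ) • fun k =>
      ContinuousLinearMap.mul ℝ A (ser (cg k j) X) * S.Δ *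
          ContinuousLinearMap.mul ℝ A (ser (ch k j) X) := by
    funext k
    rw [innerL, Finset.sum_eq_single j]
    · ext x; simp [renorm]
    · intro j' _ hj'; ext x; simp [renorm, hj']
    · simp
  have h2 : innerR cg ch X (renorm S) j = (-(1 / 2) : ℝ) • fun k =>
      (ContinuousLinearMap.mul ℝ A).flip (ser (ch k j) X) * S.Δ *
            (ContinuousLinearMap.mul ℝ A).flip (ser (cg k j) X) := by
    funext k
    rw [innerR, Finset.sum_eq_single j]
    · ext x; simp [renorm]
    · intro j' _ hj'; ext x; simp [renorm, hj'.symm]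
    · simp
  rw [h1, h2, DR_smul, DL_smul, neg_smul, neg_smul, smul_add, neg_mul, mul_neg, smul_mul_assoc,
    mul_smul_comm]
  abel

theorem norm_noise_increment_le (ρ : Fin n → Mollifier) {ε s t : ℝ} (hε : 0 ≤ ε) (hst : s ≤ t) :
    ‖increment S ρ ε s t‖ ≤ S.w * (t - s) ^ (1 / 2 : ℝ) := by
  have h0 : 0 ≤ t - s := sub_nonneg.2 hst
  have hw := S.w_nonneg
  refine (pi_norm_le_iff_of_nonneg (by positivity)).2 fun j => (S.norm_field_le _).trans ?_
  rw [← Real.sqrt_eq_rpow]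
  refine mul_le_mul_of_nonneg_left (Real.le_sqrt_of_sq_le ?_) hw
  split_ifs with h
  · exact (norm_brownVec_sq j hst).le
  · have hε' : 0 < ε := lt_of_le_of_ne hε (Ne.symm h)
    exact norm_incr_sq_le (continuous_mollVec (ρ j) j hε') ((ρ j).isKernel_cov hε' hε')
      (inner_mollVec (ρ j) j ε ε) hst

end Renorm

/-! ### Hölder regularity and uniqueness -/

section Holder
variable {F : Type*} [NormedAddCommGroup F] {T K : ℝ} {u v : ℝ → F} {α : ℝ≥0}

theorem holderOnWith_of_norm_le {δ : ℝ≥0} {s : Set ℝ}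
    (h : ∀ x ∈ s, ∀ y ∈ s, x ≤ y → ‖u y - u x‖ ≤ δ * (y - x) ^ (α : ℝ)) :
    HolderOnWith δ α u s := by
  have key : ∀ x ∈ s, ∀ y ∈ s, x ≤ y → edist (u x) (u y) ≤ δ * edist x y ^ (α : ℝ) := by
    intro x hx y hy hxy
    rw [edist_comm (u x), edist_eq_enorm_sub, edist_comm x, edist_dist y x, Real.dist_eq,
      abs_of_nonneg (sub_nonneg.2 hxy), ENNReal.ofReal_rpow_of_nonneg (sub_nonneg.2 hxy) (NNReal.coe_nonneg α),
      ← ofReal_norm, ← ENNReal.ofReal_coe_nnreal, ← ENNReal.ofReal_mul (NNReal.coe_nonneg δ)]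
    exact ENNReal.ofReal_le_ofReal (h x hx y hy hxy)
  intro x hx y hy
  rcases le_total x y with hxy | hxy
  · exact key x hx y hy hxy
  · rw [edist_comm (u x), edist_comm x]
    exact key y hy x hx hxy

/-- A function of class `𝒞^{1/2}` on an interval of length at most one is of class `𝒞^α` for
`α < 1 / 2`. -/
theorem holderOnWith_of_half (hK : 0 ≤ K) (hT : T ≤ 1) (hα : α < 1 / 2)
    (h : ∀ s t, 0 ≤ s → s ≤ t → t < T → ‖u t - u s‖ ≤ K * (t - s) ^ (1 / 2 : ℝ)) :
    HolderOnWith ⟨K, hK⟩ α u (Ico 0 T) := by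
  refine holderOnWith_of_norm_le fun s hs t ht hst => (h s t hs.1 hst ht.2).trans ?_
  have hα' : (α : ℝ) < 1 / 2 := by exact_mod_cast hα
  refine mul_le_mul_of_nonneg_left ?_ hK
  refine Real.rpow_le_rpow_of_exponent_ge_of_imp (sub_nonneg.2 hst) ?_ hα'.le fun h0 h1 => ?_
  · linarith [hs.1, ht.2]
  · linarith

/-- Interpolation between a uniform bound and a bound in `𝒞^{1/2}`. -/
theorem holderOnWith_sub {η : ℝ} (hK : 0 ≤ K) (hα : α < 1 / 2)
    (hu : ∀ s t, 0 ≤ s → s ≤ t → t < T → ‖u t - u s‖ ≤ K * (t - s) ^ (1 / 2 : ℝ))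
    (hv : ∀ s t, 0 ≤ s → s ≤ t → t < T → ‖v t - v s‖ ≤ K * (t - s) ^ (1 / 2 : ℝ))
    (huv : ∀ t ∈ Ico 0 T, ‖u t - v t‖ ≤ η) {δ : ℝ≥0}
    (hδ : (2 * K) ^ (2 * α : ℝ) * (2 * η) ^ (1 - 2 * α : ℝ) ≤ δ) :
    HolderOnWith δ α (fun t => u t - v t) (Ico 0 T) := by
  have hα' : (α : ℝ) < 1 / 2 := by exact_mod_cast hα
  have hα0 : (0 : ℝ) ≤ α := α.2
  refine holderOnWith_of_norm_le fun s hs t ht hst => ?_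
  have h0 : 0 ≤ t - s := sub_nonneg.2 hst
  have h1 : ‖u t - v t - (u s - v s)‖ ≤ 2 * K * (t - s) ^ (1 / 2 : ℝ) := by
    rw [sub_sub_sub_comm]
    refine (norm_sub_le _ _).trans ?_
    linarith [hu s t hs.1 hst ht.2, hv s t hs.1 hst ht.2]
  have h2 : ‖u t - v t - (u s - v s)‖ ≤ 2 * η := by
    refine (norm_sub_le _ _).trans ?_
    linarith [huv s hs, huv t ht]
  set x := ‖u t - v t - (u s - v s)‖
  have hx : 0 ≤ x := norm_nonneg _
  calc x = x ^ (2 * α : ℝ) * x ^ (1 - 2 * α : ℝ) := by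
        rw [← Real.rpow_add_of_nonneg hx (by positivity) (by linarith)]; simp
    _ ≤ (2 * K * (t - s) ^ (1 / 2 : ℝ)) ^ (2 * α : ℝ) * (2 * η) ^ (1 - 2 * α : ℝ) := by
        gcongr
        linarith
    _ = (2 * K) ^ (2 * α : ℝ) * (2 * η) ^ (1 - 2 * α : ℝ) * (t - s) ^ (α : ℝ) := by
        rw [Real.mul_rpow (by positivity) (by positivity), ← Real.rpow_mul h0]
        rw [show (1 / 2 : ℝ) * (2 * α) = α by ring]
        ring
    _ ≤ δ * (t - s) ^ (α : ℝ) := by gcongr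

theorem tendsto_interpolation {η : ℝ → ℝ} (hα : α < 1 / 2)
    (h : Filter.Tendsto η (𝓝[>] 0) (𝓝 0)) :
    Filter.Tendsto (fun ε => (2 * K) ^ (2 * α : ℝ) * (2 * η ε) ^ (1 - 2 * α : ℝ)) (𝓝[>] 0)
      (𝓝 0) := by
  have hα' : (α : ℝ) < 1 / 2 := by exact_mod_cast hα
  have h1 := ((h.const_mul 2).rpow_const (p := (1 - 2 * α : ℝ)) (Or.inr (by linarith))).const_mul
    ((2 * K) ^ (2 * α : ℝ))
  rwa [mul_zero, Real.zero_rpow (by linarith), mul_zero] at h1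

end Holder

section Unique
variable {n : ℕ} {A : Type*} [NormedRing A] [NormedAlgebra ℝ A] [CompleteSpace A]
  {cf : Fin n → List (Fin n) → ℝ} {cg ch : Fin n → Fin n → List (Fin n) → ℝ} {m r Λ V : ℝ}

/-- Uniqueness for the smooth equation. -/
theorem eq_of_solutions (H : EqBound m r Λ cf cg ch) (hΛ : 0 ≤ Λ) (hm : ‖(1 : A)‖ ≤ m) {T : ℝ}
    {v : ℝ → Sig n A} (hv : ∀ t ∈ Icc 0 T, ‖v t‖ ≤ V) {Y Z : ℝ → Fin n → A}
    (hY : ∀ t ∈ Icc 0 T, ‖Y t‖ ≤ r ∧ HasDerivWithinAt Y (germ cf cg ch (Y t) (v t)) (Icc 0 T) t)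
    (hZ : ∀ t ∈ Icc 0 T, ‖Z t‖ ≤ r ∧ HasDerivWithinAt Z (germ cf cg ch (Z t) (v t)) (Icc 0 T) t)
    (h0 : Y 0 = Z 0) : EqOn Y Z (Icc 0 T) := by
  have hr : ∀ {y : ℝ → Fin n → A}, (∀ t ∈ Icc 0 T, ‖y t‖ ≤ r ∧
      HasDerivWithinAt y (germ cf cg ch (y t) (v t)) (Icc 0 T) t) → ∀ t ∈ Ico 0 T,
      HasDerivWithinAt y (germ cf cg ch (y t) (v t)) (Ici t) t := fun hy t ht =>
    (hy t ⟨ht.1, ht.2.le⟩).2.mono_of_mem_nhdsWithin (Filter.mem_of_superset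
      (Icc_mem_nhdsGE ht.2) (Icc_subset_Icc_left ht.1))
  have hK := germK_nonneg (n := n) hΛ
  refine ODE_solution_unique_of_mem_Icc_right (K := (germK n Λ * V).toNNReal)
    (v := fun t X => germ cf cg ch X (v t)) (s := fun _ => Metric.closedBall 0 r) ?_
    (fun t ht => (hY t ht).2.continuousWithinAt) (hr hY)
    (fun t ht => mem_closedBall_zero_iff.2 (hY t ⟨ht.1, ht.2.le⟩).1)
    (fun t ht => (hZ t ht).2.continuousWithinAt) (hr hZ)
    (fun t ht => mem_closedBall_zero_iff.2 (hZ t ⟨ht.1, ht.2.le⟩).1) h0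
  intro t ht
  have hvt := hv t ⟨ht.1, ht.2.le⟩
  refine LipschitzOnWith.of_dist_le_mul fun x hx y hy => ?_
  rw [dist_eq_norm, dist_eq_norm,
    Real.coe_toNNReal _ (mul_nonneg hK ((norm_nonneg _).trans hvt))]
  refine ((bddLip_germ H hΛ hm (v t)).lip x hx y hy).trans ?_
  gcongr

end Unique

/-! ### The algebra of field operators -/

section Concrete
variable (q : Ioo (-1 : ℝ) 1) (V : Type*) [NormedAddCommGroup V] [InnerProductSpace ℝ V]

/-- The tensor product of two vectors in the Hilbert space tensor product. -/
def tensH : V →L[ℝ] V →L[ℝ] UniformSpace.Completion (V ⊗[ℝ] V) :=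
  ContinuousLinearMap.compL ℝ V (V ⊗[ℝ] V) _ UniformSpace.Completion.toComplL ∘L
    LinearMap.mkContinuous₂ (TensorProduct.mk ℝ V V) 1 fun f g => by
      rw [one_mul, TensorProduct.mk_apply, TensorProduct.norm_tmul]

theorem tensH_apply (f g : V) :
    tensH V f g = ((f ⊗ₜ[ℝ] g : V ⊗[ℝ] V) : UniformSpace.Completion (V ⊗[ℝ] V)) := rfl

/-- The `q`-field operators: `ξ(f) x ξ(g)` is the sum of a part which is bounded in the
Hilbert-Schmidt norm of `f ⊗ g` and of the contraction `⟨f, g⟩ Δ_q x`. -/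
def sandwichRep : SandwichRep V (UniformSpace.Completion (V ⊗[ℝ] V)) (MezdonAlg q V) where
  tens := tensH V
  field := xiL q V
  Δ := delta
  cross := crossL q V
  w := wt (q : ℝ) 1
  k := 6 * Dq (q : ℝ) ^ 2
  inner_tens f g f' g' := by
    rw [tensH_apply, tensH_apply, UniformSpace.Completion.inner_coe, TensorProduct.inner_tmul]
  sandwich_eq f g := by
    rw [tensH_apply, crossL_coe, crossPre_tmul]
    exact (sub_add_cancel _ _).symm
  w_nonneg := (wt_pos (abs_lt_one q) 1).le
  k_nonneg := by positivity
  norm_field_le f := (norm_xi f).le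
  norm_Δ_le := norm_delta_le
  norm_cross_le := norm_crossL_le

variable {V}

theorem tmul_sub_left (a a' b : MezdonAlg q V) : tmul (a - a') b = tmul a b - tmul a' b := by
  have := (PiTensorProduct.tprod ℝ (s := fun _ : Fin 2 => MezdonAlg q V)).map_update_sub
    ![a, b] 0 a a'
  simp only [tmul]
  rw [← UniformSpace.Completion.coe_sub]
  congr 1
  have h : ∀ x, Function.update ![a, b] 0 x = ![x, b] := fun x => by
    ext i; fin_cases i <;> simp
  rwa [h, h, h] at this

theorem tmul_sub_right (a b b' : MezdonAlg q V) : tmul a (b - b') = tmul a b - tmul a b' := by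
  have := (PiTensorProduct.tprod ℝ (s := fun _ : Fin 2 => MezdonAlg q V)).map_update_sub
    ![a, b] 1 b b'
  simp only [tmul]
  rw [← UniformSpace.Completion.coe_sub]
  congr 1
  have h : ∀ x, Function.update ![a, b] 1 x = ![a, x] := fun x => by
    ext i; fin_cases i <;> simp
  rwa [h, h, h] at this

theorem norm_tmul_le (a b : MezdonAlg q V) : ‖tmul a b‖ ≤ ‖a‖ * ‖b‖ := by
  rw [tmul, UniformSpace.Completion.norm_coe]
  refine (PiTensorProduct.projectiveSeminorm_tprod_le (𝕜 := ℝ) ![a, b]).trans ?_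
  simp [Fin.prod_univ_two]

theorem norm_tmul_sub_le (a b a' b' : MezdonAlg q V) :
    ‖tmul a b - tmul a' b'‖ ≤ ‖a - a'‖ * ‖b‖ + ‖a'‖ * ‖b - b'‖ := by
  have e : tmul a b - tmul a' b' = tmul (a - a') b + tmul a' (b - b') := by
    rw [tmul_sub_left, tmul_sub_right]; abel
  rw [e]
  exact (norm_add_le _ _).trans (add_le_add (norm_tmul_le q _ _) (norm_tmul_le q _ _))

end Concrete

/-! ### The noises and their covariances -/

section Noises
variable (q : Ioo (-1 : ℝ) 1) {n : ℕ}

theorem integral_noiseMoll (ρ : Mollifier) (j : Fin n) {ε : ℝ} (hε : 0 < ε) (s t : ℝ) :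
    ∫ x in s..t, noiseMoll q ρ j ε x = xi (incr (mollVec ρ j ε) s t) :=
  (xiL q (NoiseSpace n)).intervalIntegral_comp_comm
    ((continuous_mollVec ρ j hε).intervalIntegrable s t)

theorem brownianMoll_eq (ρ : Fin n → Mollifier) (j : Fin n) {ε s t : ℝ} (hε : 0 ≤ ε)
    (hst : s ≤ t) : brownianMoll q (ρ j) j ε s t =
      increment (sandwichRep q (NoiseSpace n)) ρ ε s t j := by
  by_cases h : ε = 0
  · rw [brownianMoll, if_pos h, increment, if_pos h, brownian_eq q j hst]
    rfl
  · rw [brownianMoll, if_neg h, increment, if_neg h,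
      integral_noiseMoll q (ρ j) j (lt_of_le_of_ne hε (Ne.symm h))]
    rfl

theorem brownianMoll_symm (ρ : Mollifier) (j : Fin n) (ε s t : ℝ) :
    brownianMoll q ρ j ε s t = -brownianMoll q ρ j ε t s := by
  by_cases h : ε = 0
  · have key : ∀ {U U' : Set ℝ} (_ : U = U') (hU : MeasurableSet U) (hU' : MeasurableSet U')
        (hf : volume U ≠ ⊤) (hf' : volume U' ≠ ⊤),
        indicatorConstLp 2 hU hf (1 : ℝ) = indicatorConstLp 2 hU' hf' (1 : ℝ) := by
      rintro U _ rfl _ _ _ _; rfl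
    rw [brownianMoll, if_pos h, brownianMoll, if_pos h, brownian, brownian,
      key (uIcc_comm s t) _ measurableSet_uIcc _ isCompact_uIcc.measure_lt_top.ne,
      ← neg_sub t s, Real.sign_neg, neg_smul, neg_neg]
  · rw [brownianMoll, if_neg h, brownianMoll, if_neg h, intervalIntegral.integral_symm]

/-- The renormalisation constants exist, and all are `1 / 2`: the covariance is an even kernel, half of
which is integrated. -/
theorem tendsto_covariance (ρ : Mollifier) (j : Fin n) {ε : ℝ} (hε : 0 < ε) :
    Filter.Tendsto (fun S : ℝ => omega (brownianMoll q ρ j ε 0 S * noiseMoll q ρ j ε 0))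
      Filter.atTop (𝓝 (1 / 2)) := by
  refine ((ρ.isKernel_cov hε hε).tendsto_half (ρ.cov_even ε ε)).congr fun S => ?_
  rw [brownianMoll, if_neg hε.ne', integral_noiseMoll q ρ j hε, noiseMoll_eq, omega_xi_mul_xi,
    inner_incr_left (continuous_mollVec ρ j hε)]
  simp only [inner_mollVec, sub_zero]

end Noises

/-! ### The renormalised equation -/

section Equation
variable {q : Ioo (-1 : ℝ) 1} {n : ℕ} {m r Λ : ℝ}
  {cf : Fin n → List (Fin n) → ℝ} {cg ch : Fin n → Fin n → List (Fin n) → ℝ}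

/-- The right `q`-commutative derivative in the direction of an elementary tensor, as a series in which
the letter `k` is replaced by the operator `y ↦ a Δ_q (b y)`. -/
theorem derivR_tmul (k : Fin n) (c : List (Fin n) → ℝ) (X : Fin n → Alg q n) (a b : Alg q n) :
    derivR k c X (tmul a b) =
      DR c X (Pi.single k (ContinuousLinearMap.mul ℝ (Alg q n) a * delta *
        ContinuousLinearMap.mul ℝ (Alg q n) b)) := by
  refine tsum_congr fun w => ?_
  rw [← sum_get_eq_dR]
  congr 1
  refine Finset.sum_congr rfl fun l _ => ?_
  split_ifs
  · rw [mulMap_tmul]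
    exact mul_assoc _ a _
  · rfl

/-- The left `q`-commutative derivative in the direction of an elementary tensor, as a series in which
the letter `k` is replaced by the operator `y ↦ Δ_q (y a) b`. -/
theorem derivL_tmul (k : Fin n) (c : List (Fin n) → ℝ) (X : Fin n → Alg q n) (a b : Alg q n) :
    derivL k c X (tmul a b) =
      DL c X (Pi.single k ((ContinuousLinearMap.mul ℝ (Alg q n)).flip b * delta *
        (ContinuousLinearMap.mul ℝ (Alg q n)).flip a)) := by
  refine tsum_congr fun w => ?_
  rw [← sum_get_eq_dL]
  congr 1
  refine Finset.sum_congr rfl fun l _ => ?_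
  split_ifs
  · rw [mulMap_tmul]
    exact (mul_assoc _ b _).symm
  · rfl

/-- The right-hand side of the renormalised equation is the germ at the rate of the renormalised
signal: the counterterm is the derivative of the compensation of the trace part. -/
theorem renormRHS_eq (ρ : Fin n → Mollifier) (H : EqBound m r Λ cf cg ch)
    (hm : ‖(1 : Alg q n)‖ ≤ m) {X : Fin n → Alg q n} (hX : ‖X‖ ≤ r) (ε t : ℝ)
    {X' : Fin n → Fin n → Ten q n}
    (hX' : ∀ i j, X' i j = tmul (evalSeries (cg i j) X) (evalSeries (ch i j) X)) (i : Fin n) :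
    renormRHS ρ cf cg ch (fun _ => 1 / 2) ε t X X' i =
      germ cf cg ch X (rate (noise (sandwichRep q (NoiseSpace n)) ρ ε)
        (renorm (sandwichRep q (NoiseSpace n))) t) i := by
  rw [germ]
  simp only [rate]
  rw [germ₂_renorm, one_smul, ← sub_eq_add_neg, renormRHS]
  refine congrArg₂ _ rfl (Finset.sum_congr rfl fun j _ => ?_)
  congr 1
  rw [Finset.sum_add_distrib, ← Finset.sum_mul, ← Finset.mul_sum]
  simp only [hX', derivR_tmul, derivL_tmul]
  rw [← (H.g i j).sum_DR_single hm hX, ← (H.h i j).sum_DL_single hm hX]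
  rfl

theorem norm_integrand_sub_le (H : EqBound m r Λ cf cg ch) (hΛ : 0 ≤ Λ)
    (hm : ‖(1 : Alg q n)‖ ≤ m)
    {X Z : Fin n → Alg q n} (hX : ‖X‖ ≤ r) (hZ : ‖Z‖ ≤ r) :
    ‖(fun i j => tmul (evalSeries (cg i j) X) (evalSeries (ch i j) X) :
        Fin n → Fin n → Ten q n) -
      fun i j => tmul (evalSeries (cg i j) Z) (evalSeries (ch i j) Z)‖ ≤
      2 * Λ ^ 2 * ‖X - Z‖ := by
  refine (pi_norm_le_iff_of_nonneg (by positivity)).2 fun i =>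
    (pi_norm_le_iff_of_nonneg (by positivity)).2 fun j => ?_
  refine (norm_tmul_sub_le q _ _ _ _).trans ?_
  have h1 : ‖evalSeries (cg i j) X - evalSeries (cg i j) Z‖ ≤ Λ * ‖X - Z‖ :=
    (H.g i j).ser_sub_le hm hX hZ
  have h2 : ‖evalSeries (ch i j) X - evalSeries (ch i j) Z‖ ≤ Λ * ‖X - Z‖ :=
    (H.h i j).ser_sub_le hm hX hZ
  have h3 : ‖evalSeries (ch i j) X‖ ≤ Λ := ((H.h i j).ser_le hm hX).2
  have h4 : ‖evalSeries (cg i j) Z‖ ≤ Λ := ((H.g i j).ser_le hm hZ).2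
  calc _ ≤ Λ * ‖X - Z‖ * Λ + Λ * (Λ * ‖X - Z‖) := by gcongr
    _ = _ := by ring

end Equation

/-! ### The domain of convergence -/

section Domain
variable {n : ℕ} {R : ℝ≥0∞}

theorem enorm_pi_lt {A : Type*} [NormedAddCommGroup A] (hR : 0 < R) {X : Fin n → A}
    (h : ∀ i, ‖X i‖ₑ < R) : ENNReal.ofReal ‖X‖ < R := by
  rw [ofReal_norm]
  rcases eq_or_ne R ⊤ with rfl | hR'
  · exact enorm_lt_top
  · lift R to ℝ≥0 using hR'
    refine ENNReal.coe_lt_coe.2 ((pi_nnnorm_lt_iff (by exact_mod_cast hR)).2 fun i => ?_)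
    exact ENNReal.coe_lt_coe.1 (h i)

theorem enorm_apply_lt {A : Type*} [NormedAddCommGroup A] {X : Fin n → A} {r : ℝ}
    (h : ‖X‖ ≤ r) (hr : ENNReal.ofReal r < R) (i : Fin n) : ‖X i‖ₑ < R := by
  rw [← ofReal_norm]
  exact (ENNReal.ofReal_le_ofReal ((norm_le_pi_norm X i).trans h)).trans_lt hr

/-- Inside the domain of convergence, the coefficients are dominated on slightly larger balls. -/
theorem exists_eqBound {m x : ℝ} (hm : 1 ≤ m) (hx : 0 ≤ x) (hxR : ENNReal.ofReal x < R)
    {f : Fin n → (Fin n → ℝ) → ℝ} {g h : Fin n → Fin n → (Fin n → ℝ) → ℝ}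
    {cf : Fin n → List (Fin n) → ℝ} {cg ch : Fin n → Fin n → List (Fin n) → ℝ}
    (hf : ∀ i, IsLift R (f i) (cf i)) (hg : ∀ i j, IsLift R (g i j) (cg i j))
    (hh : ∀ i j, IsLift R (h i j) (ch i j)) :
    ∃ r Λ, x < r ∧ ENNReal.ofReal r < R ∧ 0 ≤ Λ ∧ EqBound m r Λ cf cg ch := by
  obtain ⟨r', h1, h2⟩ := ENNReal.lt_iff_exists_nnreal_btwn.1 hxR
  have h1' : x < r' := by
    rwa [← ENNReal.ofReal_coe_nnreal, ENNReal.ofReal_lt_ofReal_iff_of_nonneg hx] at h1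
  obtain ⟨r, hxr, hrr'⟩ := exists_between h1'
  have h0 : 0 < r := hx.trans_lt hxr
  have key : ∀ (φ : (Fin n → ℝ) → ℝ) c, IsLift R φ c → ∃ Λ, CoefBound m r Λ c := fun φ c hc =>
    exists_coefBound hm h0 hrr' (hc.summable r' h2)
  choose Λf hΛf using fun i => key _ _ (hf i)
  choose Λg hΛg using fun i j => key _ _ (hg i j)
  choose Λh hΛh using fun i j => key _ _ (hh i j)
  have hf0 := fun i => (hΛf i).nonneg
  have hg0 := fun i j => (hΛg i j).nonneg
  have hh0 := fun i j => (hΛh i j).nonneg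
  have one : ∀ {u : Fin n → ℝ}, (∀ i, 0 ≤ u i) → ∀ i, u i ≤ ∑ i, u i := fun hu i =>
    Finset.single_le_sum (fun i _ => hu i) (Finset.mem_univ i)
  have two : ∀ {u : Fin n → Fin n → ℝ}, (∀ i j, 0 ≤ u i j) → ∀ i j, u i j ≤ ∑ i, ∑ j, u i j :=
    fun {u} hu i j => (one (hu i) j).trans
      (one (u := fun i => ∑ j, u i j) (fun i => Finset.sum_nonneg fun j _ => hu i j) i)
  have a := Finset.sum_nonneg fun i (_ : i ∈ Finset.univ) => hf0 i
  have b := Finset.sum_nonneg fun i (_ : i ∈ Finset.univ) =>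
    Finset.sum_nonneg fun j (_ : j ∈ Finset.univ) => hg0 i j
  have d := Finset.sum_nonneg fun i (_ : i ∈ Finset.univ) =>
    Finset.sum_nonneg fun j (_ : j ∈ Finset.univ) => hh0 i j
  refine ⟨r, (∑ i, Λf i) + (∑ i, ∑ j, Λg i j) + ∑ i, ∑ j, Λh i j, hxr, ?_, by positivity,
    fun i => (hΛf i).mono ?_, fun i j => (hΛg i j).mono ?_, fun i j => (hΛh i j).mono ?_⟩
  · refine lt_of_le_of_lt ?_ h2
    rw [← ENNReal.ofReal_coe_nnreal]
    exact ENNReal.ofReal_le_ofReal hrr'.le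
  · linarith [one hf0 i]
  · linarith [two hg0 i j]
  · linarith [two hh0 i j]

end Domain

/-! ### Solution families -/

section Family
variable {q : Ioo (-1 : ℝ) 1} {n : ℕ} {R : ℝ≥0∞} {f : Fin n → (Fin n → ℝ) → ℝ}
  {g h : Fin n → Fin n → (Fin n → ℝ) → ℝ} {cf : Fin n → List (Fin n) → ℝ}
  {cg ch : Fin n → Fin n → List (Fin n) → ℝ} {ρ : Fin n → Mollifier} {X₀ : Fin n → Alg q n}

theorem IsSolutionFamily.hasDerivWithinAt {m r Λ T : ℝ} {Y : ℝ → ℝ → Fin n → Alg q n}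
    {Y' : ℝ → ℝ → Fin n → Fin n → Ten q n}
    (hY : IsSolutionFamily ρ R cf cg ch (fun _ _ => 1 / 2) X₀ T Y Y')
    (H : EqBound m r Λ cf cg ch) (hm : ‖(1 : Alg q n)‖ ≤ m) {ε t : ℝ} (hε : ε ∈ Ioc (0 : ℝ) 1)
    (ht : t ∈ Ico 0 T) (hr : ‖Y ε t‖ ≤ r) :
    HasDerivWithinAt (Y ε) (germ cf cg ch (Y ε t) (rate (noise (sandwichRep q (NoiseSpace n)) ρ ε)
      (renorm (sandwichRep q (NoiseSpace n))) t)) (Ico 0 T) t := by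
  refine hasDerivWithinAt_pi.2 fun i => ?_
  rw [← renormRHS_eq ρ H hm hr ε t (hY.deriv_eq ε ⟨hε.1.le, hε.2⟩ t ht) i]
  exact hY.ode ε hε t ht i

theorem IsSolutionFamily.continuousOn {C : Fin n → ℝ → ℝ} {T : ℝ} {Y : ℝ → ℝ → Fin n → Alg q n}
    {Y' : ℝ → ℝ → Fin n → Fin n → Ten q n} (hY : IsSolutionFamily ρ R cf cg ch C X₀ T Y Y')
    {ε : ℝ} (hε : ε ∈ Ioc (0 : ℝ) 1) : ContinuousOn (Y ε) (Ico 0 T) :=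
  continuousOn_pi.2 fun i t ht => (hY.ode ε hε t ht i).continuousWithinAt

/-- On compact time intervals, a solution stays away from the boundary of the domain of convergence. -/
theorem IsSolutionFamily.exists_bound {C : Fin n → ℝ → ℝ} {T : ℝ} {Y : ℝ → ℝ → Fin n → Alg q n}
    {Y' : ℝ → ℝ → Fin n → Fin n → Ten q n} (hY : IsSolutionFamily ρ R cf cg ch C X₀ T Y Y')
    (hR : 0 < R) {ε τ : ℝ} (hε : ε ∈ Ioc (0 : ℝ) 1) (hτ : τ ∈ Ico 0 T) :
    ∃ x, 0 ≤ x ∧ ENNReal.ofReal x < R ∧ ∀ t ∈ Icc 0 τ, ‖Y ε t‖ ≤ x := by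
  obtain ⟨s, hs, hmax⟩ := isCompact_Icc.exists_isMaxOn (nonempty_Icc.2 hτ.1)
    (((hY.continuousOn hε).mono (Icc_subset_Ico_right hτ.2)).norm)
  exact ⟨‖Y ε s‖, norm_nonneg _, enorm_pi_lt hR
    (hY.mem_domain ε ⟨hε.1.le, hε.2⟩ s ⟨hs.1, hs.2.trans_lt hτ.2⟩), fun t ht => hmax ht⟩

/-- Uniqueness of the solution families: for `ε > 0` this is uniqueness for an ordinary differential
equation with locally Lipschitz right-hand side, and the convergence as `ε ↓ 0` settles `ε = 0`. -/
theorem IsSolutionFamily.unique (hR : 0 < R) (hf : ∀ i, IsLift R (f i) (cf i))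
    (hg : ∀ i j, IsLift R (g i j) (cg i j)) (hh : ∀ i j, IsLift R (h i j) (ch i j)) {T : ℝ}
    (hT : T ≤ 1) {Y Z : ℝ → ℝ → Fin n → Alg q n} {Y' Z' : ℝ → ℝ → Fin n → Fin n → Ten q n}
    (hY : IsSolutionFamily ρ R cf cg ch (fun _ _ => 1 / 2) X₀ T Y Y')
    (hZ : IsSolutionFamily ρ R cf cg ch (fun _ _ => 1 / 2) X₀ T Z Z') {ε : ℝ}
    (hε : ε ∈ Icc (0 : ℝ) 1) {t : ℝ} (ht : t ∈ Ico 0 T) : Z ε t = Y ε t ∧ Z' ε t = Y' ε t := by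
  have hpos : ∀ ε ∈ Ioc (0 : ℝ) 1, Z ε t = Y ε t := by
    intro ε hε
    obtain ⟨x, hx, hxR, hxY⟩ := hY.exists_bound hR hε ht
    obtain ⟨y, hy, hyR, hyZ⟩ := hZ.exists_bound hR hε ht
    obtain ⟨r, Λ, hr, -, hΛ, H⟩ := exists_eqBound (m := max 1 ‖(1 : Alg q n)‖) (le_max_left _ _)
      (hx.trans (le_max_left x y)) (by rw [ENNReal.ofReal_max]; exact max_lt hxR hyR) hf hg hh
    have hm : ‖(1 : Alg q n)‖ ≤ max 1 ‖(1 : Alg q n)‖ := le_max_right _ _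
    obtain ⟨V, hV, hV'⟩ := (isDriver_signal (sandwichRep q (NoiseSpace n)) ρ hε.1).rate_le
    have hsub : Icc 0 t ⊆ Ico 0 T := Icc_subset_Ico_right ht.2
    have bY : ∀ s ∈ Icc 0 t, ‖Y ε s‖ ≤ r := fun s hs =>
      (hxY s hs).trans ((le_max_left x y).trans hr.le)
    have bZ : ∀ s ∈ Icc 0 t, ‖Z ε s‖ ≤ r := fun s hs =>
      (hyZ s hs).trans ((le_max_right x y).trans hr.le)
    refine eq_of_solutions H hΛ hm (T := t)
      (fun s hs => hV' s ⟨hs.1, hs.2.trans (ht.2.le.trans hT)⟩)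
      (fun s hs => ⟨bZ s hs, (hZ.hasDerivWithinAt H hm hε (hsub hs) (bZ s hs)).mono hsub⟩)
      (fun s hs => ⟨bY s hs, (hY.hasDerivWithinAt H hm hε (hsub hs) (bY s hs)).mono hsub⟩)
      ?_ ⟨ht.1, le_rfl⟩
    rw [hY.initial ε ⟨hε.1.le, hε.2⟩, hZ.initial ε ⟨hε.1.le, hε.2⟩]
  have key : Z ε t = Y ε t := by
    rcases hε.1.eq_or_lt with rfl | h0
    · refine eq_of_forall_dist_le fun δ hδ => ?_
      have hδ' : 0 < (δ / 2).toNNReal := Real.toNNReal_pos.2 (half_pos hδ)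
      have hc : ((δ / 2).toNNReal : ℝ) = δ / 2 := Real.coe_toNNReal _ (half_pos hδ).le
      obtain ⟨ε, ⟨h1, h2⟩, h3⟩ := (((hY.tendsto 0 (by simp) _ hδ').and
        (hZ.tendsto 0 (by simp) _ hδ')).and (Ioc_mem_nhdsGT one_pos)).exists
      have h4 : ‖Y ε t - Y 0 t‖ ≤ δ / 2 := hc ▸ (h1.1 t ht).1
      have h5 : ‖Z ε t - Z 0 t‖ ≤ δ / 2 := hc ▸ (h2.1 t ht).1
      rw [hpos ε h3, norm_sub_rev] at h5
      rw [dist_eq_norm, ← sub_add_sub_cancel (Z 0 t) (Y ε t) (Y 0 t)]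
      exact (norm_add_le _ _).trans (by linarith)
    · exact hpos ε ⟨h0, hε.2⟩
  refine ⟨key, ?_⟩
  funext i j
  rw [hY.deriv_eq ε hε t ht, hZ.deriv_eq ε hε t ht, key]

/-- Existence of a solution family: the abstract solutions, with their controlled derivatives. -/
theorem exists_isSolutionFamily (hR : 0 < R) (hf : ∀ i, IsLift R (f i) (cf i))
    (hg : ∀ i j, IsLift R (g i j) (cg i j)) (hh : ∀ i j, IsLift R (h i j) (ch i j))
    (ρ : Fin n → Mollifier) (hX₀ : ∀ i, ‖X₀ i‖ₑ < R) :
    ∃ T : ℝ, 0 < T ∧ T ≤ 1 ∧ ∃ (Y : ℝ → ℝ → Fin n → Alg q n)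
      (Y' : ℝ → ℝ → Fin n → Fin n → Ten q n),
      IsSolutionFamily ρ R cf cg ch (fun _ _ => 1 / 2) X₀ T Y Y' := by
  have hm : ‖(1 : Alg q n)‖ ≤ max 1 ‖(1 : Alg q n)‖ := le_max_right _ _
  obtain ⟨r, Λ, hr, hrR, hΛ, H⟩ := exists_eqBound (m := max 1 ‖(1 : Alg q n)‖) (le_max_left _ _)
    (norm_nonneg X₀) (enorm_pi_lt hR hX₀) hf hg hh
  have hr0 : 0 ≤ r := (norm_nonneg _).trans hr.le
  have hrg := range_pos ρ
  obtain ⟨T, K, hT, hT1, hK, Y, h0, hb, hode, hhol, hrem, hconv⟩ :=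
    exists_solution_family (sandwichRep q (NoiseSpace n)) ρ H hΛ hm hr
  let Y' : ℝ → ℝ → Fin n → Fin n → Ten q n := fun ε t i j =>
    tmul (evalSeries (cg i j) (Y ε t)) (evalSeries (ch i j) (Y ε t))
  set L := 2 * Λ ^ 2
  have hL : 0 ≤ L := by positivity
  have hlip : ∀ ε δ s t, ‖Y ε s‖ ≤ r → ‖Y δ t‖ ≤ r → ‖Y' ε s - Y' δ t‖ ≤ L * ‖Y ε s - Y δ t‖ :=
    fun ε δ s t h1 h2 => norm_integrand_sub_le H hΛ hm h1 h2
  -- a common Hölder constant for the solution and its derivative process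
  set M := (1 + L) * K with hM_def
  have hM : 0 ≤ M := by positivity
  have hol : ∀ ε, 0 ≤ ε → ∀ s t, 0 ≤ s → s ≤ t → t < T →
      ‖Y ε t - Y ε s‖ ≤ M * (t - s) ^ (1 / 2 : ℝ) := fun ε hε s t hs hst ht => by
    refine (hhol ε hε s t hs hst ht.le).trans ?_
    gcongr
    rw [hM_def]; nlinarith
  have hol' : ∀ ε, 0 ≤ ε → ∀ s t, 0 ≤ s → s ≤ t → t < T →
      ‖Y' ε t - Y' ε s‖ ≤ M * (t - s) ^ (1 / 2 : ℝ) := fun ε hε s t hs hst ht => by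
    refine (hlip ε ε t s (hb ε hε t ⟨hs.trans hst, ht.le⟩)
      (hb ε hε s ⟨hs, hst.trans ht.le⟩)).trans ?_
    refine (mul_le_mul_of_nonneg_left (hhol ε hε s t hs hst ht.le) hL).trans ?_
    rw [← mul_assoc]
    have := Real.rpow_nonneg (sub_nonneg.2 hst) (1 / 2 : ℝ)
    gcongr
    rw [hM_def]; nlinarith
  let η : ℝ → ℝ := fun ε => (1 + L) * (r * (range ρ * ε) ^ (1 / 8 : ℝ))
  have hη : Filter.Tendsto η (𝓝[>] 0) (𝓝 0) := by
    have h1 : Filter.Tendsto (fun ε : ℝ => range ρ * ε) (𝓝[>] 0) (𝓝 (range ρ * 0)) :=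
      (Filter.tendsto_id.mono_left nhdsWithin_le_nhds).const_mul _
    have h2 := ((h1.rpow_const (p := (1 / 8 : ℝ)) (Or.inr (by norm_num))).const_mul r).const_mul
      (1 + L)
    rwa [mul_zero, Real.zero_rpow (by norm_num), mul_zero, mul_zero] at h2
  refine ⟨T, hT, hT1, Y, Y', ⟨?_, ?_, ?_, ?_, ?_, ?_, ?_⟩⟩
  · intro ε hε α hα
    exact ⟨⟨M, hM⟩, holderOnWith_of_half hM hT1 hα (hol ε hε.1),
      holderOnWith_of_half hM hT1 hα (hol' ε hε.1)⟩
  · intro α hα δ hδ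
    have hδ' : (0 : ℝ) < δ := hδ
    filter_upwards [hη.eventually (ge_mem_nhds hδ'),
      (tendsto_interpolation (K := M) hα hη).eventually (ge_mem_nhds hδ'),
      Ioc_mem_nhdsGT (show (0 : ℝ) < (2 * range ρ)⁻¹ by positivity)] with ε h1 h2 h3
    have hε : range ρ * ε ≤ 1 / 2 := by
      have := mul_le_mul_of_nonneg_left h3.2 hrg.le
      rwa [mul_inv, mul_comm (2 : ℝ)⁻¹, mul_inv_cancel_left₀ hrg.ne', ← one_div] at this
    have hx : 0 ≤ r * (range ρ * ε) ^ (1 / 8 : ℝ) := by have := h3.1.le; positivity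
    have d : ∀ t ∈ Ico 0 T, ‖Y ε t - Y 0 t‖ ≤ η ε := fun t ht =>
      (hconv ε h3.1 hε t ⟨ht.1, ht.2.le⟩).trans (by simp only [η]; nlinarith)
    have d' : ∀ t ∈ Ico 0 T, ‖Y' ε t - Y' 0 t‖ ≤ η ε := fun t ht => by
      have ht' : t ∈ Icc 0 T := ⟨ht.1, ht.2.le⟩
      refine (hlip ε 0 t t (hb ε h3.1.le t ht') (hb 0 le_rfl t ht')).trans ?_
      refine (mul_le_mul_of_nonneg_left (hconv ε h3.1 hε t ht') hL).trans ?_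
      simp only [η]; nlinarith
    exact ⟨fun t ht => ⟨(d t ht).trans h1, (d' t ht).trans h1⟩,
      holderOnWith_sub hM hα (hol ε h3.1.le) (hol 0 le_rfl) d h2,
      holderOnWith_sub hM hα (hol' ε h3.1.le) (hol' 0 le_rfl) d' h2⟩
  · intro κ hκ
    refine ⟨K + 4 * n * Λ ^ 2 * (wt (q : ℝ) 1 * K), fun ε hε s hs t ht i => ?_⟩
    have hsum : ∀ β : Fin n → Alg q n,
        ∑ j, sandwich (β j) (Y' ε s i j) = germ₁ cg ch (Y ε s) β i := fun β => by
      simp only [Y', sandwich_tmul]; rfl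
    have hbs := hb ε hε.1 s ⟨hs.1, hs.2.le⟩
    have hbt := hb ε hε.1 t ⟨ht.1, ht.2.le⟩
    have hw := (wt_pos (abs_lt_one q) 1).le
    have h1 : |t - s| ≤ |t - s| ^ (1 - κ) := by
      refine Real.self_le_rpow_of_le_one (abs_nonneg _) ?_ (by linarith [hκ.1])
      rw [abs_le]; constructor <;> linarith [hs.1, hs.2, ht.1, ht.2]
    refine le_trans ?_ (mul_le_mul_of_nonneg_left h1 (by positivity))
    have hrem' := fun s t hs hst ht => (norm_le_pi_norm _ i).trans (hrem ε hε.1 s t hs hst ht)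
    rw [hsum]
    rcases le_total s t with hst | hst
    · simp only [brownianMoll_eq q ρ _ hε.1 hst]
      rw [abs_of_nonneg (sub_nonneg.2 hst)]
      refine (hrem' s t hs.1 hst ht.2.le).trans (mul_le_mul_of_nonneg_right ?_ (sub_nonneg.2 hst))
      exact le_add_of_nonneg_right (by positivity)
    -- backwards in time, the expansion is at the end point of the interval; the change of base point
    -- costs a product of two increments of class `1 / 2`
    · simp only [brownianMoll_symm q _ _ ε s t, brownianMoll_eq q ρ _ hε.1 hst]
      have h0 : 0 ≤ s - t := sub_nonneg.2 hst
      rw [abs_sub_comm, abs_of_nonneg h0]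
      set β := increment (sandwichRep q (NoiseSpace n)) ρ ε t s with hβ
      have e : Y ε t i - Y ε s i - germ₁ cg ch (Y ε s) (fun j => -β j) i =
          (germ₁ cg ch (Y ε s) β i - germ₁ cg ch (Y ε t) β i) -
            (Y ε s i - Y ε t i - germ₁ cg ch (Y ε t) β i) := by
        simp only [germ₁, mul_neg, neg_mul, Finset.sum_neg_distrib]; abel
      rw [e]
      have h2 := (bddLip_germ₁ H hm β i).lip _ (mem_closedBall_zero_iff.2 hbs) _
        (mem_closedBall_zero_iff.2 hbt)
      have h3 : ‖β‖ ≤ wt (q : ℝ) 1 * (s - t) ^ (1 / 2 : ℝ) := norm_noise_increment_le _ ρ hε.1 hst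
      have h4 := hhol ε hε.1 t s ht.1 hst hs.2.le
      have h5 : (s - t) ^ (1 / 2 : ℝ) * (s - t) ^ (1 / 2 : ℝ) = s - t := by
        rw [← Real.sqrt_eq_rpow, Real.mul_self_sqrt h0]
      have h6 : 0 ≤ (s - t) ^ (1 / 2 : ℝ) := by positivity
      calc _ ≤ 4 * n * Λ ^ 2 * ‖β‖ * ‖Y ε s - Y ε t‖ + K * (s - t) :=
            (norm_sub_le _ _).trans (add_le_add h2 (hrem' t s ht.1 hst hs.2.le))
        _ ≤ 4 * n * Λ ^ 2 * (wt (q : ℝ) 1 * (s - t) ^ (1 / 2 : ℝ)) *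
            (K * (s - t) ^ (1 / 2 : ℝ)) + K * (s - t) := by gcongr
        _ = 4 * n * Λ ^ 2 * (wt (q : ℝ) 1 * K) *
            ((s - t) ^ (1 / 2 : ℝ) * (s - t) ^ (1 / 2 : ℝ)) + K * (s - t) := by ring
        _ = _ := by rw [h5]; ring
  · exact fun ε hε => h0 ε hε.1
  · exact fun ε hε t ht => enorm_apply_lt (hb ε hε.1 t ⟨ht.1, ht.2.le⟩) hrR
  · exact fun ε hε t ht i j => rfl
  · intro ε hε t ht i
    have hb' := hb ε hε.1.le t ⟨ht.1, ht.2.le⟩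
    rw [renormRHS_eq ρ H hm hb' ε t (fun _ _ => rfl) i]
    exact hasDerivWithinAt_pi.1 ((hode ε hε.1 t ⟨ht.1, ht.2.le⟩).mono Ico_subset_Icc_self) i

end Family

end Mezdon

end

/-- Local well-posedness of the rough differential equation `dX = f(X) + g(X) dB_q h(X)` driven by
`n` independent `q`-white noises. -/
theorem mainTheorem4 (q : Set.Ioo (-1 : ℝ) 1) (n : ℕ)
    (R : ℝ≥0∞) (f : Fin n → (Fin n → ℝ) → ℝ) (g h : Fin n → Fin n → (Fin n → ℝ) → ℝ)
    (cf : Fin n → List (Fin n) → ℝ) (cg ch : Fin n → Fin n → List (Fin n) → ℝ)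
    (hf : ∀ i, Mezdon.IsLift R (f i) (cf i))
    (hg : ∀ i j, Mezdon.IsLift R (g i j) (cg i j))
    (hh : ∀ i j, Mezdon.IsLift R (h i j) (ch i j))
    (ρ : Fin n → Mezdon.Mollifier)
    (X₀ : Fin n → Mezdon.Alg q n) (hX₀ : ∀ i, ‖X₀ i‖ₑ < R) :
    ∃ C : Fin n → ℝ → ℝ,
      (∀ j, ∀ ε ∈ Set.Ioc (0 : ℝ) 1, Filter.Tendsto
        (fun S : ℝ => Mezdon.omega
          (Mezdon.brownianMoll q (ρ j) j ε 0 S * Mezdon.noiseMoll q (ρ j) j ε 0))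
        Filter.atTop (𝓝 (C j ε))) ∧
      ∃ T : ℝ, 0 < T ∧
        ∃ (Y : ℝ → ℝ → Fin n → Mezdon.Alg q n) (Y' : ℝ → ℝ → Fin n → Fin n → Mezdon.Ten q n),
          Mezdon.IsSolutionFamily ρ R cf cg ch C X₀ T Y Y' ∧
          ∀ (Z : ℝ → ℝ → Fin n → Mezdon.Alg q n) (Z' : ℝ → ℝ → Fin n → Fin n → Mezdon.Ten q n),
            Mezdon.IsSolutionFamily ρ R cf cg ch C X₀ T Z Z' →
              ∀ ε ∈ Set.Icc (0 : ℝ) 1, ∀ t ∈ Set.Ico 0 T, Z ε t = Y ε t ∧ Z' ε t = Y' ε t := by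
  refine ⟨fun _ _ => 1 / 2, fun j ε hε => Mezdon.tendsto_covariance q (ρ j) j hε.1, ?_⟩
  rcases Nat.eq_zero_or_pos n with rfl | hn
  · -- there are no equations, and both families take values in a trivial space
    obtain ⟨T, hT, -, Y, Y', hY⟩ := Mezdon.exists_isSolutionFamily (R := ⊤) (f := f) (g := g)
      (h := h) (cf := cf) (cg := cg) (ch := ch) (X₀ := X₀) ENNReal.zero_lt_top
      (fun i => i.elim0) (fun i => i.elim0) (fun i => i.elim0) ρ (fun i => i.elim0)
    exact ⟨T, hT, Y, Y', { hY with mem_domain := fun _ _ _ _ i => i.elim0 },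
      fun _ _ _ _ _ _ _ => ⟨Subsingleton.elim _ _, Subsingleton.elim _ _⟩⟩
  · have hR : 0 < R := bot_le.trans_lt (hX₀ ⟨0, hn⟩)
    obtain ⟨T, hT, hT1, Y, Y', hY⟩ := Mezdon.exists_isSolutionFamily hR hf hg hh ρ hX₀
    exact ⟨T, hT, Y, Y', hY, fun Z Z' hZ ε hε t ht => hY.unique hR hf hg hh hT1 hZ hε ht⟩
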